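/- **Setting.** Let $\mathbb F_v$ be a finite field with $q$ elements, $A_v=\mathbb F_v[[z]]$, $Q_v=\mathbb F_v((z))$, let $Q_v^{\rm alg}$ be an algebraic closure, $\mathbb C_v$ its completion, $\mathscr G={\rm Aut}(Q_v^{\rm alg}/Q_v)$, and let $v$ be the valuation on $\mathbb C_v$ with $v(\zeta)=1$, where $\zeta\in\mathbb C_v$ is the image of $z$. For $0\ne x=\sum_{i\ge n}b_i(z-\zeta)^i\in\mathbb C_v((z-\zeta))$ with $b_n\neq0$ put $v(x):=v(b_n)$. Let $L\subset Q_v^{\rm alg}$ be a finite separable extension of $Q_v$ with valuation ring $R$, let $L^{\rm sep}\subset Q_v^{\rm alg}$ be its separable closure, put $H_L={\rm Hom}_{Q_v}(L,Q_v^{\rm alg})$, and let $\hat\sigma$ be the endomorphism of $R[[z]]$ (and of $L^{\rm sep}[[z]]$) with $\hat\sigma(z)=z$ and $\hat\sigma(b)=b^{q}$ for $b\in R$ (resp. $b\in L^{\rm sep}$). A *local shtuka* over $R$ is a free $R[[z]]$-module $\hat M$ of finite rank with an isomorphism $\tau:\hat\sigma^*\hat M[\frac1{z-\zeta}]\to\hat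 M[\frac1{z-\zeta}]$. Put $H^1_v(\hat M,A_v)=\{m\in\hat M\otimes L^{\rm sep}[[z]]:\tau(\hat\sigma^*m)=m\}$ and $H_{1,v}(\hat M,B)={\rm Hom}_{A_v}(H^1_v(\hat M,A_v),B)$ for $B=A_v,Q_v$. Put $H^1_{\rm dR}(\hat M,B)=\hat\sigma^*\hat M\otimes_{R[[z]]}B$ for $B=L[[z-\zeta]]$, $\mathbb C_v((z-\zeta))$ (via $z\mapsto\zeta+(z-\zeta)$) and $B=R,L$ (via $z\mapsto\zeta$). The inclusion $H^1_v(\hat M,A_v)\subset\hat M\otimes L^{\rm sep}[[z]]$ takes values in $\hat M\otimes L^{\rm sep}\langle\frac z\zeta\rangle$, where $L^{\rm sep}\langle\frac z\zeta\rangle=\{\sum b_iz^i: b_i\in L^{\rm sep},\,|b_i||\zeta|^i\to0\}$, and induces an isomorphism $h$ after base change to $\mathbb C_v((z-\zeta))$; put $h_{v,\rm dR}=\tau^{-1}\circ h: H^1_v(\hat M,A_v)\otimes_{A_v}\mathbb C_v((z-\zeta))\cong H^1_{\rm dR}(\hat M,\mathbb C_v((z-\zeta)))$. For $u\in H_{1,v}(\hat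 M,Q_v)$ and $\omega\in H^1_{\rm dR}(\hat M,L[[z-\zeta]])$ put $\int_u\omega:=(u\otimes{\rm id})(h_{v,\rm dR}^{-1}(\omega))\in\mathbb C_v((z-\zeta))$. Let $E_v$ be a commutative, semi-simple, separable finite dimensional $Q_v$-algebra, let $\mathcal O_{E_v}$ be the integral closure of $A_v$ in $E_v$, and $H_{E_v}={\rm Hom}_{Q_v}(E_v,Q_v^{\rm alg})$. Assume that $\phi(E_v)\subset L$ for all $\phi\in H_{E_v}$. Let $\hat M$ be a local shtuka over $R$ with complex multiplication by $\mathcal O_{E_v}$, i.e. with an injective ring homomorphism $\mathcal O_{E_v}\to{\rm End}(\hat M,\tau)$ over $A_v$, and with ${\rm rk}\,\hat M=\dim_{Q_v}E_v$. For $\psi\in H_{E_v}$ let $H^\psi(\hat M,L[[y-\psi(y)]])$ be the $\psi$-component of $H^1_{\rm dR}(\hat M,L[[z-\zeta]])$, i.e. the submodule on which $[a]-\psi(a)$ is topologically nilpotent for all $a\in\mathcal O_{E_v}$. Here $L[[y-\psi(y)]]$ is the $\psi$-component of $E_v\otimes_{Q_v}L[[z-\zeta]]$; it equals $L[[z-\zeta]]$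 because $E_v$ is separable. Let $H^\psi(\hat M,R)\subset H^1_{\rm dR}(\hat M,R)$ be the generalized eigenspace of all $[a]$ with eigenvalues $\psi(a)$. Let $\Phi=(d_\phi)_{\phi\in H_{E_v}}$ be the CM-type of $\hat M$, i.e. $d_\phi\in\mathbb Z$ and $\tau^{-1}(\hat M\otimes L[[z-\zeta]])=\bigoplus_\phi(z-\zeta)^{-d_\phi}H^\phi(\hat M,L[[y-\phi(y)]])$. If $\omega$ is an $L[[y-\psi(y)]]$-generator of $H^\psi(\hat M,L[[y-\psi(y)]])$, write $\omega=x\,\omega^\circ$, where $\omega^\circ$ is a generator whose reduction in $H^1_{\rm dR}(\hat M,L)$ generates the $R$-module $H^\psi(\hat M,R)$, and put $v(\omega):=v(x\bmod y-\psi(y))$. If $u$ is an $E_v$-generator of $H_{1,v}(\hat M,Q_v)$, put $v_\psi(u):=v(\psi(a))$, where $a\in E_v^\times$ is such that $a^{-1}u$ is an $\mathcal O_{E_v}$-generator of $H_{1,v}(\hat M,A_v)$. For a locally constant $a:\mathscr G\to\mathbb Q$ choose a finite Galois extension $N\subset Q_v^{\rm alg}$ of $Q_v$ such that $a$ is constant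 modulo the subgroup fixing $N$, let $\pi_N$ be a uniformizer and $e_N$ the ramification index of $N$, and view $a$ as a function on $G={\rm Gal}(N/Q_v)$. Put $$Z_v(a,s)=\frac1{e_N}\sum_{n\ge1}\ \sum_{g\in G,\ g(x)\equiv x^{q^n}\bmod \pi_N}\frac{a(g)}{q^{ns}}\quad(s>0),\qquad \mu_{{\rm Art},v}(a)=\sum_{g\in G}a(g)\mu_N(g),$$ where $\mu_N(g)=0$ if $g$ is not in the inertia group of $N/Q_v$, $\mu_N(g)=-v(g(\pi_N)-\pi_N)$ if $g\ne1$ is in the inertia group, and $\mu_N(1)=v(\mathfrak D_{N/Q_v})$ for the different $\mathfrak D_{N/Q_v}$. Both are independent of $N$. Finally put $a^0_{E_v,\psi,\Phi}(g)=\frac1{\#H_L}\sum_{\eta\in H_L}d_{\eta^{-1}g\eta\psi}$. **Statement.** Let $\psi\in H_{E_v}$ and let $\omega_\psi$ be an $L[[y-\psi(y)]]$-generator of $H^\psi(\hat M,L[[y-\psi(y)]])$. For every $\eta\in H_L$ let $\hat M^\eta$ (a local shtuka over the valuation ring of $\eta(L)$) and $\omega_\psi^\eta\in H^{\eta\psi}(\hat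 M^\eta,\eta(L)[[y-\eta\psi(y)]])$ be obtained from $\hat M$ and $\omega_\psi$ by extension of scalars via $\eta$, and let $u_\eta$ be any $E_v$-generator of $H_{1,v}(\hat M^\eta,Q_v)$. Then all periods $\int_{u_\eta}\omega_\psi^\eta$ are non-zero and $$\frac1{\#H_L}\sum_{\eta\in H_L}v\Bigl(\int_{u_\eta}\omega^\eta_\psi\Bigr)=Z_v(a^0_{E_v,\psi,\Phi},1)-\mu_{{\rm Art},v}(a^0_{E_v,\psi,\Phi})+\frac1{\#H_L}\sum_{\eta\in H_L}\bigl(v(\omega_\psi^\eta)+v_{\eta\psi}(u_\eta)\bigr).$$ -/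

import Mathlib

open scoped NNReal WithZero LaurentSeries PowerSeries Topology
open Filter

noncomputable section
namespace LocSht
universe u v w
section fields
variable (F : Type u) [Field F] [Fintype F]

/-- The field `Q_v = F⸨z⸩` over the finite field `F` with `q` elements. -/
abbrev Qv := LaurentSeries F

/-- The ring `A_v = F⟦z⟧`. -/
abbrev Av := PowerSeries F

theorem one_lt_card : (1 : ℝ≥0) < (Fintype.card F : ℝ≥0) := by
  exact_mod_cast Fintype.one_lt_card

/-- The absolute value on `Q_v` is normalised by `|z| = q⁻¹`. -/
instance rankOneQv : Valuation.RankOne (Valued.v : Valuation (Qv F) ℤᵐ⁰) where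
  hom' := (WithZeroMulInt.toNNReal (one_lt_card F).ne_zero).comp MonoidWithZeroHom.ValueGroup₀.embedding
  strictMono' := (WithZeroMulInt.toNNReal_strictMono (one_lt_card F)).comp
    MonoidWithZeroHom.ValueGroup₀.embedding_strictMono
  exists_val_nontrivial := by
    refine ⟨HahnSeries.single 1 1, ?_⟩
    have := LaurentSeries.valuation_single_zpow F 1
    rw [this]
    simp

instance normedFieldQv : NormedField (Qv F) := Valued.toNormedField (Qv F) ℤᵐ⁰

theorem norm_Qv (x : Qv F) : ‖x‖ = (WithZeroMulInt.toNNReal (one_lt_card F).ne_zero (Valued.v x) : ℝ) := by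
  have h : ‖x‖ = (WithZeroMulInt.toNNReal (one_lt_card F).ne_zero
      (MonoidWithZeroHom.ValueGroup₀.embedding ((Valued.v : Valuation (Qv F) ℤᵐ⁰).restrict x)) : ℝ) :=
    rfl
  rw [h, Valuation.embedding_restrict]

theorem norm_single (n : ℤ) : ‖(HahnSeries.single n 1 : Qv F)‖ = (Fintype.card F : ℝ) ^ (-n) := by
  rw [norm_Qv, LaurentSeries.valuation_single_zpow, WithZeroMulInt.toNNReal_neg_apply _ (by simp)]
  have h : WithZero.unzero (WithZero.exp_ne_zero (a := -n)) = Multiplicative.ofAdd (-n) := by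
    rw [← WithZero.coe_inj, WithZero.coe_unzero]
    rfl
  rw [h]
  simp

instance nontriviallyQv : NontriviallyNormedField (Qv F) where
  __ := normedFieldQv F
  non_trivial := by
    refine ⟨HahnSeries.single (-1) 1, ?_⟩
    have := norm_single F (-1)
    simp only [neg_neg, zpow_one] at this
    refine lt_of_lt_of_eq ?_ this.symm
    exact_mod_cast Fintype.one_lt_card

theorem norm_Av_le (f : Av F) : ‖algebraMap (Av F) (Qv F) f‖ ≤ 1 := by
  have h1 : ‖(1 : Qv F)‖ = 1 := norm_one
  rw [← h1, Valued.toNormedField.norm_le_iff, map_one, LaurentSeries.val_le_one_iff_eq_coe]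
  exact ⟨f, rfl⟩

/-- The algebraic closure `Q_v^alg` of `Q_v`, with the unique extension of the absolute value. -/
abbrev Qalg := AlgebraicClosure (Qv F)

instance normedFieldQalg : NormedField (Qalg F) := spectralNorm.normedField (Qv F) (Qalg F)
instance normedAlgebraQalg : NormedAlgebra (Qv F) (Qalg F) := spectralNorm.normedAlgebra _ _
theorem norm_Qalg (x : Qalg F) : ‖x‖ = spectralNorm (Qv F) (Qalg F) x := rfl
theorem norm_algebraMap_Qalg (x : Qv F) : ‖algebraMap (Qv F) (Qalg F) x‖ = ‖x‖ := norm_algebraMap' _ _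
instance : IsUltrametricDist (Qalg F) :=
  IsUltrametricDist.isUltrametricDist_of_forall_norm_add_le_max_norm
    (isNonarchimedean_spectralNorm (K := Qv F) (L := Qalg F))

/-- The completion `ℂ_v` of `Q_v^alg`. -/
abbrev Cv := UniformSpace.Completion (Qalg F)

instance : NormedField (Cv F) := inferInstance
instance : IsUltrametricDist (Cv F) := by
  refine IsUltrametricDist.isUltrametricDist_of_forall_norm_add_le_max_norm ?_
  intro x y
  induction x, y using UniformSpace.Completion.induction_on₂ with
  | hp => exact isClosed_le (by fun_prop) (by fun_prop)
  | ih x y =>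
    rw [← UniformSpace.Completion.coe_add]
    simp only [UniformSpace.Completion.norm_coe]
    exact IsUltrametricDist.norm_add_le_max x y

/-- The inclusion `Q_v^alg → ℂ_v`. -/
def toCv : Qalg F →+* Cv F := UniformSpace.Completion.coeRingHom

theorem norm_of_isIntegral {x : Qalg F} (hx : IsIntegral (Av F) x) : ‖x‖ ≤ 1 := by
  let V := NormedField.valuation (K := Qalg F)
  have hint : V.Integers V.integer := Valuation.integer.integers V
  let φ : Av F →+* V.integer := (algebraMap (Av F) (Qalg F)).codRestrict V.integer (by
    intro f
    have h := norm_Av_le F f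
    rw [← norm_algebraMap_Qalg, ← IsScalarTower.algebraMap_apply] at h
    exact h)
  obtain ⟨p, hp, hpx⟩ := hx
  have : IsIntegral V.integer x := ⟨p.map φ, hp.map φ, by
    rw [Polynomial.eval₂_map]
    exact hpx⟩
  exact hint.mem_of_integral this

variable {F} (L : IntermediateField (Qv F) (Qalg F))
instance normedFieldIF : NormedField L := inferInstance
instance [FiniteDimensional (Qv F) L] : CompleteSpace L := FiniteDimensional.complete (Qv F) L
instance : IsUltrametricDist L := inferInstance
/-- The valuation ring `R` of `L`. -/
def RL : Type u := integralClosure (Av F) L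

instance : CommRing (RL L) := inferInstanceAs (CommRing (integralClosure (Av F) L))
instance : Algebra (Av F) (RL L) := inferInstanceAs (Algebra (Av F) (integralClosure (Av F) L))
instance : Algebra (RL L) L := inferInstanceAs (Algebra (integralClosure (Av F) L) L)
instance : IsScalarTower (Av F) (RL L) L :=
  inferInstanceAs (IsScalarTower (Av F) (integralClosure (Av F) L) L)
end fields

section BaseChange

variable {A : Type*} {B : Type*} {C : Type*} [CommRing A] [CommRing B] [CommRing C]

/-- The ring `B`, seen as an algebra over `A` through a given `f : A →+* B`. -/
def Via (_ : A →+* B) : Type _ := B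

instance (f : A →+* B) : CommRing (Via f) := inferInstanceAs (CommRing B)
instance (f : A →+* B) : Algebra A (Via f) := RingHom.toAlgebra (R := A) (S := B) f

/-- A homomorphism out of `B`, seen as one out of `Via f`. -/
def Via.hom (f : A →+* B) (g : B →+* C) : Via f →+* C := g

/-- The base change `B ⊗_{A,f} M` of an `A`-module `M` along `f : A →+* B`. -/
def BC (f : A →+* B) (M : Type*) [AddCommGroup M] [Module A M] : Type _ :=
  TensorProduct A (Via f) M

namespace BC

variable (f : A →+* B) (M : Type*) [AddCommGroup M] [Module A M]

instance : AddCommGroup (BC f M) := inferInstanceAs (AddCommGroup (TensorProduct A (Via f) M))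

instance moduleVia : Module (Via f) (BC f M) :=
  inferInstanceAs (Module (Via f) (TensorProduct A (Via f) M))

instance : Module B (BC f M) := moduleVia f M

/-- The multiplication of `B ⊗_A D` for an `A`-algebra `D`. -/
instance (D : Type*) [CommRing D] [Algebra A D] : CommRing (BC f D) :=
  inferInstanceAs (CommRing (TensorProduct A (Via f) D))

variable {M}

/-- The map `m ↦ 1 ⊗ m`. -/
def mk : M →ₛₗ[f] BC f M where
  toFun := fun m => TensorProduct.tmul A (1 : Via f) m
  map_add' := fun _ _ => TensorProduct.tmul_add _ _ _
  map_smul' := fun a m => by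
    have h : TensorProduct.tmul A (1 : Via f) (a • m) =
        (algebraMap A (Via f) a) • TensorProduct.tmul A (1 : Via f) m := by
      rw [← TensorProduct.smul_tmul, TensorProduct.smul_tmul', smul_eq_mul, mul_one,
        Algebra.smul_def, mul_one]
    exact h

variable {f} in
@[elab_as_elim]
theorem induction {p : BC f M → Prop} (h0 : p 0) (hmk : ∀ (b : B) (m : M), p (b • mk f m))
    (hadd : ∀ x y, p x → p y → p (x + y)) (x : BC f M) : p x := by
  refine TensorProduct.induction_on (R := A) (M := Via f) (N := M) (motive := p) x h0 ?_ hadd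
  intro b m
  have : (TensorProduct.tmul A b m : TensorProduct A (Via f) M) = (b : B) • mk f m := by
    refine Eq.trans ?_ (TensorProduct.smul_tmul' (R := A) (R' := Via f) b (1 : Via f) m).symm
    rw [smul_eq_mul, mul_one]
  rw [this]
  exact hmk b m

variable {N : Type*} [AddCommGroup N] [Module C N]

/-- The universal property of the base change, for semilinear maps. -/
def lift (g : B →+* C) (φ : M →+ N) (hφ : ∀ a m, φ (a • m) = g (f a) • φ m) :
    BC f M →ₛₗ[g] N :=
  let g' : Via f →+* C := Via.hom f g
  let ψ : TensorProduct A (Via f) M →+ N := TensorProduct.liftAddHom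
    { toFun := fun b => (DistribSMul.toAddMonoidHom N (g' b)).comp φ
      map_zero' := by
        ext m
        change g' 0 • φ m = 0
        rw [map_zero, zero_smul]
      map_add' := fun b c => by
        ext m
        change g' (b + c) • φ m = g' b • φ m + g' c • φ m
        rw [map_add, add_smul] }
    (by
      intro a b m
      rw [Algebra.smul_def]
      change g' (algebraMap A (Via f) a * b) • φ m = g' b • φ (a • m)
      rw [hφ, map_mul, mul_comm, mul_smul]
      rfl)
  have hψ : ∀ (b : Via f) (x : TensorProduct A (Via f) M), ψ (b • x) = g' b • ψ x := by
    intro b x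
    induction x using TensorProduct.induction_on with
    | zero => rw [smul_zero, map_zero, smul_zero]
    | tmul c m =>
      rw [TensorProduct.smul_tmul']
      change g' (b * c) • φ m = g' b • g' c • φ m
      rw [map_mul, mul_smul]
    | add x y hx hy => rw [smul_add, map_add, map_add, hx, hy, smul_add]
  { toFun := ψ
    map_add' := ψ.map_add
    map_smul' := hψ }

@[simp] theorem lift_mk (g : B →+* C) (φ : M →+ N) (hφ : ∀ a m, φ (a • m) = g (f a) • φ m) (m : M) :
    lift f g φ hφ (mk f m) = φ m := by
  change g 1 • φ m = φ m
  rw [map_one, one_smul]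

variable {f} in
theorem hom_ext {g : B →+* C} {φ ψ : BC f M →ₛₗ[g] N} (h : ∀ m, φ (mk f m) = ψ (mk f m)) :
    φ = ψ := by
  ext x
  induction x using induction with
  | h0 => simp
  | hmk b m => rw [map_smulₛₗ, map_smulₛₗ, h]
  | hadd x y hx hy => rw [map_add, map_add, hx, hy]

/-- Functoriality in the ring. -/
def push (g : B →+* C) (h : A →+* C) (hh : ∀ a, h a = g (f a)) :
    BC f M →ₛₗ[g] BC h M :=
  lift f g (mk h : M →ₛₗ[h] BC h M).toAddMonoidHom (fun a m => by
    rw [← hh]; exact map_smulₛₗ (mk h) a m)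

@[simp] theorem push_mk (g : B →+* C) (h : A →+* C) (hh : ∀ a, h a = g (f a)) (m : M) :
    push f g h hh (mk f m) = mk h m := lift_mk ..

variable {M' : Type*} [AddCommGroup M'] [Module A M']
/-- Functoriality in the module. -/
def map (φ : M →ₗ[A] M') : BC f M →ₗ[B] BC f M' :=
  lift f (RingHom.id B) ((mk f).toAddMonoidHom.comp φ.toAddMonoidHom) (fun a m => by
    change mk f (φ (a • m)) = f a • mk f (φ m)
    rw [map_smul, map_smulₛₗ])

@[simp] theorem map_mk (φ : M →ₗ[A] M') (m : M) : map f φ (mk f m) = mk f (φ m) := lift_mk ..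

/-- One direction of the transitivity of base change. -/
def assocFun (g : B →+* C) (h : A →+* C) (hh : ∀ a, h a = g (f a)) :
    BC h M →ₗ[C] BC g (BC f M) :=
  lift h (RingHom.id C)
    ((mk g : BC f M →ₛₗ[g] BC g (BC f M)).toAddMonoidHom.comp (mk f : M →ₛₗ[f] _).toAddMonoidHom)
    (fun a m => by
      change (mk g (mk f (a • m)) : BC g (BC f M)) = h a • (mk g (mk f m) : BC g (BC f M))
      rw [map_smulₛₗ, map_smulₛₗ, hh])

theorem assocFun_mk (g : B →+* C) (h : A →+* C) (hh : ∀ a, h a = g (f a)) (m : M) :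
    assocFun f g h hh (mk h m) = mk g (mk f m) := by
  unfold assocFun
  rw [lift_mk]
  rfl

/-- The other direction of the transitivity of base change. -/
def assocInv (g : B →+* C) (h : A →+* C) (hh : ∀ a, h a = g (f a)) :
    BC g (BC f M) →ₗ[C] BC h M :=
  lift g (RingHom.id C) (push (M := M) f g h hh).toAddMonoidHom
    (fun b x => by
      change push (M := M) f g h hh (b • x) = g b • push (M := M) f g h hh x
      exact map_smulₛₗ (push (M := M) f g h hh) b x)

theorem assocInv_mk (g : B →+* C) (h : A →+* C) (hh : ∀ a, h a = g (f a)) (m : M) :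
    assocInv f g h hh (mk g (mk f m)) = mk h m := by
  unfold assocInv
  rw [lift_mk]
  exact push_mk f g h hh m

/-- Transitivity of base change. -/
def assoc (g : B →+* C) (h : A →+* C) (hh : ∀ a, h a = g (f a)) :
    BC h M ≃ₗ[C] BC g (BC f M) :=
  LinearEquiv.ofLinearMap (assocFun f g h hh) (assocInv f g h hh)
    (by
      apply hom_ext
      intro x
      change assocFun f g h hh (assocInv f g h hh (mk g x)) = mk g x
      induction x using induction with
      | h0 => simp only [map_zero]
      | hmk b m =>
        simp only [map_smulₛₗ, assocInv_mk, assocFun_mk, RingHom.id_apply]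
      | hadd x y hx hy => simp only [map_add, hx, hy])
    (by
      apply hom_ext
      intro m
      change assocInv f g h hh (assocFun f g h hh (mk h m)) = mk h m
      rw [assocFun_mk, assocInv_mk])

@[simp] theorem assoc_mk (g : B →+* C) (h : A →+* C) (hh : ∀ a, h a = g (f a)) (m : M) :
    assoc f g h hh (mk h m) = mk g (mk f m) := assocFun_mk f g h hh m

@[simp] theorem assoc_symm_mk (g : B →+* C) (h : A →+* C) (hh : ∀ a, h a = g (f a)) (m : M) :
    (assoc f g h hh).symm (mk g (mk f m)) = mk h m := by
  rw [LinearEquiv.symm_apply_eq, assoc_mk]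

/-- Functoriality in the module, for isomorphisms. -/
def congr (φ : M ≃ₗ[A] M') : BC f M ≃ₗ[B] BC f M' :=
  LinearEquiv.ofLinearMap (map f φ.toLinearMap) (map f φ.symm.toLinearMap)
    (by apply hom_ext; intro m; simp)
    (by apply hom_ext; intro m; simp)

@[simp] theorem congr_mk (φ : M ≃ₗ[A] M') (m : M) : congr f φ (mk f m) = mk f (φ m) := map_mk ..

theorem free (M : Type*) [AddCommGroup M] [Module A M] [Module.Free A M] :
    Module.Free B (BC f M) :=
  inferInstanceAs (Module.Free (Via f) (TensorProduct A (Via f) M))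

theorem finite (M : Type*) [AddCommGroup M] [Module A M] [Module.Finite A M] :
    Module.Finite B (BC f M) :=
  inferInstanceAs (Module.Finite (Via f) (TensorProduct A (Via f) M))

end BC
end BaseChange

section Taylor
variable {K : Type*} [NormedField K] [IsUltrametricDist K]

theorem nonarchimedeanRing_of_ultrametric : NonarchimedeanRing K :=
  { is_nonarchimedean := NonarchimedeanAddGroup.is_nonarchimedean }

/-- The power series `∑ b_i z^i` over `K` with `b_i ξ^i → 0`. -/
abbrev Restr (K : Type*) [NormedField K] [IsUltrametricDist K] (ξ : K) : Subring K⟦X⟧ :=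
  PowerSeries.IsRestricted.subring ‖ξ‖

theorem mem_Restr {K : Type*} [NormedField K] [IsUltrametricDist K] (ξ : K) (f : K⟦X⟧) :
    f ∈ Restr K ξ ↔ Tendsto (fun i => ‖PowerSeries.coeff i f‖ * ‖ξ‖ ^ i) atTop (𝓝 0) :=
  PowerSeries.isRestricted_iff' _ _

variable (ξ : K)

/-- The terms of the `n`-th coefficient of the expansion of `f` in powers of `z - ξ`. -/
def taylorTerm (f : K⟦X⟧) (n i : ℕ) : K :=
  (i.choose n : K) * PowerSeries.coeff i f * ξ ^ (i - n)

theorem tendsto_taylorTerm {f : K⟦X⟧} (hf : f ∈ Restr K ξ) (n : ℕ) :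
    Tendsto (taylorTerm ξ f n) atTop (𝓝 0) := by
  rcases eq_or_ne ξ 0 with rfl | hξ
  · refine tendsto_const_nhds.congr' ?_
    filter_upwards [eventually_gt_atTop n] with i hi
    rw [taylorTerm, zero_pow (by omega), mul_zero]
  · rw [mem_Restr] at hf
    have hf' := hf.mul_const ((‖ξ‖ ^ n)⁻¹)
    rw [zero_mul] at hf'
    refine squeeze_zero_norm' ?_ hf'
    filter_upwards [eventually_ge_atTop n] with i hi
    have hξ' : ‖ξ‖ ^ n ≠ 0 := pow_ne_zero _ (norm_ne_zero_iff.2 hξ)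
    have h1 : ‖(i.choose n : K)‖ ≤ 1 := IsUltrametricDist.norm_natCast_le_one K _
    rw [taylorTerm, norm_mul, norm_mul, norm_pow, mul_assoc ‖PowerSeries.coeff i f‖]
    have h2 : ‖ξ‖ ^ (i - n) = ‖ξ‖ ^ i * (‖ξ‖ ^ n)⁻¹ :=
      pow_sub₀ _ (norm_ne_zero_iff.2 hξ) hi
    rw [h2, mul_assoc]
    exact mul_le_of_le_one_left (by positivity) h1

theorem taylorTerm_vandermonde (f g : K⟦X⟧) (n a b : ℕ) :
    ∑ x ∈ Finset.HasAntidiagonal.antidiagonal n, taylorTerm ξ f x.1 a * taylorTerm ξ g x.2 b =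
      ((a + b).choose n : K) * (PowerSeries.coeff a f * PowerSeries.coeff b g) *
        ξ ^ (a + b - n) := by
  rw [Nat.add_choose_eq]
  push_cast
  rw [Finset.sum_mul, Finset.sum_mul]
  refine Finset.sum_congr rfl fun x hx => ?_
  rw [Finset.HasAntidiagonal.mem_antidiagonal] at hx
  unfold taylorTerm
  by_cases h : x.1 ≤ a ∧ x.2 ≤ b
  · have : a + b - n = (a - x.1) + (b - x.2) := by omega
    rw [this, pow_add]
    ring
  · rcases not_and_or.1 h with h | h
    · rw [Nat.choose_eq_zero_of_lt (not_le.1 h)]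
      simp
    · rw [Nat.choose_eq_zero_of_lt (not_le.1 h)]
      simp

theorem map_mem_Restr {K' : Type*} [NormedField K'] [IsUltrametricDist K'] (φ : K →+* K')
    (hφ : ∀ x, ‖φ x‖ = ‖x‖) {f : K⟦X⟧} (hf : f ∈ Restr K ξ) :
    PowerSeries.map φ f ∈ Restr K' (φ ξ) := by
  rw [mem_Restr] at hf ⊢
  simpa [hφ] using hf

variable [CompleteSpace K]

theorem summable_taylorTerm {f : K⟦X⟧} (hf : f ∈ Restr K ξ) (n : ℕ) :
    Summable (taylorTerm ξ f n) := by
  apply NonarchimedeanAddGroup.summable_of_tendsto_cofinite_zero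
  rw [Nat.cofinite_eq_atTop]
  exact tendsto_taylorTerm ξ hf n

/-- The expansion `f ↦ f(ξ + T)` of a convergent power series at `ξ`. -/
def taylor : Restr K ξ →+* K⟦X⟧ where
  toFun f := PowerSeries.mk fun n => ∑' i, taylorTerm ξ f.1 n i
  map_zero' := by
    ext n
    simp [taylorTerm]
  map_one' := by
    ext n
    rw [PowerSeries.coeff_mk, tsum_eq_single 0]
    · rcases Nat.eq_zero_or_pos n with rfl | hn
      · simp [taylorTerm]
      · rw [taylorTerm, Nat.choose_eq_zero_of_lt hn, PowerSeries.coeff_one, if_neg hn.ne']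
        simp
    · intro i hi
      simp [taylorTerm, PowerSeries.coeff_one, hi]
  map_add' f g := by
    ext n
    rw [map_add, PowerSeries.coeff_mk, PowerSeries.coeff_mk, PowerSeries.coeff_mk,
      ← (summable_taylorTerm ξ f.2 n).tsum_add (summable_taylorTerm ξ g.2 n)]
    congr 1
    ext i
    simp [taylorTerm]
    ring
  map_mul' f g := by
    ext n
    rw [PowerSeries.coeff_mul, PowerSeries.coeff_mk]
    simp only [PowerSeries.coeff_mk]
    have : NonarchimedeanRing K := nonarchimedeanRing_of_ultrametric
    have h1 : ∀ x ∈ Finset.HasAntidiagonal.antidiagonal n,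
        HasSum (fun p : ℕ × ℕ => taylorTerm ξ f.1 x.1 p.1 * taylorTerm ξ g.1 x.2 p.2)
          ((∑' i, taylorTerm ξ f.1 x.1 i) * ∑' i, taylorTerm ξ g.1 x.2 i) := fun x _ =>
      (summable_taylorTerm ξ f.2 _).hasSum.mul_of_nonarchimedean
        (summable_taylorTerm ξ g.2 _).hasSum
    have h2 := hasSum_sum h1
    simp only [taylorTerm_vandermonde] at h2
    rw [← Finset.HasAntidiagonal.sigmaAntidiagonalEquivProd.hasSum_iff] at h2
    have h3 := h2.sigma (g := fun m => taylorTerm ξ (f.1 * g.1) n m) (fun m => by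
      convert! hasSum_fintype _ using 1
      rw [taylorTerm, PowerSeries.coeff_mul, Finset.mul_sum, Finset.sum_mul,
        ← Finset.sum_coe_sort]
      refine Finset.sum_congr rfl fun x _ => ?_
      have := Finset.HasAntidiagonal.mem_antidiagonal.1 x.2
      simp only [Function.comp_apply, Finset.HasAntidiagonal.sigmaAntidiagonalEquivProd_apply, this])
    exact h3.tsum_eq

theorem coeff_taylor (f : Restr K ξ) (n : ℕ) :
    PowerSeries.coeff n (taylor ξ f) = ∑' i, taylorTerm ξ f.1 n i :=
  PowerSeries.coeff_mk n fun n => ∑' i, taylorTerm ξ f.1 n i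

theorem taylor_map {K' : Type*} [NormedField K'] [CompleteSpace K'] [IsUltrametricDist K']
    (φ : K →+* K') (hφ : ∀ x, ‖φ x‖ = ‖x‖) (f : Restr K ξ) (f' : Restr K' (φ ξ))
    (hf : f'.1 = PowerSeries.map φ f.1) :
    taylor (φ ξ) f' = PowerSeries.map φ (taylor ξ f) := by
  ext n
  have hc : Continuous φ := (AddMonoidHomClass.isometry_of_norm φ hφ).continuous
  rw [PowerSeries.coeff_map, coeff_taylor, coeff_taylor,
    (summable_taylorTerm ξ f.2 n).map_tsum φ hc]
  congr 1
  ext i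
  simp [taylorTerm, hf]

theorem taylor_C (b : K) (h : PowerSeries.C b ∈ Restr K ξ) :
    taylor ξ ⟨PowerSeries.C b, h⟩ = PowerSeries.C b := by
  ext n
  rw [coeff_taylor, tsum_eq_single 0]
  · rcases Nat.eq_zero_or_pos n with rfl | hn
    · simp [taylorTerm]
    · rw [taylorTerm, Nat.choose_eq_zero_of_lt hn, PowerSeries.coeff_C (n := n), if_neg hn.ne']
      simp
  · intro i hi
    simp [taylorTerm, PowerSeries.coeff_C, hi]

theorem taylor_X (h : PowerSeries.X ∈ Restr K ξ) :
    taylor ξ ⟨PowerSeries.X, h⟩ = PowerSeries.C ξ + PowerSeries.X := by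
  ext n
  rw [coeff_taylor, tsum_eq_single 1]
  · rcases n with _ | _ | n
    · simp [taylorTerm]
    · simp [taylorTerm]
    · rw [taylorTerm, Nat.choose_eq_zero_of_lt (by omega)]
      simp [PowerSeries.coeff_X]
  · intro i hi
    simp [taylorTerm, PowerSeries.coeff_X, hi]

end Taylor

section rings
variable {F : Type u} [Field F] [Fintype F]

/-- The `q`-Frobenius `b ↦ b ^ q` of an `A_v`-algebra. -/
def frob (B : Type*) [CommRing B] [Algebra (Av F) B] : B →+* B where
  toFun b := b ^ Fintype.card F
  map_one' := one_pow _
  map_mul' a b := mul_pow a b _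
  map_zero' := zero_pow Fintype.card_ne_zero
  map_add' a b := by
    let _ : Algebra F B := ((algebraMap (Av F) B).comp PowerSeries.C).toAlgebra
    exact map_add (FiniteField.frobeniusAlgHom F B) a b

theorem frob_apply (B : Type*) [CommRing B] [Algebra (Av F) B] (b : B) :
    frob (F := F) B b = b ^ Fintype.card F := rfl

/-- The map `A_v = F⟦z⟧ → B⟦z⟧` induced by `F → B`, with `z ↦ z`. -/
def coef (B : Type*) [CommRing B] [Algebra (Av F) B] : Av F →+* B⟦X⟧ :=
  PowerSeries.map ((algebraMap (Av F) B).comp PowerSeries.C)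

variable (L : IntermediateField (Qv F) (Qalg F))

/-- The ring `R⟦z⟧`. -/
abbrev RX := (RL L)⟦X⟧

/-- The image `ζ` of `z` in `R`. -/
def zeta : RL L := algebraMap (Av F) (RL L) PowerSeries.X

/-- The image `ζ` of `z` in `L`. -/
def zetaL : L := algebraMap (RL L) L (zeta L)

/-- The element `z - ζ` of `R⟦z⟧`. -/
def zmz : RX L := PowerSeries.X - PowerSeries.C (zeta L)

/-- The endomorphism `σ̂` of `R⟦z⟧` with `σ̂(z) = z` and `σ̂(b) = b ^ q` for `b ∈ R`. -/
def sigma : RX L →+* RX L := PowerSeries.map (frob (F := F) (RL L))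

/-- The structure map `A_v = F⟦z⟧ → R⟦z⟧`, `z ↦ z`. -/
def coefR : Av F →+* RX L := coef (RL L)

theorem sigma_coefR (f : Av F) : sigma L (coefR L f) = coefR L f := by
  ext n
  simp only [sigma, coefR, coef, PowerSeries.coeff_map, frob_apply]
  rw [← map_pow, FiniteField.pow_card]

/-- The ring `R⟦z⟧[1/(z - ζ)]`. -/
def Loc := Localization.Away (zmz L)

instance : CommRing (Loc L) := inferInstanceAs (CommRing (Localization.Away (zmz L)))
instance : Algebra (RX L) (Loc L) := inferInstanceAs (Algebra (RX L) (Localization.Away (zmz L)))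
instance : IsLocalization.Away (zmz L) (Loc L) :=
  inferInstanceAs (IsLocalization.Away (zmz L) (Localization.Away (zmz L)))

/-- The map `R⟦z⟧ → R⟦z⟧[1/(z - ζ)]`. -/
def loc : RX L →+* Loc L := algebraMap _ _

/-- The separable closure of `L` in `Q_v^alg`. -/
abbrev Lsep := separableClosure L (Qalg F)

instance algebraLsep : Algebra (Av F) (Lsep L) :=
  ((algebraMap L (Lsep L)).comp (algebraMap (Av F) L)).toAlgebra

instance towerQalg : IsScalarTower (Av F) L (Qalg F) := by
  refine IsScalarTower.of_algebraMap_eq fun a => ?_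
  rw [IsScalarTower.algebraMap_apply (Av F) (Qv F) (Qalg F),
    IsScalarTower.algebraMap_apply (Av F) (Qv F) L]
  rfl

/-- The inclusion `R → L^sep`. -/
def RtoSep : RL L →+* Lsep L := (algebraMap L (Lsep L)).comp (algebraMap (RL L) L)

/-- The map `R⟦z⟧ → L^sep⟦z⟧`. -/
def toSep : RX L →+* (Lsep L)⟦X⟧ := PowerSeries.map (RtoSep L)

/-- The endomorphism `σ̂` of `L^sep⟦z⟧`. -/
def sigmaSep : (Lsep L)⟦X⟧ →+* (Lsep L)⟦X⟧ := PowerSeries.map (frob (F := F) (Lsep L))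

theorem toSep_sigma (a : RX L) : (toSep L).comp (sigma L) a = sigmaSep L (toSep L a) := by
  ext n
  simp [sigma, toSep, sigmaSep, frob_apply]

theorem norm_zetaL : ‖zetaL L‖ = (Fintype.card F : ℝ)⁻¹ := by
  have h : ((zetaL L : L) : Qalg F) = algebraMap (Qv F) (Qalg F) (HahnSeries.single 1 1) := by
    change algebraMap L (Qalg F) (algebraMap (RL L) L (algebraMap (Av F) (RL L) PowerSeries.X)) = _
    rw [← IsScalarTower.algebraMap_apply (Av F) (RL L) L,
      ← IsScalarTower.algebraMap_apply (Av F) L (Qalg F),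
      IsScalarTower.algebraMap_apply (Av F) (Qv F) (Qalg F)]
    congr 1
    simp
  change ‖((zetaL L : L) : Qalg F)‖ = _
  rw [h, norm_algebraMap_Qalg, norm_single]
  simp

theorem norm_zetaL_lt_one : ‖zetaL L‖ < 1 := by
  rw [norm_zetaL]
  exact inv_lt_one_of_one_lt₀ (by exact_mod_cast Fintype.one_lt_card)

theorem zetaL_ne_zero : zetaL L ≠ 0 := by
  rw [← norm_ne_zero_iff, norm_zetaL]
  simp

theorem norm_RL_le (r : RL L) : ‖algebraMap (RL L) L r‖ ≤ 1 := by
  have h : IsIntegral (Av F) ((algebraMap (RL L) L r : L) : Qalg F) := by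
    exact (show IsIntegral (Av F) (algebraMap (RL L) L r) from Subtype.property r).map
      (IsScalarTower.toAlgHom (Av F) L (Qalg F))
  exact norm_of_isIntegral F h

theorem map_mem_Restr_of_bounded {K : Type*} [NormedField K] [IsUltrametricDist K] {B : Type*}
    [CommRing B] (φ : B →+* K) (hφ : ∀ b, ‖φ b‖ ≤ 1) {ξ : K} (hξ : ‖ξ‖ < 1) (f : B⟦X⟧) :
    PowerSeries.map φ f ∈ Restr K ξ := by
  rw [mem_Restr]
  refine squeeze_zero (fun _ => by positivity) (fun n => ?_)
    (tendsto_pow_atTop_nhds_zero_of_lt_one (norm_nonneg ξ) hξ)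
  rw [PowerSeries.coeff_map]
  exact mul_le_of_le_one_left (by positivity) (hφ _)

/-- The map `R⟦z⟧ → L⟨z/ζ⟩`. -/
def toRestrL : RX L →+* Restr L (zetaL L) :=
  (PowerSeries.map (algebraMap (RL L) L)).codRestrict _
    (map_mem_Restr_of_bounded _ (norm_RL_le L) (norm_zetaL_lt_one L))

variable [FiniteDimensional (Qv F) L]

/-- The map `R⟦z⟧ → L⟦z - ζ⟧`, where the variable of the target stands for `z - ζ`. -/
def expL : RX L →+* L⟦X⟧ := (taylor (zetaL L)).comp (toRestrL L)

theorem expL_C (r : RL L) : expL L (PowerSeries.C r) = PowerSeries.C (algebraMap (RL L) L r) := by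
  have h : ∀ h', (⟨PowerSeries.map (algebraMap (RL L) L) (PowerSeries.C r), h'⟩ :
      Restr L (zetaL L)) = ⟨PowerSeries.C (algebraMap (RL L) L r), by
        rwa [PowerSeries.map_C] at h'⟩ := fun h' => by
    ext1
    exact PowerSeries.map_C _ _
  exact (congrArg (taylor (zetaL L)) (h _)).trans (taylor_C _ _ _)

theorem expL_zmz : expL L (zmz L) = PowerSeries.X := by
  have h : ∀ h', (⟨PowerSeries.map (algebraMap (RL L) L) PowerSeries.X, h'⟩ :
      Restr L (zetaL L)) = ⟨PowerSeries.X, by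
        rwa [PowerSeries.map_X] at h'⟩ := fun h' => by
    ext1
    exact PowerSeries.map_X _
  have h1 : expL L PowerSeries.X = PowerSeries.C (zetaL L) + PowerSeries.X :=
    (congrArg (taylor (zetaL L)) (h _)).trans (taylor_X _ _)
  rw [zmz, map_sub, h1, expL_C]
  exact add_sub_cancel_left _ _
end rings

section rings2
variable {F : Type u} [Field F] [Fintype F] (L : IntermediateField (Qv F) (Qalg F))

/-- The inclusion `L^sep → ℂ_v`. -/
def sepToC : Lsep L →+* Cv F := (toCv F).comp (algebraMap (Lsep L) (Qalg F))

/-- The image `ζ` of `z` in `ℂ_v`. -/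
def zetaC : Cv F := toCv F (zetaL L : Qalg F)

theorem norm_toCv (x : Qalg F) : ‖toCv F x‖ = ‖x‖ := UniformSpace.Completion.norm_coe x

theorem norm_zetaC_lt_one : ‖zetaC L‖ < 1 := by
  rw [zetaC, norm_toCv]
  exact norm_zetaL_lt_one L

/-- The ring `L^sep⟨z/ζ⟩` of the series `∑ b_i z^i` with `b_i ∈ L^sep` and `|b_i| |ζ|^i → 0`. -/
def SepRestr : Subring (Lsep L)⟦X⟧ :=
  (Restr (Cv F) (zetaC L)).comap (PowerSeries.map (sepToC L))

theorem mem_SepRestr (f : (Lsep L)⟦X⟧) : f ∈ SepRestr L ↔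
    Tendsto (fun i => ‖((PowerSeries.coeff i f : Lsep L) : Qalg F)‖ * ‖(zetaL L : Qalg F)‖ ^ i)
      atTop (𝓝 0) := by
  change PowerSeries.map (sepToC L) f ∈ Restr (Cv F) (zetaC L) ↔ _
  rw [mem_Restr]
  simp only [PowerSeries.coeff_map, zetaC, norm_toCv]
  have (x : Lsep L) : ‖sepToC L x‖ = ‖(x : Qalg F)‖ := norm_toCv _
  simp only [this]

/-- The map `R⟦z⟧ → L^sep⟨z/ζ⟩`. -/
def toSepRestr : RX L →+* SepRestr L :=
  (toSep L).codRestrict _ (fun f => by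
    change PowerSeries.map (sepToC L) (PowerSeries.map (RtoSep L) f) ∈ Restr (Cv F) (zetaC L)
    rw [← RingHom.comp_apply, ← PowerSeries.map_comp]
    refine map_mem_Restr_of_bounded _ (fun r => ?_) (norm_zetaC_lt_one L) f
    change ‖toCv F ((algebraMap (RL L) L r : L) : Qalg F)‖ ≤ 1
    rw [norm_toCv]
    exact norm_RL_le L r)

/-- The expansion `L^sep⟨z/ζ⟩ → ℂ_v⸨z - ζ⸩`, where the variable of the target stands for
`z - ζ`. -/
def expSep : SepRestr L →+* (Cv F)⸨X⸩ :=
  (HahnSeries.ofPowerSeries ℤ (Cv F)).comp ((taylor (zetaC L)).comp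
    (((PowerSeries.map (sepToC L)).comp (SepRestr L).subtype).codRestrict _ (fun f => f.2)))

/-- The expansion `R⟦z⟧ → ℂ_v⸨z - ζ⸩`. -/
def expC : RX L →+* (Cv F)⸨X⸩ := (expSep L).comp (toSepRestr L)

theorem expC_zmz : expC L (zmz L) = HahnSeries.single 1 1 := by
  have key : ∀ h', taylor (zetaC L)
      ⟨PowerSeries.map (sepToC L) (PowerSeries.map (RtoSep L) (zmz L)), h'⟩ = PowerSeries.X := by
    intro h'
    have e1 : PowerSeries.map (sepToC L) (PowerSeries.map (RtoSep L) (zmz L)) =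
        PowerSeries.X - PowerSeries.C (zetaC L) := by
      rw [zmz, map_sub, map_sub, PowerSeries.map_X, PowerSeries.map_X, PowerSeries.map_C,
        PowerSeries.map_C]
      rfl
    have hC : PowerSeries.C (zetaC L) ∈ Restr (Cv F) (zetaC L) := PowerSeries.isRestricted_C _ _
    have hX : PowerSeries.X ∈ Restr (Cv F) (zetaC L) := by
      rw [e1] at h'
      simpa using (Restr (Cv F) (zetaC L)).add_mem h' hC
    have e2 : (⟨_, h'⟩ : Restr (Cv F) (zetaC L)) = ⟨_, hX⟩ - ⟨_, hC⟩ := by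
      ext1
      exact e1
    rw [e2, map_sub, taylor_X, taylor_C, add_sub_cancel_left]
  have h2 := congrArg (HahnSeries.ofPowerSeries ℤ (Cv F)) (key (by
    exact (toSepRestr L (zmz L)).2))
  rw [HahnSeries.ofPowerSeries_X] at h2
  exact h2

theorem expC_C (r : RL L) :
    expC L (PowerSeries.C r) = HahnSeries.C (sepToC L (RtoSep L r)) := by
  have key : ∀ h', taylor (zetaC L)
      ⟨PowerSeries.map (sepToC L) (PowerSeries.map (RtoSep L) (PowerSeries.C r)), h'⟩ =
        PowerSeries.C (sepToC L (RtoSep L r)) := by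
    intro h'
    have hC : PowerSeries.C (sepToC L (RtoSep L r)) ∈ Restr (Cv F) (zetaC L) :=
      PowerSeries.isRestricted_C _ _
    have e2 : (⟨_, h'⟩ : Restr (Cv F) (zetaC L)) = ⟨_, hC⟩ := by
      ext1
      change PowerSeries.map (sepToC L) (PowerSeries.map (RtoSep L) (PowerSeries.C r)) = _
      rw [PowerSeries.map_C, PowerSeries.map_C]
    rw [e2, taylor_C]
  have h2 := congrArg (HahnSeries.ofPowerSeries ℤ (Cv F)) (key (by
    exact (toSepRestr L (PowerSeries.C r)).2))
  rw [HahnSeries.ofPowerSeries_C] at h2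
  exact h2

theorem isUnit_expC : IsUnit (expC L (zmz L)) := by
  rw [expC_zmz]
  exact isUnit_iff_ne_zero.2 (HahnSeries.single_ne_zero one_ne_zero)

theorem isUnit_toSep : IsUnit (toSep L (zmz L)) := by
  rw [PowerSeries.isUnit_iff_constantCoeff, isUnit_iff_ne_zero]
  have : PowerSeries.constantCoeff (toSep L (zmz L)) = - algebraMap L (Lsep L) (zetaL L) := by
    rw [toSep, zmz, map_sub, PowerSeries.map_X, PowerSeries.map_C, map_sub,
      PowerSeries.constantCoeff_X, PowerSeries.constantCoeff_C, zero_sub]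
    rfl
  rw [this, neg_ne_zero]
  exact (map_ne_zero _).2 (zetaL_ne_zero L)

variable [FiniteDimensional (Qv F) L]

/-- The expansion `R⟦z⟧ → L⸨z - ζ⸩`. -/
def expLL : RX L →+* L⸨X⸩ := (HahnSeries.ofPowerSeries ℤ L).comp (expL L)

theorem isUnit_expLL : IsUnit (expLL L (zmz L)) := by
  rw [expLL, RingHom.comp_apply, expL_zmz, HahnSeries.ofPowerSeries_X]
  exact isUnit_iff_ne_zero.2 (HahnSeries.single_ne_zero one_ne_zero)

end rings2

section shtuka
variable {F : Type u} [Field F] [Fintype F] (L : IntermediateField (Qv F) (Qalg F))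

/-- A local shtuka over `R` with underlying module `M`: the module is free of finite rank over
`R⟦z⟧`, and `tau` is an isomorphism `σ̂^*M[1/(z - ζ)] ≅ M[1/(z - ζ)]`. -/
structure LocalShtuka (M : Type w) [AddCommGroup M] [Module (RX L) M] where
  free : Module.Free (RX L) M
  finite : Module.Finite (RX L) M
  tau : BC ((loc L).comp (sigma L)) M ≃ₗ[Loc L] BC (loc L) M

variable {L} {M : Type w} [AddCommGroup M] [Module (RX L) M]

/-- `A_v` acts on every base change of `M` through `F⟦z⟧ → R⟦z⟧`. -/
instance moduleAv {B : Type*} [CommRing B] (f : RX L →+* B) : Module (Av F) (BC f M) :=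
  Module.compHom _ (f.comp (coefR L))

theorem smul_Av_def {B : Type*} [CommRing B] (f : RX L →+* B) (a : Av F) (x : BC f M) :
    a • x = f (coefR L a) • x := rfl

namespace LocalShtuka
variable (S : LocalShtuka L M) {B : Type*} [CommRing B] (g : RX L →+* B)
  (hg : IsUnit (g (zmz L)))

/-- The extension of `g : R⟦z⟧ → B` to `R⟦z⟧[1/(z - ζ)]`. -/
def liftLoc (hg : IsUnit (g (zmz L))) : Loc L →+* B := IsLocalization.Away.lift (zmz L) hg

theorem liftLoc_loc (hg : IsUnit (g (zmz L))) (a : RX L) : g a = liftLoc g hg (loc L a) :=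
  (IsLocalization.Away.lift_eq (zmz L) hg a).symm

/-- The isomorphism `τ : σ̂^*M ⊗ B ≅ M ⊗ B` for an `R⟦z⟧`-algebra `B` in which `z - ζ` is
invertible. -/
def tauB : BC (g.comp (sigma L)) M ≃ₗ[B] BC g M :=
  (BC.assoc ((loc L).comp (sigma L)) (liftLoc g hg) (g.comp (sigma L))
    (fun a => liftLoc_loc g hg (sigma L a))).trans
  ((BC.congr (liftLoc g hg) S.tau).trans
    (BC.assoc (loc L) (liftLoc g hg) g (liftLoc_loc g hg)).symm)

end LocalShtuka

/-- An action of the integral closure `O_E` of `A_v` in `E` on a local shtuka by endomorphisms. -/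
structure OEAction (S : LocalShtuka L M) (E : Type v) [CommRing E] [Algebra (Av F) E] where
  act : integralClosure (Av F) E →+* Module.End (RX L) M
  act_algebraMap : ∀ (f : Av F) (m : M), act (algebraMap (Av F) _ f) m = coefR L f • m
  tau_comm : ∀ a x, S.tau (BC.map _ (act a) x) = BC.map _ (act a) (S.tau x)

namespace OEAction
variable {S : LocalShtuka L M} {E : Type v} [CommRing E] [Algebra (Av F) E] (A : OEAction S E)

theorem tauB_comm {B : Type*} [CommRing B] (g : RX L →+* B) (hg : IsUnit (g (zmz L)))
    (a : integralClosure (Av F) E) (x : BC (g.comp (sigma L)) M) :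
    S.tauB g hg (BC.map _ (A.act a) x) = BC.map _ (A.act a) (S.tauB g hg x) := by
  have key : ∀ y : BC (loc L) M,
      (BC.assoc (loc L) (LocalShtuka.liftLoc g hg) g (LocalShtuka.liftLoc_loc g hg)).symm
        (BC.mk _ (BC.map _ (A.act a) y)) = BC.map g (A.act a)
      ((BC.assoc (loc L) (LocalShtuka.liftLoc g hg) g (LocalShtuka.liftLoc_loc g hg)).symm
        (BC.mk _ y)) := by
    intro y
    induction y using BC.induction with
    | h0 => simp only [map_zero]
    | hmk b m =>
      simp only [map_smulₛₗ, BC.map_mk, RingHom.id_apply, BC.assoc_symm_mk]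
    | hadd x y hx hy => simp only [map_add, hx, hy]
  induction x using BC.induction with
  | h0 => simp only [map_zero]
  | hmk b m =>
    simp only [map_smulₛₗ, RingHom.id_apply]
    congr 1
    simp only [BC.map_mk, LocalShtuka.tauB, LinearEquiv.trans_apply, BC.assoc_mk, BC.congr_mk]
    rw [← key, ← A.tau_comm, BC.map_mk]
  | hadd x y hx hy => simp only [map_add, hx, hy]

end OEAction

namespace LocalShtuka
variable (S : LocalShtuka L M)

/-- `M ⊗ L^sep⟦z⟧`. -/
abbrev MSep (_ : LocalShtuka L M) := BC (toSep L) M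

/-- The semilinear map `σ̂_M^* : M ⊗ L^sep⟦z⟧ → σ̂^*M ⊗ L^sep⟦z⟧`. -/
def sigmaStar : S.MSep →ₛₗ[sigmaSep L] BC ((toSep L).comp (sigma L)) M :=
  BC.push (toSep L) (sigmaSep L) ((toSep L).comp (sigma L)) (toSep_sigma L)

theorem sigmaSep_coef (f : Av F) : sigmaSep L (toSep L (coefR L f)) = toSep L (coefR L f) := by
  rw [← toSep_sigma, RingHom.comp_apply, sigma_coefR]

/-- The `v`-adic realization `H^1_v(M, A_v)`: the `τ`-invariants of `M ⊗ L^sep⟦z⟧`. -/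
def H1v : Submodule (Av F) S.MSep where
  carrier := {m | S.tauB (toSep L) (isUnit_toSep L) (S.sigmaStar m) = m}
  zero_mem' := by
    change S.tauB _ _ (S.sigmaStar 0) = 0
    rw [map_zero, map_zero]
  add_mem' {a b} ha hb := by
    change S.tauB _ _ (S.sigmaStar (a + b)) = a + b
    rw [map_add, map_add, ha, hb]
  smul_mem' f m hm := by
    change S.tauB _ _ (S.sigmaStar (toSep L (coefR L f) • m)) = toSep L (coefR L f) • m
    rw [map_smulₛₗ, map_smul, hm, sigmaSep_coef]

theorem mem_H1v (m : S.MSep) :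
    m ∈ S.H1v ↔ S.tauB (toSep L) (isUnit_toSep L) (S.sigmaStar m) = m := Iff.rfl

/-- `H_{1,v}(M, A_v)` -/
abbrev HomAv := S.H1v →ₗ[Av F] Av F

/-- `H_{1,v}(M, Q_v)` -/
abbrev HomQv := S.H1v →ₗ[Av F] Qv F

/-- The elements of `M ⊗ L^sep⟨z/ζ⟩` whose image in `M ⊗ L^sep⟦z⟧` lies in `H^1_v(M, A_v)`. -/
def H1vConv : Submodule (Av F) (BC (toSepRestr L) M) where
  carrier := {m | BC.push (toSepRestr L) (SepRestr L).subtype (toSep L) (fun _ => rfl) m ∈ S.H1v}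
  zero_mem' := by
    change BC.push _ _ _ _ 0 ∈ S.H1v
    rw [map_zero]
    exact zero_mem _
  add_mem' {a b} ha hb := by
    change BC.push _ _ _ _ (a + b) ∈ S.H1v
    rw [map_add]
    exact add_mem ha hb
  smul_mem' f m hm := by
    change BC.push _ _ _ _ (toSepRestr L (coefR L f) • m) ∈ S.H1v
    rw [map_smulₛₗ]
    exact S.H1v.smul_mem f hm

/-- The identification of the elements of `H1vConv` with elements of `H^1_v(M, A_v)`. -/
def convToH1v : S.H1vConv →ₗ[Av F] S.H1v where
  toFun m := ⟨BC.push (toSepRestr L) (SepRestr L).subtype (toSep L) (fun _ => rfl) m.1, m.2⟩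
  map_add' a b := by
    ext1
    exact map_add _ _ _
  map_smul' f m := by
    ext1
    exact map_smulₛₗ (BC.push (toSepRestr L) (SepRestr L).subtype (toSep L) (fun _ => rfl)) _ m.1

variable (L) in
/-- The map `A_v → ℂ_v⸨z - ζ⸩`, `z ↦ ζ + (z - ζ)`. -/
def AvToC : Av F →+* (Cv F)⸨X⸩ := (expC L).comp (coefR L)

theorem isUnit_AvToC (f : Av F) (hf : f ≠ 0) : IsUnit (AvToC L f) := by
  have hX : IsUnit (AvToC L PowerSeries.X) := by
    have e : coefR L PowerSeries.X = zmz L + PowerSeries.C (zeta L) := by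
      rw [coefR, coef, PowerSeries.map_X, zmz, sub_add_cancel]
    rw [AvToC, RingHom.comp_apply, e, map_add, expC_zmz, expC_C, isUnit_iff_ne_zero]
    intro h
    have := congrArg (fun s => HahnSeries.coeff s 1) h
    simp at this
  obtain ⟨n, u, rfl⟩ := IsDiscreteValuationRing.eq_unit_mul_pow_irreducible hf
    PowerSeries.X_irreducible
  rw [map_mul, map_pow]
  exact (u.isUnit.map _).mul (hX.pow n)

variable (L) in
/-- The map `Q_v → ℂ_v⸨z - ζ⸩`, `z ↦ ζ + (z - ζ)`. -/
def QvToC : Qv F →+* (Cv F)⸨X⸩ :=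
  IsLocalization.lift (M := nonZeroDivisors (Av F)) (g := AvToC L)
    (fun f => isUnit_AvToC f.1 (nonZeroDivisors.ne_zero f.2))

/-- The map `h : H^1_v(M, A_v) ⊗ ℂ_v⸨z - ζ⸩ → M ⊗ ℂ_v⸨z - ζ⸩` induced by the inclusion. -/
def compare : BC (AvToC L) S.H1vConv →ₗ[(Cv F)⸨X⸩] BC (expC L) M :=
  BC.lift (AvToC L) (RingHom.id _)
    ((BC.push (toSepRestr L) (expSep L) (expC L) (fun _ => rfl)).toAddMonoidHom.comp
      S.H1vConv.subtype.toAddMonoidHom)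
    (fun f m => map_smulₛₗ (BC.push (toSepRestr L) (expSep L) (expC L) (fun _ => rfl)) _ m.1)

/-- The map `u ⊗ id : H^1_v(M, A_v) ⊗ ℂ_v⸨z - ζ⸩ → ℂ_v⸨z - ζ⸩`. -/
def evalC (u : S.HomQv) : BC (AvToC L) S.H1vConv →ₗ[(Cv F)⸨X⸩] (Cv F)⸨X⸩ :=
  BC.lift (AvToC L) (RingHom.id _)
    ((QvToC L).toAddMonoidHom.comp (u.comp S.convToH1v).toAddMonoidHom)
    (fun f m => by
      change QvToC L ((u.comp S.convToH1v) (f • m)) = AvToC L f * QvToC L ((u.comp S.convToH1v) m)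
      rw [map_smul, Algebra.smul_def, map_mul]
      congr 1
      exact IsLocalization.lift_eq _ _)

end LocalShtuka
end shtuka

section valuations
variable {F : Type u} [Field F] [Fintype F]

variable (F) in
/-- The valuation `v(x) = - log |x| / log q`, normalised by `v(ζ) = 1`. -/
def val {K : Type*} [NormedField K] (x : K) : ℝ := - Real.log ‖x‖ / Real.log (Fintype.card F)

/-- For `x = ∑_{i ≥ n} b_i (z - ζ)^i` in `ℂ_v⸨z - ζ⸩` with `b_n ≠ 0`, the value `v(b_n)`. -/
def valT (x : (Cv F)⸨X⸩) : ℝ := val F x.leadingCoeff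

variable (L : IntermediateField (Qv F) (Qalg F)) [FiniteDimensional (Qv F) L]

/-- The inclusion `L → ℂ_v`. -/
def LtoC : L →+* Cv F := (toCv F).comp (algebraMap L (Qalg F))

/-- The inclusion `L⟦z - ζ⟧ → ℂ_v⸨z - ζ⸩`. -/
def TtoC : L⟦X⟧ →+* (Cv F)⸨X⸩ :=
  (HahnSeries.ofPowerSeries ℤ (Cv F)).comp (PowerSeries.map (LtoC L))

theorem expC_eq (a : RX L) : expC L a = TtoC L (expL L a) := by
  refine congrArg (HahnSeries.ofPowerSeries ℤ (Cv F)) ?_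
  refine taylor_map (zetaL L) (LtoC L) (fun x => norm_toCv (x : Qalg F)) (toRestrL L a) _ ?_
  ext n
  rfl

/-- The evaluation `R⟦z⟧ → L`, `z ↦ ζ`. -/
def evalL : RX L →+* L := PowerSeries.constantCoeff.comp (expL L)

theorem evalL_zmz : evalL L (zmz L) = 0 := by
  rw [evalL, RingHom.comp_apply, expL_zmz, PowerSeries.constantCoeff_X]

end valuations

section deRham
variable {F : Type u} [Field F] [Fintype F] {L : IntermediateField (Qv F) (Qalg F)}
  [FiniteDimensional (Qv F) L] {M : Type w} [AddCommGroup M] [Module (RX L) M]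

namespace LocalShtuka
variable (S : LocalShtuka L M)

/-- The de Rham realization `H^1_dR(M, L⟦z - ζ⟧) = σ̂^*M ⊗ L⟦z - ζ⟧`. -/
abbrev HdR (_ : LocalShtuka L M) := BC ((expL L).comp (sigma L)) M

/-- The de Rham realization `H^1_dR(M, L) = σ̂^*M ⊗_{z ↦ ζ} L`. -/
abbrev HdRL (_ : LocalShtuka L M) := BC ((evalL L).comp (sigma L)) M

/-- The de Rham realization `H^1_dR(M, R) = σ̂^*M / (z - ζ)σ̂^*M`, as a module over `R⟦z⟧`. -/
def HdRR (_ : LocalShtuka L M) := QuotSMulTop (zmz L) (BC (sigma L) M)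

instance : AddCommGroup S.HdRR := inferInstanceAs (AddCommGroup (QuotSMulTop (zmz L) _))
instance : Module (RX L) S.HdRR := inferInstanceAs (Module (RX L) (QuotSMulTop (zmz L) _))

/-- The reduction `H^1_dR(M, L⟦z - ζ⟧) → H^1_dR(M, L)`. -/
def redT : S.HdR →ₛₗ[PowerSeries.constantCoeff (R := L)] S.HdRL :=
  BC.push _ _ _ (fun _ => rfl)

open scoped Pointwise in
/-- The natural map `H^1_dR(M, R) → H^1_dR(M, L)`. -/
def redR : S.HdRR →ₛₗ[evalL L] S.HdRL :=
  Submodule.liftQ (zmz L • (⊤ : Submodule (RX L) (BC (sigma L) M))) (BC.push (sigma L) (evalL L) ((evalL L).comp (sigma L)) (fun _ => rfl)) (by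
    intro x hx
    obtain ⟨y, -, rfl⟩ := (Submodule.mem_smul_pointwise_iff_exists _ _ _).1 hx
    rw [LinearMap.mem_ker, map_smulₛₗ, evalL_zmz, zero_smul])

/-- The inclusion `H^1_dR(M, L⟦z - ζ⟧) → H^1_dR(M, ℂ_v⸨z - ζ⸩) = σ̂^*M ⊗ ℂ_v⸨z - ζ⸩`. -/
def HdRtoC : S.HdR →ₛₗ[TtoC L] BC ((expC L).comp (sigma L)) M :=
  BC.push _ _ _ (fun a => expC_eq L (sigma L a))

/-- The inclusion `H^1_dR(M, L⟦z - ζ⟧) → H^1_dR(M, L⸨z - ζ⸩)`. -/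
def HdRtoLL : S.HdR →ₛₗ[HahnSeries.ofPowerSeries ℤ L] BC ((expLL L).comp (sigma L)) M :=
  BC.push _ _ _ (fun _ => rfl)

/-- The inclusion `M ⊗ L⟦z - ζ⟧ → M ⊗ L⸨z - ζ⸩`. -/
def MtoLL (_ : LocalShtuka L M) :
    BC (expL L) M →ₛₗ[HahnSeries.ofPowerSeries ℤ L] BC (expLL L) M :=
  BC.push _ _ _ (fun _ => rfl)

/-- The period `∫_u ω = (u ⊗ id)(h_{v,dR}⁻¹(ω))`, where `h_{v,dR} = τ⁻¹ ∘ h`. -/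
def period (u : S.HomQv) (ω : S.HdR) : (Cv F)⸨X⸩ :=
  S.evalC u (Function.invFun S.compare (S.tauB (expC L) (isUnit_expC L) (S.HdRtoC ω)))

end LocalShtuka

namespace OEAction
variable {S : LocalShtuka L M} {E : Type v} [CommRing E] [Algebra (Qv F) E] [Algebra (Av F) E]
  [IsScalarTower (Av F) (Qv F) E] (A : OEAction S E) (ψ : E →ₐ[Qv F] L)

/-- The restriction `O_E → R` of `ψ : E → L`. -/
def psiR (ψ : E →ₐ[Qv F] L) : integralClosure (Av F) E →+* RL L :=
  (ψ.restrictScalars (Av F)).mapIntegralClosure.toRingHom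

/-- The endomorphism `[a] - ψ(a)` of `H^1_dR(M, L⟦z - ζ⟧)`. -/
def dev (a : integralClosure (Av F) E) : Module.End L⟦X⟧ S.HdR :=
  BC.map _ (A.act a) - PowerSeries.C (ψ a) • LinearMap.id

/-- The endomorphism `[a] - ψ(a)` of `H^1_dR(M, R)`. -/
def devR (a : integralClosure (Av F) E) : Module.End (RX L) S.HdRR :=
  QuotSMulTop.map (zmz L) (BC.map _ (A.act a) - PowerSeries.C (psiR ψ a) • LinearMap.id)

/-- The direct summand `H^ψ(M, L⟦y - ψ(y)⟧)` of `H^1_dR(M, L⟦z - ζ⟧)`, on which all `[a] - ψ(a)`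
with `a ∈ O_E` are nilpotent in the `(z - ζ)`-adic topology. -/
def Hpsi : Submodule L⟦X⟧ S.HdR where
  carrier := {ω | ∀ (a : integralClosure (Av F) E) (n : ℕ), ∃ k₀ : ℕ, ∀ k ≥ k₀, ∃ w : S.HdR,
     (A.dev ψ a ^ k) ω = (PowerSeries.X : L⟦X⟧) ^ n • w}
  zero_mem' := fun a n => ⟨0, fun k _ => ⟨0, by rw [map_zero, smul_zero]⟩⟩
  add_mem' := fun {x y} hx hy a n => by
    obtain ⟨k₁, h₁⟩ := hx a n
    obtain ⟨k₂, h₂⟩ := hy a n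
    refine ⟨max k₁ k₂, fun k hk => ?_⟩
    obtain ⟨w₁, e₁⟩ := h₁ k (le_trans (le_max_left _ _) hk)
    obtain ⟨w₂, e₂⟩ := h₂ k (le_trans (le_max_right _ _) hk)
    exact ⟨w₁ + w₂, by rw [map_add, e₁, e₂, smul_add]⟩
  smul_mem' := fun c x hx a n => by
    obtain ⟨k₁, h₁⟩ := hx a n
    refine ⟨k₁, fun k hk => ?_⟩
    obtain ⟨w₁, e₁⟩ := h₁ k hk
    exact ⟨c • w₁, by rw [map_smul, e₁, smul_comm]⟩

/-- The generalized eigenspace `H^ψ(M, R)` in `H^1_dR(M, R)`. -/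
def HpsiR : Submodule (RX L) S.HdRR where
  carrier := {ω | ∀ a : integralClosure (Av F) E, ∃ k₀ : ℕ, ∀ k ≥ k₀, (A.devR ψ a ^ k) ω = 0}
  zero_mem' := fun a => ⟨0, fun k _ => map_zero _⟩
  add_mem' := fun {x y} hx hy a => by
    obtain ⟨k₁, h₁⟩ := hx a
    obtain ⟨k₂, h₂⟩ := hy a
    refine ⟨max k₁ k₂, fun k hk => ?_⟩
    rw [map_add, h₁ k (le_trans (le_max_left _ _) hk),
      h₂ k (le_trans (le_max_right _ _) hk), add_zero]
  smul_mem' := fun c x hx a => by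
    obtain ⟨k₁, h₁⟩ := hx a
    exact ⟨k₁, fun k hk => by rw [map_smul, h₁ k hk, smul_zero]⟩

/-- `ω` is a generator of `H^ψ(M, L⟦y - ψ(y)⟧)`. If `E` is separable over `Q_v`, then `z - ζ` is a
uniformizer of `L⟦y - ψ(y)⟧`, and hence `L⟦y - ψ(y)⟧ = L⟦z - ζ⟧`. -/
def IsGenerator (ω : S.HdR) : Prop := Submodule.span L⟦X⟧ {ω} = A.Hpsi ψ

/-- `ω` is a generator of `H^ψ(M, L⟦y - ψ(y)⟧)` whose reduction in `H^1_dR(M, L)` is a generator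
of the `R`-module `H^ψ(M, R)`. -/
def IsIntegralGenerator (ω : S.HdR) : Prop :=
  A.IsGenerator ψ ω ∧
    ∃ w : S.HdRR, Submodule.span (RX L) {w} = A.HpsiR ψ ∧ S.redR w = S.redT ω

open Classical in
/-- The valuation `v(ω) = v(x mod z - ζ)`, where `ω = x ω°` for an integral generator `ω°`. -/
def valOmega (ω : S.HdR) : ℝ :=
  if h : ∃ p : L⟦X⟧ × S.HdR, A.IsIntegralGenerator ψ p.2 ∧ ω = p.1 • p.2 then
    val F (PowerSeries.constantCoeff h.choose.1) else 0

/-- `(E, Φ)` with `Φ = (d_ψ)_ψ` is the local CM-type: the Hodge-Pink lattice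
`τ⁻¹(M ⊗ L⟦z - ζ⟧)` is the sum of the `(z - ζ)^{-d_ψ} H^ψ(M, L⟦y - ψ(y)⟧)`. -/
def HasCMType (d : (E →ₐ[Qv F] L) → ℤ) : Prop :=
  ∀ x : BC ((expLL L).comp (sigma L)) M,
    (∃ y : BC (expL L) M, S.tauB (expLL L) (isUnit_expLL L) x = S.MtoLL y) ↔
    ∃ w : (E →ₐ[Qv F] L) → S.HdR, (∀ ψ, w ψ ∈ A.Hpsi ψ) ∧
      x = ∑ᶠ ψ, (HahnSeries.single (-d ψ) (1 : L) : L⸨X⸩) • S.HdRtoLL (w ψ)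

/-- `O_E` acts on `M` faithfully and the rank of `M` equals the dimension of `E`. -/
def HasCM (A : OEAction S E) : Prop :=
  Function.Injective A.act ∧ Module.finrank (RX L) M = Module.finrank (Qv F) E

end OEAction
end deRham

section homology
variable {F : Type u} [Field F] [Fintype F] {L : IntermediateField (Qv F) (Qalg F)}
  {M : Type w} [AddCommGroup M] [Module (RX L) M]
  {S : LocalShtuka L M} {E : Type v} [CommRing E] [Algebra (Av F) E] (A : OEAction S E)

namespace OEAction

/-- The action of `a ∈ O_E` on `H^1_v(M, A_v)`. -/
def actH1v (a : integralClosure (Av F) E) : S.H1v →ₗ[Av F] S.H1v where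
  toFun m := ⟨BC.map _ (A.act a) m.1, by
    have h : ∀ x : S.MSep, S.sigmaStar (BC.map _ (A.act a) x) =
        BC.map _ (A.act a) (S.sigmaStar x) := by
      intro x
      induction x using BC.induction with
      | h0 => simp only [map_zero]
      | hmk b m =>
        simp only [map_smulₛₗ, RingHom.id_apply, LocalShtuka.sigmaStar, BC.push_mk, BC.map_mk]
      | hadd x y hx hy => simp only [map_add, hx, hy]
    rw [LocalShtuka.mem_H1v, h, tauB_comm, (S.mem_H1v _).1 m.2]⟩
  map_add' x y := by
    ext1
    exact map_add _ _ _
  map_smul' f x := by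
    ext1
    exact map_smul (BC.map (toSep L) (A.act a)) (toSep L (coefR L f)) x.1

/-- `u` is an `O_E`-generator of `H_{1,v}(M, A_v)`. -/
def IsOEGenerator (u : S.HomAv) : Prop :=
  ∀ w : S.HomAv, ∃ a, w = u.comp (A.actH1v a)

/-- `w = e u` in the `E`-module `H_{1,v}(M, Q_v)`, that is, `f w = u ∘ [f e]` for an
`f ∈ A_v ∖ {0}` with `f e ∈ O_E`. -/
def IsMul (e : E) (u w : S.HomQv) : Prop :=
  ∃ (f : Av F) (a : integralClosure (Av F) E), f ≠ 0 ∧ (a : E) = f • e ∧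
    f • w = u.comp (A.actH1v a)

/-- `u` is an `E`-generator of `H_{1,v}(M, Q_v)`. -/
def IsEGenerator (u : S.HomQv) : Prop := ∀ w : S.HomQv, ∃ e : E, A.IsMul e u w

/-- The inclusion `H_{1,v}(M, A_v) ⊂ H_{1,v}(M, Q_v)`. -/
def toHomQv (u : S.HomAv) : S.HomQv := (Algebra.linearMap (Av F) (Qv F)).comp u

open Classical in
/-- The valuation `v_ψ(u) = v(ψ(e))`, where `e ∈ E^×` and `e⁻¹ u` is an `O_E`-generator of
`H_{1,v}(M, A_v)`. -/
def valU [Algebra (Qv F) E] (ψ : E →ₐ[Qv F] L) (u : S.HomQv) : ℝ :=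
  if h : ∃ p : E × S.HomAv, IsUnit p.1 ∧ A.IsOEGenerator p.2 ∧ A.IsMul p.1 (toHomQv p.2) u then
    val F (ψ h.choose.1) else 0

end OEAction
end homology

section conjugate
variable {F : Type u} [Field F] [Fintype F] {L L' : IntermediateField (Qv F) (Qalg F)}
  (η : L →ₐ[Qv F] L')

/-- The restriction `R → R'` of `η : L → L'`. -/
def etaR : RL L →+* RL L' := (η.restrictScalars (Av F)).mapIntegralClosure.toRingHom

/-- The map `R⟦z⟧ → R'⟦z⟧` induced by `η`. -/
def etaX : RX L →+* RX L' := PowerSeries.map (etaR η)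

theorem etaR_algebraMap (f : Av F) :
    etaR η (algebraMap (Av F) (RL L) f) = algebraMap (Av F) (RL L') f :=
  (η.restrictScalars (Av F)).mapIntegralClosure.commutes f

theorem algebraMap_etaR (r : RL L) :
    algebraMap (RL L') L' (etaR η r) = η (algebraMap (RL L) L r) := rfl

theorem etaX_sigma (a : RX L) : etaX η (sigma L a) = sigma L' (etaX η a) := by
  ext n
  simp only [etaX, sigma, PowerSeries.coeff_map, frob_apply, map_pow]

theorem etaX_zmz : etaX η (zmz L) = zmz L' := by
  rw [etaX, zmz, map_sub, PowerSeries.map_X, PowerSeries.map_C, zeta, etaR_algebraMap]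
  rfl

theorem etaX_coefR (f : Av F) : etaX η (coefR L f) = coefR L' f := by
  ext n
  simp only [etaX, coefR, coef, PowerSeries.coeff_map, RingHom.comp_apply, etaR_algebraMap]

theorem isUnit_etaX {B : Type*} [CommRing B] (g : RX L' →+* B) (hg : IsUnit (g (zmz L'))) :
    IsUnit (g.comp (etaX η) (zmz L)) := by
  rwa [RingHom.comp_apply, etaX_zmz]

theorem isUnit_loc (L : IntermediateField (Qv F) (Qalg F)) : IsUnit (loc L (zmz L)) :=
  IsLocalization.Away.algebraMap_isUnit _

theorem norm_eta (x : L) : ‖η x‖ = ‖x‖ := by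
  change ‖((η x : L') : Qalg F)‖ = ‖(x : Qalg F)‖
  rw [norm_Qalg, norm_Qalg, spectralNorm, spectralNorm]
  congr 1
  have h1 := minpoly.algHom_eq (L'.val.comp η) (L'.val.comp η).injective x
  have h2 := minpoly.algHom_eq L.val L.val.injective x
  exact h1.trans h2.symm

theorem eta_zetaL : η (zetaL L) = zetaL L' := by
  rw [zetaL, ← algebraMap_etaR, zeta, etaR_algebraMap]
  rfl

theorem expL_etaX [FiniteDimensional (Qv F) L] [FiniteDimensional (Qv F) L'] (a : RX L) :
    expL L' (etaX η a) = PowerSeries.map η.toRingHom (expL L a) := by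
  have key : ∀ (ξ : L') (hξ : η.toRingHom (zetaL L) = ξ) (f' : Restr L' ξ),
      f'.1 = PowerSeries.map η.toRingHom (toRestrL L a).1 →
      taylor ξ f' = PowerSeries.map η.toRingHom (taylor (zetaL L) (toRestrL L a)) := by
    rintro ξ rfl f' hf'
    exact taylor_map (zetaL L) η.toRingHom (norm_eta η) (toRestrL L a) f' hf'
  refine key (zetaL L') (eta_zetaL η) (toRestrL L' (etaX η a)) ?_
  ext n
  rfl

variable {M : Type w} [AddCommGroup M] [Module (RX L) M]

namespace LocalShtuka
variable (S : LocalShtuka L M)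

/-- The extension of scalars of a local shtuka along `η`, with underlying module
`M ⊗_{R⟦z⟧} R'⟦z⟧`. -/
def conj : LocalShtuka L' (BC (etaX η) M) where
  free := by
    have := S.free
    exact BC.free _ _
  finite := by
    have := S.finite
    exact BC.finite _ _
  tau := (BC.assoc (etaX η) ((loc L').comp (sigma L')) (((loc L').comp (etaX η)).comp (sigma L))
      (fun a => congrArg (loc L') (etaX_sigma η a))).symm.trans
    ((S.tauB ((loc L').comp (etaX η)) (isUnit_etaX η _ (isUnit_loc L'))).trans
      (BC.assoc (etaX η) (loc L') ((loc L').comp (etaX η)) (fun _ => rfl)))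

/-- The extension of scalars `ω ↦ ω^η` on de Rham realizations. -/
def conjHdR [FiniteDimensional (Qv F) L] [FiniteDimensional (Qv F) L'] :
    S.HdR →ₛₗ[PowerSeries.map η.toRingHom] (S.conj η).HdR :=
  BC.lift _ _
    ((BC.mk ((expL L').comp (sigma L')) : BC (etaX η) M →ₛₗ[_] _).toAddMonoidHom.comp
      (BC.mk (etaX η) : M →ₛₗ[_] _).toAddMonoidHom)
    (fun a m => by
      change (BC.mk ((expL L').comp (sigma L')) (BC.mk (etaX η) (a • m)) : (S.conj η).HdR) =
        PowerSeries.map η.toRingHom (expL L (sigma L a)) •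
          (BC.mk ((expL L').comp (sigma L')) (BC.mk (etaX η) m) : (S.conj η).HdR)
      rw [map_smulₛₗ, map_smulₛₗ, ← expL_etaX, etaX_sigma]
      rfl)

end LocalShtuka

namespace OEAction
variable {S : LocalShtuka L M} {E : Type v} [CommRing E] [Algebra (Av F) E] (A : OEAction S E)

/-- The induced action on the extension of scalars along `η`. -/
def conj : OEAction (S.conj η) E where
  act :=
    { toFun := fun a => BC.map (etaX η) (A.act a)
      map_one' := by
        apply BC.hom_ext
        intro m
        rw [BC.map_mk, map_one]
        rfl
      map_mul' := fun a b => by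
        apply BC.hom_ext
        intro m
        rw [BC.map_mk, map_mul]
        change _ = BC.map (etaX η) (A.act a) (BC.map (etaX η) (A.act b) (BC.mk _ m))
        rw [BC.map_mk, BC.map_mk]
        rfl
      map_zero' := by
        apply BC.hom_ext
        intro m
        rw [BC.map_mk, map_zero]
        exact map_zero _
      map_add' := fun a b => by
        apply BC.hom_ext
        intro m
        rw [BC.map_mk, map_add]
        change BC.mk _ (A.act a m + A.act b m) =
          BC.map (etaX η) (A.act a) (BC.mk _ m) + BC.map (etaX η) (A.act b) (BC.mk _ m)
        rw [BC.map_mk, BC.map_mk, map_add] }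
  act_algebraMap f x := by
    change BC.map (etaX η) (A.act (algebraMap (Av F) _ f)) x = coefR L' f • x
    induction x using BC.induction with
    | h0 => simp only [map_zero, smul_zero]
    | hmk b m =>
      rw [map_smul, BC.map_mk, A.act_algebraMap, map_smulₛₗ, etaX_coefR, smul_comm]
    | hadd x y hx hy => simp only [map_add, smul_add, hx, hy]
  tau_comm a x := by
    change (S.conj η).tau (BC.map _ (BC.map (etaX η) (A.act a)) x) =
      BC.map _ (BC.map (etaX η) (A.act a)) ((S.conj η).tau x)
    have h1 : ∀ y : BC (((loc L').comp (etaX η)).comp (sigma L)) M,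
        BC.map _ (BC.map (etaX η) (A.act a)) (BC.assoc (etaX η) ((loc L').comp (sigma L'))
          (((loc L').comp (etaX η)).comp (sigma L))
          (fun a => congrArg (loc L') (etaX_sigma η a)) y) =
        BC.assoc (etaX η) ((loc L').comp (sigma L')) (((loc L').comp (etaX η)).comp (sigma L))
          (fun a => congrArg (loc L') (etaX_sigma η a)) (BC.map _ (A.act a) y) := by
      intro y
      induction y using BC.induction with
      | h0 => simp only [map_zero]
      | hmk b m => simp only [map_smul, BC.map_mk, BC.assoc_mk]
      | hadd x y hx hy => simp only [map_add, hx, hy]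
    have h2 : ∀ y : BC ((loc L').comp (etaX η)) M,
        BC.map _ (BC.map (etaX η) (A.act a)) (BC.assoc (etaX η) (loc L')
          ((loc L').comp (etaX η)) (fun _ => rfl) y) =
        BC.assoc (etaX η) (loc L') ((loc L').comp (etaX η)) (fun _ => rfl)
          (BC.map _ (A.act a) y) := by
      intro y
      induction y using BC.induction with
      | h0 => simp only [map_zero]
      | hmk b m => simp only [map_smul, BC.map_mk, BC.assoc_mk]
      | hadd x y hx hy => simp only [map_add, hx, hy]
    obtain ⟨y, rfl⟩ := (BC.assoc (etaX η) ((loc L').comp (sigma L'))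
      (((loc L').comp (etaX η)).comp (sigma L))
      (fun a => congrArg (loc L') (etaX_sigma η a))).surjective x
    rw [h1]
    simp only [LocalShtuka.conj, LinearEquiv.trans_apply, LinearEquiv.symm_apply_apply]
    rw [A.tauB_comm, h2]

end OEAction
end conjugate

section measures
variable {F : Type u} [Field F] [Fintype F]

variable (F) in
/-- The Galois group `Aut(Q_v^alg / Q_v) = Gal(Q_v^sep / Q_v)`. -/
abbrev GQ := Qalg F ≃ₐ[Qv F] Qalg F

section finiteLevel
variable (N : IntermediateField (Qv F) (Qalg F))

/-- The function `a` on the Galois group is constant modulo the subgroup fixing `N`. -/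
def IsConstMod (a : GQ F → ℚ) : Prop := ∀ g h : GQ F, (∀ x ∈ N, g x = h x) → a g = a h

/-- A uniformizer `π_N` of `N`. -/
def unif : RL N := Classical.epsilon fun π : RL N => Irreducible π

/-- The ramification index `e_N = ord_{π_N}(z)`. -/
def ramIdx : ℕ := multiplicity (unif N) (zeta N)

/-- The different of `N` over `Q_v`: the annihilator of the module of relative differentials. -/
def different : Ideal (RL N) := Module.annihilator (RL N) (Ω[RL N⁄Av F])

/-- The valuation of an ideal of the valuation ring of `N`. -/
def valIdeal (I : Ideal (RL N)) : ℝ :=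
  sInf ((fun x => val F (algebraMap (RL N) N x)) '' {x | x ∈ I ∧ x ≠ 0})

/-- `g` acts as `x ↦ x ^ (q ^ n)` on the residue field of `N`. For `n = 0` this means that `g` lies
in the inertia group. -/
def ActsAsFrob (n : ℕ) (g : N ≃ₐ[Qv F] N) : Prop :=
  ∀ x : N, ‖x‖ ≤ 1 → ‖g x - x ^ (Fintype.card F ^ n)‖ < 1

open Classical in
/-- The function `μ_N` on `Gal(N / Q_v)`. -/
def mu (g : N ≃ₐ[Qv F] N) : ℝ :=
  if ¬ ActsAsFrob N 0 g then 0
  else if g (algebraMap (RL N) N (unif N)) ≠ algebraMap (RL N) N (unif N) then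
    - val F (g (algebraMap (RL N) N (unif N)) - algebraMap (RL N) N (unif N))
  else valIdeal N (different N)

/-- The value at `g ∈ Gal(N / Q_v)` of a function that is constant modulo the subgroup fixing
`N`. -/
def atLevel [IsGalois (Qv F) N] (a : GQ F → ℚ) (g : N ≃ₐ[Qv F] N) : ℚ :=
  a (g.liftNormal (Qalg F))

/-- `∑_{g ∈ Gal(N / Q_v)} a(g) μ_N(g)` -/
def muArtLevel [IsGalois (Qv F) N] (a : GQ F → ℚ) : ℝ :=
  ∑ᶠ g : N ≃ₐ[Qv F] N, (atLevel N a g : ℝ) * mu N g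

/-- `e_N⁻¹ ∑_{n ≥ 1} ∑_g a(g) / q ^ (n s)`, where the inner sum is over all `g ∈ Gal(N / Q_v)` that
act as `x ↦ x ^ (q ^ n)` on the residue field of `N`. -/
def ZLevel [IsGalois (Qv F) N] (a : GQ F → ℚ) (s : ℝ) : ℝ :=
  1 / (ramIdx N : ℝ) * ∑' n : ℕ, ∑ᶠ (g : N ≃ₐ[Qv F] N) (_ : ActsAsFrob N (n + 1) g),
    (atLevel N a g : ℝ) / (Fintype.card F : ℝ) ^ (((n + 1 : ℕ) : ℝ) * s)

end finiteLevel

/-- `a` is constant modulo the subgroup fixing some finite Galois extension `N` of `Q_v`. -/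
def ExistsLevel (a : GQ F → ℚ) : Prop :=
  ∃ N : IntermediateField (Qv F) (Qalg F), FiniteDimensional (Qv F) N ∧ IsGalois (Qv F) N ∧
    IsConstMod N a

open Classical in
/-- The function `μ_{Art,v}` on locally constant functions. Its value does not depend on the
choice of the finite Galois extension `N`. -/
def muArt (a : GQ F → ℚ) : ℝ :=
  if h : ExistsLevel a then
    have := h.choose_spec.2.1
    muArtLevel h.choose a
  else 0

open Classical in
/-- The function `Z_v(a, s)` for real `s > 0` on locally constant functions `a`. Its value does
not depend on the choice of the finite Galois extension `N`. -/
def Zv (a : GQ F → ℚ) (s : ℝ) : ℝ :=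
  if h : ExistsLevel a then
    have := h.choose_spec.2.1
    ZLevel h.choose a s
  else 0

variable {L : IntermediateField (Qv F) (Qalg F)} {E : Type v} [CommRing E] [Algebra (Qv F) E]

/-- `η⁻¹ χ : E → L` for `χ : E → Q_v^alg` with values in `η(L)`. -/
def pullBack (η : L →ₐ[Qv F] Qalg F) (χ : E →ₐ[Qv F] Qalg F) [Nonempty (E →ₐ[Qv F] L)] :
    E →ₐ[Qv F] L :=
  Function.invFun (fun ψ' : E →ₐ[Qv F] L => η.comp ψ') χ

/-- The function `a⁰_{E,ψ,Φ}(g) = (#H_L)⁻¹ ∑_η d_{η⁻¹gηψ}`. -/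
def aZero (d : (E →ₐ[Qv F] L) → ℤ) (ψ : E →ₐ[Qv F] L) (g : GQ F) : ℚ :=
  have : Nonempty (E →ₐ[Qv F] L) := ⟨ψ⟩
  1 / (Nat.card (L →ₐ[Qv F] Qalg F) : ℚ) *
    ∑ᶠ η : L →ₐ[Qv F] Qalg F, (d (pullBack η (g.toAlgHom.comp (η.comp ψ))) : ℚ)

/-- The isomorphism of `L` onto `η(L)`, seen as a homomorphism between subfields of `Q_v^alg`. -/
def etaL (η : L →ₐ[Qv F] Qalg F) : L →ₐ[Qv F] η.fieldRange :=
  (AlgEquiv.ofInjectiveField η : L ≃ₐ[Qv F] η.fieldRange).toAlgHom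

instance finite_fieldRange [FiniteDimensional (Qv F) L] (η : L →ₐ[Qv F] Qalg F) :
    FiniteDimensional (Qv F) η.fieldRange :=
  LinearEquiv.finiteDimensional
    (AlgEquiv.ofInjectiveField η : L ≃ₐ[Qv F] η.fieldRange).toLinearEquiv

theorem coe_etaL (η : L →ₐ[Qv F] Qalg F) (x : L) : (etaL η x : Qalg F) = η x := rfl

end measures

end LocSht
end

open LocSht
universe u v w

/-!
# Valuations of the periods of local shtukas with complex multiplication

The formula is proved for each embedding `η` of `L` separately: the valuation of the period of
`(ω^η, u_η)` is `v(ω^η) + v(u_η)` plus a sum `periodSum` over the embeddings of the field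
`K = η(ψ(E))`, and the average over `η` of these sums is `Z_v(a⁰, 1) - μ_{Art,v}(a⁰)`.

**The measures.** The valuation ring of a finite separable `K` is `A_v[ϑ]` with `ϑ = α + π`, for a
Teichmüller generator `α` of the residue field and a uniformizer `π` (`IsGood`). If `K` is Galois,
then `g` acts as the `q^n`-Frobenius on the residue field if and only if
`v(g(ϑ) - ϑ^{q^n}) > 0`, and the valuation is then that of `π` for `n ≥ 1`, while for `n = 0` it
is `-μ(g)` if `g ≠ 1`; the different is generated by the derivative at `ϑ` of the minimal polynomial
(`annihilator_kaehler_eq`). So `Z_v - μ_{Art,v}` is the sum over `n` and `g` of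
`a(g) v(g(ϑ) - ϑ^{q^n}) / q^n`, with `a(g) - a(1)` in place of `a(g)` for `n = 0`. Such sums are
compatible with the passage from a Galois extension to a subfield (`periodSum_eq`), because
`∏_g (g(ϑ) - ϑ^{q^n})` over the extensions `g` of an embedding of `K` has the same norm as the
corresponding factor for `K`. This gives `Zv_sub_muArt_aZero`.

**The comparison isomorphism.** By Lang's theorem over `L^sep⟦z⟧`, proved by successive
approximation from the case of a separably closed field, `M ⊗ L^sep⟦z⟧` has a basis of
`τ`-invariants. A bound for the coefficients of solutions of `(z - ξ)^N σ̂(w) = c w` shows that this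
basis and its inverse converge at `z = ζ` (`LocalShtuka.exists_frame`). The pairing with a
homology class is then given by coordinates with respect to this basis.

**A period as the value of a functional.** The projection of `E` onto its component `K` has an
idempotent `e` and a lift `θ ∈ O_E` of `ϑ` (`IsComponent`). On this component, `u` is
`t ↦ Tr(α κ(t))` with an `O_E`-linear map `κ` of `H^1_v(M, A_v)` onto `O_K`, and `v(u)` is
`v(α) + v(g'(ϑ))` for the minimal polynomial `g` of `ϑ`, because the codifferent of `O_K` is
generated by `g'(ϑ)⁻¹` (`exists_kappa`, `valU_eq`). Hence the period of an eigenvector is `α` times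
the value of the functional induced by `κ`.

**The product formula.** Evaluating the coordinates at `z = ζ^{q^n}` and twisting the coefficients
of `κ` accordingly, one gets semilinear functionals `λ_n` on `M` (`lam`). Over `L⟦z - ζ⟧` the
polynomial `g` splits with roots `h_i` that lift the conjugates `c_i` of `ϑ` (`IsSplitting`), so
that the Hodge-Pink lattice given by the CM-type `d` turns into a correspondence
`τ(∏ (θ - c_i)^{N - d_i} e x) = (z - ζ)^N e m` between `σ̂^*M` and `M`
(`OEAction.tauCorr_of_cmType`). Applied to this correspondence, the `λ_n` satisfy a recursion for
their norms with factors `∏ |c_i - c_{i₀}^{q^{n+1}}|^{d_i}`, which telescopes into the norm of `λ_0`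
(`tendsto_val_supLam`). Finally, on the de Rham realization the functional differs from `λ_0` by
`(z - ζ)^{-N} ∏ (h_{i₀} - c_i)^{N - d_i}`, whose leading coefficient contributes
the terms `(d_i - d_{i₀}) v(c_{i₀} - c_i)` (`valT_divisorVal`), and it reduces modulo `z - ζ` to an
eigenfunctional on `H^1_dR(M, L)`. The value of the latter on the generator is
compared with its norm on the lattice `H^1_dR(M, R)`, by which `v(ω)` is defined
(`OEAction.IsEigenfunctional.valOmega_eq`). The result is `valT_period`.
-/

set_option linter.unusedSectionVars false

noncomputable section
namespace LocSht
open scoped Polynomial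
open Module (Basis End Free algebraMap_end_apply finrank)
open Polynomial (C X C_0 IsRoot aeval aeval_C aeval_X aeval_algHom_apply aeval_def
  aeval_map_algebraMap aeval_monomial coeToPowerSeries degree_eq_natDegree derivative
  derivative_map eval_C eval_X eval_map eval_map_algebraMap eval_mul eval_pow eval_prod eval_sub
  eval₂ eval₂_X eval₂_eq_sum_range eval₂_hom eval₂_map hom_eval₂ induction_on' monic_X_sub_C)
open Finset (HasAntidiagonal add_sum_erase mem_erase mem_univ mul_sum ne_of_mem_erase prod_congr
  prod_eq_zero prod_ne_zero_iff range smul_sum sum_add_distrib sum_comm sum_congr sum_eq_single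
  sum_mul sum_range univ)
open Function (Injective Surjective invFun)
open PowerSeries (X_dvd_iff coeff coeff_mk coeff_mul coeff_zero_eq_constantCoeff_apply
  constantCoeff constantCoeff_C constantCoeff_X isUnit_iff_constantCoeff trunc)
open Algebra (adjoin smul_def trace)
open Submodule (mem_span_singleton mem_span_singleton_self span span_le subset_span)
open IsUltrametricDist (norm_add_eq_max_of_norm_ne_norm norm_add_le_max
  norm_sum_le_of_forall_le_of_nonneg norm_tsum_le_of_forall_le_of_nonneg)
open HahnSeries (ofPowerSeries ofPowerSeries_X_pow single single_mul_single)

variable {F : Type u} [Field F] [Fintype F]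

set_option hygiene false in
/-- The number `q` of elements of `F`. -/
local notation "qF" => Fintype.card F
set_option hygiene false in
/-- The intermediate fields of `Q_v^alg / Q_v`. -/
local notation "ExtQ" => IntermediateField (Qv F) (Qalg F)
/-- The inclusion of the valuation ring `R` of `L` into `L`. -/
local notation "ι[" L "]" => algebraMap (RL L) L
set_option hygiene false in
/-- The ring `O_E` of integral elements of `E`. -/
local notation "𝓞v[" E "]" => integralClosure (Av F) E
set_option hygiene false in
/-- `K` is finite over `Q_v`. -/
local notation "FD[" K "]" => FiniteDimensional (Qv F) K
set_option hygiene false in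
/-- `K` is separable over `Q_v`. -/
local notation "Sep[" K "]" => Algebra.IsSeparable (Qv F) K

/-! ### Shortcuts for instance search -/

namespace Shortcuts
variable (L : ExtQ)

scoped instance : Field (Cv F) := inferInstance
scoped instance : CommRing (Cv F) := inferInstance
scoped instance : Semiring (Cv F) := inferInstance
scoped instance : NonAssocSemiring (Cv F) := inferInstance
scoped instance : NonUnitalNonAssocSemiring (Cv F) := inferInstance
scoped instance : AddCommMonoid (Cv F) := inferInstance
scoped instance : MonoidWithZero (Cv F) := inferInstance
scoped instance : CommRing (Cv F)⸨X⸩ := inferInstance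
scoped instance : Semiring (Cv F)⸨X⸩ := inferInstance
scoped instance : NonAssocSemiring (Cv F)⸨X⸩ := inferInstance
scoped instance : NonUnitalNonAssocSemiring (Cv F)⸨X⸩ := inferInstance
scoped instance : AddCommMonoid (Cv F)⸨X⸩ := inferInstance
scoped instance : MonoidWithZero (Cv F)⸨X⸩ := inferInstance
scoped instance : Algebra (Av F) (Qalg F) := inferInstance
scoped instance : Field L := inferInstance
scoped instance : CommRing L := inferInstance
scoped instance : Semiring L := inferInstance
scoped instance : NonAssocSemiring L := inferInstance
scoped instance : NonUnitalNonAssocSemiring L := inferInstance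
scoped instance : AddCommMonoid L := inferInstance
scoped instance : Algebra (Qv F) L := inferInstance
scoped instance : Algebra (Av F) L := inferInstance
scoped instance : CommRing L⟦X⟧ := inferInstance
scoped instance : Semiring L⟦X⟧ := inferInstance
scoped instance : NonAssocSemiring L⟦X⟧ := inferInstance
scoped instance : CommRing (Lsep L)⟦X⟧ := inferInstance
scoped instance : Semiring (Lsep L)⟦X⟧ := inferInstance
scoped instance : NonAssocSemiring (Lsep L)⟦X⟧ := inferInstance
scoped instance : CommRing (SepRestr L) := inferInstance
scoped instance : Semiring (SepRestr L) := inferInstance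
scoped instance : NonAssocSemiring (SepRestr L) := inferInstance
scoped instance : Semiring (RL L) := inferInstance
scoped instance : NonAssocSemiring (RL L) := inferInstance
scoped instance : CommRing (RX L) := inferInstance
scoped instance : Semiring (RX L) := inferInstance
scoped instance : NonAssocSemiring (RX L) := inferInstance

scoped instance : SMulCommClass (Av F) (Av F) (Qv F) := inferInstance
scoped instance : Module (Qv F) L := inferInstance
scoped instance : Module (Av F) L := inferInstance
scoped instance : Module.IsTorsionFree (Av F) (Qv F) := inferInstance
scoped instance : Module.IsTorsionFree (Qv F) (Qalg F) := inferInstance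
scoped instance : Module.IsTorsionFree (Qv F) L := inferInstance
scoped instance : AddMonoidHomClass (L →+* (Cv F)⸨X⸩) L (Cv F)⸨X⸩ := inferInstance

variable {A B : Type*} [CommRing A] [CommRing B] (f : A →+* B) (M : Type*) [AddCommGroup M]
  [Module A M]

scoped instance : SMul B (BC f M) := inferInstance
scoped instance : MulAction B (BC f M) := inferInstance
scoped instance : Algebra B (End B (BC f M)) := inferInstance
scoped instance : AddCommMonoid (BC f M) := inferInstance

end Shortcuts

open scoped Shortcuts

/-! ### Norms, integral elements and value groups -/

section norms
theorem exists_Av_of_norm_le_one {x : Qv F} (hx : ‖x‖ ≤ 1) : ∃ f : Av F, algebraMap (Av F) (Qv F) f = x := by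
  have h1 : ‖(1 : Qv F)‖ = 1 := norm_one
  rw [← h1, Valued.toNormedField.norm_le_iff, map_one, LaurentSeries.val_le_one_iff_eq_coe] at hx
  exact hx

theorem isIntegral_of_norm_le_one {x : Qalg F} (hx : ‖x‖ ≤ 1) : IsIntegral (Av F) x := by
  have hint : IsIntegral (Qv F) x := Algebra.IsIntegral.isIntegral x
  have hmon := minpoly.monic hint
  rw [norm_Qalg, spectralNorm, spectralValue_le_one_iff hmon] at hx
  have hlift : minpoly (Qv F) x ∈ Polynomial.lifts (algebraMap (Av F) (Qv F)) := by
    rw [Polynomial.lifts_iff_coeff_lifts]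
    intro n
    exact exists_Av_of_norm_le_one (hx n)
  obtain ⟨p, hp, -, hpm⟩ := Polynomial.lifts_and_degree_eq_and_monic hlift hmon
  refine ⟨p, hpm, ?_⟩
  have h := minpoly.aeval (Qv F) x
  rw [← hp, aeval_map_algebraMap] at h
  exact h

theorem isIntegral_iff_norm_le_one {x : Qalg F} : IsIntegral (Av F) x ↔ ‖x‖ ≤ 1 :=
  ⟨norm_of_isIntegral F, isIntegral_of_norm_le_one⟩

theorem algebraMap_F_Qalg (a : F) : algebraMap F (Qalg F) a =
    algebraMap (Av F) (Qalg F) (PowerSeries.C a) := by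
  rw [IsScalarTower.algebraMap_apply F (Qv F) (Qalg F),
    IsScalarTower.algebraMap_apply (Av F) (Qv F) (Qalg F)]
  congr 1

instance towerFAvQalg : IsScalarTower F (Av F) (Qalg F) :=
  IsScalarTower.of_algebraMap_eq fun a => by rw [algebraMap_F_Qalg]; rfl

theorem norm_algebraMap_Av_le (f : Av F) : ‖algebraMap (Av F) (Qalg F) f‖ ≤ 1 := by
  rw [IsScalarTower.algebraMap_apply (Av F) (Qv F) (Qalg F), norm_algebraMap_Qalg]
  exact norm_Av_le F f

theorem norm_algebraMap_F_le (a : F) : ‖algebraMap F (Qalg F) a‖ ≤ 1 := by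
  rw [algebraMap_F_Qalg]; exact norm_algebraMap_Av_le _

variable (F) in
/-- The image `ζ` of `z` in `Q_v^alg`. -/
def zetaQ : Qalg F := algebraMap (Av F) (Qalg F) PowerSeries.X

variable (F) in
theorem norm_zetaQ : ‖zetaQ F‖ = (qF : ℝ)⁻¹ := by
  rw [zetaQ, IsScalarTower.algebraMap_apply (Av F) (Qv F) (Qalg F), norm_algebraMap_Qalg]
  have : algebraMap (Av F) (Qv F) PowerSeries.X = single 1 1 := by simp
  rw [this, norm_single]
  simp

variable (F) in
theorem norm_zetaQ_lt_one : ‖zetaQ F‖ < 1 := by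
  rw [norm_zetaQ]
  exact inv_lt_one_of_one_lt₀ (by exact_mod_cast Fintype.one_lt_card)

variable (F) in
theorem norm_zetaQ_pos : 0 < ‖zetaQ F‖ := by
  rw [norm_zetaQ]
  exact inv_pos.2 (by exact_mod_cast Fintype.card_pos)

theorem norm_algHom {K : ExtQ} (φ : K →ₐ[Qv F] Qalg F) (x : K) : ‖φ x‖ = ‖x‖ := by
  change _ = ‖(x : Qalg F)‖
  rw [norm_Qalg, norm_Qalg, spectralNorm, spectralNorm, minpoly.algHom_eq φ φ.injective x]
  congr 1
  exact (minpoly.algHom_eq K.val K.val.injective x).symm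

/-- The `q`-power map is additive on algebras over `F`. -/
theorem add_pow_card {B : Type*} [CommRing B] [Algebra F B] (x y : B) (n : ℕ) : (x + y) ^ qF ^ n =
    x ^ qF ^ n + y ^ qF ^ n := by
  induction n with
  | zero => simp
  | succ n ih =>
    rw [pow_succ, pow_mul, ih, pow_mul, pow_mul]
    exact map_add (FiniteField.frobeniusAlgHom F B) _ _

theorem sub_pow_card {B : Type*} [CommRing B] [Algebra F B] (x y : B) (n : ℕ) : (x - y) ^ qF ^ n =
    x ^ qF ^ n - y ^ qF ^ n := by
  have h := add_pow_card (F := F) (x - y) y n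
  rw [sub_add_cancel] at h
  rw [h, add_sub_cancel_right]

theorem pow_card_pow_F (a : F) (n : ℕ) : a ^ qF ^ n = a := by
  induction n with
  | zero => simp
  | succ n ih => rw [pow_succ, pow_mul, ih, FiniteField.pow_card]

/-- The `q`-power map commutes with the evaluation of polynomials over `F`. -/
theorem aeval_pow_card {B : Type*} [CommRing B] [Algebra F B] (p : F[X]) (x : B) (n : ℕ) :
    aeval (x ^ qF ^ n) p = (aeval x p) ^ qF ^ n := by
  induction p using induction_on' with
  | add p r hp hr => rw [map_add, map_add, hp, hr, add_pow_card]
  | monomial k a =>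
    rw [aeval_monomial, aeval_monomial, mul_pow, ← map_pow, pow_card_pow_F, ← pow_mul, ← pow_mul,
      mul_comm k]

theorem norm_aeval_le {x : Qalg F} (hx : ‖x‖ ≤ 1) (p : F[X]) : ‖aeval x p‖ ≤ 1 := by
  rw [← isIntegral_iff_norm_le_one] at hx ⊢
  rw [← aeval_map_algebraMap (Av F)]
  have := Subalgebra.aeval_coe (integralClosure (Av F) (Qalg F)) ⟨x, hx⟩
    (p.map (algebraMap F (Av F)))
  have h2 := congrArg (IsIntegral (Av F)) this
  rw [h2]
  exact (aeval (⟨x, hx⟩ : integralClosure (Av F) (Qalg F)) _).2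

theorem norm_Qv_eq_zpow {a : Qv F} (ha : a ≠ 0) : ∃ k : ℤ, ‖a‖ = (qF : ℝ) ^ k := by
  obtain ⟨f, g, hg, rfl⟩ := IsFractionRing.div_surjective (A := Av F) a
  have key : ∀ f : Av F, f ≠ 0 → ∃ k : ℤ, ‖algebraMap (Av F) (Qv F) f‖ = (qF : ℝ) ^ k := by
    intro f hf
    obtain ⟨n, u, rfl⟩ := IsDiscreteValuationRing.eq_unit_mul_pow_irreducible hf
      PowerSeries.X_irreducible
    refine ⟨-n, ?_⟩
    have hu : ‖algebraMap (Av F) (Qv F) u‖ = 1 := by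
      refine le_antisymm (norm_Av_le F _) ?_
      have h := norm_Av_le F (↑u⁻¹ : Av F)
      have h1 : ‖algebraMap (Av F) (Qv F) u‖ * ‖algebraMap (Av F) (Qv F) (↑u⁻¹ : Av F)‖ = 1 := by
        rw [← norm_mul, ← map_mul, Units.mul_inv, map_one, norm_one]
      nlinarith [norm_nonneg (algebraMap (Av F) (Qv F) (u : Av F))]
    have hX : algebraMap (Av F) (Qv F) PowerSeries.X = single 1 1 := by simp
    rw [map_mul, map_pow, norm_mul, norm_pow, hu, one_mul, hX, norm_single]
    simp
  have hg0 : g ≠ 0 := nonZeroDivisors.ne_zero hg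
  have hf0 : f ≠ 0 := by rintro rfl; simp at ha
  obtain ⟨k, hk⟩ := key f hf0
  obtain ⟨l, hl⟩ := key g hg0
  refine ⟨k - l, ?_⟩
  have hq : (qF : ℝ) ≠ 0 := by exact_mod_cast Fintype.card_ne_zero
  rw [norm_div, hk, hl, zpow_sub₀ hq]

/-- The absolute value of a finite extension of `Q_v` is discrete. -/
theorem norm_pow_finrank_eq_zpow (K : ExtQ) [FD[K]] {x : Qalg F} (hxK : x ∈ K)
    (hx : x ≠ 0) : ∃ k : ℤ, ‖x‖ ^ finrank (Qv F) K = (qF : ℝ) ^ k := by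
  have hint : IsIntegral (Qv F) x := Algebra.IsIntegral.isIntegral x
  have hd : (minpoly (Qv F) x).natDegree ∣ finrank (Qv F) K := by
    have := minpoly.degree_dvd (K := Qv F) (x := (⟨x, hxK⟩ : K)) (Algebra.IsIntegral.isIntegral _)
    rwa [← minpoly.algHom_eq K.val K.val.injective ⟨x, hxK⟩] at this
  obtain ⟨m, hm⟩ := hd
  have h0 : (minpoly (Qv F) x).coeff 0 ≠ 0 := minpoly.coeff_zero_ne_zero hint hx
  obtain ⟨k, hk⟩ := norm_Qv_eq_zpow h0
  refine ⟨k * m, ?_⟩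
  have hn : (minpoly (Qv F) x).natDegree ≠ 0 := (minpoly.natDegree_pos hint).ne'
  rw [hm, pow_mul, norm_Qalg, spectralNorm.spectralNorm_eq_norm_coeff_zero_rpow, one_div,
    Real.rpow_inv_natCast_pow (norm_nonneg _) hn, hk, zpow_mul, zpow_natCast]

/-- A bounded set of elements of a finite extension of `Q_v` has an element of maximal norm. -/
theorem exists_max_norm (K : ExtQ) [FD[K]] (s : Set (Qalg F)) (hs : s ⊆ K)
    (hne : ∃ x ∈ s, x ≠ 0) (c : ℝ) (hc : ∀ x ∈ s, ‖x‖ ≤ c) : ∃ x ∈ s, x ≠ 0 ∧ ∀ y ∈ s, ‖y‖ ≤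
    ‖x‖ := by
  have hq : 1 < (qF : ℝ) := by exact_mod_cast Fintype.one_lt_card
  let n := finrank (Qv F) K
  have hn : n ≠ 0 := Module.finrank_pos.ne'
  obtain ⟨x₀, hx₀, hx₀0⟩ := hne
  obtain ⟨k₀, hk₀⟩ := norm_pow_finrank_eq_zpow K (hs hx₀) hx₀0
  have hbdd : ∃ b : ℤ, ∀ k : ℤ, (∃ x ∈ s, x ≠ 0 ∧ ‖x‖ ^ n = (qF : ℝ) ^ k) → k ≤ b := by
    obtain ⟨b, hb⟩ := pow_unbounded_of_one_lt (c ^ n) hq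
    refine ⟨b, fun k ⟨x, hx, _, hk⟩ => ?_⟩
    have h1 : ‖x‖ ^ n ≤ c ^ n := pow_le_pow_left₀ (norm_nonneg _) (hc x hx) n
    rw [hk] at h1
    have h2 : (qF : ℝ) ^ k < (qF : ℝ) ^ (b : ℤ) := by
      rw [zpow_natCast]; exact lt_of_le_of_lt h1 hb
    exact ((zpow_lt_zpow_iff_right₀ hq).1 h2).le
  obtain ⟨k, ⟨x, hx, hx0, hk⟩, hmax⟩ := Int.exists_greatest_of_bdd hbdd ⟨k₀, x₀, hx₀, hx₀0, hk₀⟩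
  refine ⟨x, hx, hx0, fun y hy => ?_⟩
  rcases eq_or_ne y 0 with rfl | hy0
  · simp
  · obtain ⟨l, hl⟩ := norm_pow_finrank_eq_zpow K (hs hy) hy0
    have := hmax l ⟨y, hy, hy0, hl⟩
    refine (pow_le_pow_iff_left₀ (norm_nonneg _) (norm_nonneg _) hn).1 ?_
    rw [hk, hl]
    exact zpow_le_zpow_right₀ hq.le this

end norms

/-! ### Teichmüller elements and uniformizers -/

section teich
variable (K : ExtQ)

/-- `α ∈ K` is a Teichmüller element which generates the residue field of `K` over `F`. -/
structure IsTeich (α : Qalg F) : Prop where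
  mem : α ∈ K
  pow : ∃ r : ℕ, 0 < r ∧ α ^ qF ^ r = α
  residue : ∀ x ∈ K, ‖x‖ ≤ 1 → ∃ p : F[X], ‖x - aeval α p‖ < 1

/-- `π` is a uniformizer of `K`. -/
structure IsUnif (π : Qalg F) : Prop where
  mem : π ∈ K
  ne_zero : π ≠ 0
  lt_one : ‖π‖ < 1
  max : ∀ x ∈ K, ‖x‖ < 1 → ‖x‖ ≤ ‖π‖

theorem zetaQ_mem : zetaQ F ∈ K := by
  rw [zetaQ, IsScalarTower.algebraMap_apply (Av F) (Qv F) (Qalg F)]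
  exact K.algebraMap_mem _

theorem zetaQ_ne_zero : zetaQ F ≠ 0 := norm_pos_iff.1 (norm_zetaQ_pos F)

theorem exists_isUnif [FD[K]] : ∃ π, IsUnif K π := by
  obtain ⟨π, ⟨h1, h2⟩, h3, h4⟩ := exists_max_norm K {x | x ∈ K ∧ ‖x‖ < 1} (fun x hx => hx.1)
    ⟨zetaQ F, ⟨zetaQ_mem K, norm_zetaQ_lt_one F⟩, zetaQ_ne_zero⟩ 1 (fun x hx => hx.2.le)
  exact ⟨π, h1, h3, h2, fun x hx hx1 => h4 x ⟨hx, hx1⟩⟩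

instance algebraFIF : Algebra F K := ((algebraMap (Qv F) K).comp (algebraMap F (Qv F))).toAlgebra

theorem algebraMap_F_IF (a : F) :
    algebraMap F K a = algebraMap (Qv F) K (algebraMap F (Qv F) a) := rfl

theorem coe_algebraMap_F (a : F) : ((algebraMap F K a : K) : Qalg F) = algebraMap F (Qalg F) a := by
  rw [IsScalarTower.algebraMap_apply F (Qv F) (Qalg F)]
  rfl

theorem algebraMap_F_mem (a : F) : algebraMap F (Qalg F) a ∈ K := by
  rw [IsScalarTower.algebraMap_apply F (Qv F) (Qalg F)]
  exact K.algebraMap_mem _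

theorem aeval_mem {x : Qalg F} (hx : x ∈ K) (p : F[X]) : aeval x p ∈ K := by
  induction p using induction_on' with
  | add p r hp hr => rw [map_add]; exact K.add_mem hp hr
  | monomial k a =>
    rw [aeval_monomial]
    exact K.mul_mem (algebraMap_F_mem K a) (pow_mem hx k)

instance [FD[K]] [Sep[K]] :
    Module.Finite (Av F) (RL K) :=
  IsIntegralClosure.finite (Av F) (Qv F) K (integralClosure (Av F) K)

theorem mem_RL_iff (x : K) : x ∈ integralClosure (Av F) K ↔ ‖x‖ ≤ 1 := by
  change IsIntegral (Av F) x ↔ ‖(x : Qalg F)‖ ≤ 1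
  rw [← isIntegral_iff_norm_le_one]
  exact (isIntegral_algHom_iff (IsScalarTower.toAlgHom (Av F) K (Qalg F))
    (algebraMap K (Qalg F)).injective).symm

/-- An element of norm at most one, as an element of the valuation ring. -/
def mkRL (x : K) (hx : ‖x‖ ≤ 1) : RL K := (⟨x, (mem_RL_iff K x).2 hx⟩ : integralClosure (Av F) K)

@[simp] theorem algebraMap_mkRL (x : K) (hx : ‖x‖ ≤ 1) : ι[K] (mkRL K x hx) = x := rfl

theorem algebraMap_RL_injective : Injective ι[K] := Subtype.val_injective

/-- Modulo `ζ`, the valuation ring of `K` is finite over `F`. -/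
theorem exists_finite_residue [FD[K]] [Sep[K]] :
    ∃ (m : ℕ) (b : Fin m → K), (∀ i, ‖b i‖ ≤ 1) ∧ ∀ x : K, ‖x‖ ≤ 1 → ∃ a : Fin m → F, ‖x - ∑ i,
    algebraMap F K (a i) * b i‖ < 1 := by
  obtain ⟨m, b, hb⟩ := Module.Finite.exists_fin (R := Av F) (M := RL K)
  refine ⟨m, fun i => ι[K] (b i), fun i => norm_RL_le K (b i), fun x hx => ?_⟩
  have hmem : mkRL K x hx ∈ span (Av F) (Set.range b) := by rw [hb]; trivial
  rw [Submodule.mem_span_range_iff_exists_fun] at hmem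
  obtain ⟨c, hc⟩ := hmem
  refine ⟨fun i => constantCoeff (c i), ?_⟩
  have h1 : x = ∑ i, algebraMap (Av F) K (c i) * ι[K] (b i) := by
    have := congrArg ι[K] hc
    rw [map_sum, algebraMap_mkRL] at this
    rw [← this]
    refine sum_congr rfl fun i _ => ?_
    rw [smul_def, map_mul, ← IsScalarTower.algebraMap_apply]
  rw [h1, ← Finset.sum_sub_distrib]
  have h2 : ∀ i, algebraMap (Av F) K (c i) * ι[K] (b i) -
      algebraMap F K (constantCoeff (c i)) * ι[K] (b i) =
      zetaL K * (algebraMap (Av F) K (PowerSeries.mk fun n => coeff (n + 1) (c i)) *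
        ι[K] (b i)) := by
    intro i
    have h3 : algebraMap (Av F) K (c i) = zetaL K * algebraMap (Av F) K
        (PowerSeries.mk fun n => coeff (n + 1) (c i)) +
        algebraMap F K (constantCoeff (c i)) := by
      conv_lhs => rw [PowerSeries.eq_X_mul_shift_add_const (c i)]
      rw [map_add, map_mul]
      congr 1
    rw [h3]; ring
  rw [sum_congr rfl fun i _ => h2 i, ← mul_sum, norm_mul]
  refine lt_of_le_of_lt (mul_le_of_le_one_right (norm_nonneg _) ?_) (norm_zetaL_lt_one K)
  refine norm_sum_le_of_forall_le_of_nonneg zero_le_one fun i _ => ?_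
  rw [norm_mul]
  refine mul_le_one₀ ?_ (norm_nonneg _) (norm_RL_le K (b i))
  exact norm_algebraMap_Av_le _

/-- The Teichmüller lift is the limit of the `x ^ (Q ^ j)`, here written as a telescoping series. -/
theorem exists_teichmuller_lift [FD[K]] {x : K} {r : ℕ} (hr : 0 < r)
    (hx : ‖x ^ qF ^ r - x‖ < 1) : ∃ α : K, α ^ qF ^ r = α ∧ ‖α - x‖ < 1 := by
  set Q := qF ^ r with hQ
  have hQ1 : 1 < Q := Nat.one_lt_pow hr.ne' Fintype.one_lt_card
  set δ := x ^ Q - x with hδ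
  have hsum : Summable fun j : ℕ => δ ^ Q ^ j := by
    apply NonarchimedeanAddGroup.summable_of_tendsto_cofinite_zero
    rw [Nat.cofinite_eq_atTop]
    exact (tendsto_pow_atTop_nhds_zero_of_norm_lt_one hx).comp
      (tendsto_atTop_mono (fun j => (Nat.lt_pow_self hQ1 (n := j)).le) tendsto_id)
  let φ : K →+ K :=
    { toFun := fun y => y ^ Q
      map_zero' := zero_pow (by omega)
      map_add' := fun a b => add_pow_card (F := F) a b r }
  refine ⟨x + ∑' j, δ ^ Q ^ j, ?_, ?_⟩
  · change φ _ = _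
    have hcont : Continuous φ := continuous_pow Q
    rw [map_add, hsum.map_tsum φ hcont, hsum.tsum_eq_zero_add]
    have h1 : φ x = x + δ := by change x ^ Q = _; rw [hδ]; ring
    have h2 : ∀ j, φ (δ ^ Q ^ j) = δ ^ Q ^ (j + 1) := fun j => by
      change (δ ^ Q ^ j) ^ Q = _
      rw [← pow_mul, pow_succ]
    simp only [h1, h2, pow_zero, pow_one, add_assoc]
  · rw [add_sub_cancel_left]
    refine lt_of_le_of_lt (norm_tsum_le_of_forall_le_of_nonneg (norm_nonneg δ) fun j => ?_) hx
    rw [norm_pow]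
    exact pow_le_of_le_one (norm_nonneg _) hx.le (pow_ne_zero _ (by omega))

/-- A Teichmüller lift of a generator of the multiplicative group of the residue field. -/
theorem exists_isTeich [FD[K]] [Sep[K]] : ∃ α,
    IsTeich K α := by
  let O := (NormedField.valuation (K := K)).valuationSubring
  have hO : ∀ x : K, x ∈ O ↔ ‖x‖ ≤ 1 := fun x => by
    rw [Valuation.mem_valuationSubring_iff]; rfl
  have hres : ∀ x : O, IsLocalRing.residue O x = 0 ↔ ‖(x : K)‖ < 1 := by
    intro x
    rw [IsLocalRing.residue_eq_zero_iff, IsLocalRing.mem_maximalIdeal, mem_nonunits_iff]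
    constructor
    · intro h
      by_contra hlt
      have h1 : ‖(x : K)‖ = 1 := le_antisymm ((hO _).1 x.2) (not_lt.1 hlt)
      apply h
      have h0 : (x : K) ≠ 0 := by rintro h0; rw [h0] at h1; simp at h1
      refine ⟨⟨x, ⟨(x : K)⁻¹, (hO _).2 (by rw [norm_inv, h1, inv_one])⟩, ?_, ?_⟩, rfl⟩
      · ext; exact congrArg _ (mul_inv_cancel₀ h0)
      · ext; exact congrArg _ (inv_mul_cancel₀ h0)
    · rintro h ⟨u, rfl⟩
      have h1 : ((u : O) : K) * ((↑u⁻¹ : O) : K) = 1 := by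
        exact_mod_cast congrArg Subtype.val u.mul_inv
      have h2 := congrArg norm h1
      rw [norm_mul, norm_one] at h2
      have h3 := (hO _).1 (↑u⁻¹ : O).2
      nlinarith [norm_nonneg ((u : O) : K), norm_nonneg ((↑u⁻¹ : O) : K)]
  let k := IsLocalRing.ResidueField O
  let ι : F →+* O := (algebraMap F K).codRestrict O.toSubring (fun a => (hO _).2 (norm_algebraMap_F_le a))
  obtain ⟨m, b, hb1, hb⟩ := exists_finite_residue K
  have hfin : Finite k := by
    refine Finite.of_surjective (fun a : Fin m → F => IsLocalRing.residue O
      (∑ i, ι (a i) * ⟨b i, (hO _).2 (hb1 i)⟩)) fun y => ?_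
    obtain ⟨x, rfl⟩ := IsLocalRing.residue_surjective y
    obtain ⟨a, ha⟩ := hb x ((hO _).1 x.2)
    refine ⟨a, ?_⟩
    rw [eq_comm, ← sub_eq_zero, ← map_sub, hres]
    have h1 : ((x - ∑ i, ι (a i) * ⟨b i, (hO _).2 (hb1 i)⟩ : O) : K) =
        x - ∑ i, algebraMap F K (a i) * b i := by
      push_cast
      rfl
    rw [h1]
    exact ha
  have := Fintype.ofFinite k
  let _ : Algebra F k := ((IsLocalRing.residue O).comp ι).toAlgebra
  have hr : Fintype.card k = qF ^ finrank F k := Module.card_eq_pow_finrank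
  have hr0 : 0 < finrank F k := Module.finrank_pos
  obtain ⟨g, hg⟩ := IsCyclic.exists_generator (α := kˣ)
  obtain ⟨x, hx⟩ := IsLocalRing.residue_surjective (g : k)
  have hxQ : ‖(x : K) ^ qF ^ finrank F k - x‖ < 1 := by
    have : IsLocalRing.residue O (x ^ qF ^ finrank F k - x) = 0 := by
      rw [map_sub, map_pow, ← hr, FiniteField.pow_card, sub_self]
    rw [hres] at this
    exact_mod_cast this
  obtain ⟨α, hα, hαx⟩ := exists_teichmuller_lift K hr0 hxQ
  refine ⟨α, α.2, ⟨_, hr0, by exact_mod_cast congrArg Subtype.val hα⟩, fun y hy hy1 => ?_⟩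
  have hα1 : α ∈ O := by
    rw [hO]
    have : α = (α - x) + x := by ring
    rw [this]
    exact (norm_add_le_max _ _).trans (max_le hαx.le ((hO _).1 x.2))
  have hαres : IsLocalRing.residue O ⟨α, hα1⟩ = g := by
    rw [← hx, ← sub_eq_zero, ← map_sub, hres]
    exact hαx
  let y' : O := ⟨⟨y, hy⟩, (hO _).2 hy1⟩
  by_cases h0 : IsLocalRing.residue O y' = 0
  · refine ⟨0, ?_⟩
    rw [map_zero, sub_zero]
    exact (hres y').1 h0
  · obtain ⟨i, hi⟩ := (Submonoid.mem_powers_iff _ _).1 (mem_powers_iff_mem_zpowers.2 (hg (Units.mk0 _ h0)))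
    refine ⟨X ^ i, ?_⟩
    have h1 : IsLocalRing.residue O (y' - ⟨α, hα1⟩ ^ i) = 0 := by
      rw [map_sub, map_pow, hαres, sub_eq_zero]
      have := congrArg Units.val hi
      simpa using this.symm
    rw [hres] at h1
    rw [map_pow, aeval_X]
    exact h1

end teich

/-! ### Monogenic generators of valuation rings -/

section good
variable {K : ExtQ}

theorem norm_add_eq_of_lt {G : Type*} [SeminormedAddCommGroup G] [IsUltrametricDist G] {x y : G}
    (h : ‖y‖ < ‖x‖) : ‖x + y‖ = ‖x‖ := by
  rw [norm_add_eq_max_of_norm_ne_norm h.ne', max_eq_left h.le]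

theorem norm_sub_eq_of_lt {G : Type*} [SeminormedAddCommGroup G] [IsUltrametricDist G] {x y : G}
    (h : ‖y‖ < ‖x‖) : ‖x - y‖ = ‖x‖ := by
  rw [sub_eq_add_neg]
  exact norm_add_eq_of_lt (by rwa [norm_neg])

theorem norm_sub_le_max {G : Type*} [SeminormedAddCommGroup G] [IsUltrametricDist G] (x y : G) :
    ‖x - y‖ ≤ max ‖x‖ ‖y‖ := by
  rw [sub_eq_add_neg, ← norm_neg y]
  exact norm_add_le_max _ _

/-- Polynomial functions with integral coefficients are Lipschitz. -/
theorem norm_aeval_sub_aeval_le {a b : Qalg F} (ha : ‖a‖ ≤ 1) (hb : ‖b‖ ≤ 1) (p : (Av F)[X]) :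
    ‖aeval a p - aeval b p‖ ≤ ‖a - b‖ := by
  let a' : integralClosure (Av F) (Qalg F) := ⟨_, isIntegral_of_norm_le_one ha⟩
  let b' : integralClosure (Av F) (Qalg F) := ⟨_, isIntegral_of_norm_le_one hb⟩
  obtain ⟨k, hk⟩ := Polynomial.sub_dvd_eval_sub a' b' (p.map (algebraMap (Av F) _))
  rw [eval_map_algebraMap, eval_map_algebraMap] at hk
  have := congrArg Subtype.val hk
  simp only [AddSubgroupClass.coe_sub, Subalgebra.coe_mul, ← Subalgebra.aeval_coe] at this
  rw [show aeval a p - aeval b p = (a - b) * k from this, norm_mul]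
  exact mul_le_of_le_one_right (norm_nonneg _) (norm_of_isIntegral F k.2)

/-- Embeddings commute with polynomials over `F`. -/
theorem algHom_aeval (φ : K →ₐ[Qv F] Qalg F) (x : K) (p : F[X]) :
    φ ⟨aeval (x : Qalg F) p, aeval_mem K x.2 p⟩ = aeval (φ x) p := by
  have e1 : aeval (x : Qalg F) p = ((aeval x p : K) : Qalg F) := by
    rw [aeval_def, aeval_def, eval₂_eq_sum_range, eval₂_eq_sum_range]
    push_cast
    simp only [coe_algebraMap_F]
  have e2 : (⟨aeval (x : Qalg F) p, aeval_mem K x.2 p⟩ : K) = aeval x p := Subtype.ext e1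
  rw [e2, aeval_def, aeval_def, eval₂_eq_sum_range, eval₂_eq_sum_range, map_sum]
  refine sum_congr rfl fun i _ => ?_
  rw [map_mul, map_pow, algebraMap_F_IF, AlgHom.commutes,
    IsScalarTower.algebraMap_apply F (Qv F) (Qalg F)]

/-- `ϑ = α + π` for a Teichmüller generator `α` of the residue field and a uniformizer `π`. -/
structure IsGood (K : ExtQ) (α π ϑ : Qalg F) : Prop where
  teich : IsTeich K α
  unif : IsUnif K π
  eq : ϑ = α + π

theorem exists_isGood (K : ExtQ) [FD[K]] [Sep[K]] :
    ∃ α π ϑ, IsGood K α π ϑ := by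
  obtain ⟨α, hα⟩ := exists_isTeich K
  obtain ⟨π, hπ⟩ := exists_isUnif K
  exact ⟨α, π, _, hα, hπ, rfl⟩

theorem IsTeich.eq_zero_of_norm_lt_one {y : Qalg F} {r : ℕ} (hr : 0 < r) (hy : y ^ qF ^ r = y)
    (h : ‖y‖ < 1) : y = 0 := by
  by_contra h0
  have hQ : 1 < qF ^ r := Nat.one_lt_pow hr.ne' Fintype.one_lt_card
  have h1 : ‖y‖ ^ qF ^ r < ‖y‖ := pow_lt_self_of_lt_one₀ (norm_pos_iff.2 h0) h hQ
  rw [← norm_pow, hy] at h1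
  exact lt_irrefl _ h1

theorem pow_card_mul {y : Qalg F} {r : ℕ} (hy : y ^ qF ^ r = y) (k : ℕ) : y ^ qF ^ (r * k) = y := by
  induction k with
  | zero => simp
  | succ k ih => rw [Nat.mul_succ, pow_add, pow_mul, ih, hy]

theorem IsTeich.norm_le {α : Qalg F} (h : IsTeich K α) : ‖α‖ ≤ 1 := by
  obtain ⟨r, hr, hα⟩ := h.pow
  by_contra! h1
  have hQ : 1 < qF ^ r := Nat.one_lt_pow hr.ne' Fintype.one_lt_card
  have h2 := lt_self_pow₀ h1 hQ
  rw [← norm_pow, hα] at h2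
  exact lt_irrefl _ h2

/-- A nonzero polynomial in a Teichmüller element is a Teichmüller element, hence a unit. -/
theorem IsTeich.norm_aeval {α : Qalg F} (h : IsTeich K α) {p : F[X]} (hp : aeval α p ≠ 0) :
    ‖aeval α p‖ = 1 := by
  obtain ⟨r, hr, hα⟩ := h.pow
  by_contra h1
  refine hp (IsTeich.eq_zero_of_norm_lt_one hr ?_
    (lt_of_le_of_ne (norm_aeval_le h.norm_le p) h1))
  rw [← aeval_pow_card, hα]

namespace IsGood
variable {α π ϑ : Qalg F}

theorem norm_le (h : IsGood K α π ϑ) : ‖ϑ‖ ≤ 1 := by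
  rw [h.eq]
  exact (norm_add_le_max _ _).trans (max_le h.teich.norm_le h.unif.lt_one.le)

theorem mem (h : IsGood K α π ϑ) : ϑ ∈ K := by
  rw [h.eq]; exact K.add_mem h.teich.mem h.unif.mem

theorem isIntegral (h : IsGood K α π ϑ) : IsIntegral (Av F) ϑ := isIntegral_of_norm_le_one h.norm_le

theorem tendsto_teich (h : IsGood K α π ϑ) {r : ℕ} (hr : 0 < r) (hα : α ^ qF ^ r = α) :
    Tendsto (fun k : ℕ => ϑ ^ qF ^ (r * k)) atTop (𝓝 α) := by
  have h1 : Tendsto (fun k : ℕ => α + π ^ qF ^ (r * k)) atTop (𝓝 (α + 0)) := by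
    refine tendsto_const_nhds.add
      ((tendsto_pow_atTop_nhds_zero_of_norm_lt_one h.unif.lt_one).comp
        (tendsto_atTop_mono (fun k => ?_) tendsto_id))
    have h2 : r * k < qF ^ (r * k) := Nat.lt_pow_self Fintype.one_lt_card
    exact (Nat.le_mul_of_pos_left k hr).trans h2.le
  rw [add_zero] at h1
  refine h1.congr fun k => ?_
  rw [h.eq, add_pow_card, pow_card_mul hα]

/-- `F[ϑ]` is dense in the valuation ring of `K`. -/
theorem dense (h : IsGood K α π ϑ) {x : Qalg F} (hx : x ∈ K) (hx1 : ‖x‖ ≤ 1) {ε : ℝ} (hε : 0 < ε) :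
    ∃ p : F[X], ‖x - aeval ϑ p‖ < ε := by
  let S := (adjoin F {ϑ}).topologicalClosure
  have hϑS : ϑ ∈ S := Subalgebra.le_topologicalClosure _ (Algebra.self_mem_adjoin_singleton F ϑ)
  have hclosed : IsClosed (S : Set (Qalg F)) := Subalgebra.isClosed_topologicalClosure _
  obtain ⟨r, hr, hα⟩ := h.teich.pow
  have hαS : α ∈ S := hclosed.mem_of_tendsto (h.tendsto_teich hr hα)
    (Eventually.of_forall fun k => pow_mem hϑS _)
  have hπS : π ∈ S := by
    have : π = ϑ - α := by rw [h.eq]; ring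
    rw [this]; exact sub_mem hϑS hαS
  have key : ∀ (n : ℕ) (x : Qalg F), x ∈ K → ‖x‖ ≤ 1 → ∃ s ∈ S, ‖x - s‖ ≤ ‖π‖ ^ n := by
    intro n
    induction n with
    | zero => exact fun x _ hx1 => ⟨0, zero_mem _, by simpa using hx1⟩
    | succ n ih =>
      intro x hx hx1
      obtain ⟨p, hp⟩ := h.teich.residue x hx hx1
      have hle := h.unif.max _ (K.sub_mem hx (aeval_mem K h.teich.mem p)) hp
      have hπ0 := norm_pos_iff.2 h.unif.ne_zero
      obtain ⟨s, hs, hxs⟩ := ih ((x - aeval α p) / π)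
        (K.div_mem (K.sub_mem hx (aeval_mem K h.teich.mem p)) h.unif.mem)
        (by rw [norm_div]; exact (div_le_one hπ0).2 hle)
      refine ⟨aeval α p + π * s, add_mem ?_ (mul_mem hπS hs), ?_⟩
      · exact (aeval (⟨α, hαS⟩ : S) p).2 |> fun h => by rwa [← Subalgebra.aeval_coe] at h
      · have h1 : x - (aeval α p + π * s) = π * ((x - aeval α p) / π - s) := by
          field_simp [h.unif.ne_zero]; ring
        rw [h1, norm_mul, pow_succ, mul_comm]
        exact mul_le_mul_of_nonneg_right hxs hπ0.le
  have hxS : x ∈ S := by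
    choose s hs hsx using fun n => key n x hx hx1
    refine hclosed.mem_of_tendsto (f := s) (b := atTop) ?_ (Eventually.of_forall hs)
    rw [tendsto_iff_norm_sub_tendsto_zero]
    refine squeeze_zero (fun _ => norm_nonneg _) (fun n => ?_)
      (tendsto_pow_atTop_nhds_zero_of_lt_one (norm_nonneg π) h.unif.lt_one)
    rw [norm_sub_rev]; exact hsx n
  have hxc : x ∈ closure (adjoin F {ϑ} : Set (Qalg F)) := hxS
  obtain ⟨y, hy, hxy⟩ := Metric.mem_closure_iff.1 hxc ε hε
  rw [SetLike.mem_coe, Algebra.adjoin_singleton_eq_range_aeval] at hy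
  obtain ⟨p, rfl⟩ := hy
  exact ⟨p, by rwa [dist_eq_norm] at hxy⟩

/-- The valuation ring of `K` is `A_v[ϑ]`. -/
theorem exists_aeval [FD[K]] [Sep[K]]
    (h : IsGood K α π ϑ) {x : Qalg F} (hx : x ∈ K) (hx1 : ‖x‖ ≤ 1) : ∃ p : (Av F)[X], x =
    aeval ϑ p := by
  let i : RL K →ₐ[Av F] Qalg F :=
    (IsScalarTower.toAlgHom (Av F) K (Qalg F)).comp (IsScalarTower.toAlgHom (Av F) (RL K) K)
  have hi : Injective i := (algebraMap K (Qalg F)).injective.comp (algebraMap_RL_injective K)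
  let θ : RL K := mkRL K ⟨ϑ, h.mem⟩ h.norm_le
  have hiθ : i θ = ϑ := rfl
  let N : Submodule (Av F) (RL K) := Subalgebra.toSubmodule (adjoin (Av F) {θ})
  have hle : (⊤ : Submodule (Av F) (RL K)) ≤ N ⊔ (Ideal.span {(PowerSeries.X : Av F)}) • ⊤ := by
    intro y _
    obtain ⟨p, hp⟩ := h.dense (x := i y) (ι[K] y).2 (norm_RL_le K y)
      (norm_zetaQ_pos F)
    let p' := p.map (algebraMap F (Av F))
    have hp' : i (aeval θ p') = aeval ϑ p := by
      rw [← aeval_algHom_apply, hiθ, aeval_map_algebraMap]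
    have hK : i y - aeval ϑ p ∈ K := K.sub_mem (ι[K] y).2 (aeval_mem K h.mem p)
    let w : RL K := mkRL K ⟨(i y - aeval ϑ p) / zetaQ F, K.div_mem hK (zetaQ_mem K)⟩ (by
      change ‖(i y - aeval ϑ p) / zetaQ F‖ ≤ 1
      rw [norm_div]
      exact (div_le_one (norm_zetaQ_pos F)).2 hp.le)
    have hy : y = aeval θ p' + (PowerSeries.X : Av F) • w := by
      apply hi
      rw [map_add, hp', map_smul, smul_def]
      have : i w = (i y - aeval ϑ p) / zetaQ F := rfl
      rw [this, ← zetaQ, mul_div_cancel₀ _ zetaQ_ne_zero]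
      ring
    rw [hy]
    refine Submodule.add_mem_sup ?_
      (Submodule.smul_mem_smul (Ideal.mem_span_singleton_self _) trivial)
    change _ ∈ adjoin (Av F) {θ}
    rw [Algebra.adjoin_singleton_eq_range_aeval]
    exact ⟨_, rfl⟩
  have hN : (⊤ : Submodule (Av F) (RL K)) ≤ N :=
    Submodule.le_of_le_smul_of_le_jacobson_bot Module.Finite.fg_top (by
      rw [IsLocalRing.jacobson_eq_maximalIdeal _ bot_ne_top, Ideal.span_singleton_le_iff_mem,
        IsLocalRing.mem_maximalIdeal, mem_nonunits_iff]
      exact PowerSeries.X_prime.not_isUnit) hle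
  have h1 : mkRL K ⟨x, hx⟩ hx1 ∈ adjoin (Av F) {θ} := hN trivial
  rw [Algebra.adjoin_singleton_eq_range_aeval] at h1
  obtain ⟨p, hp⟩ := h1
  refine ⟨p, ?_⟩
  have h2 := congrArg i hp
  change i (aeval θ p) = x at h2
  rw [← h2, ← hiθ, aeval_algHom_apply]

/-- If `c ↦ c ^ (q ^ n)` and an isometric embedding agree on `ϑ` up to `δ`, then they agree up to
`δ` on the whole valuation ring. -/
theorem norm_algHom_sub_pow_le (h : IsGood K α π ϑ) (φ : K →ₐ[Qv F] Qalg F) (n : ℕ) (c : K)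
    (hc : ‖c‖ ≤ 1) : ‖φ c - (c : Qalg F) ^ qF ^ n‖ ≤ ‖φ ⟨ϑ, h.mem⟩ - ϑ ^ qF ^ n‖ := by
  set δ := ‖φ ⟨ϑ, h.mem⟩ - ϑ ^ qF ^ n‖
  have hφn : ‖φ ⟨ϑ, h.mem⟩‖ ≤ 1 := by rw [norm_algHom]; exact h.norm_le
  have hϑn : ‖ϑ ^ qF ^ n‖ ≤ 1 := by
    rw [norm_pow]; exact pow_le_one₀ (norm_nonneg _) h.norm_le
  refine le_of_forall_pos_le_add fun ε hε => ?_
  obtain ⟨p, hp⟩ := h.dense c.2 hc (lt_min hε zero_lt_one)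
  have hφp := algHom_aeval φ ⟨ϑ, h.mem⟩ p
  have h1 : ‖φ c - aeval (φ ⟨ϑ, h.mem⟩) p‖ < min ε 1 := by
    rw [← hφp, ← map_sub, norm_algHom]
    exact hp
  have h2 : ‖aeval (φ ⟨ϑ, h.mem⟩) p - aeval (ϑ ^ qF ^ n) p‖
      ≤ δ := by
    have := norm_aeval_sub_aeval_le hφn hϑn (p.map (algebraMap F (Av F)))
    rwa [aeval_map_algebraMap, aeval_map_algebraMap] at this
  have h3 : ‖aeval (ϑ ^ qF ^ n) p - (c : Qalg F) ^ qF ^ n‖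
      ≤ ε := by
    rw [aeval_pow_card, ← sub_pow_card, norm_pow, norm_sub_rev]
    refine (pow_le_of_le_one (norm_nonneg _) (hp.le.trans (min_le_right _ _))
      (pow_ne_zero _ Fintype.card_ne_zero)).trans (hp.le.trans (min_le_left _ _))
  have e : φ c - (c : Qalg F) ^ qF ^ n = (φ c - aeval (φ ⟨ϑ, h.mem⟩) p) +
      ((aeval (φ ⟨ϑ, h.mem⟩) p - aeval (ϑ ^ qF ^ n) p) +
      (aeval (ϑ ^ qF ^ n) p - (c : Qalg F) ^ qF ^ n)) := by ring
  rw [e]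
  refine (norm_add_le_max _ _).trans (max_le (h1.le.trans ((min_le_left _ _).trans
    (le_add_of_nonneg_left (norm_nonneg _)))) ((norm_add_le_max _ _).trans
    (max_le (h2.trans (le_add_of_nonneg_right hε.le))
      (h3.trans (le_add_of_nonneg_left (norm_nonneg _))))))

/-- For `n ≥ 1`, either `ϑ` and `ϑ ^ (q ^ n)` differ under `φ` by a unit, or by a uniformizer. -/
theorem norm_algHom_sub_pow (h : IsGood K α π ϑ) (φ : K →ₐ[Qv F] Qalg F) (n : ℕ)
    (hlt : ‖φ ⟨ϑ, h.mem⟩ - ϑ ^ qF ^ n‖ < 1) : φ ⟨ϑ, h.mem⟩ - ϑ ^ qF ^ n =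
    φ ⟨π, h.unif.mem⟩ - π ^ qF ^ n := by
  have h1 := (h.norm_algHom_sub_pow_le φ n ⟨α, h.teich.mem⟩ h.teich.norm_le).trans_lt hlt
  obtain ⟨r, hr, hα⟩ := h.teich.pow
  have h2 : φ ⟨α, h.teich.mem⟩ - α ^ qF ^ n = 0 := by
    refine IsTeich.eq_zero_of_norm_lt_one hr ?_ h1
    have hφα : (φ ⟨α, h.teich.mem⟩) ^ qF ^ r = φ ⟨α, h.teich.mem⟩ := by
      rw [← map_pow]
      congr 1
      exact Subtype.ext hα
    rw [sub_pow_card, hφα, pow_right_comm, hα]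
  have h3 : (⟨ϑ, h.mem⟩ : K) = ⟨α, h.teich.mem⟩ + ⟨π, h.unif.mem⟩ := Subtype.ext h.eq
  have h4 : ϑ ^ qF ^ n = α ^ qF ^ n + π ^ qF ^ n := by
    rw [h.eq, add_pow_card]
  rw [h3, map_add, h4]
  linear_combination h2

theorem norm_algHom_sub_pow_of_lt (h : IsGood K α π ϑ) (φ : K →ₐ[Qv F] Qalg F) {n : ℕ} (hn : n ≠ 0)
    (hlt : ‖φ ⟨ϑ, h.mem⟩ - ϑ ^ qF ^ n‖ < 1) : ‖φ ⟨ϑ, h.mem⟩ - ϑ ^ qF ^ n‖ = ‖π‖ := by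
  rw [h.norm_algHom_sub_pow φ n hlt]
  have h1 : ‖φ ⟨π, h.unif.mem⟩‖ = ‖π‖ := norm_algHom φ _
  have h2 : ‖π ^ qF ^ n‖ < ‖π‖ := by
    rw [norm_pow]
    exact pow_lt_self_of_lt_one₀ (norm_pos_iff.2 h.unif.ne_zero) h.unif.lt_one
      (Nat.one_lt_pow hn Fintype.one_lt_card)
  rw [← h1] at h2 ⊢
  exact norm_sub_eq_of_lt h2

end IsGood
end good

/-! ### The minimal polynomial of a monogenic generator -/

section minpoly
variable {K : ExtQ}
variable {α π ϑ : Qalg F}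

theorem IsTeich.isIntegral (h : IsTeich K α) : IsIntegral F α := by
  obtain ⟨r, hr, hα⟩ := h.pow
  have hQ : 1 < qF ^ r := Nat.one_lt_pow hr.ne' Fintype.one_lt_card
  refine ⟨X ^ qF ^ r - X, ?_, ?_⟩
  · exact Polynomial.monic_X_pow_sub (by rw [Polynomial.degree_X]; exact_mod_cast hQ)
  · simp [hα]

theorem IsUnif.exists_norm_eq_pow (h : IsUnif K π) {x : Qalg F} (hx : x ∈ K) (hx0 : x ≠ 0)
    (hx1 : ‖x‖ ≤ 1) : ∃ e : ℕ, ‖x‖ = ‖π‖ ^ e := by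
  obtain ⟨n, hn1, hn2⟩ := exists_nat_pow_near_of_lt_one (norm_pos_iff.2 hx0) hx1
    (norm_pos_iff.2 h.ne_zero) h.lt_one
  refine ⟨n, le_antisymm hn2 (not_lt.1 fun hlt => ?_)⟩
  have hπn : 0 < ‖π‖ ^ n := pow_pos (norm_pos_iff.2 h.ne_zero) n
  have h1 := h.max (x / π ^ n) (K.div_mem hx (pow_mem h.mem n)) (by
    rw [norm_div, norm_pow]; exact (div_lt_one hπn).2 hlt)
  rw [norm_div, norm_pow, div_le_iff₀ hπn, ← pow_succ'] at h1
  exact absurd h1 (not_le.2 hn1)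

namespace IsGood

theorem norm_aeval_minpoly (h : IsGood K α π ϑ) : ‖aeval ϑ (minpoly F α)‖ = ‖π‖ := by
  have hαi := h.teich.isIntegral
  let a : integralClosure (Av F) (Qalg F) := ⟨α, isIntegral_of_norm_le_one h.teich.norm_le⟩
  let b : integralClosure (Av F) (Qalg F) := ⟨π, isIntegral_of_norm_le_one h.unif.lt_one.le⟩
  let p := ((minpoly F α).map (algebraMap F (Av F))).map
    (algebraMap (Av F) (integralClosure (Av F) (Qalg F)))
  obtain ⟨k, hk⟩ := Polynomial.binomExpansion p a b
  have ev : ∀ (f : F[X]) (x : integralClosure (Av F) (Qalg F)), ((((f.map (algebraMap F (Av F))).map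
        (algebraMap (Av F) (integralClosure (Av F) (Qalg F)))).eval x : _) : Qalg F) =
        aeval (x : Qalg F) f := by
    intro f x
    rw [eval_map_algebraMap, ← Subalgebra.aeval_coe, aeval_map_algebraMap]
  have hder : p.derivative = ((minpoly F α).derivative.map (algebraMap F (Av F))).map
    (algebraMap (Av F) (integralClosure (Av F) (Qalg F))) := by
    rw [derivative_map, derivative_map]
  rw [hder] at hk
  have h1 := congrArg Subtype.val hk
  simp only [AddMemClass.coe_add, MulMemClass.coe_mul, SubmonoidClass.coe_pow] at h1
  rw [ev, ev, ev] at h1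
  have ha : (a : Qalg F) = α := rfl
  have hb : (b : Qalg F) = π := rfl
  rw [AddMemClass.coe_add, ha, hb, ← h.eq, minpoly.aeval, zero_add] at h1
  have hsep : (minpoly F α).Separable :=
    PerfectField.separable_of_irreducible (minpoly.irreducible hαi)
  have h2 : ‖aeval α (minpoly F α).derivative‖ = 1 :=
    h.teich.norm_aeval (hsep.aeval_derivative_ne_zero (minpoly.aeval F α))
  have hπ0 := norm_pos_iff.2 h.unif.ne_zero
  have h3 : ‖aeval α (minpoly F α).derivative * π‖ = ‖π‖ := by
    rw [norm_mul, h2, one_mul]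
  rw [h1, norm_add_eq_of_lt, h3]
  rw [h3, norm_mul, norm_pow]
  calc ‖(k : Qalg F)‖ * ‖π‖ ^ 2 ≤ 1 * ‖π‖ ^ 2 :=
        mul_le_mul_of_nonneg_right (norm_of_isIntegral F k.2) (by positivity)
    _ < ‖π‖ := by rw [one_mul, sq]; exact mul_lt_of_lt_one_left hπ0 h.unif.lt_one

/-- A polynomial with coefficients in `A_v` is, up to a multiple of `ζ`, its reduction mod `z`. -/
theorem _root_.LocSht.exists_aeval_eq_add {x : Qalg F} (hx : ‖x‖ ≤ 1) (p : (Av F)[X]) : ∃ y :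
    Qalg F, ‖y‖ ≤ 1 ∧ aeval x p = aeval x (p.map constantCoeff) + zetaQ F * y := by
  induction p using induction_on' with
  | add p r hp hr =>
    obtain ⟨y, hy, h1⟩ := hp
    obtain ⟨y', hy', h1'⟩ := hr
    refine ⟨y + y', (norm_add_le_max _ _).trans (max_le hy hy'), ?_⟩
    rw [map_add, h1, h1', Polynomial.map_add, map_add]
    ring
  | monomial k a =>
    refine ⟨algebraMap (Av F) (Qalg F) (PowerSeries.mk fun n => coeff (n + 1) a)
      * x ^ k, ?_, ?_⟩
    · rw [norm_mul, norm_pow]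
      exact mul_le_one₀ (norm_algebraMap_Av_le _) (by positivity)
        (pow_le_one₀ (norm_nonneg _) hx)
    · rw [Polynomial.map_monomial, aeval_monomial, aeval_monomial]
      conv_lhs => rw [PowerSeries.eq_X_mul_shift_add_const a]
      rw [map_add, map_mul, algebraMap_F_Qalg, zetaQ]
      ring

instance _root_.LocSht.torsionFreeAvQalg : Module.IsTorsionFree (Av F) (Qalg F) := by
  have : FaithfulSMul (Av F) (Qalg F) := (faithfulSMul_iff_algebraMap_injective _ _).2 (by
    rw [IsScalarTower.algebraMap_eq (Av F) (Qv F) (Qalg F)]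
    exact (algebraMap (Qv F) (Qalg F)).injective.comp (IsFractionRing.injective (Av F) (Qv F)))
  infer_instance

/-- The minimal polynomial of `ϑ`, reduced modulo `z`, takes at `ϑ` a value of norm `|ζ|`. -/
theorem norm_aeval_reduction [FD[K]] [Sep[K]]
    (h : IsGood K α π ϑ) : ‖aeval ϑ ((minpoly (Av F) ϑ).map constantCoeff)‖ = ‖zetaQ F‖ := by
  apply le_antisymm
  · obtain ⟨y, hy, h1⟩ := exists_aeval_eq_add h.norm_le (minpoly (Av F) ϑ)
    rw [minpoly.aeval] at h1
    rw [eq_neg_of_add_eq_zero_left h1.symm, norm_neg, norm_mul]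
    exact mul_le_of_le_one_right (norm_nonneg _) hy
  · obtain ⟨e, he⟩ := h.unif.exists_norm_eq_pow (zetaQ_mem K) zetaQ_ne_zero (norm_zetaQ_lt_one F).le
    set G := minpoly F α
    have hG : ‖aeval ϑ (G ^ e)‖ = ‖zetaQ F‖ := by
      rw [map_pow, norm_pow, h.norm_aeval_minpoly, he]
    -- `G(ϑ)^e = ζ·H(ϑ)`, hence the reduced minimal polynomial divides `G^e`
    obtain ⟨H, hH⟩ := h.exists_aeval
      (K.div_mem (aeval_mem K h.mem (G ^ e)) (zetaQ_mem K))
      (by rw [norm_div, hG]; exact div_self_le_one _)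
    have h0 : aeval ϑ ((G ^ e).map (algebraMap F (Av F)) -
        C PowerSeries.X * H) = 0 := by
      rw [map_sub, map_mul, aeval_map_algebraMap, aeval_C, ← hH, ← zetaQ,
        mul_div_cancel₀ _ zetaQ_ne_zero, sub_self]
    obtain ⟨Q, hQ⟩ := minpoly.isIntegrallyClosed_dvd h.isIntegral h0
    have h2 := congrArg (Polynomial.map constantCoeff) hQ
    rw [Polynomial.map_sub, Polynomial.map_mul, Polynomial.map_C, constantCoeff_X, C_0, zero_mul,
      sub_zero, Polynomial.map_map, Polynomial.map_mul] at h2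
    have h3 : (constantCoeff : Av F →+* F).comp (algebraMap F (Av F)) = RingHom.id F := by
      ext a; exact constantCoeff_C a
    rw [h3, Polynomial.map_id] at h2
    rw [← hG, h2, map_mul, norm_mul]
    exact mul_le_of_le_one_right (norm_nonneg _) (norm_aeval_le h.norm_le _)

end IsGood
end minpoly

/-! ### Products over the extensions of an embedding -/

section fibres
variable {K N : ExtQ} [FD[N]] [Sep[N]]
variable {α π ϑ α' π' θ : Qalg F}

open Classical in
/-- The embeddings of `N` which extend a given embedding of `K`. -/
def extensions (hKN : K ≤ N) (φ : K →ₐ[Qv F] Qalg F) : Finset (N →ₐ[Qv F] Qalg F) :=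
  univ.filter fun g => g.comp (IntermediateField.inclusion hKN) = φ

theorem mem_extensions {hKN : K ≤ N} {φ : K →ₐ[Qv F] Qalg F} {g : N →ₐ[Qv F] Qalg F} : g ∈
    extensions hKN φ ↔ ∀ x : K, g ⟨x, hKN x.2⟩ = φ x := by
  classical
  rw [extensions, Finset.mem_filter, AlgHom.ext_iff]
  simp only [mem_univ, true_and]
  rfl

theorem exists_aut_extends (φ : K →ₐ[Qv F] Qalg F) : ∃ σ : GQ F, ∀ x : K, σ x = φ x := by
  obtain ⟨σ, hσ⟩ := IntermediateField.exists_algHom_of_splits (F := Qv F) (E := Qalg F)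
    (K := Qalg F) (L := K)
    (fun x => ⟨Algebra.IsIntegral.isIntegral x, IsAlgClosed.splits _⟩) φ
  exact ⟨AlgEquiv.ofBijective σ (Algebra.IsAlgebraic.algHom_bijective σ),
    fun x => DFunLike.congr_fun hσ x⟩

theorem exists_mul_zetaQ_pow_le_one (x : Qalg F) : ∃ n : ℕ, ‖zetaQ F ^ n * x‖ ≤ 1 := by
  have h := (tendsto_pow_atTop_nhds_zero_of_norm_lt_one (norm_zetaQ_lt_one F)).mul_const x
  rw [zero_mul] at h
  have h1 := h.norm
  rw [norm_zero] at h1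
  obtain ⟨n, hn⟩ := (h1.eventually (gt_mem_nhds zero_lt_one)).exists
  exact ⟨n, hn.le⟩

theorem aeval_Av_mem (K : ExtQ) {x : Qalg F} (hx : x ∈ K) (p : (Av F)[X]) : aeval x p ∈ K := by
  rw [← aeval_map_algebraMap (Qv F)]
  exact (aeval (⟨x, hx⟩ : K.toSubalgebra) _).2 |> fun h => by
    rwa [← Subalgebra.aeval_coe] at h

/-- Embeddings commute with polynomials over `A_v`. -/
theorem algHom_aeval_Av (φ : K →ₐ[Qv F] Qalg F) (x : K) (p : (Av F)[X]) :
    φ ⟨aeval (x : Qalg F) p, aeval_Av_mem K x.2 p⟩ = aeval (φ x) p := by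
  have e1 : (⟨aeval (x : Qalg F) p, aeval_Av_mem K x.2 p⟩ : K) = aeval x p :=
    Subtype.ext (aeval_algHom_apply (IsScalarTower.toAlgHom (Av F) K (Qalg F)) x p)
  rw [e1]
  exact (aeval_algHom_apply (φ.restrictScalars (Av F)) x p).symm

theorem IsGood.algHom_ext (h : IsGood N α' π' θ) {g g' : N →ₐ[Qv F] Qalg F}
    (hg : g ⟨θ, h.mem⟩ = g' ⟨θ, h.mem⟩) : g = g' := by
  ext x
  obtain ⟨n, hn⟩ := exists_mul_zetaQ_pow_le_one (x : Qalg F)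
  obtain ⟨p, hp⟩ := h.exists_aeval (N.mul_mem (pow_mem (zetaQ_mem N) n) x.2) hn
  have hz : ∀ f : N →ₐ[Qv F] Qalg F, f ⟨zetaQ F, zetaQ_mem N⟩ = zetaQ F := fun f => by
    have : (⟨zetaQ F, zetaQ_mem N⟩ : N) =
        algebraMap (Qv F) N (algebraMap (Av F) (Qv F) PowerSeries.X) := rfl
    rw [this, f.commutes, ← IsScalarTower.algebraMap_apply]
    rfl
  have key : ∀ f : N →ₐ[Qv F] Qalg F, zetaQ F ^ n * f x = aeval (f ⟨θ, h.mem⟩) p := by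
    intro f
    have e : (⟨aeval θ p, aeval_Av_mem N h.mem p⟩ : N) =
      ⟨zetaQ F, zetaQ_mem N⟩ ^ n * x := Subtype.ext hp.symm
    rw [← algHom_aeval_Av f ⟨θ, h.mem⟩ p, e, map_mul, map_pow, hz]
  have h1 := (key g).trans ((congrArg (fun t => aeval t p) hg).trans (key g').symm)
  exact mul_left_cancel₀ (pow_ne_zero n zetaQ_ne_zero) h1

/-- The conjugates of a monogenic generator of `N` over the image of an embedding of `K`. -/
theorem IsGood.minpoly_map_eq_prod (hN : IsGood N α' π' θ) (hKN : K ≤ N) (φ : K →ₐ[Qv F] Qalg F) :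
    (minpoly K θ).map (φ : K →+* Qalg F) = ∏ g ∈ extensions hKN φ, (X - C (g ⟨θ, hN.mem⟩)) := by
  classical
  obtain ⟨σ, hσ⟩ := exists_aut_extends φ
  have hint : IsIntegral K θ := Algebra.IsIntegral.isIntegral θ
  set P := (minpoly K θ).map (φ : K →+* Qalg F)
  have hPm : P.Monic := (minpoly.monic hint).map _
  have hinj : Injective fun g : N →ₐ[Qv F] Qalg F => g ⟨θ, hN.mem⟩ := fun g g' h => hN.algHom_ext h
  have hsep : P.Separable := by
    have h1 : (minpoly (Qv F) θ).Separable := by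
      have := Algebra.IsSeparable.isSeparable (Qv F) (⟨θ, hN.mem⟩ : N)
      rwa [IsSeparable, ← minpoly.algHom_eq N.val N.val.injective] at this
    exact ((h1.map (f := algebraMap (Qv F) K)).of_dvd
      (minpoly.dvd_map_of_isScalarTower (Qv F) K θ)).map
  have hroots : P.roots = ((extensions hKN φ).image fun g => g ⟨θ, hN.mem⟩).val := by
    refine (Multiset.Nodup.ext (Polynomial.nodup_roots hsep) (Finset.nodup _)).2 fun y => ?_
    rw [Polynomial.mem_roots hPm.ne_zero, Finset.mem_val, Finset.mem_image]
    constructor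
    · intro hy
      have hy' : aeval (σ.symm y) (minpoly K θ) = 0 := by
        apply σ.injective
        rw [map_zero]
        rw [IsRoot, eval_map] at hy
        rw [aeval_def]
        refine (hom_eval₂ _ _ (σ : Qalg F →+* Qalg F) _).trans ?_
        rw [← hy]
        change eval₂ _ (σ (σ.symm y)) _ = _
        rw [AlgEquiv.apply_symm_apply]
        congr 1
        ext x
        exact hσ x
      obtain ⟨τ, hτ⟩ := IntermediateField.exists_algHom_of_splits_of_aeval (F := K)
        (E := Qalg F) (K := Qalg F)
        (fun x => ⟨Algebra.IsIntegral.isIntegral x, IsAlgClosed.splits _⟩) hy'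
      refine ⟨((σ : Qalg F →ₐ[Qv F] Qalg F).comp (τ.restrictScalars (Qv F))).comp N.val, ?_, ?_⟩
      · rw [mem_extensions]
        intro x
        change σ (τ (algebraMap K (Qalg F) x)) = _
        rw [τ.commutes]
        exact hσ x
      · change σ (τ θ) = y
        rw [hτ, AlgEquiv.apply_symm_apply]
    · rintro ⟨g, hg, rfl⟩
      rw [mem_extensions] at hg
      rw [IsRoot, eval_map]
      have h0 : eval₂ (IntermediateField.inclusion hKN : K →+* N) ⟨θ, hN.mem⟩
          (minpoly K θ) = 0 := by
        apply (algebraMap N (Qalg F)).injective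
        rw [map_zero, hom_eval₂, ← minpoly.aeval K θ, aeval_def]
        rfl
      have h1 := congrArg (g : N →+* Qalg F) h0
      rw [map_zero, hom_eval₂] at h1
      rw [← h1]
      change _ = eval₂ _ (g ⟨θ, hN.mem⟩) _
      congr 1
      ext x
      exact (hg x).symm
  rw [(IsAlgClosed.splits P).eq_prod_roots_of_monic hPm, hroots, ← Finset.prod_image
    (f := fun y => X - C y) (fun a _ b _ h => hinj h), Finset.prod]

/-- A monic polynomial whose roots are integral has integral coefficients. -/
theorem norm_coeff_prod_le {ι : Type*} (s : Finset ι) (r : ι → Qalg F) (hr : ∀ i, ‖r i‖ ≤ 1)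
    (k : ℕ) : ‖(∏ i ∈ s, (X - C (r i))).coeff k‖ ≤ 1 := by
  let O := integralClosure (Av F) (Qalg F)
  let r' : ι → O := fun i => ⟨r i, isIntegral_of_norm_le_one (hr i)⟩
  have h : (∏ i ∈ s, (X - C (r i))) = (∏ i ∈ s, (X - C (r' i))).map (algebraMap O (Qalg F)) := by
    rw [Polynomial.map_prod]
    refine prod_congr rfl fun i _ => ?_
    rw [Polynomial.map_sub, Polynomial.map_X, Polynomial.map_C]
    rfl
  rw [h, Polynomial.coeff_map]
  exact norm_of_isIntegral F ((∏ i ∈ s, (X - C (r' i))).coeff k).2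

variable [FD[K]] [Sep[K]]

theorem IsGood.norm_prod_le (hK : IsGood K α π ϑ) (hN : IsGood N α' π' θ) (hKN : K ≤ N)
    (φ : K →ₐ[Qv F] Qalg F) (n : ℕ) : ∏ g ∈ extensions hKN φ, ‖g ⟨θ, hN.mem⟩ - θ ^ qF ^ n‖ ≤
    ‖φ ⟨ϑ, hK.mem⟩ - ϑ ^ qF ^ n‖ := by
  set Q := qF ^ n
  set x := θ ^ Q
  have hxn : ‖x‖ ≤ 1 := by rw [norm_pow]; exact pow_le_one₀ (norm_nonneg _) hN.norm_le
  set P := ∏ g ∈ extensions hKN φ, (X - C (g ⟨θ, hN.mem⟩))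
  have hP : (minpoly K θ).map (φ : K →+* Qalg F) = P := hN.minpoly_map_eq_prod hKN φ
  have h1 : ∏ g ∈ extensions hKN φ, ‖g ⟨θ, hN.mem⟩ - x‖ = ‖P.eval x‖ := by
    rw [eval_prod, norm_prod]
    refine prod_congr rfl fun g _ => ?_
    rw [eval_sub, eval_X, eval_C, norm_sub_rev]
  have hc : ∀ k, ‖(minpoly K θ).coeff k‖ ≤ 1 := by
    intro k
    have := norm_coeff_prod_le (extensions hKN φ) (fun g => g ⟨θ, hN.mem⟩)
      (fun g => by rw [norm_algHom]; exact hN.norm_le) k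
    change ‖P.coeff k‖ ≤ 1 at this
    rwa [← hP, Polynomial.coeff_map, RingHom.coe_coe, norm_algHom] at this
  have h2 : P.eval x = ∑ k ∈ range ((minpoly K θ).natDegree + 1),
      (φ ((minpoly K θ).coeff k) - (((minpoly K θ).coeff k : K) : Qalg F) ^ Q) * x ^ k := by
    have h3 : ∑ k ∈ range ((minpoly K θ).natDegree + 1),
        (((minpoly K θ).coeff k : K) : Qalg F) ^ Q * x ^ k = 0 := by
      have h4 := minpoly.aeval K θ
      rw [aeval_def, eval₂_eq_sum_range] at h4
      have h5 := congrArg (· ^ Q) h4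
      have h6 : ∀ (s : Finset ℕ) (f : ℕ → Qalg F), (∑ k ∈ s, f k) ^ Q = ∑ k ∈ s, f k ^ Q := by
        intro s f
        exact map_sum (AddMonoidHom.mk' (fun y : Qalg F => y ^ Q)
          (fun a b => add_pow_card (F := F) a b n)) f s
      simp only [h6] at h5
      rw [zero_pow (pow_ne_zero n (Fintype.card_ne_zero (α := F)))] at h5
      rw [← h5]
      refine sum_congr rfl fun k _ => ?_
      rw [mul_pow, ← pow_mul, ← pow_mul, mul_comm k]
      rfl
    rw [← hP, eval_map, eval₂_eq_sum_range]
    simp only [sub_mul, Finset.sum_sub_distrib]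
    rw [h3, sub_zero]
    rfl
  rw [h1, h2]
  refine norm_sum_le_of_forall_le_of_nonneg (norm_nonneg _) fun k _ => ?_
  rw [norm_mul, norm_pow]
  exact (mul_le_of_le_one_right (norm_nonneg _) (pow_le_one₀ (norm_nonneg _) hxn)).trans
    (hK.norm_algHom_sub_pow_le φ n _ (hc k))

/-- A polynomial with integral coefficients which is small at all roots of a product of distinct
linear factors is, up to a small error, bounded by that product. -/
theorem exists_norm_eval_le {O : Type*} [CommRing O] (i : O →+* Qalg F) (hi : ∀ o, ‖i o‖ ≤ 1)
    {ι : Type*} (s : Finset ι) (r : ι → O) (hr : Injective fun g => i (r g)) (x : O) : ∃ C : ℝ, 0 ≤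
    C ∧ ∀ (f : O[X]) (ε : ℝ), (∀ g ∈ s, ‖i (f.eval (r g))‖ ≤ ε) → ‖i (f.eval x)‖ ≤ ε * C + ∏ g ∈ s,
    ‖i (r g) - i x‖ := by
  classical
  let v : ι → Qalg F := fun g => i (r g)
  let P : O[X] := ∏ g ∈ s, (X - C (r g))
  have hPm : P.Monic := Polynomial.monic_prod_of_monic _ _ fun g _ => monic_X_sub_C _
  have hO : Nontrivial O := i.domain_nontrivial
  have hPdeg : P.degree = s.card := by
    rw [degree_eq_natDegree hPm.ne_zero,
      Polynomial.natDegree_prod_of_monic _ _ fun g _ => monic_X_sub_C _]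
    simp
  refine ⟨∑ g ∈ s, ‖(Lagrange.basis s v g).eval (i x)‖,
    Finset.sum_nonneg fun _ _ => norm_nonneg _, fun f ε hf => ?_⟩
  have h1 : ∏ g ∈ s, ‖i (r g) - i x‖ = ‖i (P.eval x)‖ := by
    rw [eval_prod, map_prod, norm_prod]
    refine prod_congr rfl fun g _ => ?_
    rw [eval_sub, eval_X, eval_C, map_sub, norm_sub_rev]
  have hrem : ∀ t, f.eval t = (f %ₘ P).eval t + P.eval t * (f /ₘ P).eval t := by
    intro t
    conv_lhs => rw [← Polynomial.modByMonic_add_div f P]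
    rw [Polynomial.eval_add, eval_mul]
  let R := (f %ₘ P).map i
  have hRdeg : R.degree < s.card := by
    rw [← hPdeg]
    exact Polynomial.degree_map_le.trans_lt (Polynomial.degree_modByMonic_lt f hPm)
  have hRv : ∀ g ∈ s, ‖R.eval (v g)‖ ≤ ε := by
    intro g hg
    have hPg : P.eval (r g) = 0 := by
      rw [eval_prod]
      exact prod_eq_zero hg (by simp)
    have e1 : R.eval (v g) = i (f.eval (r g)) := by
      rw [hrem, hPg, zero_mul, add_zero]
      exact Polynomial.eval_map_apply i (r g)
    rw [e1]
    exact hf g hg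
  have hRx : ‖R.eval (i x)‖ ≤ ε * ∑ g ∈ s, ‖(Lagrange.basis s v g).eval (i x)‖ := by
    rw [Lagrange.eq_interpolate hr.injOn hRdeg, Lagrange.interpolate_apply,
      Polynomial.eval_finsetSum, mul_sum]
    refine (norm_sum_le _ _).trans (Finset.sum_le_sum fun g hg => ?_)
    rw [eval_mul, eval_C, norm_mul]
    exact mul_le_mul_of_nonneg_right (hRv g hg) (norm_nonneg _)
  have e1 : i (f.eval x) = R.eval (i x) + i (P.eval x) * i ((f /ₘ P).eval x) := by
    rw [hrem, map_add, map_mul]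
    congr 1
    exact (Polynomial.eval_map_apply i x).symm
  rw [e1, h1]
  refine (norm_add_le _ _).trans (add_le_add hRx ?_)
  rw [norm_mul]
  exact mul_le_of_le_one_right (norm_nonneg _) (hi _)

theorem IsGood.le_norm_prod (hK : IsGood K α π ϑ) (hN : IsGood N α' π' θ) (hKN : K ≤ N)
    (φ : K →ₐ[Qv F] Qalg F) (n : ℕ) : ‖φ ⟨ϑ, hK.mem⟩ - ϑ ^ qF ^ n‖ ≤ ∏ g ∈ extensions hKN φ,
    ‖g ⟨θ, hN.mem⟩ - θ ^ qF ^ n‖ := by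
  set Q := qF ^ n
  have hQ : Q ≠ 0 := pow_ne_zero n Fintype.card_ne_zero
  let O := integralClosure (Av F) (Qalg F)
  let x : O := ⟨θ ^ Q, isIntegral_of_norm_le_one
    (by rw [norm_pow]; exact pow_le_one₀ (norm_nonneg _) hN.norm_le)⟩
  let y : O := ⟨φ ⟨ϑ, hK.mem⟩, isIntegral_of_norm_le_one (by rw [norm_algHom]; exact hK.norm_le)⟩
  let r : (N →ₐ[Qv F] Qalg F) → O := fun g => ⟨g ⟨θ, hN.mem⟩,
    isIntegral_of_norm_le_one (by rw [norm_algHom]; exact hN.norm_le)⟩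
  obtain ⟨C, hC, hfC⟩ := exists_norm_eval_le (algebraMap O (Qalg F))
    (fun o => norm_of_isIntegral F o.2) (extensions hKN φ) r (fun g g' h => hN.algHom_ext h) x
  refine le_of_forall_pos_le_add fun δ hδ => ?_
  obtain ⟨ε, hε0, hε1, hε2⟩ : ∃ ε : ℝ, 0 < ε ∧ ε ≤ 1 ∧ ε * (1 + C) ≤ δ := by
    refine ⟨min 1 (δ / (1 + C)), lt_min one_pos (by positivity), min_le_left _ _, ?_⟩
    exact (mul_le_mul_of_nonneg_right (min_le_right _ _) (by positivity)).trans
      (div_mul_cancel₀ _ (by positivity)).le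
  obtain ⟨p, hp⟩ := hN.dense (hKN hK.mem) hK.norm_le hε0
  let f : O[X] := (p.map (algebraMap F (Av F))).map (algebraMap (Av F) O) - Polynomial.C y
  have hf : ∀ t : O, algebraMap O (Qalg F) (f.eval t) = aeval (t : Qalg F) p - φ ⟨ϑ, hK.mem⟩ := by
    intro t
    rw [eval_sub, eval_C, eval_map_algebraMap, map_sub, ← Polynomial.aeval_algebraMap_apply,
      aeval_map_algebraMap]
    rfl
  have h1 := hfC f ε fun g hg => by
    have e2 := algHom_aeval g ⟨θ, hN.mem⟩ p
    have e3 : φ ⟨ϑ, hK.mem⟩ = g ⟨ϑ, hKN hK.mem⟩ := ((mem_extensions.1 hg) ⟨ϑ, hK.mem⟩).symm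
    rw [hf, e3]
    change ‖aeval (g ⟨θ, hN.mem⟩) p - _‖ ≤ ε
    rw [← e2, ← map_sub, norm_algHom]
    change ‖aeval θ p - ϑ‖ ≤ ε
    rw [norm_sub_rev]
    exact hp.le
  have e2 : aeval ((x : O) : Qalg F) p = (aeval θ p) ^ Q := aeval_pow_card p θ n
  rw [hf, e2] at h1
  have hx1 : φ ⟨ϑ, hK.mem⟩ - ϑ ^ Q = (aeval θ p - ϑ) ^ Q -
      ((aeval θ p) ^ Q - φ ⟨ϑ, hK.mem⟩) := by
    rw [sub_pow_card]
    ring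
  have b1 : ‖(aeval θ p - ϑ) ^ Q‖ ≤ ε := by
    rw [norm_pow, norm_sub_rev]
    exact (pow_le_of_le_one (norm_nonneg _) (hp.le.trans hε1) hQ).trans hp.le
  rw [hx1]
  refine (norm_sub_le _ _).trans ((add_le_add b1 h1).trans ?_)
  change ε + (ε * C + ∏ g ∈ extensions hKN φ, ‖g ⟨θ, hN.mem⟩ - θ ^ Q‖) ≤ _
  linarith

/-- The product over the embeddings of `N` above an embedding `φ` of `K`, in terms of `K`. -/
theorem IsGood.norm_prod_eq (hK : IsGood K α π ϑ) (hN : IsGood N α' π' θ) (hKN : K ≤ N)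
    (φ : K →ₐ[Qv F] Qalg F) (n : ℕ) : ∏ g ∈ extensions hKN φ, ‖g ⟨θ, hN.mem⟩ - θ ^ qF ^ n‖ =
    ‖φ ⟨ϑ, hK.mem⟩ - ϑ ^ qF ^ n‖ :=
  le_antisymm (hK.norm_prod_le hN hKN φ n) (hK.le_norm_prod hN hKN φ n)

end fibres

/-! ### The different of a monogenic extension -/

section different
variable {A B : Type*} [CommRing A] [CommRing B] [Algebra A B]

/-- The differentials of a monogenic algebra `A[X]/(f)` are annihilated exactly by the multiples of
`f'`. -/
theorem annihilator_kaehler_eq (θ : B) (f : A[X]) (hsurj : ∀ b : B, ∃ p : A[X], aeval θ p = b)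
    (hf : aeval θ f = 0) (hker : ∀ p : A[X], aeval θ p = 0 → f ∣ p) :
    Module.annihilator B (Ω[B⁄A]) = Ideal.span {aeval θ f.derivative} := by
  set I := Ideal.span {aeval θ f.derivative}
  apply le_antisymm
  · choose s hs using hsurj
    have hwd : ∀ p p' : A[X], aeval θ p = aeval θ p' → Ideal.Quotient.mk I (aeval θ p.derivative) =
          Ideal.Quotient.mk I (aeval θ p'.derivative) := by
      intro p p' h
      obtain ⟨k, hk⟩ := hker (p - p') (by rw [map_sub, h, sub_self])
      rw [Ideal.Quotient.eq, ← map_sub, ← Polynomial.derivative_sub, hk, Polynomial.derivative_mul,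
        map_add, map_mul, map_mul, hf, zero_mul, add_zero]
      exact Ideal.mul_mem_right _ _ (Ideal.mem_span_singleton_self _)
    let D₀ : B →ₗ[A] B ⧸ I :=
      { toFun := fun b => Ideal.Quotient.mk I (aeval θ (s b).derivative)
        map_add' := fun b c => by
          rw [← map_add, ← map_add, ← Polynomial.derivative_add]
          exact hwd _ _ (by rw [hs, map_add, hs, hs])
        map_smul' := fun a b => by
          rw [hwd (s (a • b)) (a • s b) (by rw [hs, map_smul, hs]), Polynomial.derivative_smul,
            map_smul]
          rfl }
    have hD₀ : ∀ p : A[X], D₀ (aeval θ p) =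
        Ideal.Quotient.mk I (aeval θ p.derivative) := fun p => hwd _ _ (hs _)
    let D : Derivation A B (B ⧸ I) := Derivation.mk' D₀ (by
      intro b c
      obtain ⟨p, rfl⟩ : ∃ p, aeval θ p = b := ⟨_, hs b⟩
      obtain ⟨r, rfl⟩ : ∃ p, aeval θ p = c := ⟨_, hs c⟩
      rw [← map_mul, hD₀, hD₀, hD₀, Polynomial.derivative_mul]
      simp only [map_add, map_mul, smul_def, Ideal.Quotient.algebraMap_eq]
      ring)
    intro x hx
    have h1 : D θ = 1 := by
      have := hD₀ X
      rw [aeval_X, Polynomial.derivative_X, map_one, map_one] at this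
      exact this
    have h2 : x • D θ = 0 := by
      rw [← D.liftKaehlerDifferential_comp_D, ← map_smul, Module.mem_annihilator.1 hx, map_zero]
    rw [h1, smul_def, mul_one] at h2
    exact Ideal.Quotient.eq_zero_iff_mem.1 h2
  · rw [Ideal.span_singleton_le_iff_mem, Module.mem_annihilator]
    intro m
    have hm : m ∈ span B (Set.range (KaehlerDifferential.D A B)) := by
      rw [KaehlerDifferential.span_range_derivation]; trivial
    induction hm using Submodule.span_induction with
    | mem m hm =>
      obtain ⟨b, rfl⟩ := hm
      obtain ⟨p, rfl⟩ := hsurj b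
      have h1 := (KaehlerDifferential.D A B).map_aeval f θ
      rw [hf, map_zero] at h1
      rw [(KaehlerDifferential.D A B).map_aeval p θ, smul_comm, ← h1, smul_zero]
    | zero => exact smul_zero _
    | add x y _ _ hx hy => rw [smul_add, hx, hy, add_zero]
    | smul c x _ hx => rw [smul_comm, hx, smul_zero]

end different

section minpolyProd
variable {K : ExtQ} [FD[K]] [Sep[K]]
variable {α π ϑ : Qalg F}

namespace IsGood

/-- The minimal polynomial of `ϑ` over `A_v` is the product over the embeddings of `K`. -/
theorem minpoly_Av_map_eq_prod (h : IsGood K α π ϑ) :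
    (minpoly (Av F) ϑ).map (algebraMap (Av F) (Qalg F)) = Lagrange.nodal univ fun φ :
    K →ₐ[Qv F] Qalg F => φ ⟨ϑ, h.mem⟩ := by
  classical
  set P := (minpoly (Av F) ϑ).map (algebraMap (Av F) (Qalg F))
  have hPm : P.Monic := (minpoly.monic h.isIntegral).map _
  have hinj : Injective fun φ : K →ₐ[Qv F] Qalg F => φ ⟨ϑ, h.mem⟩ := fun g g' hh => h.algHom_ext hh
  have hdvd : Lagrange.nodal univ (fun φ : K →ₐ[Qv F] Qalg F => φ ⟨ϑ, h.mem⟩) ∣ P := by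
    refine Finset.prod_dvd_of_coprime (fun i _ j _ hij => ?_) fun φ _ => ?_
    · exact Polynomial.isCoprime_X_sub_C_of_isUnit_sub
        (sub_ne_zero.2 fun e => hij (hinj e)).isUnit
    · rw [Polynomial.dvd_iff_isRoot, IsRoot, eval_map_algebraMap, ← algHom_aeval_Av φ ⟨ϑ, h.mem⟩]
      have : (⟨aeval ϑ (minpoly (Av F) ϑ), aeval_Av_mem K h.mem _⟩ : K) = 0 :=
        Subtype.ext (minpoly.aeval _ _)
      exact (congrArg φ this).trans (map_zero φ)
  refine (Polynomial.eq_of_monic_of_dvd_of_natDegree_le (Lagrange.nodal_monic) hPm hdvd ?_)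
  rw [Lagrange.natDegree_nodal, Finset.card_univ, AlgHom.card,
    (minpoly.monic h.isIntegral).natDegree_map]
  have h1 : (minpoly (Av F) ϑ).map (algebraMap (Av F) (Qv F)) = minpoly (Qv F) ϑ :=
    (minpoly.isIntegrallyClosed_eq_field_fractions (Qv F) (Qalg F) h.isIntegral).symm
  rw [← (minpoly.monic h.isIntegral).natDegree_map (algebraMap (Av F) (Qv F)), h1,
    show minpoly (Qv F) ϑ = minpoly (Qv F) (⟨ϑ, h.mem⟩ : K) from
      minpoly.algHom_eq K.val K.val.injective ⟨ϑ, h.mem⟩]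
  exact minpoly.natDegree_le _

theorem aeval_derivative_minpoly [DecidableEq (K →ₐ[Qv F] Qalg F)] (h : IsGood K α π ϑ)
    (φ : K →ₐ[Qv F] Qalg F) : aeval (φ ⟨ϑ, h.mem⟩) (minpoly (Av F) ϑ).derivative = ∏ χ ∈
    univ.erase φ, (φ ⟨ϑ, h.mem⟩ - χ ⟨ϑ, h.mem⟩) := by
  rw [← eval_map_algebraMap, ← derivative_map, h.minpoly_Av_map_eq_prod]
  refine (Lagrange.eval_nodal_derivative_eval_node_eq
    (v := fun φ : K →ₐ[Qv F] Qalg F => φ ⟨ϑ, h.mem⟩) (mem_univ φ)).trans ?_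
  rw [Lagrange.eval_nodal]

theorem aeval_derivative_minpoly_ne_zero (h : IsGood K α π ϑ) :
    aeval ϑ (minpoly (Av F) ϑ).derivative ≠ 0 := by
  classical
  have := h.aeval_derivative_minpoly K.val
  change aeval ϑ (minpoly (Av F) ϑ).derivative = _ at this
  rw [this, prod_ne_zero_iff]
  intro χ hχ
  rw [mem_erase] at hχ
  exact sub_ne_zero.2 fun e => hχ.1 (h.algHom_ext e).symm

/-- The different of `K` is generated by the derivative of the minimal polynomial of `ϑ`. -/
theorem valIdeal_different (h : IsGood K α π ϑ) : valIdeal K (different K) =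
    val F (aeval ϑ (minpoly (Av F) ϑ).derivative) := by
  let i : RL K →ₐ[Av F] Qalg F :=
    (IsScalarTower.toAlgHom (Av F) K (Qalg F)).comp (IsScalarTower.toAlgHom (Av F) (RL K) K)
  have hi : Injective i := (algebraMap K (Qalg F)).injective.comp (algebraMap_RL_injective K)
  let θ : RL K := mkRL K ⟨ϑ, h.mem⟩ h.norm_le
  have hev : ∀ p : (Av F)[X], i (aeval θ p) = aeval ϑ p := fun p => (aeval_algHom_apply i θ p).symm
  have hd : different K = Ideal.span {aeval θ (minpoly (Av F) ϑ).derivative} := by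
    refine annihilator_kaehler_eq θ _ (fun b => ?_) ?_ fun p hp => ?_
    · obtain ⟨p, hp⟩ := h.exists_aeval (x := i b) (ι[K] b).2 (norm_RL_le K b)
      exact ⟨p, hi ((hev p).trans hp.symm)⟩
    · apply hi
      rw [hev, minpoly.aeval, map_zero]
    · refine minpoly.isIntegrallyClosed_dvd h.isIntegral ?_
      rw [← hev, hp, map_zero]
  set y := aeval θ (minpoly (Av F) ϑ).derivative
  have hy : i y = aeval ϑ (minpoly (Av F) ϑ).derivative := hev _
  have hy0 : y ≠ 0 := fun e => h.aeval_derivative_minpoly_ne_zero (by rw [← hy, e, map_zero])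
  have hv : ∀ x : RL K, val F (ι[K] x) = val F (i x) := fun x => rfl
  rw [← hy, ← hv]
  refine IsLeast.csInf_eq ⟨⟨y, ⟨?_, hy0⟩, rfl⟩, ?_⟩
  · rw [hd]; exact Ideal.mem_span_singleton_self _
  · rintro _ ⟨x, ⟨hx, hx0⟩, rfl⟩
    rw [hd, Ideal.mem_span_singleton] at hx
    obtain ⟨c, rfl⟩ := hx
    have hlog : 0 < Real.log (qF) := Real.log_pos (by exact_mod_cast Fintype.one_lt_card)
    unfold val
    refine div_le_div_of_nonneg_right (neg_le_neg (Real.log_le_log ?_ ?_)) hlog.le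
    · rw [norm_pos_iff, Ne, map_eq_zero_iff _ (algebraMap_RL_injective K)]; exact hx0
    · rw [map_mul, norm_mul]
      exact mul_le_of_le_one_right (norm_nonneg _) (norm_RL_le K c)

end IsGood
end minpolyProd

/-! ### The measures at finite level -/

section level
theorem log_card_pos : 0 < Real.log (qF) := Real.log_pos (by exact_mod_cast Fintype.one_lt_card)

theorem val_mul {k : Type*} [NormedField k] {x y : k} (hx : x ≠ 0) (hy : y ≠ 0) : val F (x * y) =
    val F x + val F y := by
  rw [val, val, val, norm_mul, Real.log_mul (norm_ne_zero_iff.2 hx) (norm_ne_zero_iff.2 hy)]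
  ring

theorem val_prod {k : Type*} [NormedField k] {ι : Type*} (s : Finset ι) (f : ι → k)
    (h : ∀ i ∈ s, f i ≠ 0) : val F (∏ i ∈ s, f i) = ∑ i ∈ s, val F (f i) := by
  simp only [val, norm_prod]
  rw [Real.log_prod fun i hi => norm_ne_zero_iff.2 (h i hi), ← Finset.sum_neg_distrib,
    Finset.sum_div]

theorem val_eq_of_norm_eq {k k' : Type*} [NormedField k] [NormedField k'] {x : k} {y : k'}
    (h : ‖x‖ = ‖y‖) : val F x = val F y := by
  rw [val, val, h]

theorem val_zetaQ : val F (zetaQ F) = 1 := by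
  rw [val, norm_zetaQ, Real.log_inv, neg_neg, div_self log_card_pos.ne']

/-- The right hand side of the period formula, for a function `c` on the embeddings of `K` and a
monogenic generator `ϑ`. -/
def periodSum (K : ExtQ) [FD[K]] (ϑ : K) (c : (K →ₐ[Qv F] Qalg F) → ℝ) : ℝ :=
  ∑' n : ℕ, (∑ φ, c φ * val F (φ ϑ - (ϑ : Qalg F) ^ qF ^ (n + 1))) /
      (qF : ℝ) ^ (n + 1) +
    ∑ φ : K →ₐ[Qv F] Qalg F, (c φ - c K.val) * val F (φ ϑ - (ϑ : Qalg F))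

variable {K N : ExtQ} [FD[K]] [Sep[K]]
  [FD[N]] [Sep[N]]
variable {α π ϑ α' π' θ : Qalg F}

namespace IsGood

theorem sub_pow_ne_zero (h : IsGood K α π ϑ) (φ : K →ₐ[Qv F] Qalg F) {n : ℕ} (hn : n ≠ 0) :
    φ ⟨ϑ, h.mem⟩ - ϑ ^ qF ^ n ≠ 0 := by
  intro h0
  have := h.norm_algHom_sub_pow_of_lt φ hn (by rw [h0, norm_zero]; exact one_pos)
  rw [h0, norm_zero] at this
  exact h.unif.ne_zero (norm_eq_zero.1 this.symm)

theorem sub_ne_zero_of_ne (h : IsGood K α π ϑ) {φ : K →ₐ[Qv F] Qalg F} (hφ : φ ≠ K.val) :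
    φ ⟨ϑ, h.mem⟩ - ϑ ≠ 0 :=
  fun h0 => hφ (h.algHom_ext (sub_eq_zero.1 h0))

theorem sum_val_extensions (hK : IsGood K α π ϑ) (hN : IsGood N α' π' θ) (hKN : K ≤ N)
    (φ : K →ₐ[Qv F] Qalg F) (n : ℕ) (h : n ≠ 0 ∨ φ ≠ K.val) : ∑ g ∈ extensions hKN φ,
    val F (g ⟨θ, hN.mem⟩ - θ ^ qF ^ n) = val F (φ ⟨ϑ, hK.mem⟩ - ϑ ^ qF ^ n) := by
  rw [← val_prod]
  · exact val_eq_of_norm_eq (by rw [norm_prod, hK.norm_prod_eq hN hKN])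
  · intro g hg
    rcases h with h | h
    · exact hN.sub_pow_ne_zero g h
    · rcases eq_or_ne n 0 with rfl | hn
      · rw [pow_zero, pow_one]
        refine hN.sub_ne_zero_of_ne ?_
        rintro rfl
        apply h
        ext x
        exact ((mem_extensions.1 hg) x).symm
      · exact hN.sub_pow_ne_zero g hn

/-- `periodSum` is compatible with the restriction of embeddings. -/
theorem periodSum_eq (hK : IsGood K α π ϑ) (hN : IsGood N α' π' θ) (hKN : K ≤ N)
    (c : (K →ₐ[Qv F] Qalg F) → ℝ) :
    periodSum N ⟨θ, hN.mem⟩ (fun g => c (g.comp (IntermediateField.inclusion hKN))) =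
    periodSum K ⟨ϑ, hK.mem⟩ c := by
  classical
  have hmaps : ∀ g ∈ (univ : Finset (N →ₐ[Qv F] Qalg F)),
      g.comp (IntermediateField.inclusion hKN) ∈ (univ : Finset (K →ₐ[Qv F] Qalg F)) :=
    fun _ _ => mem_univ _
  have hval : N.val.comp (IntermediateField.inclusion hKN) = K.val := rfl
  unfold periodSum
  congr 1
  · congr 1
    ext n
    congr 1
    rw [← Finset.sum_fiberwise_of_maps_to hmaps]
    refine sum_congr rfl fun φ _ => ?_
    rw [← hK.sum_val_extensions hN hKN φ (n + 1) (Or.inl n.succ_ne_zero), mul_sum]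
    refine sum_congr (by rw [extensions]) fun g hg => ?_
    beta_reduce
    rw [(Finset.mem_filter.1 hg).2]
  · rw [← Finset.sum_fiberwise_of_maps_to hmaps]
    refine sum_congr rfl fun φ _ => ?_
    rcases eq_or_ne φ K.val with rfl | hφ
    · rw [sub_self, zero_mul]
      refine Finset.sum_eq_zero fun g hg => ?_
      beta_reduce
      rw [(Finset.mem_filter.1 hg).2, hval, sub_self, zero_mul]
    · have := hK.sum_val_extensions hN hKN φ 0 (Or.inr hφ)
      rw [pow_zero, pow_one, pow_one] at this
      rw [← this, mul_sum]
      refine sum_congr (by rw [extensions]) fun g hg => ?_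
      beta_reduce
      rw [(Finset.mem_filter.1 hg).2, hval]

end IsGood

theorem isUnit_RL_iff (x : RL K) : IsUnit x ↔ ‖ι[K] x‖ = 1 := by
  constructor
  · rintro ⟨u, rfl⟩
    refine le_antisymm (norm_RL_le K _) ?_
    have h1 := norm_RL_le K (↑u⁻¹ : RL K)
    have h2 : ‖ι[K] u‖ * ‖ι[K] (↑u⁻¹ : RL K)‖ = 1 := by
      rw [← norm_mul, ← map_mul, Units.mul_inv, map_one, norm_one]
    nlinarith [norm_nonneg (ι[K] (u : RL K))]
  · intro h
    have h0 : ι[K] x ≠ 0 := by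
      intro h0; rw [h0, norm_zero] at h; exact zero_ne_one h
    refine IsUnit.of_mul_eq_one (mkRL K (ι[K] x)⁻¹ (by rw [norm_inv, h, inv_one])) ?_
    apply algebraMap_RL_injective
    rw [map_mul, algebraMap_mkRL, mul_inv_cancel₀ h0, map_one]

theorem RL_dvd_iff {x y : RL K} (hx : x ≠ 0) : x ∣ y ↔ ‖ι[K] y‖ ≤ ‖ι[K] x‖ := by
  constructor
  · rintro ⟨c, rfl⟩
    rw [map_mul, norm_mul]
    exact mul_le_of_le_one_right (norm_nonneg _) (norm_RL_le K c)
  · intro h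
    have h0 : ι[K] x ≠ 0 := by
      rwa [Ne, map_eq_zero_iff _ (algebraMap_RL_injective K)]
    refine ⟨mkRL K (ι[K] y / ι[K] x) ?_, ?_⟩
    · rw [norm_div]; exact (div_le_one (norm_pos_iff.2 h0)).2 h
    · apply algebraMap_RL_injective
      rw [map_mul, algebraMap_mkRL, mul_div_cancel₀ _ h0]

theorem isUnif_unif : IsUnif K ((ι[K] (unif K) : K) : Qalg F) := by
  obtain ⟨π, hπ⟩ := exists_isUnif K
  let p : RL K := mkRL K ⟨π, hπ.mem⟩ hπ.lt_one.le
  have hpn : ‖ι[K] p‖ = ‖π‖ := rfl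
  have hp0 : p ≠ 0 := by
    intro h; rw [h, map_zero, norm_zero] at hpn; exact hπ.ne_zero (norm_eq_zero.1 hpn.symm)
  have hnu : ∀ x : RL K, ¬ IsUnit x → ‖ι[K] x‖ ≤ ‖π‖ := fun x hx =>
    hπ.max _ (ι[K] x).2
      (lt_of_le_of_ne (norm_RL_le K x) fun h => hx ((isUnit_RL_iff x).2 h))
  have hirr : Irreducible p := by
    refine ⟨fun h => ?_, fun a b hab => ?_⟩
    · rw [isUnit_RL_iff, hpn] at h
      exact hπ.lt_one.ne h
    · by_contra! h
      have ha := hnu a h.1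
      have hb := hnu b h.2
      have h1 : ‖π‖ ≤ ‖π‖ * ‖π‖ := by
        conv_lhs => rw [← hpn, hab, map_mul, norm_mul]
        exact mul_le_mul ha hb (norm_nonneg _) (norm_nonneg _)
      nlinarith [norm_pos_iff.2 hπ.ne_zero, hπ.lt_one]
  have hu : Irreducible (unif K) := Classical.epsilon_spec (p := fun π : RL K => Irreducible π) ⟨p, hirr⟩
  have h1 : ‖ι[K] (unif K)‖ = ‖π‖ := by
    obtain ⟨c, hc⟩ := (RL_dvd_iff (y := unif K) hp0).2 (hnu _ hu.not_isUnit)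
    have := (hu.isUnit_or_isUnit hc).resolve_left hirr.not_isUnit
    rw [isUnit_RL_iff] at this
    rw [hc, map_mul, norm_mul, this, mul_one, hpn]
  refine ⟨(ι[K] (unif K)).2, ?_, ?_, fun x hx hx1 => ?_⟩
  · intro h
    change ‖((ι[K] (unif K) : K) : Qalg F)‖ = _ at h1
    rw [h, norm_zero] at h1
    exact hπ.ne_zero (norm_eq_zero.1 h1.symm)
  · change ‖ι[K] (unif K)‖ < 1
    rw [h1]; exact hπ.lt_one
  · change _ ≤ ‖ι[K] (unif K)‖
    rw [h1]; exact hπ.max x hx hx1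

theorem one_div_ramIdx : 1 / (ramIdx K : ℝ) = val F ((ι[K] (unif K) : K) : Qalg F) := by
  have hπ := isUnif_unif (K := K)
  set π : Qalg F := ((ι[K] (unif K) : K) : Qalg F) with hπdef
  obtain ⟨e, he⟩ := hπ.exists_norm_eq_pow (zetaQ_mem K) zetaQ_ne_zero (norm_zetaQ_lt_one F).le
  have hζ : ‖ι[K] (zeta K)‖ = ‖zetaQ F‖ := by
    rw [norm_zetaQ]; exact norm_zetaL K
  have hu0 : ∀ m, unif K ^ m ≠ 0 := by
    intro m h
    have := congrArg ι[K] h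
    rw [map_pow, map_zero] at this
    exact pow_ne_zero m hπ.ne_zero (congrArg Subtype.val this)
  have hpow : ∀ m, ‖ι[K] (unif K ^ m)‖ = ‖π‖ ^ m := fun m => by
    rw [map_pow, norm_pow]; rfl
  have hmul : ramIdx K = e := by
    refine multiplicity_eq_of_dvd_of_not_dvd ?_ ?_
    · rw [RL_dvd_iff (hu0 _), hζ, hpow, he]
    · rw [RL_dvd_iff (hu0 _), hζ, hpow, he, not_le]
      exact pow_lt_pow_right_of_lt_one₀ (norm_pos_iff.2 hπ.ne_zero) hπ.lt_one (Nat.lt_succ_self e)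
  have h1 := val_zetaQ (F := F)
  rw [val, he, Real.log_pow] at h1
  have h2 : (e : ℝ) * val F π = 1 := by rw [← h1, val]; ring
  have h0 : (e : ℝ) ≠ 0 := by rintro h0; rw [h0, zero_mul] at h2; exact zero_ne_one h2
  rw [hmul, one_div, eq_comm, eq_inv_of_mul_eq_one_right h2]

end level

section galois
variable {N : ExtQ}

/-- The value of a function on the Galois group at an extension of an embedding of `N`. -/
def extValue (a : GQ F → ℚ) (g : N →ₐ[Qv F] Qalg F) : ℝ := a (exists_aut_extends g).choose

theorem extValue_eq {a : GQ F → ℚ} (ha : IsConstMod N a) {g : N →ₐ[Qv F] Qalg F} {σ : GQ F}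
    (hσ : ∀ x : N, σ x = g x) : extValue a g = a σ := by
  rw [extValue]
  congr 1
  exact ha _ _ fun x hx =>
    ((exists_aut_extends g).choose_spec ⟨x, hx⟩).trans (hσ ⟨x, hx⟩).symm

theorem IsGood.norm_sub_pow_le_one {α π θ : Qalg F} (h : IsGood N α π θ) (φ : N →ₐ[Qv F] Qalg F)
    (n : ℕ) : ‖φ ⟨θ, h.mem⟩ - θ ^ qF ^ n‖ ≤ 1 := by
  refine (norm_sub_le_max _ _).trans (max_le ?_ ?_)
  · rw [norm_algHom]; exact h.norm_le
  · rw [norm_pow]; exact pow_le_one₀ (norm_nonneg _) h.norm_le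

theorem val_eq_zero_of_norm_eq_one {k : Type*} [NormedField k] {x : k} (hx : ‖x‖ = 1) : val F x =
    0 := by
  rw [val, hx, Real.log_one, neg_zero, zero_div]

variable [FD[N]] [IsGalois (Qv F) N] {α π θ : Qalg F}

/-- Automorphisms of a Galois extension, as embeddings. -/
def autEquivEmb : (N ≃ₐ[Qv F] N) ≃ (N →ₐ[Qv F] Qalg F) :=
  (Normal.algHomEquivAut (Qv F) (Qalg F) N).symm

theorem autEquivEmb_apply (g : N ≃ₐ[Qv F] N) (x : N) : autEquivEmb g x = ((g x : N) : Qalg F) := rfl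

theorem atLevel_eq {a : GQ F → ℚ} (ha : IsConstMod N a) (g : N ≃ₐ[Qv F] N) : (atLevel N a g : ℝ) =
    extValue a (autEquivEmb g) :=
  (extValue_eq ha fun x => g.liftNormal_commutes (Qalg F) x).symm

theorem IsGood.actsAsFrob_iff (h : IsGood N α π θ) (n : ℕ) (g : N ≃ₐ[Qv F] N) : ActsAsFrob N n g ↔
    ‖autEquivEmb g ⟨θ, h.mem⟩ - θ ^ qF ^ n‖ < 1 :=
  ⟨fun H => H ⟨θ, h.mem⟩ h.norm_le,
    fun H x hx => (h.norm_algHom_sub_pow_le (autEquivEmb g) n x hx).trans_lt H⟩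

/-- The contribution of the `q ^ n`-Frobenius elements, for `n ≥ 1`. -/
theorem IsGood.ite_actsAsFrob [DecidableEq (N →ₐ[Qv F] Qalg F)]
    (h : IsGood N α ((ι[N] (LocSht.unif N) : N) : Qalg F) θ) {n : ℕ} (hn : n ≠ 0) (g : N ≃ₐ[Qv F] N)
    [Decidable (ActsAsFrob N n g)] : (if ActsAsFrob N n g then 1 / (ramIdx N : ℝ) else 0) =
    val F (autEquivEmb g ⟨θ, h.mem⟩ - θ ^ qF ^ n) := by
  split_ifs with hg
  · rw [one_div_ramIdx]
    rw [h.actsAsFrob_iff] at hg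
    exact (val_eq_of_norm_eq (h.norm_algHom_sub_pow_of_lt _ hn hg)).symm
  · rw [h.actsAsFrob_iff, not_lt] at hg
    exact (val_eq_zero_of_norm_eq_one (le_antisymm (h.norm_sub_pow_le_one _ n) hg)).symm

theorem IsGood.mu_of_ne (h : IsGood N α ((ι[N] (LocSht.unif N) : N) : Qalg F) θ) {g : N ≃ₐ[Qv F] N}
    (hg : autEquivEmb g ≠ N.val) : mu N g = - val F (autEquivEmb g ⟨θ, h.mem⟩ - θ) := by
  have h0 := h.actsAsFrob_iff 0 g
  have h1 := h.norm_sub_pow_le_one (autEquivEmb g) 0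
  have h2 := h.norm_algHom_sub_pow (autEquivEmb g) 0
  rw [pow_zero, pow_one] at h0 h1 h2
  rw [pow_one] at h2
  unfold mu
  by_cases hfrob : ActsAsFrob N 0 g
  · rw [if_neg (not_not.2 hfrob)]
    have h3 := h2 (h0.1 hfrob)
    rw [h3]
    rw [if_pos]
    · rfl
    · intro h4
      refine h.sub_ne_zero_of_ne hg ?_
      rw [h3, autEquivEmb_apply, sub_eq_zero]
      exact congrArg Subtype.val h4
  · rw [if_pos hfrob, val_eq_zero_of_norm_eq_one (le_antisymm h1 (not_lt.1 fun h => hfrob (h0.2 h))),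
      neg_zero]

theorem IsGood.mu_one [DecidableEq (N →ₐ[Qv F] Qalg F)] (h : IsGood N α π θ) {g : N ≃ₐ[Qv F] N}
    (hg : autEquivEmb g = N.val) : mu N g = ∑ χ ∈ univ.erase N.val, val F (χ ⟨θ, h.mem⟩ - θ) := by
  have hg1 : ∀ x, g x = x := fun x => Subtype.ext (DFunLike.congr_fun hg x)
  have h0 : ActsAsFrob N 0 g := fun x _ => by
    rw [hg1, pow_zero, pow_one, sub_self, norm_zero]; exact one_pos
  rw [mu, if_neg (not_not.2 h0), if_neg (not_not.2 (hg1 _)), h.valIdeal_different]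
  have h1 := h.aeval_derivative_minpoly N.val
  change aeval θ (minpoly (Av F) θ).derivative = _ at h1
  rw [h1, val_prod]
  · exact sum_congr rfl fun χ _ => val_eq_of_norm_eq (norm_sub_rev _ _)
  · intro χ hχ
    have := h.sub_ne_zero_of_ne (ne_of_mem_erase hχ)
    exact sub_ne_zero.2 (sub_ne_zero.1 this).symm

theorem IsGood.muArtLevel_eq (h : IsGood N α ((ι[N] (LocSht.unif N) : N) : Qalg F) θ) {a : GQ F → ℚ}
    (ha : IsConstMod N a) : muArtLevel N a = - ∑ g : N →ₐ[Qv F] Qalg F,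
    (extValue a g - extValue a N.val) * val F (g ⟨θ, h.mem⟩ - θ) := by
  classical
  rw [muArtLevel, finsum_eq_sum_of_fintype]
  let f : (N →ₐ[Qv F] Qalg F) → ℝ := fun χ => extValue a χ * (if χ = N.val then
    ∑ χ ∈ univ.erase N.val, val F (χ ⟨θ, h.mem⟩ - θ) else - val F (χ ⟨θ, h.mem⟩ - θ))
  have h1 : ∀ g : N ≃ₐ[Qv F] N, (atLevel N a g : ℝ) * mu N g = f (autEquivEmb g) := by
    intro g
    simp only [f]
    rw [atLevel_eq ha]
    split_ifs with hg
    · rw [h.mu_one hg]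
    · rw [h.mu_of_ne hg]
  refine (sum_congr rfl fun g _ => h1 g).trans
    ((Equiv.sum_comp (autEquivEmb (N := N)) f).trans ?_)
  simp only [f]
  rw [← add_sum_erase _ _ (mem_univ N.val), ← add_sum_erase univ
      (fun g : N →ₐ[Qv F] Qalg F => (extValue a g - extValue a N.val) *
        val F (g ⟨θ, h.mem⟩ - θ)) (mem_univ N.val), if_pos rfl, sub_self, zero_mul, zero_add,
    mul_sum, ← sum_add_distrib, ← Finset.sum_neg_distrib]
  refine sum_congr rfl fun χ hχ => ?_
  rw [if_neg (ne_of_mem_erase hχ)]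
  ring

theorem IsGood.ZLevel_eq (h : IsGood N α ((ι[N] (LocSht.unif N) : N) : Qalg F) θ) {a : GQ F → ℚ}
    (ha : IsConstMod N a) : ZLevel N a 1 = ∑' n : ℕ, (∑ g : N →ₐ[Qv F] Qalg F,
    extValue a g * val F (g ⟨θ, h.mem⟩ - θ ^ qF ^ (n + 1))) / (qF : ℝ) ^ (n + 1) := by
  classical
  rw [ZLevel, ← tsum_mul_left]
  congr 1
  ext n
  rw [finsum_eq_sum_of_fintype, mul_sum, Finset.sum_div, ← Equiv.sum_comp (autEquivEmb (N := N))]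
  refine sum_congr rfl fun g _ => ?_
  rw [finsum_eq_if, ← h.ite_actsAsFrob n.succ_ne_zero g, atLevel_eq ha, mul_one, Real.rpow_natCast]
  split_ifs with hg
  · ring
  · ring

/-- At a finite Galois level, `Z_v(a, 1) - μ_{Art,v}(a)` is a `periodSum`. -/
theorem exists_periodSum_eq {a : GQ F → ℚ} (ha : IsConstMod N a) :
    ∃ (α π θ : Qalg F) (h : IsGood N α π θ), ZLevel N a 1 - muArtLevel N a =
    periodSum N ⟨θ, h.mem⟩ (extValue a) := by
  obtain ⟨α, hα⟩ := exists_isTeich N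
  let h : IsGood N α ((ι[N] (LocSht.unif N) : N) : Qalg F) _ := ⟨hα, isUnif_unif, rfl⟩
  exact ⟨_, _, _, h, by rw [h.ZLevel_eq ha, h.muArtLevel_eq ha, sub_neg_eq_add]; rfl⟩

end galois

section embeddings
variable {L : ExtQ} [FD[L]] [Sep[L]]
variable {E : Type v} [CommRing E] [Algebra (Qv F) E]

theorem pullBack_apply {η : L →ₐ[Qv F] Qalg F} {χ : E →ₐ[Qv F] Qalg F} [Nonempty (E →ₐ[Qv F] L)]
    (h : ∃ ψ' : E →ₐ[Qv F] L, η.comp ψ' = χ) : η.comp (pullBack η χ) = χ :=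
  Function.invFun_eq h

theorem pullBack_comp (η : L →ₐ[Qv F] Qalg F) (ψ' : E →ₐ[Qv F] L) [Nonempty (E →ₐ[Qv F] L)] :
    pullBack η (η.comp ψ') = ψ' := by
  refine Function.leftInverse_invFun (f := fun ψ' : E →ₐ[Qv F] L => η.comp ψ') (fun a b hab => ?_) ψ'
  ext x
  exact congrArg Subtype.val (η.injective (DFunLike.congr_fun hab x))

section
variable {K : ExtQ} [FD[K]] [Sep[K]] {α π ϑ : Qalg F}

theorem IsGood.summable_periodSum (h : IsGood K α π ϑ) (c : (K →ₐ[Qv F] Qalg F) → ℝ) :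
    Summable fun n :
    ℕ => (∑ φ, c φ * val F (φ ⟨ϑ, h.mem⟩ - ϑ ^ qF ^ (n + 1))) / (qF : ℝ) ^ (n + 1) := by
  have hq : 1 < (qF : ℝ) := by exact_mod_cast Fintype.one_lt_card
  have hval : ∀ (φ : K →ₐ[Qv F] Qalg F) (n : ℕ),
      |val F (φ ⟨ϑ, h.mem⟩ - ϑ ^ qF ^ (n + 1))| ≤ |val F π| := by
    intro φ n
    rcases (h.norm_sub_pow_le_one φ (n + 1)).lt_or_eq with hlt | heq
    · rw [val_eq_of_norm_eq (h.norm_algHom_sub_pow_of_lt φ n.succ_ne_zero hlt)]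
    · rw [val_eq_zero_of_norm_eq_one heq, abs_zero]
      exact abs_nonneg _
  refine Summable.of_norm_bounded
    (g := fun n : ℕ => (∑ φ, |c φ| * |val F π|) * ((qF : ℝ)⁻¹) ^ (n + 1)) ?_ fun n => ?_
  · refine Summable.mul_left _ ((summable_nat_add_iff 1).2
      (summable_geometric_of_lt_one (by positivity) (inv_lt_one_of_one_lt₀ hq)))
  · rw [norm_div, norm_pow, inv_pow, ← div_eq_mul_inv, Real.norm_of_nonneg (by positivity : (0 : ℝ) ≤ qF)]
    refine div_le_div_of_nonneg_right ?_ (by positivity)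
    refine (norm_sum_le _ _).trans (Finset.sum_le_sum fun φ _ => ?_)
    rw [norm_mul]
    exact mul_le_mul_of_nonneg_left (hval φ n) (norm_nonneg _)

theorem IsGood.periodSum_mul_sum (h : IsGood K α π ϑ) {ι : Type*} (s : Finset ι) (r : ℝ)
    (c : ι → (K →ₐ[Qv F] Qalg F) → ℝ) : periodSum K ⟨ϑ, h.mem⟩ (fun φ => r * ∑ i ∈ s, c i φ) = r *
    ∑ i ∈ s, periodSum K ⟨ϑ, h.mem⟩ (c i) := by
  unfold periodSum
  rw [sum_add_distrib, mul_add, ← Summable.tsum_finsetSum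
    (fun i _ => h.summable_periodSum (c i)), ← tsum_mul_left]
  congr 1
  · congr 1
    ext n
    rw [← Finset.sum_div, sum_comm, ← mul_div_assoc, mul_sum]
    congr 1
    refine sum_congr rfl fun φ _ => ?_
    rw [mul_assoc, sum_mul]
  · rw [sum_comm, mul_sum]
    refine sum_congr rfl fun φ _ => ?_
    rw [← sum_mul, Finset.sum_sub_distrib]
    ring
end

variable (d : (E →ₐ[Qv F] L) → ℤ) (ψ : E →ₐ[Qv F] L)

theorem aZero_eq [Nonempty (E →ₐ[Qv F] L)] (g : GQ F) : aZero d ψ g =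
    1 / (Nat.card (L →ₐ[Qv F] Qalg F) : ℚ) * ∑ η : L →ₐ[Qv F] Qalg F,
    (d (pullBack η (g.toAlgHom.comp (η.comp ψ))) : ℚ) :=
  congrArg _ (finsum_eq_sum_of_fintype _)

theorem exists_level_aZero : ExistsLevel (aZero d ψ) := by
  let N := IntermediateField.normalClosure (Qv F) L (Qalg F)
  have hsep : Sep[N] := by
    have : ∀ η : L →ₐ[Qv F] Qalg F, Sep[η.fieldRange] := fun η =>
      Algebra.IsSeparable.of_equiv_equiv (RingEquiv.refl _)
        (AlgEquiv.ofInjectiveField η : L ≃ₐ[Qv F] η.fieldRange).toRingEquiv (by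
          ext x
          exact congrArg Subtype.val ((AlgEquiv.ofInjectiveField η).commutes x).symm)
    exact IntermediateField.isSeparable_iSup _ _
  refine ⟨N, inferInstance, ⟨⟩, fun g h hgh => ?_⟩
  have : Nonempty (E →ₐ[Qv F] L) := ⟨ψ⟩
  rw [aZero_eq, aZero_eq]
  congr 1
  refine sum_congr rfl fun η _ => ?_
  congr 3
  ext e
  exact hgh _ (AlgHom.fieldRange_le_normalClosure η ⟨ψ e, rfl⟩)

/-- The function `a⁰` is determined by finitely many restrictions of embeddings, so that
`Z_v(a⁰, 1) - μ_{Art,v}(a⁰)` is an average of sums over embeddings of the fields `η(ψ(E))`. -/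
theorem Zv_sub_muArt_aZero [Nonempty (E →ₐ[Qv F] L)] (K : (L →ₐ[Qv F] Qalg F) → ExtQ)
    [∀ η, FD[K η]] [∀ η, Sep[K η]]
    (ρ : ∀ η, E →ₐ[Qv F] K η) (hρ : ∀ η e, ((ρ η e : K η) : Qalg F) = η (ψ e))
    (ϑ : (L →ₐ[Qv F] Qalg F) → Qalg F) (α π : (L →ₐ[Qv F] Qalg F) → Qalg F)
    (hϑ : ∀ η, IsGood (K η) (α η) (π η) (ϑ η)) : Zv (aZero d ψ) 1 - muArt (aZero d ψ) =
    1 / (Nat.card (L →ₐ[Qv F] Qalg F) : ℝ) * ∑ η,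
    periodSum (K η) ⟨ϑ η, (hϑ η).mem⟩ fun φ => (d (pullBack η (φ.comp (ρ η))) : ℝ) := by
  have hex := exists_level_aZero d ψ
  rw [Zv, muArt, dif_pos hex, dif_pos hex]
  obtain ⟨hfin, hgal, hconst⟩ := hex.choose_spec
  set N := hex.choose
  obtain ⟨α₁, π₁, θ, hθ, h1⟩ := exists_periodSum_eq hconst
  refine h1.trans ?_
  let N' : ExtQ := N ⊔ ⨆ η, K η
  have hN : N ≤ N' := le_sup_left
  have hK : ∀ η, K η ≤ N' := fun η => (le_iSup K η).trans le_sup_right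
  have : FD[(⨆ η, K η : ExtQ)] :=
    IntermediateField.finiteDimensional_iSup_of_finite
  have : FD[N'] := IntermediateField.finiteDimensional_sup _ _
  have : Sep[(⨆ η, K η : ExtQ)] := IntermediateField.isSeparable_iSup _ _
  have : Sep[N'] := IntermediateField.isSeparable_sup _ _ _ _
  obtain ⟨α₂, π₂, θ', hθ'⟩ := exists_isGood N'
  rw [← hθ.periodSum_eq hθ' hN]
  have h2 : ∀ g : N' →ₐ[Qv F] Qalg F, extValue (aZero d ψ) (g.comp (IntermediateField.inclusion hN)) =
      1 / (Nat.card (L →ₐ[Qv F] Qalg F) : ℝ) * ∑ η,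
        (d (pullBack η ((g.comp (IntermediateField.inclusion (hK η))).comp (ρ η))) : ℝ) := by
    intro g
    obtain ⟨σ, hσ⟩ := exists_aut_extends g
    rw [extValue_eq hconst (σ := σ) fun x => hσ ⟨x, hN x.2⟩]
    rw [aZero_eq]
    push_cast
    congr 1
    refine sum_congr rfl fun η _ => ?_
    congr 3
    ext e
    change σ (η (ψ e)) = g ⟨ρ η e, _⟩
    rw [← hσ]
    exact congrArg σ (hρ η e).symm
  simp only [h2]
  rw [hθ'.periodSum_mul_sum]
  congr 1
  refine sum_congr rfl fun η _ => ?_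
  exact (hϑ η).periodSum_eq hθ' (hK η) fun φ => (d (pullBack η (φ.comp (ρ η))) : ℝ)

end embeddings

/-! ### Bases of base changes -/

section BCbasis
namespace BC
variable {A B C : Type*} [CommRing A] [CommRing B] [CommRing C] (f : A →+* B) {M : Type*}
  [AddCommGroup M] [Module A M] {ι : Type*}

/-- The basis `1 ⊗ b_i` of a base change. -/
def basis (b : Basis ι A M) : Basis ι B (BC f M) :=
  (Algebra.TensorProduct.basis (Via f) b : Basis ι (Via f) (TensorProduct A (Via f) M))

@[simp] theorem basis_apply (b : Basis ι A M) (i : ι) : basis f b i = mk f (b i) :=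
  Algebra.TensorProduct.basis_apply (A := Via f) b i

theorem basis_repr_mk (b : Basis ι A M) (m : M) (i : ι) : (basis f b).repr (mk f m) i =
    f (b.repr m i) := by
  have := Algebra.TensorProduct.basis_repr_tmul (A := Via f) b (1 : Via f) m
  have h2 := DFunLike.congr_fun this i
  refine h2.trans ?_
  rw [Finsupp.smul_apply, Finsupp.mapRange_apply, one_smul]
  rfl

theorem assoc_symm_mk' (g : B →+* C) (h : A →+* C) (hh : ∀ a, h a = g (f a)) (x : BC f M) :
    (assoc f g h hh).symm (mk g x) = push f g h hh x := by
  induction x using BC.induction with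
  | h0 => simp only [map_zero]
  | hmk b m => simp only [map_smulₛₗ, assoc_symm_mk, push_mk, RingHom.id_apply]
  | hadd x y hx hy => simp only [map_add, hx, hy]

/-- The image of a basis of `B ⊗ M` in `C ⊗ M`. -/
def pushBasis (g : B →+* C) (h : A →+* C) (hh : ∀ a, h a = g (f a)) (b : Basis ι B (BC f M)) :
    Basis ι C (BC h M) :=
  (basis g b).map (assoc f g h hh).symm

@[simp] theorem pushBasis_apply (g : B →+* C) (h : A →+* C) (hh : ∀ a, h a = g (f a))
    (b : Basis ι B (BC f M)) (i : ι) : pushBasis f g h hh b i = push f g h hh (b i) := by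
  rw [pushBasis, Basis.map_apply, basis_apply, assoc_symm_mk']

theorem pushBasis_repr (g : B →+* C) (h : A →+* C) (hh : ∀ a, h a = g (f a))
    (b : Basis ι B (BC f M)) (x : BC f M) (i : ι) :
    (pushBasis f g h hh b).repr (push f g h hh x) i = g (b.repr x i) := by
  rw [pushBasis, Basis.map_repr, LinearEquiv.symm_symm, LinearEquiv.trans_apply, ← assoc_symm_mk',
    LinearEquiv.apply_symm_apply, basis_repr_mk]

theorem push_injective (g : B →+* C) (hg : Injective g) (h : A →+* C)
    (hh : ∀ a, h a = g (f a)) (b : Basis ι B (BC f M)) :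
    Injective (push (M := M) f g h hh) := by
  intro x y hxy
  apply b.repr.injective
  ext i
  apply hg
  rw [← pushBasis_repr f g h hh b, hxy, pushBasis_repr]

theorem push_push {D : Type*} [CommRing D] (g : B →+* C) (h : A →+* C) (hh : ∀ a, h a = g (f a))
    (k : C →+* D) (l : A →+* D) (hl : ∀ a, l a = k (h a)) (m : B →+* D) (hm : ∀ a, m a = k (g a))
    (x : BC f M) : push h k l hl (push f g h hh x) =
      push f m l (fun a => by rw [hl, hh, hm]) x := by
  induction x using BC.induction with
  | h0 => simp only [map_zero]
  | hmk b m => simp only [map_smulₛₗ, push_mk, hm]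
  | hadd x y hx hy => simp only [map_add, hx, hy]

variable {M' : Type*} [AddCommGroup M'] [Module A M']

theorem push_map (g : B →+* C) (h : A →+* C) (hh : ∀ a, h a = g (f a)) (φ : M →ₗ[A] M')
    (x : BC f M) : push f g h hh (map f φ x) = map h φ (push f g h hh x) := by
  induction x using BC.induction with
  | h0 => simp only [map_zero]
  | hmk b m => simp only [map_smulₛₗ, push_mk, map_mk, RingHom.id_apply]
  | hadd x y hx hy => simp only [map_add, hx, hy]

end BC
end BCbasis

/-! ### The relation `τ(x) = y` between `σ̂^*M` and `M` -/

section tauRel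
variable {L : ExtQ} {M : Type w} [AddCommGroup M] [Module (RX L) M]

namespace LocalShtuka
variable (S : LocalShtuka L M)

/-- The relation `τ(x) = y` in `M[1/(z - ζ)]`, for `x ∈ σ̂^*M` and `y ∈ M`. -/
def TauRel (x : BC (sigma L) M) (y : M) : Prop :=
  S.tau (BC.push (sigma L) (loc L) ((loc L).comp (sigma L)) (fun _ => rfl) x) = BC.mk (loc L) y

variable {S}

theorem TauRel.tauB {x : BC (sigma L) M} {y : M} (h : S.TauRel x y) {B : Type*} [CommRing B]
    (g : RX L →+* B) (hg : IsUnit (g (zmz L))) :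
    S.tauB g hg (BC.push (sigma L) g (g.comp (sigma L)) (fun _ => rfl) x) = BC.mk g y := by
  have h1 : BC.assoc ((loc L).comp (sigma L)) (liftLoc g hg) (g.comp (sigma L))
      (fun a => liftLoc_loc g hg (sigma L a))
      (BC.push (sigma L) g (g.comp (sigma L)) (fun _ => rfl) x) =
      BC.mk _ (BC.push (sigma L) (loc L) ((loc L).comp (sigma L)) (fun _ => rfl) x) := by
    rw [← LinearEquiv.eq_symm_apply, BC.assoc_symm_mk',
      BC.push_push _ _ _ _ _ _ _ g (liftLoc_loc g hg)]
  rw [LocalShtuka.tauB, LinearEquiv.trans_apply, LinearEquiv.trans_apply, h1, BC.congr_mk, h,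
    BC.assoc_symm_mk]

theorem TauRel.add {x x' : BC (sigma L) M} {y y' : M} (h : S.TauRel x y) (h' : S.TauRel x' y') :
    S.TauRel (x + x') (y + y') := by
  unfold TauRel at *
  rw [map_add, map_add, map_add, h, h']

theorem TauRel.smul {x : BC (sigma L) M} {y : M} (h : S.TauRel x y) (a : RX L) :
    S.TauRel (a • x) (a • y) := by
  unfold TauRel at *
  rw [map_smulₛₗ, map_smul, map_smulₛₗ (BC.mk (loc L)), h]

theorem TauRel.zero : S.TauRel 0 0 := by
  unfold TauRel
  simp only [map_zero]

theorem TauRel.map {E : Type v} [CommRing E] [Algebra (Av F) E] (A : OEAction S E)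
    {x : BC (sigma L) M} {y : M} (h : S.TauRel x y) (a : 𝓞v[E]) :
    S.TauRel (BC.map _ (A.act a) x) (A.act a y) := by
  unfold TauRel at *
  rw [BC.push_map, A.tau_comm, h, BC.map_mk]

/-- Every element of `M[1/(z - ζ)]` becomes an element of `M` after multiplication by a power of
`z - ζ`. -/
theorem exists_zmz_pow_smul {P : Type*} [AddCommGroup P] [Module (RX L) P] (y : BC (loc L) P) :
    ∃ (N : ℕ) (p : P), loc L (zmz L ^ N) • y = BC.mk (loc L) p := by
  induction y using BC.induction with
  | h0 => exact ⟨0, 0, by rw [smul_zero, map_zero]⟩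
  | hmk b m =>
    obtain ⟨N, a, ha⟩ := IsLocalization.Away.surj (zmz L) b
    refine ⟨N, a • m, ?_⟩
    rw [map_smulₛₗ, smul_smul, mul_comm, map_pow]
    congr 1
  | hadd x y hx hy =>
    obtain ⟨N, p, hp⟩ := hx
    obtain ⟨N', p', hp'⟩ := hy
    refine ⟨N + N', zmz L ^ N' • p + zmz L ^ N • p', ?_⟩
    rw [map_add, map_smulₛₗ, map_smulₛₗ, ← hp, ← hp', smul_smul, smul_smul, ← map_mul, ← map_mul,
      smul_add, ← pow_add, ← pow_add, add_comm N' N]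

variable (S)

/-- `τ` maps `(z - ζ)^N σ̂^*M` into `M` for large `N`. -/
theorem exists_tauRel_left : ∃ N : ℕ, ∀ x : BC (sigma L) M, ∃ y, S.TauRel (zmz L ^ N • x) y := by
  have := S.free
  have := S.finite
  have := BC.finite (sigma L) M
  obtain ⟨n, s, hs⟩ := Module.Finite.exists_fin (R := RX L) (M := BC (sigma L) M)
  choose N p hp using fun i => exists_zmz_pow_smul
    (S.tau (BC.push (sigma L) (loc L) ((loc L).comp (sigma L)) (fun _ => rfl) (s i)))
  refine ⟨∑ i, N i, fun x => ?_⟩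
  have hx : x ∈ span (RX L) (Set.range s) := by rw [hs]; trivial
  induction hx using Submodule.span_induction with
  | mem x hx =>
    obtain ⟨i, rfl⟩ := hx
    obtain ⟨k, hk⟩ := Nat.exists_eq_add_of_le
      (Finset.single_le_sum (f := N) (fun _ _ => Nat.zero_le _) (mem_univ i))
    have h1 : S.TauRel (zmz L ^ N i • s i) (p i) := by
      unfold TauRel
      rw [map_smulₛₗ, map_smul, hp]
    refine ⟨zmz L ^ k • p i, ?_⟩
    rw [hk, add_comm, pow_add, mul_smul]
    exact h1.smul _
  | zero => exact ⟨0, by rw [smul_zero]; exact TauRel.zero⟩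
  | add x x' _ _ hx hx' =>
    obtain ⟨y, hy⟩ := hx
    obtain ⟨y', hy'⟩ := hx'
    exact ⟨y + y', by rw [smul_add]; exact hy.add hy'⟩
  | smul a x _ hx =>
    obtain ⟨y, hy⟩ := hx
    exact ⟨a • y, by rw [smul_comm]; exact hy.smul a⟩

/-- `τ(σ̂^*M)` contains `(z - ζ)^N M` for large `N`. -/
theorem exists_tauRel_right : ∃ N : ℕ, ∀ y : M, ∃ x, S.TauRel x (zmz L ^ N • y) := by
  have := S.free
  have := S.finite
  obtain ⟨n, s, hs⟩ := Module.Finite.exists_fin (R := RX L) (M := M)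
  let e := BC.assoc (M := M) (sigma L) (loc L) ((loc L).comp (sigma L)) (fun _ => rfl)
  choose N p hp using fun i => exists_zmz_pow_smul
    (e (S.tau.symm (BC.mk (loc L) (s i))))
  refine ⟨∑ i, N i, fun x => ?_⟩
  have hx : x ∈ span (RX L) (Set.range s) := by rw [hs]; trivial
  induction hx using Submodule.span_induction with
  | mem x hx =>
    obtain ⟨i, rfl⟩ := hx
    obtain ⟨k, hk⟩ := Nat.exists_eq_add_of_le
      (Finset.single_le_sum (f := N) (fun _ _ => Nat.zero_le _) (mem_univ i))
    have h1 : S.TauRel (p i) (zmz L ^ N i • s i) := by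
      unfold TauRel
      rw [← BC.assoc_symm_mk' (sigma L) (loc L) ((loc L).comp (sigma L)) (fun _ => rfl), ← hp,
        map_smul, LinearEquiv.symm_apply_apply, map_smul, LinearEquiv.apply_symm_apply,
        map_smulₛₗ]
    refine ⟨zmz L ^ k • p i, ?_⟩
    rw [hk, add_comm, pow_add, mul_smul]
    exact h1.smul _
  | zero => exact ⟨0, by rw [smul_zero]; exact TauRel.zero⟩
  | add x x' _ _ hx hx' =>
    obtain ⟨y, hy⟩ := hx
    obtain ⟨y', hy'⟩ := hx'
    exact ⟨y + y', by rw [smul_add]; exact hy.add hy'⟩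
  | smul a x _ hx =>
    obtain ⟨y, hy⟩ := hx
    exact ⟨a • y, by rw [smul_comm]; exact hy.smul a⟩

end LocalShtuka
end tauRel

/-! ### Lang's theorem over `k⟦z⟧` -/

section Lang
variable {k : Type v} [Field k] [Algebra (Av F) k]

variable (F k) in
theorem card_cast_eq_zero : (qF : k) = 0 := by
  have h : (qF : F) = 0 := FiniteField.cast_card_eq_zero F
  have := congrArg ((algebraMap (Av F) k).comp PowerSeries.C) h
  rwa [map_natCast, map_zero] at this

variable (F k) in
theorem derivative_X_pow_card : derivative (X ^ qF : k[X]) = 0 := by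
  rw [Polynomial.derivative_X_pow, card_cast_eq_zero F k, C_0, zero_mul]

/-- The polynomials `f_i(Y) = f_{i-1}(Y) ^ q + a_i Y ^ q`, which express the `i`-th coordinate of a
`φ`-fixed vector in a cyclic subspace through its last coordinate. -/
def cyclicPoly (F : Type u) [Fintype F] (a : ℕ → k) : ℕ → k[X]
  | 0 => C (a 0) * X ^ qF
  | i + 1 => cyclicPoly F a i ^ qF + C (a (i + 1)) * X ^ qF

theorem derivative_cyclicPoly (a : ℕ → k) (i : ℕ) : derivative (cyclicPoly F a i) = 0 := by
  have hX := derivative_X_pow_card F k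
  cases i with
  | zero => rw [cyclicPoly, Polynomial.derivative_C_mul, hX, mul_zero]
  | succ i =>
    rw [cyclicPoly, Polynomial.derivative_add, Polynomial.derivative_C_mul, hX, mul_zero, add_zero,
      Polynomial.derivative_pow, card_cast_eq_zero F k, C_0, zero_mul, zero_mul]

theorem cyclicPoly_natDegree (a : ℕ → k) (i : ℕ) :
    (cyclicPoly F a i = 0 ∨ qF ≤ (cyclicPoly F a i).natDegree) ∧
    (cyclicPoly F a i = 0 → ∀ j ≤ i, a j = 0) := by
  have hq : 1 < qF := Fintype.one_lt_card
  have mono : ∀ c : k, c ≠ 0 → (C c * X ^ qF).natDegree =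
      qF := fun c hc => Polynomial.natDegree_C_mul_X_pow _ _ hc
  induction i with
  | zero =>
    by_cases h : a 0 = 0
    · refine ⟨Or.inl (by simp [cyclicPoly, h]), fun _ j hj => ?_⟩
      obtain rfl : j = 0 := by omega
      exact h
    · have := mono _ h
      refine ⟨Or.inr this.ge, fun h0 => ?_⟩
      rw [cyclicPoly] at h0
      rw [h0, Polynomial.natDegree_zero] at this
      omega
  | succ i ih =>
    rcases eq_or_ne (cyclicPoly F a i) 0 with h0 | h0
    · have e : cyclicPoly F a (i + 1) = C (a (i + 1)) * X ^ qF := by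
        rw [cyclicPoly, h0, zero_pow (by omega), zero_add]
      rw [e]
      by_cases h : a (i + 1) = 0
      · refine ⟨Or.inl (by simp [h]), fun _ j hj => ?_⟩
        rcases Nat.le_succ_iff.1 hj with hj | rfl
        · exact ih.2 h0 j hj
        · exact h
      · have := mono _ h
        refine ⟨Or.inr this.ge, fun h1 => ?_⟩
        rw [h1, Polynomial.natDegree_zero] at this
        omega
    · have h1 := ih.1.resolve_left h0
      have h2 : (C (a (i + 1)) * X ^ qF).natDegree <
          (cyclicPoly F a i ^ qF).natDegree := by
        rw [Polynomial.natDegree_pow]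
        refine lt_of_le_of_lt (Polynomial.natDegree_C_mul_X_pow_le _ _) ?_
        nlinarith
      have h3 : (cyclicPoly F a (i + 1)).natDegree = (cyclicPoly F a i ^ qF).natDegree := by
        rw [cyclicPoly, Polynomial.natDegree_add_eq_left_of_natDegree_lt h2]
      rw [Polynomial.natDegree_pow] at h3
      have h4 : qF ≤ (cyclicPoly F a (i + 1)).natDegree := by
        rw [h3]; nlinarith
      refine ⟨Or.inr h4, fun h5 => ?_⟩
      rw [h5, Polynomial.natDegree_zero] at h4
      omega

variable [IsSepClosed k]

theorem exists_ne_zero_eval_eq (f : k[X]) (hf : derivative f = 0) (hd : 2 ≤ f.natDegree) : ∃ y : k,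
    y ≠ 0 ∧ f.eval y = y := by
  have hs : (f - X).Separable := by
    rw [Polynomial.separable_def, Polynomial.derivative_sub, hf, Polynomial.derivative_X, zero_sub]
    exact isCoprime_one_right.neg_right
  have hdeg : (f - X).natDegree = f.natDegree :=
    Polynomial.natDegree_sub_eq_left_of_natDegree_lt (by rw [Polynomial.natDegree_X]; omega)
  have hsp := IsSepClosed.splits_of_separable _ hs
  have hc := hsp.natDegree_eq_card_roots
  classical
  by_contra! hcon
  have hsub : (f - X).roots.toFinset ⊆ {0} := by
    intro y hy
    rw [Multiset.mem_toFinset, Polynomial.mem_roots'] at hy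
    by_contra h0
    refine hcon y (by simpa using h0) ?_
    have := hy.2
    rw [IsRoot.def, eval_sub, eval_X, sub_eq_zero] at this
    exact this
  have := Finset.card_le_card hsub
  rw [Multiset.toFinset_card_of_nodup (Polynomial.nodup_roots hs), ← hc, hdeg,
    Finset.card_singleton] at this
  omega

variable (F) in
theorem exists_sub_frob_eq (c : k) : ∃ y : k, y - frob (F := F) k y = c := by
  have hq : 1 < qF := Fintype.one_lt_card
  let f : k[X] := X ^ qF - (X - C c)
  have hd : f.natDegree = qF := by
    rw [Polynomial.natDegree_sub_eq_left_of_natDegree_lt] <;>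
      simp only [Polynomial.natDegree_X_pow, Polynomial.natDegree_X_sub_C, hq]
  have hs : f.Separable := by
    rw [Polynomial.separable_def]
    have : derivative f = -1 := by
      simp only [f, Polynomial.derivative_sub, derivative_X_pow_card F k, Polynomial.derivative_X,
        Polynomial.derivative_C]
      ring
    rw [this]
    exact isCoprime_one_right.neg_right
  obtain ⟨y, hy⟩ := IsSepClosed.exists_root f (by
    intro h
    have : f.natDegree = 0 := Polynomial.natDegree_eq_zero_iff_degree_le_zero.2 h.le
    omega) hs
  refine ⟨y, ?_⟩
  rw [IsRoot.def] at hy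
  simp only [f, eval_sub, eval_pow, eval_X, eval_C] at hy
  rw [frob_apply]
  linear_combination -hy

section semilinear
variable {V : Type w} [AddCommGroup V] [Module k V]

theorem semilinear_ne_zero [FiniteDimensional k V] (φ : V →ₛₗ[frob (F := F) k] V)
    (hφ : span k (Set.range φ) = ⊤) {v : V} (hv : v ≠ 0) : φ v ≠ 0 := by
  intro h0
  have hli : LinearIndepOn k id {v} := LinearIndepOn.singleton hv
  let b := Basis.extend hli
  have hvm : v ∈ hli.extend (Set.subset_univ _) := hli.subset_extend _ rfl
  have := FiniteDimensional.fintypeBasisIndex b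
  have hsp : ⊤ ≤ span k (Set.range (φ ∘ b)) := by
    rw [← hφ, span_le]
    rintro _ ⟨x, rfl⟩
    rw [← b.sum_repr x, map_sum]
    refine Submodule.sum_mem _ fun i _ => ?_
    rw [map_smulₛₗ]
    exact Submodule.smul_mem _ _ (subset_span ⟨i, rfl⟩)
  have hli2 : LinearIndependent k (φ ∘ b) :=
    linearIndependent_of_top_le_span_of_card_eq_finrank hsp (Module.finrank_eq_card_basis b).symm
  have := hli2.ne_zero ⟨v, hvm⟩
  rw [Function.comp_apply, Basis.extend_apply_self] at this
  exact this h0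

/-- On a cyclic subspace, the fixed vectors are given by the roots of a separable polynomial of degree
greater than one in the last coordinate, so one of them is nonzero. -/
theorem exists_fixed_ne_zero [FiniteDimensional k V] [Nontrivial V]
    (φ : V →ₛₗ[frob (F := F) k] V) (hφ : span k (Set.range φ) = ⊤) :
    ∃ w : V, w ≠ 0 ∧ φ w = w := by
  classical
  obtain ⟨v, hv⟩ := exists_ne (0 : V)
  have hex : ∃ n, ¬ LinearIndependent k (fun i : Fin (n + 1) => φ^[i] v) := by
    refine ⟨finrank k V, fun h => ?_⟩
    have := h.fintype_card_le_finrank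
    simp at this
  obtain ⟨n, hn, hmin⟩ : ∃ n, ¬ LinearIndependent k (fun i : Fin (n + 1) => φ^[i] v) ∧
      LinearIndependent k (fun i : Fin n => φ^[i] v) := by
    refine ⟨Nat.find hex, Nat.find_spec hex, ?_⟩
    rcases h : Nat.find hex with _ | m
    · exact linearIndependent_empty_type
    · by_contra hcon
      exact Nat.find_min hex (m := m) (by omega) hcon
  have hmem : φ^[n] v ∈ span k (Set.range fun i : Fin n => φ^[i] v) := by
    by_contra hcon
    apply hn
    have := linearIndependent_finSnoc.2 ⟨hmin, hcon⟩
    convert this using 1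
    ext i
    induction i using Fin.lastCases with
    | last => simp
    | cast i => simp
  obtain ⟨c, hc⟩ := (Submodule.mem_span_range_iff_exists_fun k).1 hmem
  have hn0 : n ≠ 0 := by
    rintro rfl
    simp at hmem
    exact hv hmem
  obtain ⟨m, rfl⟩ := Nat.exists_eq_succ_of_ne_zero hn0
  have hφn : ∀ i, φ^[i] v ≠ 0 := by
    intro i
    induction i with
    | zero => exact hv
    | succ i ih =>
      rw [Function.iterate_succ_apply']
      exact semilinear_ne_zero φ hφ ih
  let a : ℕ → k := fun i => if h : i < m + 1 then c ⟨i, h⟩ else 0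
  have ha : φ^[m + 1] v = ∑ i ∈ range (m + 1), a i • φ^[i] v := by
    rw [← hc, sum_range]
    refine sum_congr rfl fun i _ => ?_
    simp only [a, dif_pos i.2]
  have hq : 1 < qF := Fintype.one_lt_card
  have hdeg : 2 ≤ (cyclicPoly F a m).natDegree := by
    obtain ⟨h1, h2⟩ := cyclicPoly_natDegree (F := F) a m
    refine le_trans hq (h1.resolve_left fun h0 => hφn (m + 1) ?_)
    rw [ha]
    refine Finset.sum_eq_zero fun i hi => ?_
    rw [h2 h0 i (by simpa [Nat.lt_succ_iff] using hi), zero_smul]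
  obtain ⟨y, hy0, hy⟩ := exists_ne_zero_eval_eq _ (derivative_cyclicPoly a m) hdeg
  let x : ℕ → k := fun i => (cyclicPoly F a i).eval y
  have hx0 : x 0 = a 0 * y ^ qF := by simp [x, cyclicPoly]
  have hxs : ∀ i, x (i + 1) = x i ^ qF + a (i + 1) * y ^ qF := by
    intro i; simp [x, cyclicPoly]
  have hxm : x m = y := hy
  refine ⟨∑ i ∈ range (m + 1), x i • φ^[i] v, fun h0 => ?_, ?_⟩
  · rw [sum_range] at h0
    have := Fintype.linearIndependent_iff.1 hmin (fun i => x i) h0 (Fin.last m)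
    rw [Fin.val_last, hxm] at this
    exact hy0 this
  · rw [map_sum]
    simp only [map_smulₛₗ, frob_apply, ← Function.iterate_succ_apply' φ]
    rw [Finset.sum_range_succ, hxm, ha, smul_sum, Finset.sum_range_succ',
      Finset.sum_range_succ' (fun i => x i • φ^[i] v), ← add_assoc, ← sum_add_distrib, hx0]
    congr 1
    · refine sum_congr rfl fun i _ => ?_
      rw [hxs, add_smul, smul_smul, mul_comm (a (i + 1))]
    · rw [smul_smul, mul_comm]

/-- **Lang's theorem**: a finite dimensional space over a separably closed field is spanned by the
fixed vectors of any Frobenius-semilinear endomorphism whose linearization is bijective. -/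
theorem span_fixed_eq_top : ∀ (n : ℕ) {V : Type w} [AddCommGroup V] [Module k V]
    [FiniteDimensional k V] (_ : finrank k V = n) (φ : V →ₛₗ[frob (F := F) k] V)
    (_ : span k (Set.range φ) = ⊤), span k {v | φ v = v} = ⊤ := by
  intro n
  induction n with
  | zero =>
    intro V _ _ _ hV φ _
    have := Module.finrank_zero_iff.1 hV
    exact Subsingleton.elim _ _
  | succ n ih =>
    intro V _ _ _ hV φ hφ
    have : Nontrivial V := Module.nontrivial_of_finrank_pos (R := k) (by omega)
    obtain ⟨w, hw0, hw⟩ := exists_fixed_ne_zero φ hφ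
    let W := span k {w}
    have hW : W ≤ W.comap φ := by
      rw [span_le, Set.singleton_subset_iff]
      change φ w ∈ W
      rw [hw]
      exact mem_span_singleton_self w
    let φ' : V ⧸ W →ₛₗ[frob (F := F) k] V ⧸ W := W.mapQ W φ hW
    have hφ' : span k (Set.range φ') = ⊤ := by
      have h1 : (Set.range φ') = W.mkQ '' Set.range φ := by
        ext x
        constructor
        · rintro ⟨y, rfl⟩
          obtain ⟨y, rfl⟩ := W.mkQ_surjective y
          exact ⟨φ y, ⟨y, rfl⟩, rfl⟩
        · rintro ⟨_, ⟨y, rfl⟩, rfl⟩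
          exact ⟨W.mkQ y, rfl⟩
      rw [h1, Submodule.span_image, hφ, Submodule.map_top, Submodule.range_mkQ]
    have hfr : finrank k (V ⧸ W) = n := by
      have := Submodule.finrank_quotient_add_finrank W
      rw [finrank_span_singleton hw0] at this
      omega
    have key := ih hfr φ' hφ'
    have hlift : ∀ x : V ⧸ W, φ' x = x → ∃ v, φ v = v ∧ W.mkQ v = x := by
      intro x hx
      obtain ⟨v, rfl⟩ := W.mkQ_surjective x
      have h1 : φ v - v ∈ W := (Submodule.Quotient.eq W).1 hx
      obtain ⟨c, hc⟩ := mem_span_singleton.1 h1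
      obtain ⟨y, hy⟩ := exists_sub_frob_eq F c
      refine ⟨v + y • w, ?_, ?_⟩
      · rw [map_add, map_smulₛₗ, hw, ← sub_eq_zero]
        have : φ v = v + c • w := by rw [hc]; abel
        rw [this, ← hy, sub_smul]
        abel
      · rw [map_add, add_eq_left]
        exact (Submodule.Quotient.mk_eq_zero W).2
          (W.smul_mem _ (mem_span_singleton_self w))
    rw [eq_top_iff]
    intro v _
    have hv : W.mkQ v ∈ Submodule.map W.mkQ (span k {v | φ v = v}) := by
      have : (⊤ : Submodule k (V ⧸ W)) ≤ Submodule.map W.mkQ (span k {v | φ v = v}) := by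
        rw [← key, span_le]
        intro x hx
        obtain ⟨v, hv, rfl⟩ := hlift x hx
        exact ⟨v, subset_span hv, rfl⟩
      exact this trivial
    obtain ⟨v', hv', he⟩ := hv
    have h1 : v - v' ∈ W := (Submodule.Quotient.eq W).1 he.symm
    have h2 : W ≤ span k {v | φ v = v} := Submodule.span_mono (Set.singleton_subset_iff.2 hw)
    have := Submodule.add_mem _ (h2 h1) hv'
    rwa [sub_add_cancel] at this

theorem exists_sub_semilinear_eq [FiniteDimensional k V] (φ : V →ₛₗ[frob (F := F) k] V)
    (hφ : span k (Set.range φ) = ⊤) (c : V) : ∃ v, v - φ v = c := by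
  have hc : c ∈ span k {v | φ v = v} := by
    rw [span_fixed_eq_top _ rfl φ hφ]
    trivial
  obtain ⟨n, a, g, rfl⟩ := Submodule.mem_span_set'.1 hc
  choose y hy using fun i => exists_sub_frob_eq F (a i)
  refine ⟨∑ i, y i • (g i : V), ?_⟩
  rw [map_sum, ← Finset.sum_sub_distrib]
  refine sum_congr rfl fun i _ => ?_
  rw [map_smulₛₗ, (g i).2, ← sub_smul, hy]

end semilinear
section matrix
variable {ι : Type w} [Fintype ι] [DecidableEq ι]

/-- The semilinear endomorphism `v ↦ C σ(v)` of `k^ι`. -/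
def frobMulVec (F : Type u) [Field F] [Fintype F] [Algebra (Av F) k] (C : Matrix ι ι k) :
    (ι → k) →ₛₗ[frob (F := F) k] (ι → k) where
  toFun v := C.mulVec fun i => frob (F := F) k (v i)
  map_add' v w := by
    rw [← Matrix.mulVec_add]
    congr 1
    ext i
    simp
  map_smul' a v := by
    rw [← Matrix.mulVec_smul]
    congr 1
    ext i
    simp

theorem span_range_frobMulVec {C : Matrix ι ι k} (hC : IsUnit C.det) :
    span k (Set.range (frobMulVec F C)) = ⊤ := by
  rw [eq_top_iff]
  intro v _
  have hv : v = C.mulVec (C⁻¹.mulVec v) := by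
    rw [Matrix.mulVec_mulVec, Matrix.mul_nonsing_inv _ hC, Matrix.one_mulVec]
  have h1 : ∀ i, C.mulVec (Pi.single i 1) = frobMulVec F C (Pi.single i 1) := by
    intro i
    change _ = C.mulVec fun j => frob (F := F) k ((Pi.single i 1 : ι → k) j)
    congr 1
    ext j
    rcases eq_or_ne j i with rfl | h
    · simp
    · simp [h]
  rw [hv, pi_eq_sum_univ' (C⁻¹.mulVec v), Matrix.mulVec_sum]
  refine Submodule.sum_mem _ fun i _ => ?_
  rw [Matrix.mulVec_smul, h1]
  exact Submodule.smul_mem _ _ (subset_span ⟨_, rfl⟩)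

/-- The coefficients of a `σ̂`-fixed vector with given constant coefficient. -/
theorem exists_fixed_lift (C : Matrix ι ι k⟦X⟧)
    (hC : IsUnit (C.map constantCoeff).det) (v : ι → k)
    (hv : frobMulVec F (C.map constantCoeff) v = v) :
    ∃ w : ι → k⟦X⟧, (∀ i, constantCoeff (w i) = v i) ∧
      (C.mulVec fun i => PowerSeries.map (frob (F := F) k) (w i)) = w := by
  classical
  let φ := frobMulVec F (C.map constantCoeff)
  choose s hs using exists_sub_semilinear_eq φ (span_range_frobMulVec hC)
  -- the contribution of the lower coefficients to the `m`-th coefficient of `C σ̂(w)`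
  let rhs : (m : ℕ) → (∀ l < m, ι → k) → ι → k := fun m x i =>
    ∑ p ∈ HasAntidiagonal.antidiagonal m, if h : p.2 < m then
      ∑ j, coeff p.1 (C i j) * frob (F := F) k (x p.2 h j) else 0
  let x : ℕ → ι → k := fun m => Nat.strongRec (motive := fun _ => ι → k)
    (fun m x => if m = 0 then v else s (rhs m x)) m
  have hx : ∀ m, x m = if m = 0 then v else s (rhs m fun l _ => x l) := by
    intro m
    simp only [x]
    rw [Nat.strongRec]
  refine ⟨fun i => PowerSeries.mk fun m => x m i, fun i => ?_, ?_⟩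
  · rw [← coeff_zero_eq_constantCoeff_apply, coeff_mk, hx, if_pos rfl]
  · ext i m
    rw [coeff_mk]
    change coeff m (∑ j, C i j * PowerSeries.map (frob (F := F) k) _) = _
    simp only [map_sum, coeff_mul, PowerSeries.coeff_map, coeff_mk]
    rw [sum_comm]
    have e0 : ∑ j, coeff 0 (C i j) * frob (F := F) k (x m j) = φ (x m) i := by
      simp only [coeff_zero_eq_constantCoeff_apply]
      rfl
    rw [← add_sum_erase _ _ (HasAntidiagonal.mem_antidiagonal.2 (zero_add m) :
      ((0, m) : ℕ × ℕ) ∈ _), e0]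
    rcases eq_or_ne m 0 with rfl | hm
    · have h2 : φ (x 0) = x 0 := by rw [hx, if_pos rfl, hv]
      rw [h2]
      simp
    · have h2 : x m - φ (x m) = rhs m fun l _ => x l := by
        conv_lhs => rw [hx, if_neg hm]
        exact hs _
      have h3 := congrFun h2 i
      rw [Pi.sub_apply, sub_eq_iff_eq_add'] at h3
      rw [h3]
      congr 1
      simp only [rhs]
      rw [← add_sum_erase _ _ (HasAntidiagonal.mem_antidiagonal.2 (zero_add m) :
          ((0, m) : ℕ × ℕ) ∈ _), dif_neg (lt_irrefl m), zero_add]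
      refine sum_congr rfl fun p hp => ?_
      rw [mem_erase, HasAntidiagonal.mem_antidiagonal] at hp
      rw [dif_pos]
      have : p.1 ≠ 0 := fun h => hp.1 (by ext <;> simp <;> omega)
      omega

/-- **Lang's theorem** over `k⟦z⟧`: every `C ∈ GL_n(k⟦z⟧)` is of the form `B σ̂(B)⁻¹`. -/
theorem exists_mul_map_eq (C : Matrix ι ι k⟦X⟧) (hC : IsUnit C.det) :
    ∃ B : Matrix ι ι k⟦X⟧, IsUnit B.det ∧ C * B.map (PowerSeries.map (frob (F := F) k)) = B := by
  have hC0 : IsUnit (C.map constantCoeff).det := by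
    rw [← RingHom.mapMatrix_apply, ← RingHom.map_det]
    exact hC.map _
  have hsp := span_fixed_eq_top _ rfl _ (span_range_frobMulVec (F := F) hC0)
  obtain ⟨b, hb⟩ : ∃ b : Basis ι k (ι → k), ∀ i,
      frobMulVec F (C.map constantCoeff) (b i) = b i := by
    let b0 := Basis.ofSpan hsp.ge
    have e := b0.indexEquiv (Pi.basisFun k ι)
    refine ⟨b0.reindex e, fun i => ?_⟩
    rw [Basis.reindex_apply]
    exact Basis.ofSpan_subset hsp.ge ⟨_, rfl⟩
  choose w hw0 hw using fun i => exists_fixed_lift C hC0 (b i) (hb i)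
  refine ⟨Matrix.of fun i j => w j i, ?_, ?_⟩
  · rw [isUnit_iff_constantCoeff, RingHom.map_det, RingHom.mapMatrix_apply]
    have : (Matrix.of fun i j => w j i).map constantCoeff = (Pi.basisFun k ι).toMatrix b := by
      ext i j
      simp [hw0, Basis.toMatrix_apply]
    rw [this]
    have h2 := (Pi.basisFun k ι).toMatrix_mul_toMatrix_flip b
    exact (Matrix.isUnit_iff_isUnit_det _).1 (IsUnit.of_mul_eq_one _ h2)
  · ext1 i j
    exact congrFun (hw j) i

end matrix
end Lang

/-! ### The period matrix of a local shtuka -/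

namespace BC
variable {A B C : Type*} [CommRing A] [CommRing B] [CommRing C] (f : A →+* B) {M : Type*}
  [AddCommGroup M] [Module A M] {ι : Type*}

theorem basis_repr_push (g : B →+* C) (h : A →+* C) (hh : ∀ a, h a = g (f a)) (b : Basis ι A M)
    (x : BC f M) (i : ι) : (basis h b).repr (push f g h hh x) i = g ((basis f b).repr x i) := by
  have : pushBasis f g h hh (basis f b) = basis h b := by
    apply Basis.eq_of_apply_eq
    intro i
    rw [pushBasis_apply, basis_apply, basis_apply, push_mk]
  rw [← this, pushBasis_repr]

end BC

section convergence
variable {K : Type*} [NormedField K] [IsUltrametricDist K]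

theorem norm_coeff_X_sub_C_pow (ξ : K) (N l : ℕ) :
    ‖coeff l ((PowerSeries.X - PowerSeries.C ξ) ^ N)‖ * ‖ξ‖ ^ l ≤ ‖ξ‖ ^ N := by
  induction N generalizing l with
  | zero =>
    rw [pow_zero, pow_zero, PowerSeries.coeff_one]
    split_ifs with h
    · simp [h]
    · simp
  | succ N ih =>
    have h0 : ‖coeff l (PowerSeries.C ξ * (PowerSeries.X - PowerSeries.C ξ) ^ N)‖ *
        ‖ξ‖ ^ l ≤ ‖ξ‖ ^ (N + 1) := by
      rw [PowerSeries.coeff_C_mul, norm_mul, mul_assoc, pow_succ']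
      exact mul_le_mul_of_nonneg_left (ih l) (norm_nonneg _)
    have h1 : ‖coeff l (PowerSeries.X * (PowerSeries.X - PowerSeries.C ξ) ^ N)‖ *
        ‖ξ‖ ^ l ≤ ‖ξ‖ ^ (N + 1) := by
      cases l with
      | zero => rw [PowerSeries.coeff_zero_X_mul, norm_zero, zero_mul]; positivity
      | succ l =>
        rw [PowerSeries.coeff_succ_X_mul, pow_succ, ← mul_assoc, pow_succ]
        exact mul_le_mul_of_nonneg_right (ih l) (norm_nonneg _)
    rw [pow_succ', sub_mul, map_sub]
    rcases le_max_iff.1 (norm_sub_le_max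
      (coeff l (PowerSeries.X * (PowerSeries.X - PowerSeries.C ξ) ^ N))
      (coeff l (PowerSeries.C ξ * (PowerSeries.X - PowerSeries.C ξ) ^ N))) with h | h
    · exact (mul_le_mul_of_nonneg_right h (by positivity)).trans h1
    · exact (mul_le_mul_of_nonneg_right h (by positivity)).trans h0

/-- The growth of the coefficients of a solution of `(z - ξ)^N σ̂(w) = c w` with integral `c`. -/
theorem norm_coeff_le_of_frobenius_eq {ι : Type*} [Fintype ι] {ξ : K} (hξ0 : ξ ≠ 0) (hξ : ‖ξ‖ ≤ 1)
    {q N : ℕ} (hq : 2 ≤ q) {ρ : ℝ} (hρ : 0 < ρ) (hρq : ρ ^ q = ‖ξ‖) (w s : ι → K⟦X⟧)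
    (c : ι → ι → K⟦X⟧) (hs : ∀ i m, ‖coeff m (s i)‖ = ‖coeff m (w i)‖ ^ q)
    (hc : ∀ i j m, ‖coeff m (c i j)‖ ≤ 1)
    (h : ∀ i, (PowerSeries.X - PowerSeries.C ξ) ^ N * s i = ∑ j, c i j * w j) (m : ℕ) (i : ι) :
    ‖coeff m (w i)‖ * ρ ^ m ≤ (‖ξ‖ ^ N)⁻¹ := by
  have hξp : 0 < ‖ξ‖ := norm_pos_iff.2 hξ0
  have hρ1 : ρ ≤ 1 := by
    by_contra hcon
    exact absurd (one_lt_pow₀ (not_le.1 hcon) (by omega : q ≠ 0)) (by rw [hρq]; exact not_lt.2 hξ)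
  set κ := (‖ξ‖ ^ N)⁻¹ with hκ
  have hκ1 : 1 ≤ κ := (one_le_inv₀ (by positivity)).2 (pow_le_one₀ hξp.le hξ)
  have hκN : ‖ξ‖ ^ N * κ = 1 := mul_inv_cancel₀ (by positivity)
  induction m using Nat.strong_induction_on generalizing i with
  | _ m ih =>
  obtain ⟨i₀, -, hi₀⟩ := Finset.exists_max_image univ
    (fun i => ‖coeff m (w i)‖) ⟨i, mem_univ i⟩
  refine (mul_le_mul_of_nonneg_right (hi₀ i (mem_univ i)) (by positivity)).trans ?_
  set a := ‖coeff m (w i₀)‖ with ha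
  by_contra! hcon
  have hρm : 0 < ρ ^ m := by positivity
  have ha1 : κ < a := by
    refine hcon.trans_le (mul_le_of_le_one_right (norm_nonneg _) (pow_le_one₀ hρ.le hρ1))
  have ha0 : 0 < a := by linarith
  -- the bound `κ ρ⁻ˡ` for the coefficients of index `l ≤ m`
  have hw : ∀ l ≤ m, ∀ j, ‖coeff l (w j)‖ ≤ a := by
    intro l hl j
    rcases hl.eq_or_lt with rfl | hl
    · exact hi₀ j (mem_univ j)
    · have h1 := ih l hl j
      have h2 : ‖coeff l (w j)‖ * ρ ^ m ≤ a * ρ ^ m :=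
        (mul_le_mul_of_nonneg_left (pow_le_pow_of_le_one hρ.le hρ1 hl.le) (norm_nonneg _)).trans
          (h1.trans hcon.le)
      exact le_of_mul_le_mul_right h2 hρm
  have hR : ‖coeff m (∑ j, c i₀ j * w j)‖ ≤ a := by
    rw [map_sum]
    refine norm_sum_le_of_forall_le_of_nonneg ha0.le fun j _ => ?_
    rw [coeff_mul]
    refine norm_sum_le_of_forall_le_of_nonneg ha0.le fun p hp => ?_
    rw [HasAntidiagonal.mem_antidiagonal] at hp
    rw [norm_mul]
    exact (mul_le_of_le_one_left (norm_nonneg _) (hc _ _ _)).trans (hw _ (by omega) j)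
  rw [← h, coeff_mul, ← add_sum_erase _ _
    (HasAntidiagonal.mem_antidiagonal.2 (zero_add m) : ((0, m) : ℕ × ℕ) ∈ _)] at hR
  have hmain : ‖coeff 0 ((PowerSeries.X - PowerSeries.C ξ) ^ N) *
      coeff m (s i₀)‖ = ‖ξ‖ ^ N * a ^ q := by
    rw [norm_mul, hs, coeff_zero_eq_constantCoeff_apply, map_pow, map_sub, constantCoeff_X,
      constantCoeff_C, zero_sub, norm_pow, norm_neg]
  have hrest : ‖∑ p ∈ (HasAntidiagonal.antidiagonal m).erase (0, m),
      coeff p.1 ((PowerSeries.X - PowerSeries.C ξ) ^ N) * coeff p.2 (s i₀)‖ < ‖ξ‖ ^ N * a ^ q := by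
    refine lt_of_le_of_lt (b := ‖ξ‖ ^ N * (κ / ρ ^ m) ^ q) ?_ ?_
    · refine norm_sum_le_of_forall_le_of_nonneg (by positivity) fun p hp => ?_
      rw [mem_erase, HasAntidiagonal.mem_antidiagonal] at hp
      have hp1 : p.1 ≠ 0 := fun h => hp.1 (by ext <;> simp <;> omega)
      have h1 := ih p.2 (by omega) i₀
      have h2 := norm_coeff_X_sub_C_pow ξ N p.1
      have h3 : (ρ ^ m) ^ q = ‖ξ‖ ^ p.1 * (ρ ^ p.2) ^ q := by
        rw [← hρq, ← hp.2, pow_add, mul_pow, ← pow_mul, ← pow_mul, ← pow_mul]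
        ring
      rw [norm_mul, hs, div_pow, ← mul_div_assoc, le_div_iff₀ (by positivity), h3]
      have h4 : (‖coeff p.2 (w i₀)‖ * ρ ^ p.2) ^ q ≤ κ ^ q := pow_le_pow_left₀ (by positivity) h1 q
      calc _ = (‖coeff p.1 ((PowerSeries.X - PowerSeries.C ξ) ^ N)‖ * ‖ξ‖ ^ p.1) *
            (‖coeff p.2 (w i₀)‖ * ρ ^ p.2) ^ q := by rw [mul_pow]; ring
        _ ≤ _ := mul_le_mul h2 h4 (by positivity) (by positivity)
    · refine mul_lt_mul_of_pos_left (pow_lt_pow_left₀ ?_ (by positivity) (by omega)) (by positivity)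
      rwa [div_lt_iff₀ hρm]
  have hle : ‖ξ‖ ^ N * a ^ q ≤ a := by
    rw [← hmain] at hrest ⊢
    rwa [norm_add_eq_of_lt hrest] at hR
  have h5 : a ^ q ≤ κ * a := by
    calc a ^ q = κ * (‖ξ‖ ^ N * a ^ q) := by rw [← mul_assoc, mul_comm κ, hκN, one_mul]
      _ ≤ κ * a := mul_le_mul_of_nonneg_left hle (by positivity)
  have h6 : a * a ≤ a ^ q := by
    rw [← pow_two]
    exact pow_le_pow_right₀ (by linarith) hq
  nlinarith

end convergence

theorem exists_basis_of_mul_eq_one {ι R N : Type*} [Fintype ι] [DecidableEq ι] [CommRing R]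
    [AddCommGroup N] [Module R N] (b : Basis ι R N) {B B' : Matrix ι ι R} (h : B * B' = 1) : ∃ b' :
    Basis ι R N, ∀ j, b' j = ∑ i, B i j • b i := by
  have hB : IsUnit B.det := (Matrix.isUnit_iff_isUnit_det _).1 (IsUnit.of_mul_eq_one _ h)
  refine ⟨b.map (Matrix.toLinearEquiv b B hB), fun j => ?_⟩
  rw [Basis.map_apply]
  exact Matrix.toLin_self b b B j

theorem matrix_mul_repr_symm {ι R N N' : Type*} [Fintype ι] [DecidableEq ι] [CommRing R]
    [AddCommGroup N] [Module R N] [AddCommGroup N'] [Module R N'] (b : Basis ι R N)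
    (b' : Basis ι R N') (e : N ≃ₗ[R] N') : (Matrix.of fun i j => b'.repr (e (b j)) i) *
    (Matrix.of fun i j => b.repr (e.symm (b' j)) i) = (1 : Matrix ι ι R) := by
  have h : LinearMap.toMatrix b b' e.toLinearMap * LinearMap.toMatrix b' b e.symm.toLinearMap =
      1 := by
    rw [← LinearMap.toMatrix_comp b' b b', ← LinearMap.toMatrix_id b']
    congr 1
    ext x
    simp
  rw [← h]
  ext i j
  simp [Matrix.mul_apply, LinearMap.toMatrix_apply]

section frame
variable (L : ExtQ)

instance isDomainRL : IsDomain (RL L) := inferInstanceAs (IsDomain (integralClosure (Av F) L))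

instance isSepClosedLsep : IsSepClosed (Lsep L) := separableClosure.isSepClosure L (Qalg F) |>.1

theorem norm_RtoSep_le (r : RL L) : ‖((RtoSep L r : Lsep L) : Qalg F)‖ ≤ 1 := norm_RL_le L r

theorem toSep_zmz : toSep L (zmz L) = PowerSeries.X - PowerSeries.C (algebraMap L (Lsep L) (zetaL L)) := by
  rw [zmz, map_sub, toSep, PowerSeries.map_X, PowerSeries.map_C]
  rfl

theorem mem_SepRestr_of_frobenius_eq {ι : Type*} [Fintype ι] (N : ℕ) (w : ι → (Lsep L)⟦X⟧)
    (c : ι → ι → RX L)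
    (h : ∀ i, toSep L (zmz L) ^ N * sigmaSep L (w i) = ∑ j, toSep L (c i j) * w j) (i : ι) : w i ∈
    SepRestr L := by
  set ξ : Qalg F := (zetaL L : Qalg F) with hξdef
  have hξ1 : ‖ξ‖ < 1 := norm_zetaL_lt_one L
  have hξ0 : ξ ≠ 0 := fun h => zetaL_ne_zero L (Subtype.ext h)
  have hξp : 0 < ‖ξ‖ := norm_pos_iff.2 hξ0
  have hq : 2 ≤ qF := Fintype.one_lt_card
  set ρ : ℝ := ‖ξ‖ ^ ((qF : ℝ)⁻¹) with hρdef
  have hρ : 0 < ρ := Real.rpow_pos_of_pos hξp _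
  have hρq : ρ ^ qF = ‖ξ‖ := Real.rpow_inv_natCast_pow hξp.le (by omega)
  have hρ1 : ρ < 1 := Real.rpow_lt_one hξp.le hξ1 (by positivity)
  let j : (Lsep L)⟦X⟧ →+* (Qalg F)⟦X⟧ := PowerSeries.map (algebraMap (Lsep L) (Qalg F))
  have key := norm_coeff_le_of_frobenius_eq hξ0 hξ1.le hq hρ hρq (N := N) (fun i => j (w i))
    (fun i => j (sigmaSep L (w i))) (fun i l => j (toSep L (c i l)))
    (fun i m => by
      change ‖algebraMap (Lsep L) (Qalg F) (frob (F := F) (Lsep L) _)‖ = _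
      rw [frob_apply, map_pow, norm_pow]
      rfl)
    (fun i l m => norm_RtoSep_le L _)
    (fun i => by
      have h1 := congrArg j (h i)
      rw [map_mul, map_pow, toSep_zmz, map_sub, map_sum] at h1
      simp only [map_mul] at h1
      rw [show j PowerSeries.X = PowerSeries.X from PowerSeries.map_X _,
        show j (PowerSeries.C (algebraMap L (Lsep L) (zetaL L))) = PowerSeries.C ξ from
          PowerSeries.map_C _ _] at h1
      exact h1)
  rw [mem_SepRestr]
  -- `‖w_m‖ ‖ξ‖ ^ m ≤ κ (ρ ^ (q - 1)) ^ m`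
  refine squeeze_zero (fun _ => by positivity) (fun m => ?_) (g := fun m =>
    (‖ξ‖ ^ N)⁻¹ * (ρ ^ (qF - 1)) ^ m) ?_
  · have e : ‖ξ‖ = ρ * ρ ^ (qF - 1) := by
      rw [← pow_succ', Nat.sub_add_cancel (by omega), hρq]
    change ‖coeff m (j (w i))‖ * ‖ξ‖ ^ m ≤ _
    calc _ = (‖coeff m (j (w i))‖ * ρ ^ m) * (ρ ^ (qF - 1)) ^ m := by
          conv_lhs => rw [e]
          rw [mul_pow, mul_assoc]
      _ ≤ _ := mul_le_mul_of_nonneg_right (key m i) (by positivity)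
  · have : ρ ^ (qF - 1) < 1 := pow_lt_one₀ hρ.le hρ1 (by omega)
    simpa using (tendsto_pow_atTop_nhds_zero_of_lt_one (by positivity) this).const_mul _

theorem exists_convergent_mul_map_eq {ι : Type*} [Fintype ι] [DecidableEq ι]
    {C C' : Matrix ι ι (Lsep L)⟦X⟧} {N N' : ℕ} {c c' : ι → ι → RX L} (hCC' : C * C' = 1)
    (hc : ∀ i j, toSep L (zmz L) ^ N * C i j = toSep L (c i j))
    (hc' : ∀ i j, toSep L (zmz L) ^ N' * C' i j = toSep L (c' i j)) : ∃ B B' :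
    Matrix ι ι (Lsep L)⟦X⟧, B * B' = 1 ∧ (∀ i j, B i j ∈ SepRestr L) ∧
    (∀ i j, B' i j ∈ SepRestr L) ∧ ∀ i j, ∑ l, C i l * sigmaSep L (B l j) = B i j := by
  have hC'C : C' * C = 1 := mul_eq_one_comm.1 hCC'
  have hCdet : IsUnit C.det := (Matrix.isUnit_iff_isUnit_det _).1 (IsUnit.of_mul_eq_one _ hCC')
  obtain ⟨B, hB, hCB⟩ := exists_mul_map_eq (F := F) C hCdet
  have hCB' : C * (sigmaSep L).mapMatrix B = B := hCB
  have hBB := Matrix.mul_nonsing_inv B hB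
  have hBB' := Matrix.nonsing_inv_mul B hB
  refine ⟨B, B⁻¹, hBB, fun i j => ?_, fun i j => ?_, fun i j => congrFun (congrFun hCB' i) j⟩
  · refine mem_SepRestr_of_frobenius_eq L N' (fun i => B i j) c' (fun i => ?_) i
    have h1 : (sigmaSep L).mapMatrix B = C' * B := by
      conv_rhs => rw [← hCB', ← Matrix.mul_assoc, hC'C, Matrix.one_mul]
    have h2 : sigmaSep L (B i j) = ∑ l, C' i l * B l j := congrFun (congrFun h1 i) j
    rw [h2, mul_sum]
    refine sum_congr rfl fun l _ => ?_
    rw [← mul_assoc, hc']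
  · refine mem_SepRestr_of_frobenius_eq L N (fun j => B⁻¹ i j) (fun j l => c l j) (fun j => ?_) j
    have h1 : (sigmaSep L).mapMatrix B⁻¹ = B⁻¹ * C := by
      have e1 : (sigmaSep L).mapMatrix B * (sigmaSep L).mapMatrix B⁻¹ = 1 := by
        rw [← map_mul, hBB, map_one]
      calc _ = (B⁻¹ * (C * (sigmaSep L).mapMatrix B)) * (sigmaSep L).mapMatrix B⁻¹ := by
            rw [hCB', hBB', Matrix.one_mul]
        _ = B⁻¹ * C * ((sigmaSep L).mapMatrix B * (sigmaSep L).mapMatrix B⁻¹) := by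
            simp only [Matrix.mul_assoc]
        _ = _ := by rw [e1, Matrix.mul_one]
    have h2 : sigmaSep L (B⁻¹ i j) = ∑ l, B⁻¹ i l * C l j := congrFun (congrFun h1 i) j
    rw [h2, mul_sum]
    refine sum_congr rfl fun l _ => ?_
    rw [← hc]
    ring

variable {L} {M : Type w} [AddCommGroup M] [Module (RX L) M]

namespace LocalShtuka
variable (S : LocalShtuka L M)

/-- The `σ̂`-semilinear endomorphism `m ↦ τ(σ̂^*m)` of `M ⊗ L^sep⟦z⟧`. -/
def phiSep : S.MSep →ₛₗ[sigmaSep L] S.MSep :=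
  (S.tauB (toSep L) (isUnit_toSep L)).toLinearMap.comp S.sigmaStar

theorem mem_H1v_iff_phiSep (m : S.MSep) : m ∈ S.H1v ↔ S.phiSep m = m := Iff.rfl

theorem phiSep_basis {ι : Type*} (b : Basis ι (RX L) M) (i : ι) :
    S.phiSep (BC.basis (toSep L) b i) =
    S.tauB (toSep L) (isUnit_toSep L) (BC.basis ((toSep L).comp (sigma L)) b i) := by
  have h2 : S.sigmaStar (BC.basis (toSep L) b i) = BC.basis ((toSep L).comp (sigma L)) b i := by
    rw [BC.basis_apply, BC.basis_apply, sigmaStar, BC.push_mk]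
  exact congrArg (S.tauB (toSep L) (isUnit_toSep L)) h2

theorem sum_mem_H1v {ι : Type*} [Fintype ι] (b : Basis ι (RX L) M) (v : ι → (Lsep L)⟦X⟧)
    (hv : ∀ l, ∑ i, (BC.basis (toSep L) b).repr (S.tauB (toSep L) (isUnit_toSep L)
      (BC.basis ((toSep L).comp (sigma L)) b i)) l * sigmaSep L (v i) = v l) :
    ∑ i, v i • BC.basis (toSep L) b i ∈ S.H1v := by
  rw [mem_H1v_iff_phiSep, map_sum]
  apply (BC.basis (toSep L) b).ext_elem
  intro l
  rw [(BC.basis (toSep L) b).repr_sum_self, map_sum, Finsupp.finsetSum_apply, ← hv l]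
  refine sum_congr rfl fun i _ => ?_
  rw [map_smulₛₗ, phiSep_basis, map_smul, Finsupp.smul_apply, smul_eq_mul, mul_comm]

/-- Lang's theorem for a local shtuka, with the convergence of the solution and of its inverse. -/
theorem exists_period_matrix {ι : Type*} [Fintype ι] [DecidableEq ι] (b : Basis ι (RX L) M) :
    ∃ (B B' : Matrix ι ι (Lsep L)⟦X⟧), B * B' = 1 ∧ (∀ i j, B i j ∈ SepRestr L) ∧
    (∀ i j, B' i j ∈ SepRestr L) ∧ ∀ j, ∑ i, B i j • BC.basis (toSep L) b i ∈ S.H1v := by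
  obtain ⟨N, hN⟩ := S.exists_tauRel_left
  obtain ⟨N', hN'⟩ := S.exists_tauRel_right
  choose y hy using fun j => hN (BC.mk (sigma L) (b j))
  choose x hx using fun j => hN' (b j)
  have hc : ∀ i j, toSep L (zmz L) ^ N * (BC.basis (toSep L) b).repr (S.tauB (toSep L)
      (isUnit_toSep L) (BC.basis ((toSep L).comp (sigma L)) b j)) i =
      toSep L (b.repr (y j) i) := by
    intro i j
    have h1 := (hy j).tauB (toSep L) (isUnit_toSep L)
    rw [map_smulₛₗ, map_smul, BC.push_mk, map_pow] at h1
    rw [← BC.basis_repr_mk (toSep L) b, ← h1, map_smul, Finsupp.smul_apply, smul_eq_mul,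
      BC.basis_apply]
  have hc' : ∀ i j, toSep L (zmz L) ^ N' * (BC.basis ((toSep L).comp (sigma L)) b).repr
      ((S.tauB (toSep L) (isUnit_toSep L)).symm (BC.basis (toSep L) b j)) i =
      toSep L ((BC.basis (sigma L) b).repr (x j) i) := by
    intro i j
    have h1 := (hx j).tauB (toSep L) (isUnit_toSep L)
    rw [map_smulₛₗ, map_pow, ← LinearEquiv.eq_symm_apply, map_smul] at h1
    have h2 := BC.basis_repr_push (sigma L) (toSep L) ((toSep L).comp (sigma L)) (fun _ => rfl)
      b (x j) i
    rw [h1, map_smul, Finsupp.smul_apply, smul_eq_mul] at h2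
    rw [← h2, BC.basis_apply]
  obtain ⟨B, B', hBB, hB, hB', hCB⟩ := exists_convergent_mul_map_eq L
    (matrix_mul_repr_symm (BC.basis ((toSep L).comp (sigma L)) b) (BC.basis (toSep L) b)
      (S.tauB (toSep L) (isUnit_toSep L))) hc hc'
  refine ⟨B, B', hBB, hB, hB', fun j => ?_⟩
  exact S.sum_mem_H1v b (fun i => B i j) fun l => hCB l j

/-- The map `M ⊗ L^sep⟨z/ζ⟩ → M ⊗ L^sep⟦z⟧`. -/
abbrev convToSep (_ : LocalShtuka L M) :
    BC (toSepRestr L) M →ₛₗ[(SepRestr L).subtype] BC (toSep L) M :=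
  BC.push (toSepRestr L) (SepRestr L).subtype (toSep L) (fun _ => rfl)

/-- `M ⊗ L^sep⟨z/ζ⟩` has a basis of `τ`-invariants. -/
theorem exists_frame {ι : Type*} [Fintype ι] [DecidableEq ι] (b : Basis ι (RX L) M) : ∃ tc :
    Basis ι (SepRestr L) (BC (toSepRestr L) M), ∀ l, S.convToSep (tc l) ∈ S.H1v := by
  obtain ⟨B, B', hBB, hB, hB', hfix⟩ := S.exists_period_matrix b
  let Bc : Matrix ι ι (SepRestr L) := Matrix.of fun i j => ⟨B i j, hB i j⟩
  let Bi : Matrix ι ι (SepRestr L) := Matrix.of fun i j => ⟨B' i j, hB' i j⟩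
  have hBcBi : Bc * Bi = 1 := by
    apply Matrix.map_injective (f := (SepRestr L).subtype) Subtype.val_injective
    have e : (SepRestr L).subtype.mapMatrix (Bc * Bi) = (SepRestr L).subtype.mapMatrix 1 := by
      rw [map_mul, map_one]
      exact hBB
    exact e
  obtain ⟨tc, htc⟩ := exists_basis_of_mul_eq_one (BC.basis (toSepRestr L) b) hBcBi
  refine ⟨tc, fun j => ?_⟩
  have e1 : S.convToSep (tc j) = ∑ i, B i j • BC.basis (toSep L) b i := by
    rw [htc, map_sum]
    refine sum_congr rfl fun i _ => ?_
    rw [map_smulₛₗ, BC.basis_apply, BC.basis_apply]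
    exact congrArg (B i j • ·) (BC.push_mk _ _ _ _ _)
  rw [e1]
  exact hfix j

end LocalShtuka
end frame

/-! ### The `v`-adic realization and the comparison isomorphism -/

section bases
variable {R N N' ι : Type*} [CommRing R] [AddCommGroup N] [AddCommGroup N'] [Module R N]
  [Module R N'] [Fintype ι] (f : N →ₗ[R] N') (b : Basis ι R N) (b' : Basis ι R N')
  (h : ∀ i, f (b i) = b' i)
include h

theorem bijective_of_basis : Function.Bijective f := by
  have : f = (b.equiv b' (Equiv.refl ι)).toLinearMap := b.ext fun i => by
    rw [h, LinearEquiv.coe_coe, Basis.equiv_apply, Equiv.refl_apply]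
  rw [this]
  exact LinearEquiv.bijective _

theorem invFun_eq_sum (y : N') : invFun f y = ∑ i, b'.repr y i • b i := by
  have hb := bijective_of_basis f b b' h
  apply hb.1
  rw [Function.invFun_eq (hb.2 y), map_sum]
  conv_lhs => rw [← b'.sum_repr y]
  exact sum_congr rfl fun i _ => by rw [map_smul, h]

end bases

section realization
theorem exists_algebraMap_eq_of_pow_card {k : Type*} [Field k] (i : F →+* k) {x : k}
    (hx : x ^ qF = x) : ∃ c : F, i c = x := by
  have h1 : (X ^ qF - X : F[X]) = ∏ c : F, (X - C c) := by
    have hr := FiniteField.roots_X_pow_card_sub_X F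
    have hd := FiniteField.X_pow_card_sub_X_natDegree_eq F (Fintype.one_lt_card (α := F))
    have hm : (X ^ qF - X : F[X]).Monic :=
      Polynomial.monic_X_pow_sub (by
        rw [Polynomial.degree_X]
        exact_mod_cast Fintype.one_lt_card)
    have h2 := Polynomial.prod_multiset_X_sub_C_of_monic_of_roots_card_eq hm (by
      rw [hr, hd]
      rfl)
    rw [← h2, hr]
    rfl
  have h2 := congrArg (eval₂ i x) h1
  rw [Polynomial.eval₂_sub, Polynomial.eval₂_X_pow, eval₂_X, hx, sub_self,
    Polynomial.eval₂_finsetProd] at h2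
  obtain ⟨c, -, hc⟩ := Finset.prod_eq_zero_iff.1 h2.symm
  refine ⟨c, ?_⟩
  rw [Polynomial.eval₂_sub, eval₂_X, Polynomial.eval₂_C, sub_eq_zero] at hc
  exact hc.symm

variable (L : ExtQ)

theorem exists_coefR_eq {f : (Lsep L)⟦X⟧} (hf : sigmaSep L f = f) : ∃ a : Av F,
    toSep L (coefR L a) = f := by
  have h : ∀ n, ∃ c : F, ((RtoSep L).comp ((algebraMap (Av F) (RL L)).comp PowerSeries.C)) c =
      coeff n f := by
    intro n
    apply exists_algebraMap_eq_of_pow_card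
    have := congrArg (coeff n) hf
    rwa [sigmaSep, PowerSeries.coeff_map, frob_apply] at this
  choose c hc using h
  refine ⟨PowerSeries.mk c, ?_⟩
  ext n
  rw [← hc n]
  simp only [toSep, coefR, coef, PowerSeries.coeff_map, coeff_mk]
  rfl

theorem toSep_coefR_injective : Injective fun a : Av F => toSep L (coefR L a) := by
  intro a b hab
  ext n
  have := congrArg (coeff n) hab
  simp only [toSep, coefR, coef, PowerSeries.coeff_map] at this
  exact ((RtoSep L).comp ((algebraMap (Av F) (RL L)).comp PowerSeries.C)).injective this

variable {L} {M : Type w} [AddCommGroup M] [Module (RX L) M]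

namespace LocalShtuka
variable {S : LocalShtuka L M} {ι : Type*} [Fintype ι] [DecidableEq ι]
  (tc : Basis ι (SepRestr L) (BC (toSepRestr L) M))

/-- The basis of `M ⊗ L^sep⟦z⟧` given by a basis of `M ⊗ L^sep⟨z/ζ⟩`. -/
def sepBasis : Basis ι (Lsep L)⟦X⟧ (BC (toSep L) M) :=
  BC.pushBasis (toSepRestr L) (SepRestr L).subtype (toSep L) (fun _ => rfl) tc

variable (S) in
theorem sepBasis_apply (l : ι) : sepBasis tc l = S.convToSep (tc l) := BC.pushBasis_apply ..

theorem sepBasis_repr (x : BC (toSepRestr L) M) (l : ι) : (sepBasis tc).repr (S.convToSep x) l =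
    (tc.repr x l : (Lsep L)⟦X⟧) :=
  BC.pushBasis_repr _ _ _ _ _ _ _

include tc in
theorem convToSep_injective : Injective S.convToSep :=
  BC.push_injective _ _ Subtype.val_injective _ _ tc

variable (htc : ∀ l, S.convToSep (tc l) ∈ S.H1v)
include htc

theorem exists_repr_of_mem_H1v {m : S.MSep} (hm : m ∈ S.H1v) : ∃ a : ι → Av F, m = ∑ l,
    toSep L (coefR L (a l)) • S.convToSep (tc l) := by
  have h : ∀ l, sigmaSep L ((sepBasis tc).repr m l) = (sepBasis tc).repr m l := by
    have h1 : ∑ l, sigmaSep L ((sepBasis tc).repr m l) • sepBasis tc l = m := by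
      conv_rhs => rw [← (S.mem_H1v_iff_phiSep m).1 hm, ← (sepBasis tc).sum_repr m, map_sum]
      refine sum_congr rfl fun l _ => ?_
      rw [map_smulₛₗ, sepBasis_apply S, (S.mem_H1v_iff_phiSep _).1 (htc l)]
    intro l
    conv_rhs => rw [← h1, (sepBasis tc).repr_sum_self]
  choose a ha using fun l => exists_coefR_eq L (h l)
  refine ⟨a, ?_⟩
  conv_lhs => rw [← (sepBasis tc).sum_repr m]
  refine sum_congr rfl fun l _ => ?_
  rw [ha, sepBasis_apply S]

/-- The basis of `H^1_v(M, A_v)`. -/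
def h1vBasis : Basis ι (Av F) S.H1v :=
  Basis.mk (v := fun l => ⟨S.convToSep (tc l), htc l⟩)
    (by
      rw [Fintype.linearIndependent_iff]
      intro g hg i
      have h1 : ∑ l, toSep L (coefR L (g l)) • sepBasis tc l = 0 := by
        have := congrArg Subtype.val hg
        rw [AddSubmonoidClass.coe_finsetSum] at this
        simp only [sepBasis_apply S]
        exact this
      have h2 := Fintype.linearIndependent_iff.1 (sepBasis tc).linearIndependent _ h1 i
      apply toSep_coefR_injective L
      simp only [h2, map_zero])
    (by
      rintro ⟨m, hm⟩ -
      obtain ⟨a, ha⟩ := exists_repr_of_mem_H1v tc htc hm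
      have : (⟨m, hm⟩ : S.H1v) = ∑ l, a l • ⟨S.convToSep (tc l), htc l⟩ := by
        ext1
        rw [AddSubmonoidClass.coe_finsetSum]
        exact ha
      rw [this]
      exact Submodule.sum_mem _ fun l _ => Submodule.smul_mem _ _ (subset_span ⟨l, rfl⟩))

theorem h1vBasis_apply (l : ι) : h1vBasis tc htc l = ⟨S.convToSep (tc l), htc l⟩ := by
  rw [h1vBasis, Basis.mk_apply]

theorem convToH1v_bijective : Function.Bijective S.convToH1v := by
  constructor
  · intro x y hxy
    ext1
    exact convToSep_injective (S := S) tc (congrArg Subtype.val hxy)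
  · rw [← LinearMap.range_eq_top, eq_top_iff, ← (h1vBasis tc htc).span_eq, span_le]
    rintro _ ⟨l, rfl⟩
    exact ⟨⟨tc l, htc l⟩, by rw [h1vBasis_apply]; rfl⟩

/-- The identification of the convergent elements of `H^1_v(M, A_v)` with all elements. -/
def convEquiv : S.H1vConv ≃ₗ[Av F] S.H1v :=
  LinearEquiv.ofBijective S.convToH1v (convToH1v_bijective tc htc)

theorem convEquiv_symm_h1vBasis (l : ι) : (convEquiv tc htc).symm (h1vBasis tc htc l) =
    ⟨tc l, htc l⟩ := by
  rw [LinearEquiv.symm_apply_eq, h1vBasis_apply]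
  rfl

/-- The basis of `M ⊗ ℂ_v⸨z - ζ⸩` given by a basis of `M ⊗ L^sep⟨z/ζ⟩`. -/
def expBasis {ι : Type*} (tc : Basis ι (SepRestr L) (BC (toSepRestr L) M)) :
    Basis ι (Cv F)⸨X⸩ (BC (expC L) M) :=
  BC.pushBasis (toSepRestr L) (expSep L) (expC L) (fun _ => rfl) tc

/-- The basis of the convergent elements of `H^1_v(M, A_v)`. -/
def convBasis : Basis ι (Av F) S.H1vConv := (h1vBasis tc htc).map (convEquiv tc htc).symm

theorem convBasis_apply (l : ι) : convBasis tc htc l = ⟨tc l, htc l⟩ := by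
  rw [convBasis, Basis.map_apply, convEquiv_symm_h1vBasis]

theorem convToH1v_convBasis (l : ι) : S.convToH1v (convBasis tc htc l) = h1vBasis tc htc l := by
  rw [convBasis_apply, h1vBasis_apply]
  rfl

theorem compare_basis (l : ι) : S.compare (BC.basis (AvToC L) (convBasis tc htc) l) =
    expBasis tc l := by
  rw [BC.basis_apply, convBasis_apply]
  refine (BC.lift_mk ..).trans (BC.pushBasis_apply ..).symm

/-- The pairing with `u` in terms of a basis of `τ`-invariants. -/
theorem evalC_invFun_compare (u : S.HomQv) (y : BC (expC L) M) : S.evalC u (invFun S.compare y) =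
    ∑ l, (expBasis tc).repr y l * QvToC L (u (h1vBasis tc htc l)) := by
  rw [invFun_eq_sum S.compare (BC.basis (AvToC L) (convBasis tc htc)) (expBasis tc)
    (compare_basis tc htc), map_sum]
  refine sum_congr rfl fun l _ => ?_
  rw [map_smul, smul_eq_mul, BC.basis_apply]
  congr 1
  refine (BC.lift_mk ..).trans ?_
  change QvToC L (u (S.convToH1v (convBasis tc htc l))) = _
  rw [convToH1v_convBasis]

end LocalShtuka

namespace OEAction
variable {S : LocalShtuka L M} {E : Type v} [CommRing E] [Algebra (Av F) E] (A : OEAction S E)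

theorem actH1v_mul (a b : 𝓞v[E]) (t : S.H1v) : A.actH1v (a * b) t = A.actH1v a (A.actH1v b t) := by
  ext1
  change BC.map _ (A.act (a * b)) t.1 = BC.map _ (A.act a) (BC.map _ (A.act b) t.1)
  induction t.1 using BC.induction with
  | h0 => simp only [map_zero]
  | hmk b m => simp only [map_smul, BC.map_mk, map_mul, End.mul_apply]
  | hadd x y hx hy => simp only [map_add, hx, hy]

theorem actH1v_add (a b : 𝓞v[E]) (t : S.H1v) : A.actH1v (a + b) t = A.actH1v a t +
    A.actH1v b t := by
  ext1
  change BC.map _ (A.act (a + b)) t.1 = BC.map _ (A.act a) t.1 + BC.map _ (A.act b) t.1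
  induction t.1 using BC.induction with
  | h0 => simp only [map_zero, add_zero]
  | hmk b m => simp only [map_smul, BC.map_mk, map_add, LinearMap.add_apply, smul_add]
  | hadd x y hx hy =>
    rw [map_add (BC.map (toSep L) (A.act (a + b))), map_add (BC.map (toSep L) (A.act a)),
      map_add (BC.map (toSep L) (A.act b)), hx, hy]
    abel

theorem actH1v_algebraMap (f : Av F) (t : S.H1v) : A.actH1v (algebraMap (Av F) _ f) t = f • t := by
  ext1
  change BC.map _ (A.act (algebraMap (Av F) _ f)) t.1 = toSep L (coefR L f) • t.1
  induction t.1 using BC.induction with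
  | h0 => simp only [map_zero, smul_zero]
  | hmk b m => rw [map_smul, BC.map_mk, A.act_algebraMap, map_smulₛₗ, smul_comm]
  | hadd x y hx hy => simp only [map_add, hx, hy, smul_add]

/-- An element of `O_E` that kills the `τ`-invariants is zero, if `O_E` acts faithfully. -/
theorem eq_zero_of_actH1v_eq_zero {ι : Type*} [Fintype ι] [DecidableEq ι]
    (tc : Basis ι (SepRestr L) (BC (toSepRestr L) M)) (htc : ∀ l, S.convToSep (tc l) ∈ S.H1v)
    (hA : Injective A.act) {a : 𝓞v[E]} (ha : ∀ t, A.actH1v a t = 0) : a = 0 := by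
  have := S.free
  have h1 : BC.map (toSep L) (A.act a) = 0 := by
    apply (LocalShtuka.sepBasis tc).ext
    intro l
    rw [LocalShtuka.sepBasis_apply S, LinearMap.zero_apply]
    exact congrArg Subtype.val (ha ⟨_, htc l⟩)
  apply hA
  rw [map_zero]
  ext m
  rw [LinearMap.zero_apply]
  have h2 : BC.mk (toSep L) (A.act a m) = 0 := by
    rw [← BC.map_mk, h1, LinearMap.zero_apply]
  let b := Free.chooseBasis (RX L) M
  refine b.ext_elem fun i => ?_
  have h3 := BC.basis_repr_mk (toSep L) b (A.act a m) i
  rw [h2, map_zero, Finsupp.zero_apply] at h3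
  rw [map_zero, Finsupp.zero_apply]
  have hinj : Injective (toSep L) := by
    apply PowerSeries.map_injective
    exact (algebraMap L (Lsep L)).injective.comp (algebraMap_RL_injective L)
  exact hinj (h3.symm.trans (map_zero _).symm)

end OEAction
end realization

/-! ### The trace form of a monogenic extension -/

section trace
variable {k K : Type*} [Field k] [Field K] [Algebra k K] [FiniteDimensional k K]
  [Algebra.IsSeparable k K]

theorem sum_traceDual_mul {n : Type*} [Fintype n] [DecidableEq n] (b : Basis n k K) : ∑ i,
    b.traceDual i * b i = 1 := by
  have key : ∀ x, trace k K ((∑ i, b.traceDual i * b i) * x) = trace k K (1 * x) := by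
    intro x
    rw [one_mul, Algebra.trace_eq_matrix_trace b x, Matrix.trace, sum_mul, map_sum]
    refine sum_congr rfl fun i _ => ?_
    rw [Matrix.diag_apply, Algebra.leftMulMatrix_eq_repr_mul]
    have := b.traceDual.traceDual_repr_apply (x * b i) i
    rw [Basis.traceDual_traceDual, Algebra.traceForm_apply] at this
    rw [this]
    congr 1
    ring
  have h := (traceForm_nondegenerate k K).1 (∑ i, b.traceDual i * b i - 1) (fun x => by
    rw [Algebra.traceForm_apply, sub_mul, map_sub, key, sub_self])
  exact sub_eq_zero.1 h

theorem sum_trace_smul_traceDual {n : Type*} [Fintype n] [DecidableEq n] (b : Basis n k K) (x : K) :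
    ∑ i, trace k K (x * b i) • b.traceDual i = x := by
  conv_rhs => rw [← b.traceDual.sum_repr x]
  refine sum_congr rfl fun i _ => ?_
  rw [Basis.traceDual_repr_apply, Algebra.traceForm_apply]

end trace

section traceGood
variable {K : ExtQ} [FD[K]] [Sep[K]] {α π ϑ : Qalg F}

theorem coe_aeval_Av (x : K) (p : (Av F)[X]) : ((aeval x p : K) : Qalg F) = aeval (x : Qalg F) p :=
  (Polynomial.aeval_algebraMap_apply (Qalg F) x p).symm

namespace IsGood

theorem adjoin_eq_top (h : IsGood K α π ϑ) : adjoin (Qv F) {(⟨ϑ, h.mem⟩ : K)} = ⊤ := by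
  rw [eq_top_iff]
  intro x _
  obtain ⟨n, hn⟩ := exists_mul_zetaQ_pow_le_one (x : Qalg F)
  obtain ⟨p, hp⟩ := h.exists_aeval (K.mul_mem (pow_mem (zetaQ_mem K) n) x.2) hn
  have hz : (zetaQ F : Qalg F) ^ n ≠ 0 := pow_ne_zero _ zetaQ_ne_zero
  have h1 : x = ((algebraMap (Av F) (Qv F) PowerSeries.X) ^ n)⁻¹ •
      aeval (⟨ϑ, h.mem⟩ : K) (p.map (algebraMap (Av F) (Qv F))) := by
    have h2 : (zetaQ F : Qalg F) ^ n =
        algebraMap (Qv F) (Qalg F) ((algebraMap (Av F) (Qv F) PowerSeries.X) ^ n) := by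
      rw [map_pow, ← IsScalarTower.algebraMap_apply]
      rfl
    ext
    rw [aeval_map_algebraMap]
    change (x : Qalg F) = ((algebraMap (Av F) (Qv F) PowerSeries.X) ^ n)⁻¹ •
      ((aeval (⟨ϑ, h.mem⟩ : K) p : K) : Qalg F)
    rw [coe_aeval_Av, ← hp, smul_def, map_inv₀, ← h2, inv_mul_cancel_left₀ hz]
  rw [h1]
  exact Subalgebra.smul_mem _ (Polynomial.aeval_mem_adjoin_singleton _ _) _

/-- The power basis of `K` given by a generator of its ring of integers. -/
def powerBasis (h : IsGood K α π ϑ) : PowerBasis (Qv F) K :=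
  PowerBasis.ofAdjoinEqTop (Algebra.IsIntegral.isIntegral _) h.adjoin_eq_top

theorem powerBasis_gen (h : IsGood K α π ϑ) : h.powerBasis.gen = ⟨ϑ, h.mem⟩ := by
  rw [powerBasis]
  simp

theorem isIntegral_gen (h : IsGood K α π ϑ) : IsIntegral (Av F) (⟨ϑ, h.mem⟩ : K) := by
  have := (mem_RL_iff K (⟨ϑ, h.mem⟩ : K)).2 h.norm_le
  exact this

theorem minpoly_coe (h : IsGood K α π ϑ) : minpoly (Av F) ϑ = minpoly (Av F) (⟨ϑ, h.mem⟩ : K) :=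
  minpoly.algebraMap_eq (algebraMap K (Qalg F)).injective (⟨ϑ, h.mem⟩ : K)

theorem coe_minpoly (h : IsGood K α π ϑ) : minpoly (Qv F) (⟨ϑ, h.mem⟩ : K) =
    (minpoly (Av F) ϑ).map (algebraMap (Av F) (Qv F)) := by
  rw [minpoly.isIntegrallyClosed_eq_field_fractions' (Qv F) h.isIntegral_gen, h.minpoly_coe]

/-- The value `g'(ϑ)` of the derivative of the minimal polynomial. -/
def derivGen (h : IsGood K α π ϑ) : K := aeval (⟨ϑ, h.mem⟩ : K) (minpoly (Av F) ϑ).derivative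

theorem coe_derivGen (h : IsGood K α π ϑ) : (h.derivGen : Qalg F) =
    aeval ϑ (minpoly (Av F) ϑ).derivative :=
  coe_aeval_Av _ _

theorem derivGen_ne_zero (h : IsGood K α π ϑ) : h.derivGen ≠ 0 := by
  intro h0
  apply h.aeval_derivative_minpoly_ne_zero
  rw [← h.coe_derivGen, h0]
  rfl

theorem traceDual_eq (h : IsGood K α π ϑ) (i : Fin h.powerBasis.dim) :
    h.powerBasis.basis.traceDual i * h.derivGen = (minpolyDiv (Av F) (⟨ϑ, h.mem⟩ : K)).coeff i := by
  rw [Basis.traceDual_powerBasis_eq, powerBasis_gen,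
    minpolyDiv_eq_of_isIntegrallyClosed (Qv F) h.isIntegral_gen]
  have : aeval (⟨ϑ, h.mem⟩ : K) (derivative (minpoly (Qv F) (⟨ϑ, h.mem⟩ : K))) = h.derivGen := by
    rw [h.coe_minpoly, derivative_map, aeval_map_algebraMap, derivGen]
  rw [this, div_mul_cancel₀ _ h.derivGen_ne_zero]

/-- The codifferent is contained in `g'(ϑ)⁻¹ O_K`. -/
theorem norm_mul_derivGen_le (h : IsGood K α π ϑ) {x : K} (hx : ∀ k : ℕ, ∃ a : Av F,
    trace (Qv F) K (x * (⟨ϑ, h.mem⟩ : K) ^ k) = algebraMap (Av F) (Qv F) a) : ‖x * h.derivGen‖ ≤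
    1 := by
  choose a ha using hx
  rw [← sum_trace_smul_traceDual h.powerBasis.basis x, sum_mul]
  refine norm_sum_le_of_forall_le_of_nonneg zero_le_one fun i _ => ?_
  rw [PowerBasis.basis_eq_pow, powerBasis_gen, ha, smul_mul_assoc, norm_smul, h.traceDual_eq]
  refine mul_le_one₀ (norm_Av_le F _) (norm_nonneg _) ?_
  rw [← mem_RL_iff]
  have h1 : adjoin (Av F) {(⟨ϑ, h.mem⟩ : K)} ≤ integralClosure (Av F) K := by
    rw [Algebra.adjoin_le_iff, Set.singleton_subset_iff]
    exact h.isIntegral_gen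
  exact h1 (coeff_minpolyDiv_mem_adjoin _ _)

/-- The codifferent contains `g'(ϑ)⁻¹ O_K`. -/
theorem exists_trace_eq (h : IsGood K α π ϑ) {y : K} (hy : ‖y‖ ≤ 1) : ∃ a : Av F,
    trace (Qv F) K (h.derivGen⁻¹ * y) = algebraMap (Av F) (Qv F) a := by
  obtain ⟨p, hp⟩ := h.exists_aeval y.2 hy
  have hm : (minpoly (Av F) (⟨ϑ, h.mem⟩ : K)).Monic := minpoly.monic h.isIntegral_gen
  set n := h.powerBasis.dim
  set r := p %ₘ minpoly (Av F) (⟨ϑ, h.mem⟩ : K) with hr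
  have hy' : y = aeval (⟨ϑ, h.mem⟩ : K) r := by
    rw [hr, Polynomial.aeval_modByMonic_eq_self_of_root (minpoly.aeval _ _)]
    ext
    rw [hp, coe_aeval_Av]
  have hdeg : (minpoly (Av F) (⟨ϑ, h.mem⟩ : K)).natDegree = n := by
    have h1 := h.powerBasis.natDegree_minpoly
    rw [powerBasis_gen, h.coe_minpoly, (minpoly.monic h.isIntegral).natDegree_map,
      h.minpoly_coe] at h1
    exact h1
  have hn : 0 < n := h.powerBasis.dim_pos
  have hrd : r.natDegree < n := by
    rw [← hdeg]
    refine Polynomial.natDegree_modByMonic_lt _ hm fun h1 => ?_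
    rw [h1, Polynomial.natDegree_one] at hdeg
    omega
  let i₀ : Fin n := ⟨n - 1, by omega⟩
  have hβ : h.powerBasis.basis.traceDual i₀ = h.derivGen⁻¹ := by
    have h1 := h.traceDual_eq i₀
    have h2 : (minpolyDiv (Av F) (⟨ϑ, h.mem⟩ : K)).coeff (n - 1) = 1 := by
      have h3 := natDegree_minpolyDiv_succ h.isIntegral_gen
      rw [hdeg] at h3
      have h4 := minpolyDiv_monic h.isIntegral_gen
      rw [show n - 1 = (minpolyDiv (Av F) (⟨ϑ, h.mem⟩ : K)).natDegree by omega]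
      exact h4.coeff_natDegree
    exact eq_inv_of_mul_eq_one_left (h1.trans h2)
  refine ⟨r.coeff (n - 1), ?_⟩
  rw [hy', Polynomial.aeval_eq_sum_range' hrd, mul_sum, map_sum, sum_range, sum_eq_single i₀]
  · have h1 := h.powerBasis.basis.trace_traceDual_mul i₀ i₀
    rw [if_pos rfl, hβ, PowerBasis.basis_eq_pow, powerBasis_gen] at h1
    rw [mul_smul_comm, ← algebraMap_smul (Qv F), map_smul, h1, smul_eq_mul, mul_one]
  · intro j _ hj
    have h1 := h.powerBasis.basis.trace_traceDual_mul i₀ j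
    rw [if_neg hj, hβ, PowerBasis.basis_eq_pow, powerBasis_gen] at h1
    rw [mul_smul_comm, ← algebraMap_smul (Qv F), map_smul, h1, smul_zero]
  · intro h1
    exact absurd (mem_univ _) h1

end IsGood
end traceGood

/-! ### A component of `E` and the pairing with a homology class -/

section component
variable {K : ExtQ} {E : Type v} [CommRing E] [Algebra (Qv F) E] [Algebra (Av F) E]
  [IsScalarTower (Av F) (Qv F) E]

/-- The idempotent `e ∈ O_E` of the component of `E` that a homomorphism `ρ : E → K` factors
through, together with a lift `θ ∈ O_E` of the generator `ϑ` of `O_K`. -/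
structure IsComponent (ρ : E →ₐ[Qv F] K) (α π ϑ : Qalg F) (e θ : 𝓞v[E]) : Prop where
  good : IsGood K α π ϑ
  idem : e * e = e
  map_e : ρ e = 1
  eq_zero : ∀ x : E, ρ x = 0 → (e : E) * x = 0
  map_theta : ρ θ = ⟨ϑ, good.mem⟩

theorem isIntegral_rho_iff [IsSemisimpleRing E] {ρ : E →ₐ[Qv F] K} {e : E}
    (h0 : ∀ x : E, ρ x = 0 → e * x = 0) (h1 : ρ e = 1) {x : E} (hx : IsIntegral (Av F) (ρ x)) :
    IsIntegral (Av F) (e * x) := by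
  obtain ⟨p, hp, hpx⟩ := hx
  refine ⟨X * p, Polynomial.monic_X.mul hp, ?_⟩
  have h2 : e * aeval (e * x) p = 0 := by
    apply h0
    have : ρ (aeval (e * x) p) = aeval (ρ x) p := by
      have h3 := aeval_algHom_apply (ρ.restrictScalars (Av F)) (e * x) p
      have h4 : (ρ.restrictScalars (Av F)) (e * x) = ρ x := by
        change ρ (e * x) = ρ x
        rw [map_mul, h1, one_mul]
      rw [h4] at h3
      exact h3.symm
    rw [this]
    exact hpx
  rw [Polynomial.eval₂_mul, eval₂_X]
  change e * x * aeval (e * x) p = 0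
  rw [mul_right_comm, h2, zero_mul]

variable [FD[K]] [Sep[K]] {α π ϑ : Qalg F}
  {ρ : E →ₐ[Qv F] K} {e θ : 𝓞v[E]}

theorem exists_isComponent [IsSemisimpleRing E] (hρ : Surjective ρ) (h : IsGood K α π ϑ) : ∃ e θ,
    IsComponent ρ α π ϑ e θ := by
  obtain ⟨J, hJ⟩ := exists_isCompl (RingHom.ker ρ.toRingHom)
  have h1 : (1 : E) ∈ RingHom.ker ρ.toRingHom ⊔ J := by
    rw [hJ.sup_eq_top]
    trivial
  obtain ⟨a, ha, e, he, hae⟩ := Submodule.mem_sup.1 h1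
  have ha0 : ρ a = 0 := ha
  have he1 : ρ e = 1 := by
    rw [← map_one ρ, ← hae, map_add, ha0, zero_add]
  have h0 : ∀ x : E, ρ x = 0 → e * x = 0 := by
    intro x hx
    have h2 : e * x ∈ RingHom.ker ρ.toRingHom ⊓ J :=
      ⟨Ideal.mul_mem_left _ _ hx, Ideal.mul_mem_right _ _ he⟩
    rw [hJ.inf_eq_bot] at h2
    exact h2
  have hee : e * e = e := by
    have h2 := h0 a ha0
    have h3 : e * (a + e) = e := by rw [hae, mul_one]
    rwa [mul_add, h2, zero_add] at h3
  obtain ⟨x, hx⟩ := hρ ⟨ϑ, h.mem⟩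
  have hei : IsIntegral (Av F) e := by
    have := isIntegral_rho_iff h0 he1 (x := 1) (by rw [map_one]; exact isIntegral_one)
    rwa [mul_one] at this
  have hxi : IsIntegral (Av F) (e * x) := isIntegral_rho_iff h0 he1 (by rw [hx]; exact h.isIntegral_gen)
  exact ⟨⟨e, hei⟩, ⟨e * x, hxi⟩, h, Subtype.ext hee, he1, h0, by
    change ρ (e * x) = ⟨ϑ, h.mem⟩
    rw [map_mul, he1, one_mul, hx]⟩

theorem IsGood.exists_aeval_eq (h : IsGood K α π ϑ) {x : K} (hx : ‖x‖ ≤ 1) : ∃ p : (Av F)[X], x =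
    aeval (⟨ϑ, h.mem⟩ : K) p := by
  obtain ⟨p, hp⟩ := h.exists_aeval x.2 hx
  refine ⟨p, ?_⟩
  ext
  rw [hp, coe_aeval_Av]

theorem norm_rho_le (ρ : E →ₐ[Qv F] K) (a : 𝓞v[E]) : ‖ρ a‖ ≤ 1 := by
  rw [← mem_RL_iff]
  have : IsIntegral (Av F) (a : E) := a.2
  exact this.map (ρ.restrictScalars (Av F))

namespace IsComponent
variable (C : IsComponent ρ α π ϑ e θ)
include C

theorem map_aeval (p : (Av F)[X]) : ρ (aeval θ p : 𝓞v[E]) = aeval (⟨ϑ, C.good.mem⟩ : K) p := by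
  have h1 := aeval_algHom_apply
    ((ρ.restrictScalars (Av F)).comp 𝓞v[E].val) θ p
  have h2 : ((ρ.restrictScalars (Av F)).comp 𝓞v[E].val) θ = ⟨ϑ, C.good.mem⟩ := C.map_theta
  rw [h2] at h1
  exact h1.symm

theorem mul_eq_mul {a b : 𝓞v[E]} (hab : ρ a = ρ b) : e * a = e * b := by
  apply Subtype.ext
  have := C.eq_zero (a - b : E) (by rw [map_sub, hab, sub_self])
  rw [mul_sub, sub_eq_zero] at this
  exact this

theorem exists_aeval_eq (a : 𝓞v[E]) : ∃ p : (Av F)[X], ρ a = aeval (⟨ϑ, C.good.mem⟩ : K) p ∧ e * a =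
    e * aeval θ p := by
  obtain ⟨p, hp⟩ := C.good.exists_aeval_eq (norm_rho_le ρ a)
  exact ⟨p, hp, C.mul_eq_mul (by rw [hp, C.map_aeval])⟩

theorem mul_aeval_minpoly : e * aeval θ (minpoly (Av F) ϑ) = 0 := by
  rw [← mul_zero e]
  apply C.mul_eq_mul
  rw [C.map_aeval, C.good.minpoly_coe, minpoly.aeval]
  exact (map_zero ρ).symm

/-- Elements of `K` are equal if they pair equally with `O_E` under the trace form. -/
theorem eq_of_trace_eq {x y : K}
    (hxy : ∀ a : 𝓞v[E], trace (Qv F) K (x * ρ a) = trace (Qv F) K (y * ρ a)) : x = y := by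
  rw [← sum_trace_smul_traceDual C.good.powerBasis.basis x,
    ← sum_trace_smul_traceDual C.good.powerBasis.basis y]
  refine sum_congr rfl fun i _ => ?_
  congr 1
  have h1 : C.good.powerBasis.basis i = ρ (θ ^ (i : ℕ) : 𝓞v[E]) := by
    rw [PowerBasis.basis_eq_pow, C.good.powerBasis_gen, ← C.map_theta, ← map_pow]
    rfl
  rw [h1, hxy]

end IsComponent
end component

section traceRep
variable {K : ExtQ} {E : Type v} [CommRing E] [Algebra (Qv F) E] [Algebra (Av F) E]
  [IsScalarTower (Av F) (Qv F) E] {T : Type w} [AddCommGroup T] [Module (Av F) T]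
  (act : 𝓞v[E] →ₐ[Av F] End (Av F) T) [FD[K]] [Sep[K]]
  {α π ϑ : Qalg F} {ρ : E →ₐ[Qv F] K} {e θ : 𝓞v[E]}

/-- The element `α_t ∈ K` with `u(e a t) = Tr(α_t ρ(a))` for all `a ∈ O_E`. -/
def traceRep (h : IsGood K α π ϑ) (e θ : 𝓞v[E]) (u : T →ₗ[Av F] Qv F) : T →ₗ[Av F] K where
  toFun t := ∑ i : Fin h.powerBasis.dim,
    u (act (e * θ ^ (i : ℕ)) t) • h.powerBasis.basis.traceDual i
  map_add' s t := by
    simp only [map_add, add_smul, sum_add_distrib]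
  map_smul' f t := by
    simp only [map_smul, RingHom.id_apply, smul_sum, smul_assoc]

theorem trace_smul_Av (f : Av F) (x : K) : trace (Qv F) K (f • x) = f • trace (Qv F) K x := by
  rw [← algebraMap_smul (Qv F) f x, map_smul, algebraMap_smul]

variable (C : IsComponent ρ α π ϑ e θ)

theorem trace_traceRep_pow (h : IsGood K α π ϑ) (u : T →ₗ[Av F] Qv F) (t : T)
    (j : Fin h.powerBasis.dim) :
    trace (Qv F) K (traceRep act h e θ u t * (⟨ϑ, h.mem⟩ : K) ^ (j : ℕ)) =
    u (act (e * θ ^ (j : ℕ)) t) := by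
  change trace (Qv F) K ((∑ i : Fin h.powerBasis.dim,
      u (act (e * θ ^ (i : ℕ)) t) • h.powerBasis.basis.traceDual i) * _) = _
  have hj : (⟨ϑ, h.mem⟩ : K) ^ (j : ℕ) = h.powerBasis.basis j := by
    rw [PowerBasis.basis_eq_pow, h.powerBasis_gen]
  rw [hj, sum_mul, map_sum, sum_eq_single j]
  · rw [smul_mul_assoc, map_smul, Basis.trace_traceDual_mul, if_pos rfl, smul_eq_mul, mul_one]
  · intro i _ hi
    rw [smul_mul_assoc, map_smul, Basis.trace_traceDual_mul, if_neg hi.symm, smul_zero]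
  · intro h1
    exact absurd (mem_univ _) h1

theorem natDegree_minpoly_good (h : IsGood K α π ϑ) : (minpoly (Av F) ϑ).natDegree =
    h.powerBasis.dim := by
  have h1 := h.powerBasis.natDegree_minpoly
  rwa [h.powerBasis_gen, h.coe_minpoly, (minpoly.monic h.isIntegral).natDegree_map] at h1

include C in
theorem IsComponent.exists_small_aeval_eq (a : 𝓞v[E]) : ∃ r : (Av F)[X], r.natDegree <
    C.good.powerBasis.dim ∧ ρ a = aeval (⟨ϑ, C.good.mem⟩ : K) r ∧ e * a = e * aeval θ r := by
  obtain ⟨p, hp, hpe⟩ := C.exists_aeval_eq a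
  have hm : (minpoly (Av F) ϑ).Monic := minpoly.monic C.good.isIntegral
  have hdeg := natDegree_minpoly_good C.good
  refine ⟨p %ₘ minpoly (Av F) ϑ, ?_, ?_, ?_⟩
  · rw [← hdeg]
    refine Polynomial.natDegree_modByMonic_lt _ hm fun h1 => ?_
    have := C.good.powerBasis.dim_pos
    rw [h1, Polynomial.natDegree_one] at hdeg
    omega
  · rw [hp, Polynomial.aeval_modByMonic_eq_self_of_root]
    rw [C.good.minpoly_coe, minpoly.aeval]
  · conv_lhs => rw [hpe, ← Polynomial.modByMonic_add_div p (minpoly (Av F) ϑ), map_add, map_mul,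
    mul_add, ← mul_assoc e (aeval θ (minpoly (Av F) ϑ)), C.mul_aeval_minpoly, zero_mul, add_zero]

theorem trace_traceRep (u : T →ₗ[Av F] Qv F) (t : T) (a : 𝓞v[E]) :
    trace (Qv F) K (traceRep act C.good e θ u t * ρ a) = u (act (e * a) t) := by
  obtain ⟨r, hrd, hρ, hpr⟩ := C.exists_small_aeval_eq a
  rw [hρ, hpr, Polynomial.aeval_eq_sum_range' hrd, Polynomial.aeval_eq_sum_range' hrd, sum_range,
    sum_range, mul_sum, mul_sum, map_sum, map_sum, LinearMap.sum_apply, map_sum]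
  refine sum_congr rfl fun i _ => ?_
  rw [mul_smul_comm, mul_smul_comm, trace_smul_Av, trace_traceRep_pow act C.good, map_smul,
    LinearMap.smul_apply, map_smul]

include C in
theorem IsComponent.rho_mul (a b : 𝓞v[E]) : ρ ((a * b : 𝓞v[E]) : E) = ρ a * ρ b := map_mul ρ _ _

theorem traceRep_act (u : T →ₗ[Av F] Qv F) (a : 𝓞v[E]) (t : T) :
    traceRep act C.good e θ u (act a t) = ρ a * traceRep act C.good e θ u t := by
  apply C.eq_of_trace_eq
  intro b
  rw [trace_traceRep act C, ← End.mul_apply, ← map_mul, mul_assoc e b a, ← trace_traceRep act C,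
    C.rho_mul]
  congr 1
  ring

/-- The element `α_t` for a homology class that is integral on a line `O_K t`. -/
theorem norm_traceRep_mul_le {u : T →ₗ[Av F] Qv F} {t : T}
    (h : ∀ a, ∃ f : Av F, algebraMap (Av F) (Qv F) f = u (act a t)) : ‖traceRep act C.good e θ u t *
    C.good.derivGen‖ ≤ 1 := by
  apply C.good.norm_mul_derivGen_le
  intro k
  obtain ⟨f, hf⟩ := h (e * θ ^ k)
  refine ⟨f, ?_⟩
  rw [hf, ← trace_traceRep act C]
  have h2 : ρ ((θ ^ k : 𝓞v[E]) : E) = (⟨ϑ, C.good.mem⟩ : K) ^ k := by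
    rw [← C.map_theta, ← map_pow]
    rfl
  rw [h2]

/-- A homology class `u`, given by an `O_E`-linear map `κ` onto `O_K` and `α ∈ K` on the component
`e`, such that every homology class with values in `A_v` is an `O_E`-multiple of `u`. -/
theorem norm_inv_derivGen_le {u : T →ₗ[Av F] Qv F} {β : K} {κ : T →ₗ[Av F] K} (hκ : ∀ t, ‖κ t‖ ≤ 1)
    {t₀ : T} (ht₀ : κ t₀ = 1) (hκa : ∀ a t, κ (act a t) = ρ a * κ t)
    (hrep : traceRep act C.good e θ u t₀ = β)
    (hu : ∀ W : T →ₗ[Av F] Av F, ∃ b, ∀ t, algebraMap (Av F) (Qv F) (W t) = u (act b t)) :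
    ‖C.good.derivGen⁻¹‖ ≤ ‖β‖ := by
  choose w hw using fun t => C.good.exists_trace_eq (hκ t)
  let W : T →ₗ[Av F] Av F :=
    { toFun := w
      map_add' := fun s t => by
        apply IsFractionRing.injective (Av F) (Qv F)
        rw [map_add, ← hw, ← hw, ← hw, map_add, mul_add, map_add]
      map_smul' := fun f t => by
        apply IsFractionRing.injective (Av F) (Qv F)
        rw [RingHom.id_apply, smul_eq_mul, map_mul, ← hw, ← hw, map_smul, mul_smul_comm,
          trace_smul_Av, smul_def] }
  obtain ⟨b, hb⟩ := hu W
  have h1 : C.good.derivGen⁻¹ = β * ρ b := by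
    apply C.eq_of_trace_eq
    intro c
    have h3 := hb (act (e * c) t₀)
    rw [show W (act (e * c) t₀) = w (act (e * c) t₀) from rfl, ← hw, ← End.mul_apply, ← map_mul,
      mul_left_comm, ← trace_traceRep act C, hrep, hκa, ht₀, mul_one, C.rho_mul, C.map_e, one_mul,
      C.rho_mul] at h3
    rw [mul_assoc, h3]
  rw [h1, norm_mul]
  exact mul_le_of_le_one_right (norm_nonneg _) (norm_rho_le ρ b)

end traceRep

section pairing
variable {L K : ExtQ} {M : Type w} [AddCommGroup M] [Module (RX L) M] {S : LocalShtuka L M}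
  {E : Type v} [CommRing E] [Algebra (Qv F) E] [Algebra (Av F) E] [IsScalarTower (Av F) (Qv F) E]
  (A : OEAction S E)

namespace OEAction

/-- The action of `O_E` on `H^1_v(M, A_v)` as a ring homomorphism. -/
def actHom : 𝓞v[E] →ₐ[Av F] End (Av F) S.H1v where
  toFun := A.actH1v
  map_one' := by
    ext1 t
    have := A.actH1v_algebraMap 1 t
    rwa [map_one, one_smul] at this
  map_mul' a b := LinearMap.ext fun t => A.actH1v_mul a b t
  map_zero' := by
    ext1 t
    have := A.actH1v_algebraMap 0 t
    rwa [map_zero, zero_smul] at this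
  map_add' a b := LinearMap.ext fun t => A.actH1v_add a b t
  commutes' f := LinearMap.ext fun t => A.actH1v_algebraMap f t

theorem actHom_apply (a : 𝓞v[E]) : A.actHom a = A.actH1v a := rfl

variable [FD[K]] [Sep[K]] {α π ϑ : Qalg F}
  {ρ : E →ₐ[Qv F] K} {e θ : 𝓞v[E]} (C : IsComponent ρ α π ϑ e θ)
include C

/-- If `f w = u ∘ [f e']`, then the elements of `K` that represent `u` and `w` differ by the factor
`ρ(e')`. -/
theorem traceRep_of_isMul {e' : E} {u w : S.HomQv} (hmul : A.IsMul e' u w) (t : S.H1v) :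
    traceRep A.actHom C.good e θ w t = ρ e' * traceRep A.actHom C.good e θ u t := by
  obtain ⟨f, a, hf, hfa, hfu⟩ := hmul
  have hf' : algebraMap (Av F) (Qv F) f ≠ 0 := by
    rwa [Ne, IsFractionRing.to_map_eq_zero_iff]
  have hρa : ρ a = f • ρ e' := by
    rw [hfa, ← algebraMap_smul (Qv F) f e', map_smul, algebraMap_smul]
  have h1 : f • traceRep A.actHom C.good e θ w t = ρ a * traceRep A.actHom C.good e θ u t := by
    apply C.eq_of_trace_eq
    intro b
    have h2 := LinearMap.congr_fun hfu (A.actHom (e * b) t)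
    rw [LinearMap.smul_apply, LinearMap.comp_apply, ← actHom_apply, ← End.mul_apply, ← map_mul,
      mul_left_comm, ← trace_traceRep A.actHom C, ← trace_traceRep A.actHom C, C.rho_mul] at h2
    rw [smul_mul_assoc, trace_smul_Av, h2]
    congr 1
    ring
  rw [hρa, smul_mul_assoc, ← algebraMap_smul (Qv F) f (_ : K),
    ← algebraMap_smul (Qv F) f (_ * _ : K)] at h1
  exact smul_right_injective K hf' h1

/-- The homology class `u = e' u₀` for an `O_E`-generator `u₀`: comparison of `α` with the
codifferent of `K`. -/
theorem norm_rho_eq {u : S.HomQv} {a₀ : K} {κ : S.H1v →ₗ[Av F] K} (hκ : ∀ t, ‖κ t‖ ≤ 1)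
    (hκ1 : ∃ t, κ t = 1) (hκa : ∀ a t, κ (A.actHom a t) = ρ a * κ t)
    (hrep : ∀ t, traceRep A.actHom C.good e θ u t = a₀ * κ t) {e' : E} {u₀ : S.HomAv}
    (he' : IsUnit e') (hu₀ : A.IsOEGenerator u₀) (hmul : A.IsMul e' (toHomQv u₀) u) : ‖ρ e'‖ = ‖a₀ *
    C.good.derivGen‖ := by
  have hρe : ρ e' ≠ 0 := (he'.map ρ).ne_zero
  obtain ⟨t₀, ht₀⟩ := hκ1
  have hrep₀ : traceRep A.actHom C.good e θ (toHomQv u₀) t₀ = a₀ / ρ e' := by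
    rw [eq_div_iff hρe, mul_comm, ← A.traceRep_of_isMul C hmul, hrep, ht₀, mul_one]
  have hle := norm_traceRep_mul_le A.actHom C (u := toHomQv u₀) (t := t₀) fun a => ⟨_, rfl⟩
  have hge := norm_inv_derivGen_le A.actHom C hκ ht₀ hκa hrep₀ fun W => by
    obtain ⟨b, hb⟩ := hu₀ W
    refine ⟨b, fun t => ?_⟩
    rw [hb]
    rfl
  rw [hrep₀] at hle
  have hG : 0 < ‖C.good.derivGen‖ := norm_pos_iff.2 C.good.derivGen_ne_zero
  have hβG : ‖a₀ / ρ e'‖ * ‖C.good.derivGen‖ = 1 := by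
    apply le_antisymm
    · rwa [← norm_mul]
    · rw [norm_inv] at hge
      calc 1 = ‖C.good.derivGen‖⁻¹ * ‖C.good.derivGen‖ := (inv_mul_cancel₀ hG.ne').symm
        _ ≤ _ := mul_le_mul_of_nonneg_right hge hG.le
  rw [norm_div, div_mul_eq_mul_div, div_eq_one_iff_eq (norm_ne_zero_iff.2 hρe)] at hβG
  rw [norm_mul, hβG]

variable {ι : Type*} [Fintype ι] [DecidableEq ι] (tc : Basis ι (SepRestr L) (BC (toSepRestr L) M))
  (htc : ∀ l, S.convToSep (tc l) ∈ S.H1v) (hA : Injective A.act)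
include htc hA

theorem exists_traceRep_ne_zero {u : S.HomQv} (hu : A.IsEGenerator u) : ∃ t,
    traceRep A.actHom C.good e θ u t ≠ 0 := by
  by_contra! h0
  have h1 : ∀ (w : S.HomQv) (t : S.H1v), w (A.actHom e t) = 0 := by
    intro w t
    obtain ⟨x, f, a, hf, -, hw⟩ := hu w
    have h2 := LinearMap.congr_fun hw (A.actHom e t)
    rw [LinearMap.smul_apply, LinearMap.comp_apply, ← actHom_apply, ← End.mul_apply, ← map_mul,
      mul_comm, ← trace_traceRep A.actHom C, h0, zero_mul, map_zero] at h2
    exact (smul_eq_zero.1 h2).resolve_left hf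
  have he : e = 0 := by
    apply A.eq_zero_of_actH1v_eq_zero tc htc hA
    intro t
    let b := LocalShtuka.h1vBasis tc htc
    refine b.ext_elem fun i => ?_
    have h3 := h1 ((Algebra.linearMap (Av F) (Qv F)).comp (b.coord i)) t
    rw [map_zero, Finsupp.zero_apply]
    exact IsFractionRing.injective (Av F) (Qv F) (h3.trans (map_zero _).symm)
  have h4 := C.map_e
  rw [he] at h4
  exact zero_ne_one ((map_zero ρ).symm.trans h4)

/-- The `e`-part of the pairing with an `E`-generator `u` is `Tr(α κ(t))` with an `O_E`-linear
map `κ` of `H^1_v(M, A_v)` onto `O_K`. -/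
theorem exists_kappa {u : S.HomQv} (hu : A.IsEGenerator u) : ∃ (a₀ : K) (κ : S.H1v →ₗ[Av F] K), a₀ ≠
    0 ∧ (∀ t, ‖κ t‖ ≤ 1) ∧ (∃ t, κ t = 1) ∧ (∀ a t, κ (A.actHom a t) = ρ a * κ t) ∧ ∀ t,
    traceRep A.actHom C.good e θ u t = a₀ * κ t := by
  let b := LocalShtuka.h1vBasis tc htc
  obtain ⟨t₁, ht₁⟩ := A.exists_traceRep_ne_zero C tc htc hA hu
  have hbd : ∀ t, ‖traceRep A.actHom C.good e θ u t‖ ≤ ∑ i, ‖traceRep A.actHom C.good e θ u (b i)‖ := by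
    intro t
    rw [← b.sum_repr t, map_sum]
    refine (norm_sum_le_of_forall_le_of_nonneg
      (Finset.sum_nonneg fun i _ => norm_nonneg (traceRep A.actHom C.good e θ u (b i))) fun i _ => ?_)
    rw [map_smul, ← algebraMap_smul (Qv F), norm_smul]
    refine (mul_le_of_le_one_left (norm_nonneg _) (norm_Av_le F _)).trans ?_
    exact Finset.single_le_sum (f := fun i => ‖traceRep A.actHom C.good e θ u (b i)‖)
      (fun _ _ => norm_nonneg _) (mem_univ i)
  obtain ⟨x, ⟨t₀, rfl⟩, hx0, hmax⟩ := exists_max_norm K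
    (Set.range fun t => (traceRep A.actHom C.good e θ u t : Qalg F)) (by rintro _ ⟨t, rfl⟩; exact (traceRep A.actHom C.good e θ u t).2)
    ⟨_, ⟨t₁, rfl⟩, fun h0 => ht₁ (Subtype.ext h0)⟩ _ (by rintro _ ⟨t, rfl⟩; exact hbd t)
  have ha0 : traceRep A.actHom C.good e θ u t₀ ≠ 0 := fun h0 => hx0 (congrArg Subtype.val h0)
  refine ⟨traceRep A.actHom C.good e θ u t₀, (LinearMap.mulLeft (Av F) (traceRep A.actHom C.good e θ u t₀)⁻¹).comp
    (traceRep A.actHom C.good e θ u), ha0, fun t => ?_, ⟨t₀, inv_mul_cancel₀ ha0⟩, fun a t => ?_, fun t => ?_⟩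
  · change ‖(traceRep A.actHom C.good e θ u t₀)⁻¹ * traceRep A.actHom C.good e θ u t‖ ≤ 1
    rw [norm_mul, norm_inv, inv_mul_le_one₀ (norm_pos_iff.2 ha0)]
    exact hmax _ ⟨t, rfl⟩
  · change (traceRep A.actHom C.good e θ u t₀)⁻¹ * traceRep A.actHom C.good e θ u (A.actHom a t) =
      ρ a * ((traceRep A.actHom C.good e θ u t₀)⁻¹ * traceRep A.actHom C.good e θ u t)
    rw [traceRep_act A.actHom C]
    ring
  · exact (mul_inv_cancel_left₀ ha0 _).symm

end OEAction
end pairing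

/-! ### Generators of the homology over `O_E` -/

section semisimple
variable {E : Type v} [CommRing E] [Algebra (Qv F) E] [Module.Finite (Qv F) E]

/-- The image of a homomorphism `E → Q_v^alg`, as an intermediate field. -/
def rangeField (χ : E →ₐ[Qv F] Qalg F) : ExtQ :=
  χ.range.toIntermediateField fun x hx => by
    have := Subalgebra.inv_mem_of_algebraic (A := χ.range) (x := ⟨x, hx⟩)
      (Algebra.IsAlgebraic.isAlgebraic (R := Qv F) x)
    exact this

/-- A homomorphism `E → Q_v^alg` as a homomorphism onto its image. -/
def rangeHom (χ : E →ₐ[Qv F] Qalg F) : E →ₐ[Qv F] rangeField χ where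
  toFun x := ⟨χ x, x, rfl⟩
  map_one' := Subtype.ext (map_one χ)
  map_mul' x y := Subtype.ext (map_mul χ x y)
  map_zero' := Subtype.ext (map_zero χ)
  map_add' x y := Subtype.ext (map_add χ x y)
  commutes' r := Subtype.ext (χ.commutes r)

theorem rangeHom_surjective (χ : E →ₐ[Qv F] Qalg F) : Surjective (rangeHom χ) := by
  rintro ⟨-, x, rfl⟩
  exact ⟨x, rfl⟩

instance finite_rangeField (χ : E →ₐ[Qv F] Qalg F) : FD[rangeField χ] :=
  Module.Finite.of_surjective (rangeHom χ).toLinearMap (rangeHom_surjective χ)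

theorem exists_algHom_of_isMaximal (I : Ideal E) [I.IsMaximal] : ∃ χ : E →ₐ[Qv F] Qalg F, ∀ x, χ x =
    0 ↔ x ∈ I := by
  let _ : Field (E ⧸ I) := Ideal.Quotient.field I
  have : Module.Finite (Qv F) (E ⧸ I) :=
    Module.Finite.of_surjective (Ideal.Quotient.mkₐ (Qv F) I).toLinearMap
      (Ideal.Quotient.mkₐ_surjective (Qv F) I)
  let f : (E ⧸ I) →ₐ[Qv F] Qalg F := IsAlgClosed.lift
  refine ⟨f.comp (Ideal.Quotient.mkₐ (Qv F) I), fun x => ?_⟩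
  rw [AlgHom.comp_apply, map_eq_zero, Ideal.Quotient.mkₐ_eq_mk, Ideal.Quotient.eq_zero_iff_mem]

theorem isUnit_of_forall_algHom {x : E} (hx : ∀ χ : E →ₐ[Qv F] Qalg F, χ x ≠ 0) : IsUnit x := by
  by_contra h
  obtain ⟨I, hI, hxI⟩ := exists_max_ideal_of_mem_nonunits h
  obtain ⟨χ, hχ⟩ := exists_algHom_of_isMaximal (F := F) I
  exact hx χ ((hχ x).2 hxI)

theorem exists_max_norm_prod (L : ExtQ) [FD[L]]
    (hEL : ∀ (χ : E →ₐ[Qv F] Qalg F) (e : E), χ e ∈ L) (J : Set E) {c : (E →ₐ[Qv F] Qalg F) → ℝ}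
    (hc : ∀ χ, ∀ x ∈ J, ‖χ x‖ ≤ c χ) (hJ : ∃ x ∈ J, ∀ χ : E →ₐ[Qv F] Qalg F, χ x ≠ 0) : ∃ x : Eˣ,
    (x : E) ∈ J ∧ ∀ y ∈ J, ‖∏ χ : E →ₐ[Qv F] Qalg F, χ y‖ ≤ ‖∏ χ : E →ₐ[Qv F] Qalg F, χ x‖ := by
  obtain ⟨-, ⟨x₀, hxJ, rfl⟩, hx₀, hmax⟩ := exists_max_norm L
    ((fun x => ∏ χ : E →ₐ[Qv F] Qalg F, χ x) '' J)
    (by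
      rintro - ⟨x, -, rfl⟩
      exact prod_mem fun χ _ => hEL χ x)
    (by
      obtain ⟨x, hx, hx0⟩ := hJ
      exact ⟨_, ⟨x, hx, rfl⟩, prod_ne_zero_iff.2 fun χ _ => hx0 χ⟩)
    (∏ χ : E →ₐ[Qv F] Qalg F, c χ) (by
      rintro - ⟨x, hx, rfl⟩
      beta_reduce
      rw [norm_prod]
      exact Finset.prod_le_prod (fun _ _ => norm_nonneg _) fun χ _ => hc χ x hx)
  have hχ₀ : ∀ χ : E →ₐ[Qv F] Qalg F, χ x₀ ≠ 0 := fun χ =>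
    prod_ne_zero_iff.1 hx₀ χ (mem_univ χ)
  obtain ⟨x, rfl⟩ := isUnit_of_forall_algHom hχ₀
  exact ⟨x, hxJ, fun y hy => hmax _ ⟨y, hy, rfl⟩⟩

variable [IsSemisimpleRing E]

theorem eq_zero_of_forall_algHom {x : E} (hx : ∀ χ : E →ₐ[Qv F] Qalg F, χ x = 0) : x = 0 := by
  have h : x ∈ Ring.jacobson E := by
    rw [Ring.jacobson_eq_sInf_isMaximal]
    refine Ideal.mem_sInf.2 fun {I} hI => ?_
    have : I.IsMaximal := hI
    obtain ⟨χ, hχ⟩ := exists_algHom_of_isMaximal (F := F) I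
    exact (hχ x).1 (hx χ)
  rwa [IsSemisimpleRing.jacobson_eq_bot] at h

theorem isIntegral_of_forall_norm_le [Algebra (Av F) E] [IsScalarTower (Av F) (Qv F) E] {x : E}
    (hx : ∀ χ : E →ₐ[Qv F] Qalg F, ‖χ x‖ ≤ 1) : IsIntegral (Av F) x := by
  have hi : ∀ χ : E →ₐ[Qv F] Qalg F, IsIntegral (Av F) (χ x) := fun χ =>
    isIntegral_iff_norm_le_one.2 (hx χ)
  refine ⟨∏ χ : E →ₐ[Qv F] Qalg F, minpoly (Av F) (χ x),
    Polynomial.monic_prod_of_monic _ _ fun χ _ => minpoly.monic (hi χ), ?_⟩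
  apply eq_zero_of_forall_algHom (F := F)
  intro χ
  have h1 := aeval_algHom_apply (χ.restrictScalars (Av F)) x
    (∏ χ : E →ₐ[Qv F] Qalg F, minpoly (Av F) (χ x))
  refine h1.symm.trans ?_
  rw [map_prod]
  exact prod_eq_zero (mem_univ χ) (minpoly.aeval _ _)

omit [IsSemisimpleRing E] [Module.Finite (Qv F) E] in
theorem norm_eq_of_ker_le {χ χ' : E →ₐ[Qv F] Qalg F} (h : ∀ x, χ x = 0 → χ' x = 0) (x : E) :
    ‖χ' x‖ = ‖χ x‖ := by
  have hi : IsIntegral (Qv F) (χ x) := Algebra.IsIntegral.isIntegral _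
  have h1 : minpoly (Qv F) (χ x) = minpoly (Qv F) (χ' x) := by
    refine minpoly.eq_of_irreducible_of_monic (minpoly.irreducible hi) ?_ (minpoly.monic hi)
    rw [aeval_algHom_apply]
    apply h
    rw [← aeval_algHom_apply, minpoly.aeval]
  rw [norm_Qalg, norm_Qalg, spectralNorm, spectralNorm, h1]

theorem isSeparable_of_le {K L : ExtQ} [Sep[L]] (h : K ≤ L) :
    Sep[K] :=
  Algebra.IsSeparable.of_algHom (Qv F) L (IntermediateField.inclusion h)

theorem exists_norm_prod_lt [Algebra (Av F) E] [IsScalarTower (Av F) (Qv F) E]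
    {χ : E →ₐ[Qv F] Qalg F} [Sep[rangeField χ]] (x : Eˣ) {y : E}
    (hχ : 1 < ‖χ (y * (x⁻¹ : Eˣ))‖) : ∃ e : 𝓞v[E], ‖∏ χ' : E →ₐ[Qv F] Qalg F, χ' x‖ < ‖∏ χ' :
    E →ₐ[Qv F] Qalg F, χ' ((1 - e : 𝓞v[E]) * x + e * y)‖ := by
  obtain ⟨α, π, ϑ, hϑ⟩ := exists_isGood (rangeField χ)
  obtain ⟨e, θ, C⟩ := exists_isComponent (rangeHom_surjective χ) hϑ
  have he : (e : E) * e = e := congrArg Subtype.val C.idem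
  have hχ₀ : ∀ χ : E →ₐ[Qv F] Qalg F, χ x ≠ 0 := fun χ => (x.isUnit.map χ).ne_zero
  refine ⟨e, ?_⟩
  have h4 : ∀ χ' : E →ₐ[Qv F] Qalg F, χ' e = 0 ∨ χ' e = 1 := by
    intro χ'
    have h5 := congrArg χ' he
    rw [map_mul] at h5
    rcases eq_or_ne (χ' e) 0 with h6 | h6
    · exact Or.inl h6
    · exact Or.inr (mul_left_cancel₀ h6 (h5.trans (mul_one _).symm))
  have h5 : ∀ χ' : E →ₐ[Qv F] Qalg F, χ' e = 0 →
      ‖χ' (((1 - e : 𝓞v[E]) : E) * x + e * y)‖ = ‖χ' x‖ := by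
    intro χ' h6
    change ‖χ' ((1 - (e : E)) * x + e * y)‖ = _
    rw [map_add, map_mul, map_sub, map_one, map_mul, h6, sub_zero, one_mul, zero_mul, add_zero]
  have h6 : ∀ χ' : E →ₐ[Qv F] Qalg F, χ' e = 1 →
      ‖χ' x‖ < ‖χ' (((1 - e : 𝓞v[E]) : E) * x + e * y)‖ := by
    intro χ' h7
    have h8 : ∀ z, χ z = 0 → χ' z = 0 := by
      intro z hz
      have h9 := congrArg χ' (C.eq_zero z (Subtype.ext hz))
      rwa [map_mul, h7, one_mul, map_zero] at h9
    change _ < ‖χ' ((1 - (e : E)) * x + e * y)‖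
    rw [map_add, map_mul, map_sub, map_one, map_mul, h7, sub_self, one_mul, zero_mul, zero_add]
    have h9 : y = y * (x⁻¹ : Eˣ) * x := by rw [mul_assoc, Units.inv_mul, mul_one]
    conv_rhs => rw [h9]
    rw [map_mul χ' (y * _), norm_mul, norm_eq_of_ker_le h8 (y * (x⁻¹ : Eˣ))]
    exact lt_mul_of_one_lt_left (norm_pos_iff.2 (hχ₀ χ')) hχ
  rw [norm_prod, norm_prod]
  refine Finset.prod_lt_prod (fun χ' _ => norm_pos_iff.2 (hχ₀ χ')) (fun χ' _ => ?_)
    ⟨χ, mem_univ _, h6 χ (congrArg Subtype.val C.map_e)⟩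
  rcases h4 χ' with h7 | h7
  · exact (h5 χ' h7).ge
  · exact (h6 χ' h7).le

end semisimple

section generator
variable {L : ExtQ} {M : Type w} [AddCommGroup M] [Module (RX L) M] {S : LocalShtuka L M}
  {E : Type v} [CommRing E] [Algebra (Qv F) E] [Algebra (Av F) E] [IsScalarTower (Av F) (Qv F) E]
  (A : OEAction S E)

namespace OEAction

theorem toHomQv_apply (w : S.HomAv) (t : S.H1v) :
    toHomQv w t = algebraMap (Av F) (Qv F) (w t) := rfl

theorem toHomQv_comp (w : S.HomAv) (f : S.H1v →ₗ[Av F] S.H1v) :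
    toHomQv (w.comp f) = (toHomQv w).comp f := rfl

theorem toHomQv_add (w w' : S.HomAv) : toHomQv (w + w') = toHomQv w + toHomQv w' :=
  LinearMap.comp_add _ _ _

theorem toHomQv_injective : Injective (toHomQv (S := S)) := by
  intro w w' h
  ext1 t
  exact IsFractionRing.injective (Av F) (Qv F) (LinearMap.congr_fun h t)

omit [Algebra (Qv F) E] [IsScalarTower (Av F) (Qv F) E] in
theorem smul_comp_act (u : S.HomQv) (f : Av F) (a : 𝓞v[E]) : f • u.comp (A.actH1v a) =
    u.comp (A.actH1v (f • a)) := by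
  ext1 t
  have h1 : A.actHom (f • a) t = f • A.actHom a t := by
    rw [map_smul, LinearMap.smul_apply]
  change f • u (A.actHom a t) = u (A.actHom (f • a) t)
  rw [h1, map_smul]

omit [Algebra (Qv F) E] [IsScalarTower (Av F) (Qv F) E] in
theorem comp_act_comp_act (u : S.HomQv) (a b : 𝓞v[E]) : (u.comp (A.actH1v a)).comp (A.actH1v b) =
    u.comp (A.actH1v (a * b)) := by
  ext1 t
  change u (A.actH1v a (A.actH1v b t)) = u (A.actH1v (a * b) t)
  rw [A.actH1v_mul]

omit [Algebra (Qv F) E] [IsScalarTower (Av F) (Qv F) E] in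
theorem comp_act_add (u : S.HomQv) (a b : 𝓞v[E]) : u.comp (A.actH1v a) + u.comp (A.actH1v b) =
    u.comp (A.actH1v (a + b)) := by
  ext1 t
  change u (A.actH1v a t) + u (A.actH1v b t) = u (A.actH1v (a + b) t)
  rw [A.actH1v_add, map_add]

variable {A}

omit [Algebra (Qv F) E] [IsScalarTower (Av F) (Qv F) E] in
theorem IsMul.add {x y : E} {u w w' : S.HomQv} (h : A.IsMul x u w) (h' : A.IsMul y u w') :
    A.IsMul (x + y) u (w + w') := by
  obtain ⟨f, a, hf, hfa, hw⟩ := h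
  obtain ⟨g, b, hg, hgb, hw'⟩ := h'
  refine ⟨f * g, g • a + f • b, mul_ne_zero hf hg, ?_, ?_⟩
  · change g • (a : E) + f • (b : E) = _
    rw [hfa, hgb, smul_smul, smul_smul, mul_comm g f, smul_add]
  · rw [smul_add, mul_comm f g, mul_smul, hw, mul_comm g f, mul_smul, hw', A.smul_comp_act,
    A.smul_comp_act, A.comp_act_add]

omit [Algebra (Qv F) E] [IsScalarTower (Av F) (Qv F) E] in
theorem IsMul.comp_act {x : E} {u w : S.HomQv} (h : A.IsMul x u w) (c : 𝓞v[E]) :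
    A.IsMul (c * x) u (w.comp (A.actH1v c)) := by
  obtain ⟨f, a, hf, hfa, hw⟩ := h
  refine ⟨f, c * a, hf, ?_, ?_⟩
  · change (c : E) * a = _
    rw [hfa, mul_smul_comm]
  · rw [← LinearMap.smul_comp, hw, A.comp_act_comp_act, mul_comm]

omit [Algebra (Qv F) E] [IsScalarTower (Av F) (Qv F) E] in
theorem IsMul.unique {x : E} {u w w' : S.HomQv} (h : A.IsMul x u w) (h' : A.IsMul x u w') : w =
    w' := by
  obtain ⟨f, a, hf, hfa, hw⟩ := h
  obtain ⟨g, b, hg, hgb, hw'⟩ := h'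
  have hab : g • a = f • b := by
    apply Subtype.ext
    change g • (a : E) = f • (b : E)
    rw [hfa, hgb, smul_comm]
  have h1 : (f * g) • w = (f * g) • w' := by
    rw [mul_comm f g, mul_smul, hw, mul_comm g f, mul_smul, hw', A.smul_comp_act, A.smul_comp_act,
      hab]
  ext1 t
  have h2 := LinearMap.congr_fun h1 t
  rw [LinearMap.smul_apply, LinearMap.smul_apply] at h2
  exact smul_right_injective (Qv F) (mul_ne_zero hf hg) h2

variable (A)

variable [Module.Finite (Qv F) E]

theorem isMul_inv {x : Eˣ} {u w : S.HomQv} (h : A.IsMul x u w) : A.IsMul (x⁻¹ : Eˣ) w u := by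
  obtain ⟨g, b, hg, hgb, hgu⟩ := h
  obtain ⟨f, hf, hint⟩ : ∃ f : Av F, f ≠ 0 ∧ IsIntegral (Av F) (f • ((x⁻¹ : Eˣ) : E)) := by
    have : Algebra.IsAlgebraic (Av F) E := by
      have := IsFractionRing.comap_isAlgebraic_iff (A := Av F) (K := Qv F) (C := E)
      exact this.2 inferInstance
    exact (Algebra.IsAlgebraic.isAlgebraic (R := Av F) ((x⁻¹ : Eˣ) : E)).exists_integral_multiple
  refine ⟨f, ⟨_, hint⟩, hf, rfl, ?_⟩
  have h1 : g • (f • u) = g • (w).comp (A.actH1v ⟨_, hint⟩) := by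
    rw [← LinearMap.smul_comp, hgu, A.comp_act_comp_act]
    have h2 : b * ⟨_, hint⟩ = algebraMap (Av F) 𝓞v[E] (g * f) := by
      apply Subtype.ext
      change (b : E) * (f • ((x⁻¹ : Eˣ) : E)) = algebraMap (Av F) E (g * f)
      rw [hgb, smul_mul_smul_comm, Units.mul_inv, Algebra.algebraMap_eq_smul_one]
    rw [h2, smul_smul]
    ext1 t
    rw [LinearMap.comp_apply, A.actH1v_algebraMap, map_smul, LinearMap.smul_apply]
  ext1 t
  exact smul_right_injective (Qv F) hg (LinearMap.congr_fun h1 t)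

variable [IsSemisimpleRing E] [FD[L]] [Sep[L]]
  (hEL : ∀ (χ : E →ₐ[Qv F] Qalg F) (e : E), χ e ∈ L) {ι : Type*} [Fintype ι] [DecidableEq ι]
  (tc : Basis ι (SepRestr L) (BC (toSepRestr L) M)) (htc : ∀ l, S.convToSep (tc l) ∈ S.H1v)
  (hA : Injective A.act)
include hEL tc htc hA

theorem exists_norm_le_of_isMul {u : S.HomQv} (hu : A.IsEGenerator u) (χ : E →ₐ[Qv F] Qalg F) : ∃ c,
    ∀ (x : E) (w : S.HomAv), A.IsMul x u (toHomQv w) → ‖χ x‖ ≤ c := by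
  have hle : rangeField χ ≤ L := by
    rintro - ⟨x, rfl⟩
    exact hEL χ x
  have := isSeparable_of_le hle
  obtain ⟨α, π, ϑ, hϑ⟩ := exists_isGood (rangeField χ)
  obtain ⟨e, θ, C⟩ := exists_isComponent (rangeHom_surjective χ) hϑ
  obtain ⟨a₀, κ, ha₀, -, ⟨t, ht⟩, -, hrep⟩ := A.exists_kappa C tc htc hA hu
  refine ⟨(‖a₀‖ * ‖C.good.derivGen‖)⁻¹, fun x w hw => ?_⟩
  have h1 := norm_traceRep_mul_le A.actHom C (u := toHomQv w) (t := t) fun a => ⟨_, rfl⟩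
  rw [A.traceRep_of_isMul C hw, hrep, ht, mul_one, mul_assoc, norm_mul, norm_mul] at h1
  have h2 : 0 < ‖a₀‖ * ‖C.good.derivGen‖ :=
    mul_pos (norm_pos_iff.2 ha₀) (norm_pos_iff.2 C.good.derivGen_ne_zero)
  rw [← one_div, le_div_iff₀ h2]
  exact h1

omit hEL [Module.Finite (Qv F) E] [IsSemisimpleRing E] [FD[L]]
  [Sep[L]] hA in
theorem exists_isMul_smul (u : S.HomQv) : ∃ (f : Av F) (w : S.HomAv), f ≠ 0 ∧
    A.IsMul (algebraMap (Av F) E f) u (toHomQv w) := by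
  let b := LocalShtuka.h1vBasis tc htc
  obtain ⟨f, hf⟩ := IsLocalization.exist_integer_multiples_of_finite (nonZeroDivisors (Av F))
    fun i => u (b i)
  choose w hw using hf
  refine ⟨f, b.constr (Av F) w, nonZeroDivisors.ne_zero f.2, 1, algebraMap (Av F) _ (f : Av F),
    one_ne_zero, (one_smul _ _).symm, ?_⟩
  rw [one_smul]
  refine b.ext fun i => ?_
  rw [toHomQv_apply, b.constr_basis, hw, LinearMap.comp_apply, A.actH1v_algebraMap, map_smul]

/-- Every `E`-generator of the rational homology is a multiple of an `O_E`-generator of the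
integral homology. -/
theorem exists_isOEGenerator {u : S.HomQv} (hu : A.IsEGenerator u) : ∃ p : E × S.HomAv, IsUnit p.1 ∧
    A.IsOEGenerator p.2 ∧ A.IsMul p.1 (toHomQv p.2) u := by
  choose c hc using A.exists_norm_le_of_isMul hEL tc htc hA hu
  -- the norm is bounded on the elements `x` for which `x u` is integral
  obtain ⟨f, w₁, hf, hw₁⟩ := A.exists_isMul_smul tc htc u
  obtain ⟨x, ⟨u₀, hu₀⟩, hmax⟩ := exists_max_norm_prod L hEL
    {x | ∃ w : S.HomAv, A.IsMul x u (toHomQv w)} (fun χ x ⟨w, hw⟩ => hc χ x w hw)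
    ⟨_, ⟨w₁, hw₁⟩, fun χ => by
      have h1 : χ (algebraMap (Av F) E f) = algebraMap (Av F) (Qalg F) f :=
        (χ.restrictScalars (Av F)).commutes f
      rw [h1, IsScalarTower.algebraMap_apply (Av F) (Qv F) (Qalg F), Ne, map_eq_zero,
        IsFractionRing.to_map_eq_zero_iff]
      exact hf⟩
  have key : ∀ (y : E) (w : S.HomAv), A.IsMul y u (toHomQv w) →
      IsIntegral (Av F) (y * (x⁻¹ : Eˣ)) := by
    intro y w hw
    apply isIntegral_of_forall_norm_le (F := F)
    by_contra! hlt
    obtain ⟨χ, hχ⟩ := hlt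
    have hle : rangeField χ ≤ L := by
      rintro - ⟨x, rfl⟩
      exact hEL χ x
    have := isSeparable_of_le hle
    -- replacing the component of `x` at `χ` by the one of `y` increases the norm
    obtain ⟨e, he⟩ := exists_norm_prod_lt x hχ
    have h2 := (hu₀.comp_act (1 - e)).add (hw.comp_act e)
    rw [← toHomQv_comp, ← toHomQv_comp, ← toHomQv_add] at h2
    exact absurd (hmax _ ⟨_, h2⟩) (not_le.2 he)
  refine ⟨((x⁻¹ : Eˣ), u₀), (x⁻¹).isUnit, fun W => ?_, ?_⟩
  · obtain ⟨y, hy⟩ := hu (toHomQv W)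
    refine ⟨⟨_, key y W hy⟩, toHomQv_injective ?_⟩
    rw [toHomQv_comp]
    refine hy.unique ?_
    have h1 := hu₀.comp_act ⟨_, key y W hy⟩
    rwa [show ((⟨_, key y W hy⟩ : 𝓞v[E]) : E) * x = y by
      rw [mul_assoc, Units.inv_mul, mul_one]] at h1
  · exact A.isMul_inv hu₀

end OEAction
end generator

/-! ### Evaluation of power series -/

section evaluation

theorem constantCoeff_taylor {K : Type*} [NormedField K] [IsUltrametricDist K] [CompleteSpace K]
    (ξ : K) (f : Restr K ξ) : constantCoeff (taylor ξ f) = ∑' i, coeff i f.1 * ξ ^ i := by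
  rw [← coeff_zero_eq_constantCoeff_apply, coeff_taylor]
  simp only [taylorTerm, Nat.choose_zero_right, Nat.cast_one, one_mul, Nat.sub_zero]

theorem norm_constantCoeff_taylor_le {K : Type*} [NormedField K] [IsUltrametricDist K]
    [CompleteSpace K] (ξ : K) (f : Restr K ξ) {c : ℝ} (hc0 : 0 ≤ c)
    (hc : ∀ i, ‖coeff i f.1‖ * ‖ξ‖ ^ i ≤ c) : ‖constantCoeff (taylor ξ f)‖ ≤ c := by
  rw [constantCoeff_taylor]
  refine norm_tsum_le_of_forall_le_of_nonneg hc0 fun i => ?_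
  rw [norm_mul, norm_pow]
  exact hc i

/-- Continuous homomorphisms out of `A_v` that agree on `F` and at `z` are equal. -/
theorem Av_hom_ext {Ω : Type*} [NormedField Ω] {φ χ : Av F →+* Ω} (hφ : ∀ f, ‖φ f‖ ≤ 1)
    (hχ : ∀ f, ‖χ f‖ ≤ 1) (hX : ‖φ PowerSeries.X‖ < 1) (h1 : φ PowerSeries.X = χ PowerSeries.X)
    (h2 : ∀ a, φ (PowerSeries.C a) = χ (PowerSeries.C a)) : φ = χ := by
  ext f
  have hpoly : φ.comp coeToPowerSeries.ringHom = χ.comp coeToPowerSeries.ringHom := by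
    apply Polynomial.ringHom_ext
    · intro a
      simp only [RingHom.comp_apply, coeToPowerSeries.ringHom_apply, Polynomial.coe_C, h2]
    · simp only [RingHom.comp_apply, coeToPowerSeries.ringHom_apply, Polynomial.coe_X, h1]
  have hb : ∀ n : ℕ, ‖φ f - χ f‖ ≤ 2 * ‖φ PowerSeries.X‖ ^ n := by
    intro n
    have h3 := PowerSeries.eq_X_pow_mul_shift_add_trunc n f
    set r : PowerSeries F := PowerSeries.mk fun i => coeff (i + n) f
    have h4 : φ (trunc n f : PowerSeries F) = χ (trunc n f : PowerSeries F) :=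
      RingHom.congr_fun hpoly (trunc n f)
    have h5 : φ f - χ f = φ PowerSeries.X ^ n * (φ r - χ r) := by
      conv_lhs => rw [h3]
      rw [map_add, map_add, h4, map_mul, map_mul, map_pow, map_pow, ← h1]
      ring
    rw [h5, norm_mul, norm_pow, mul_comm]
    refine mul_le_mul_of_nonneg_right ((norm_sub_le _ _).trans ?_) (by positivity)
    linarith [hφ r, hχ r]
  have hlim := (tendsto_pow_atTop_nhds_zero_of_lt_one (norm_nonneg _) hX).const_mul 2
  rw [mul_zero] at hlim
  have := ge_of_tendsto' hlim hb
  exact sub_eq_zero.1 (norm_le_zero_iff.1 this)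

variable (L : ExtQ) [FD[L]]

theorem evalL_apply (f : RX L) : evalL L f = ∑' i, ι[L] (coeff i f) * zetaL L ^ i := by
  rw [evalL, RingHom.comp_apply, expL, RingHom.comp_apply, constantCoeff_taylor]
  congr 1

theorem norm_evalL_le (f : RX L) : ‖evalL L f‖ ≤ 1 := by
  rw [evalL_apply]
  refine norm_tsum_le_of_forall_le_of_nonneg zero_le_one fun i => ?_
  rw [norm_mul, norm_pow]
  exact mul_le_one₀ (norm_RL_le L _) (by positivity)
    (pow_le_one₀ (norm_nonneg _) (norm_zetaL_lt_one L).le)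

theorem evalL_C (r : RL L) : evalL L (PowerSeries.C r) = ι[L] r := by
  rw [evalL, RingHom.comp_apply, expL_C, constantCoeff_C]

theorem coefR_X : coefR L PowerSeries.X = zmz L + PowerSeries.C (zeta L) := by
  rw [coefR, coef, PowerSeries.map_X, zmz, sub_add_cancel]

theorem evalL_coefR (f : Av F) : evalL L (coefR L f) = ι[L] (algebraMap (Av F) (RL L) f) := by
  refine RingHom.congr_fun (f := (evalL L).comp (coefR L))
    (g := ι[L].comp (algebraMap (Av F) (RL L)))
    (Av_hom_ext (fun f => norm_evalL_le L _) (fun f => norm_RL_le L _) ?_ ?_ fun a => ?_) f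
  · rw [RingHom.comp_apply, coefR_X, map_add, evalL_zmz, zero_add, evalL_C]
    exact norm_zetaL_lt_one L
  · rw [RingHom.comp_apply, coefR_X, map_add, evalL_zmz, zero_add, evalL_C]
    rfl
  · rw [RingHom.comp_apply, coefR, coef, PowerSeries.map_C, evalL_C]
    rfl

/-- A power series over `R` that vanishes at `z = ζ` is divisible by `z - ζ`. -/
theorem exists_eq_zmz_mul {f : RX L} (hf : evalL L f = 0) : ∃ f', f = zmz L * f' := by
  -- the coefficients of the quotient are the tails `∑_j f_{k+1+j} ζ^j`
  let a : ℕ → L := fun i => ι[L] (coeff i f)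
  let t : ℕ → L := fun k => ∑' j, a (k + j) * zetaL L ^ j
  have hsum : ∀ k, Summable fun j => a (k + j) * zetaL L ^ j := by
    intro k
    refine Summable.of_norm_bounded (summable_geometric_of_lt_one (norm_nonneg (zetaL L))
      (norm_zetaL_lt_one L)) fun j => ?_
    rw [norm_mul, norm_pow]
    exact mul_le_of_le_one_left (by positivity) (norm_RL_le L _)
  have ht : ∀ k, t k = a k + zetaL L * t (k + 1) := by
    intro k
    have h1 := (hsum k).tsum_eq_zero_add
    simp only [t]
    rw [h1, add_zero, pow_zero, mul_one, ← tsum_mul_left]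
    congr 2
    ext j
    rw [show k + (j + 1) = k + 1 + j by omega, pow_succ, mul_comm _ (zetaL L), mul_left_comm]
  have hn : ∀ k, ‖t k‖ ≤ 1 := by
    intro k
    refine norm_tsum_le_of_forall_le_of_nonneg zero_le_one fun j => ?_
    rw [norm_mul, norm_pow]
    exact mul_le_one₀ (norm_RL_le L _) (by positivity)
      (pow_le_one₀ (norm_nonneg _) (norm_zetaL_lt_one L).le)
  have h0 : t 0 = 0 := by
    rw [← hf, evalL_apply]
    simp only [t, a, zero_add]
  have hmk : ∀ k, ι[L] (mkRL L (t k) (hn k)) = t k := fun _ => rfl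
  refine ⟨PowerSeries.mk fun k => mkRL L (t (k + 1)) (hn (k + 1)), ?_⟩
  ext n
  apply algebraMap_RL_injective L
  rw [zmz, sub_mul, map_sub, map_sub, PowerSeries.coeff_C_mul, coeff_mk, map_mul ι[L] (zeta L), hmk]
  have h2 := ht n
  change a n = _ - zetaL L * t (n + 1)
  rcases n with _ | n
  · rw [PowerSeries.coeff_zero_X_mul, map_zero, zero_sub]
    rw [h0] at h2
    exact eq_neg_of_add_eq_zero_left h2.symm
  · rw [PowerSeries.coeff_succ_X_mul, coeff_mk, hmk]
    exact eq_sub_of_add_eq h2.symm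

theorem exists_eq_zmz_pow_mul {f : RX L} {N : ℕ} {y : L⟦X⟧}
    (hf : expL L f = PowerSeries.X ^ N * y) : ∃ f', f = zmz L ^ N * f' ∧ expL L f' = y := by
  induction N generalizing f with
  | zero => exact ⟨f, by rw [pow_zero, one_mul], by rw [hf, pow_zero, one_mul]⟩
  | succ N ih =>
    have h0 : evalL L f = 0 := by
      rw [evalL, RingHom.comp_apply, hf, map_mul, map_pow, constantCoeff_X,
        zero_pow (Nat.succ_ne_zero N), zero_mul]
    obtain ⟨f', rfl⟩ := exists_eq_zmz_mul L h0
    rw [map_mul, expL_zmz, pow_succ', mul_assoc] at hf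
    obtain ⟨f'', rfl, h⟩ := ih (mul_left_cancel₀ PowerSeries.X_ne_zero hf)
    exact ⟨f'', by rw [pow_succ', mul_assoc], h⟩

theorem isUnit_RX_of_norm [Sep[L]] {f : RX L}
    (hf : ‖ι[L] (constantCoeff f)‖ = 1) : IsUnit f := by
  rw [isUnit_iff_constantCoeff, isUnit_RL_iff]
  exact hf

end evaluation

/-! ### The roots of the minimal polynomial over `L⟦z - ζ⟧` -/

section splitting
variable {L : ExtQ} [FD[L]] {ι : Type*} [Fintype ι]

/-- The polynomial `g` over `A_v` has over `L⟦z - ζ⟧` the roots `h_i`, which lift the distinct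
elements `c_i` of `R`; and `g(c_i)`, computed in `R⟦z⟧`, equals `z - ζ` up to a unit. -/
abbrev IsSplitting (g : (Av F)[X]) (c : ι → RL L) (h : ι → L⟦X⟧) : Prop :=
  (∀ i, constantCoeff (h i) = ι[L] (c i)) ∧ Injective c ∧
  (∀ i, ∃ u : (RX L)ˣ, (g.map (coefR L)).eval (PowerSeries.C (c i)) = zmz L * u) ∧
  g.map ((expL L).comp (coefR L)) = ∏ i, (X - C (h i))

/-- The roots `h_i` come from the `c_i` by Hensel's lemma over `L⟦z - ζ⟧`. The value `g(c_i)` vanishes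
at `z = ζ`, and is `z - ζ` up to a unit because of the size of its constant coefficient. -/
theorem exists_isSplitting [Sep[L]] {g : (Av F)[X]} (hg : g.Monic) {c : ι → RL L}
    (hc : Injective c)
    (hprod : g.map (algebraMap (Av F) (RL L)) = ∏ i, (X - C (c i)))
    (hnorm : ∀ i, ‖ι[L] ((g.map ((algebraMap (Av F) (RL L)).comp
      (PowerSeries.C.comp constantCoeff))).eval (c i))‖ = (qF : ℝ)⁻¹) :
    ∃ h : ι → L⟦X⟧, IsSplitting g c h := by
  classical
  set G := g.map ((expL L).comp (coefR L)) with hG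
  have hGm : G.Monic := hg.map _
  have hGc : G.map constantCoeff = ∏ i, (X - C (ι[L] (c i))) := by
    have h1 : G.map constantCoeff = (g.map (algebraMap (Av F) (RL L))).map ι[L] := by
      rw [hG, Polynomial.map_map, Polynomial.map_map]
      congr 1
      ext f
      exact congrArg Subtype.val (evalL_coefR L f)
    rw [h1, hprod, Polynomial.map_prod]
    simp only [Polynomial.map_sub, Polynomial.map_X, Polynomial.map_C]
  have hcL : Injective fun i => ι[L] (c i) := (algebraMap_RL_injective L).comp hc
  have hroot : ∀ i, ∃ r : L⟦X⟧, G.IsRoot r ∧ constantCoeff r = ι[L] (c i) := by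
    intro i
    have hev : ∀ (P : L⟦X⟧[X]) , constantCoeff
        (P.eval (PowerSeries.C (ι[L] (c i)))) =
        (P.map constantCoeff).eval (ι[L] (c i)) := by
      intro P
      rw [eval_map, ← eval₂_hom, constantCoeff_C]
    obtain ⟨r, hr, hrc⟩ := HenselianRing.is_henselian (I := Ideal.span {(PowerSeries.X : L⟦X⟧)})
      G hGm (PowerSeries.C (ι[L] (c i))) (by
        rw [Ideal.mem_span_singleton, X_dvd_iff, hev, hGc, eval_prod]
        refine prod_eq_zero (mem_univ i) ?_
        rw [eval_sub, eval_X, eval_C, sub_self])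
      (by
        refine IsUnit.map _ ?_
        rw [isUnit_iff_constantCoeff, hev, ← derivative_map, hGc, isUnit_iff_ne_zero]
        have h2 := Lagrange.eval_nodal_derivative_eval_node_eq (s := univ)
          (v := fun i => ι[L] (c i)) (mem_univ i)
        rw [Lagrange.eval_nodal] at h2
        refine h2.trans_ne (prod_ne_zero_iff.2 fun j hj => ?_)
        rw [sub_ne_zero]
        exact fun e => (ne_of_mem_erase hj) (hcL e).symm)
    refine ⟨r, hr, ?_⟩
    rw [Ideal.mem_span_singleton, X_dvd_iff, map_sub, constantCoeff_C, sub_eq_zero] at hrc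
    exact hrc
  choose h hh hhc using hroot
  have hinj : Injective h := fun i j hij => hcL (by
    simp only
    rw [← hhc, ← hhc, hij])
  refine ⟨h, hhc, hc, fun i => ?_, ?_⟩
  · -- the value `g(c_i)` vanishes at `z = ζ`, and its constant coefficient has norm `|ζ|`
    have hv0 : evalL L ((g.map (coefR L)).eval (PowerSeries.C (c i))) = 0 := by
      rw [← eval₂_hom, eval₂_map, evalL_C]
      have h1 : (evalL L).comp (coefR L) = ι[L].comp (algebraMap (Av F) (RL L)) :=
        RingHom.ext fun f => evalL_coefR L f
      rw [h1, ← eval₂_map, eval₂_hom, hprod, eval_prod, prod_eq_zero (mem_univ i), map_zero]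
      rw [eval_sub, eval_X, eval_C, sub_self]
    obtain ⟨u, hu⟩ := exists_eq_zmz_mul L hv0
    have h1 := congrArg constantCoeff hu
    rw [← eval₂_hom, eval₂_map, constantCoeff_C, map_mul, zmz, map_sub, constantCoeff_X,
      constantCoeff_C, zero_sub] at h1
    have h2 : (constantCoeff (R := RL L)).comp (coefR L) =
        (algebraMap (Av F) (RL L)).comp (PowerSeries.C.comp constantCoeff) := by
      ext f
      rw [RingHom.comp_apply, coefR, coef, ← coeff_zero_eq_constantCoeff_apply,
        PowerSeries.coeff_map, coeff_zero_eq_constantCoeff_apply]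
      rfl
    rw [h2, ← eval_map] at h1
    have h3 := hnorm i
    rw [h1, map_mul, map_neg, norm_mul, norm_neg] at h3
    change ‖zetaL L‖ * _ = _ at h3
    rw [norm_zetaL] at h3
    have h4 : IsUnit u := by
      apply isUnit_RX_of_norm
      have hq : ((qF : ℝ)⁻¹) ≠ 0 := by
        rw [← norm_zetaL L]
        exact norm_ne_zero_iff.2 (zetaL_ne_zero L)
      exact mul_left_cancel₀ hq (h3.trans (mul_one _).symm)
    obtain ⟨u, rfl⟩ := h4
    exact ⟨u, hu⟩
  · have hdeg : G.natDegree = Fintype.card ι := by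
      rw [← hGm.natDegree_map constantCoeff, hGc,
        Polynomial.natDegree_prod_of_monic _ _ fun i _ => monic_X_sub_C _]
      simp
    have hPm : (∏ i, (X - C (h i))).Monic :=
      Polynomial.monic_prod_of_monic _ _ fun i _ => monic_X_sub_C _
    have hPd : (∏ i, (X - C (h i))).natDegree = Fintype.card ι := by
      rw [Polynomial.natDegree_prod_of_monic _ _ fun i _ => monic_X_sub_C _]
      simp
    refine Polynomial.eq_of_degree_sub_lt_of_eval_index_eq univ (v := h) hinj.injOn ?_ ?_
    · have h1 := Polynomial.degree_sub_lt_left (p := G) (q := ∏ i, (X - C (h i)))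
        (by rw [degree_eq_natDegree hGm.ne_zero, degree_eq_natDegree hPm.ne_zero, hdeg,
          hPd]) hGm.ne_zero
        (by rw [hGm.leadingCoeff, hPm.leadingCoeff])
      rwa [degree_eq_natDegree hGm.ne_zero, hdeg] at h1
    · intro i _
      rw [hh i, eval_prod, prod_eq_zero (mem_univ i)]
      rw [eval_sub, eval_X, eval_C, sub_self]

namespace IsSplitting
variable {g : (Av F)[X]} {c : ι → RL L} {h : ι → L⟦X⟧} (H : IsSplitting g c h)
include H

theorem constantCoeff_eq (i : ι) : constantCoeff (h i) = ι[L] (c i) := H.1 i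

theorem injective : Injective c := H.2.1

theorem exists_unit (i : ι) :
    ∃ u : (RX L)ˣ, (g.map (coefR L)).eval (PowerSeries.C (c i)) = zmz L * u := H.2.2.1 i

theorem map_eq : g.map ((expL L).comp (coefR L)) = ∏ i, (X - C (h i)) := H.2.2.2

theorem isUnit_sub {i j : ι} (hij : i ≠ j) : IsUnit (h i - h j) := by
  rw [isUnit_iff_constantCoeff, map_sub, H.constantCoeff_eq, H.constantCoeff_eq, isUnit_iff_ne_zero,
    sub_ne_zero]
  exact fun e => hij (H.injective (algebraMap_RL_injective L e))

theorem isUnit_sub_C {i j : ι} (hij : i ≠ j) : IsUnit (h i - PowerSeries.C (ι[L] (c j))) := by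
  rw [isUnit_iff_constantCoeff, map_sub, H.constantCoeff_eq, constantCoeff_C, isUnit_iff_ne_zero,
    sub_ne_zero]
  exact fun e => hij (H.injective (algebraMap_RL_injective L e))

theorem eval_eq_zero (i : ι) : (g.map ((expL L).comp (coefR L))).eval (h i) = 0 := by
  rw [H.map_eq, eval_prod, prod_eq_zero (mem_univ i)]
  rw [eval_sub, eval_X, eval_C, sub_self]

theorem map_constantCoeff : (g.map ((expL L).comp (coefR L))).map constantCoeff = ∏ i,
    (X - C (ι[L] (c i))) := by
  rw [H.map_eq, Polynomial.map_prod]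
  simp only [Polynomial.map_sub, Polynomial.map_X, Polynomial.map_C, H.constantCoeff_eq]

/-- The factorization `(Y - c_i) Q_i = g - (z - ζ) u` over `R⟦z⟧` with a unit `u`. -/
theorem exists_factor (i : ι) : ∃ (Q : (RX L)[X]) (u : (RX L)ˣ), (X - C (PowerSeries.C (c i))) * Q =
    g.map (coefR L) - C (zmz L * u) := by
  obtain ⟨u, hu⟩ := H.exists_unit i
  have h1 : (X - C (PowerSeries.C (c i))) ∣
      g.map (coefR L) - C (zmz L * u) := by
    rw [Polynomial.dvd_iff_isRoot, IsRoot, eval_sub, eval_C, hu, sub_self]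
  obtain ⟨Q, hQ⟩ := h1
  exact ⟨Q, u, hQ.symm⟩

variable [DecidableEq ι]

theorem eval_factor {i : ι} {Q : (RX L)[X]} {u : (RX L)ˣ}
    (hQ : (X - C (PowerSeries.C (c i))) * Q = g.map (coefR L) - C (zmz L * u)) :
    (Q.map (evalL L)).eval (ι[L] (c i)) = ∏ j ∈ univ.erase i, (ι[L] (c i) - ι[L] (c j)) := by
  have h1 := congrArg (Polynomial.map (evalL L)) hQ
  rw [Polynomial.map_sub, Polynomial.map_C, map_mul, evalL_zmz, zero_mul, map_zero, sub_zero,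
    Polynomial.map_mul, Polynomial.map_sub, Polynomial.map_X, Polynomial.map_C, evalL_C,
    Polynomial.map_map] at h1
  have h2 : g.map ((evalL L).comp (coefR L)) = ∏ i, (X - C (ι[L] (c i))) := by
    rw [← H.map_constantCoeff, Polynomial.map_map]
    rfl
  rw [h2, ← Finset.mul_prod_erase _ _ (mem_univ i)] at h1
  rw [mul_left_cancel₀ (Polynomial.X_sub_C_ne_zero _) h1, eval_prod]
  simp only [eval_sub, eval_X, eval_C]

/-- The root `h_i` differs from the constant `c_i` by a uniformizer of `L⟦z - ζ⟧`, with leading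
coefficient the inverse of the derivative of `g`, up to a unit of `R`. -/
theorem exists_sub_C (i : ι) : ∃ (w : L⟦X⟧), h i - PowerSeries.C (ι[L] (c i)) = PowerSeries.X * w ∧
    IsUnit w ∧ ‖constantCoeff w * ∏ j ∈ univ.erase i, (ι[L] (c i) - ι[L] (c j))‖ = 1 := by
  obtain ⟨Q, u, hQ⟩ := H.exists_factor i
  have h0 : PowerSeries.X ∣ h i - PowerSeries.C (ι[L] (c i)) := by
    rw [X_dvd_iff, map_sub, H.constantCoeff_eq, constantCoeff_C, sub_self]
  obtain ⟨w, hw⟩ := h0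
  have h1 := congrArg (fun P => (Polynomial.map (expL L) P).eval (h i)) hQ
  simp only [Polynomial.map_sub, Polynomial.map_mul, Polynomial.map_X, Polynomial.map_C,
    Polynomial.map_map, eval_sub, eval_mul, eval_X, eval_C, map_mul, expL_zmz, expL_C,
    H.eval_eq_zero, zero_sub, hw] at h1
  rw [mul_assoc, ← mul_neg] at h1
  have h2 := mul_left_cancel₀ PowerSeries.X_ne_zero h1
  have h3 : IsUnit w := isUnit_of_mul_isUnit_left (h2 ▸ (u.isUnit.map (expL L)).neg)
  refine ⟨w, hw, h3, ?_⟩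
  have h4 := congrArg constantCoeff h2
  have h5 : constantCoeff ((Q.map (expL L)).eval (h i)) = (Q.map (evalL L)).eval (ι[L] (c i)) := by
    rw [← eval₂_hom, eval₂_map, H.constantCoeff_eq, eval_map]
    rfl
  rw [map_mul, h5, H.eval_factor hQ, map_neg] at h4
  rw [h4, norm_neg]
  change ‖evalL L u‖ = 1
  apply le_antisymm (norm_evalL_le L _)
  have h6 : evalL L (u : RX L) * evalL L ((u⁻¹ : (RX L)ˣ) : RX L) = 1 := by
    rw [← map_mul, Units.mul_inv, map_one]
  have h7 := congrArg norm h6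
  rw [norm_mul, norm_one] at h7
  rw [← h7]
  exact mul_le_of_le_one_right (norm_nonneg _) (norm_evalL_le L _)

/-- The polynomials that project to the eigenspaces for the roots `h_i`. -/
theorem exists_projectors [Nonempty ι] : ∃ P : ι → L⟦X⟧[X], ∑ i, P i = 1 ∧
    (∀ i, ∃ R : L⟦X⟧[X], (X - C (h i)) * P i = g.map ((expL L).comp (coefR L)) * R) ∧ ∀ i j,
    (P i).eval (h j) = if i = j then 1 else 0 := by
  have hu : ∀ i, IsUnit (∏ j ∈ univ.erase i, (h i - h j)) := fun i =>
    IsUnit.prod_iff.2 fun j hj => H.isUnit_sub (ne_of_mem_erase hj).symm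
  choose u hu using hu
  have hinj : Injective h := by
    intro i j hij
    by_contra hne
    have := (H.isUnit_sub hne).ne_zero
    exact this (sub_eq_zero.2 hij)
  have hev : ∀ i j, (C ((u i)⁻¹ : (L⟦X⟧)ˣ).1 * ∏ k ∈ univ.erase i, (X - C (h k))).eval (h j) =
      if i = j then 1 else 0 := by
    intro i j
    rw [eval_mul, eval_C, eval_prod]
    simp only [eval_sub, eval_X, eval_C]
    split_ifs with hij
    · subst hij
      rw [← hu, Units.inv_mul]
    · rw [prod_eq_zero (mem_erase.2 ⟨fun e => hij e.symm, mem_univ j⟩)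
        (sub_self _), mul_zero]
  refine ⟨fun i => C ((u i)⁻¹ : (L⟦X⟧)ˣ).1 * ∏ j ∈ univ.erase i, (X - C (h j)), ?_,
    fun i => ⟨C ((u i)⁻¹ : (L⟦X⟧)ˣ).1, ?_⟩, hev⟩
  · refine Polynomial.eq_of_degree_sub_lt_of_eval_index_eq univ (v := h) hinj.injOn ?_ ?_
    · rw [← Polynomial.mem_degreeLT]
      refine Submodule.sub_mem _ (Submodule.sum_mem _ fun i _ => ?_) ?_
      · rw [Polynomial.mem_degreeLT]
        refine (Polynomial.degree_le_natDegree.trans (Nat.cast_le.2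
          (Polynomial.natDegree_C_mul_le _ _))).trans_lt (Nat.cast_lt.2 ?_)
        rw [Polynomial.natDegree_prod_of_monic _ _ fun j _ => monic_X_sub_C _]
        simp only [Polynomial.natDegree_X_sub_C, Finset.sum_const, smul_eq_mul, mul_one]
        exact Finset.card_erase_lt_of_mem (mem_univ i)
      · rw [Polynomial.mem_degreeLT, Polynomial.degree_one]
        exact_mod_cast Finset.card_pos.2 Finset.univ_nonempty
    · intro j _
      rw [Polynomial.eval_finsetSum, Polynomial.eval_one]
      simp only [hev]
      rw [Finset.sum_ite_eq' univ j, if_pos (mem_univ _)]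
  · rw [H.map_eq, ← Finset.mul_prod_erase _ _ (mem_univ i)]
    ring

end IsSplitting
end splitting

/-! ### Operators on the base changes of a local shtuka -/

section operators

theorem aeval_apply_of_eigen {B V : Type*} [CommRing B] [AddCommGroup V] [Module B V] {T : End B V}
    {b : B} {w : V} (h : T w = b • w) (p : B[X]) : aeval T p w = p.eval b • w := by
  induction p using induction_on' with
  | add p q hp hq => rw [map_add, LinearMap.add_apply, hp, hq, Polynomial.eval_add, add_smul]
  | monomial n a =>
    have h1 : (T ^ n) w = b ^ n • w := by
      induction n with
      | zero => rw [pow_zero, pow_zero, one_smul, End.one_apply]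
      | succ n ih => rw [pow_succ', End.mul_apply, ih, map_smul, h, smul_smul, pow_succ]
    rw [aeval_monomial, End.mul_apply, h1, Polynomial.eval_monomial, algebraMap_end_apply,
      smul_smul]

theorem eq_zero_of_forall_X_pow {k V κ : Type*} [Field k] [AddCommGroup V] [Module k⟦X⟧ V]
    (b : Basis κ k⟦X⟧ V) {w : V} (hw : ∀ n : ℕ, ∃ v, w = (PowerSeries.X : k⟦X⟧) ^ n • v) : w =
    0 := by
  refine b.ext_elem fun i => ?_
  rw [map_zero, Finsupp.zero_apply]
  ext n
  obtain ⟨v, hv⟩ := hw (n + 1)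
  have h1 : (PowerSeries.X : k⟦X⟧) ^ (n + 1) ∣ b.repr w i :=
    ⟨b.repr v i, by rw [hv, map_smul, Finsupp.smul_apply, smul_eq_mul]⟩
  rw [PowerSeries.X_pow_dvd_iff.1 h1 n (Nat.lt_succ_self n), map_zero]

variable {L : ExtQ}

theorem exists_eq_zmz_pow_smul [FD[L]] {P V κ : Type*} [Fintype κ]
    [AddCommGroup P] [Module (RX L) P] [AddCommGroup V] [Module L⟦X⟧ V] (b : Basis κ (RX L) P)
    (b' : Basis κ L⟦X⟧ V) (j : P →ₛₗ[expL L] V) (hj : ∀ p i, b'.repr (j p) i = expL L (b.repr p i))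
    {p : P} {N : ℕ} {y : V} (h : j p = (PowerSeries.X : L⟦X⟧) ^ N • y) : ∃ p', p = zmz L ^ N • p' ∧
    j p' = y := by
  have h1 : ∀ i, expL L (b.repr p i) = PowerSeries.X ^ N * b'.repr y i := by
    intro i
    rw [← hj, h, map_smul, Finsupp.smul_apply, smul_eq_mul]
  choose f hf hfy using fun i => exists_eq_zmz_pow_mul L (h1 i)
  have h2 : ∀ i, b.repr (∑ i, f i • b i) i = f i := fun i => by
    rw [b.repr_sum_self]
  refine ⟨∑ i, f i • b i, b.ext_elem fun i => ?_, b'.ext_elem fun i => ?_⟩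
  · rw [map_smul, Finsupp.smul_apply, h2, hf, smul_eq_mul]
  · rw [hj, h2, hfy]

variable {M : Type w} [AddCommGroup M] [Module (RX L) M] {S : LocalShtuka L M} {E : Type v}
  [CommRing E] [Algebra (Av F) E] (A : OEAction S E)

namespace OEAction

/-- The action of `O_E` on a base change of `M`. -/
def actBC {B : Type*} [CommRing B] (f : RX L →+* B) : 𝓞v[E] →+* End B (BC f M) where
  toFun a := BC.map f (A.act a)
  map_one' := by
    apply BC.hom_ext
    intro m
    rw [BC.map_mk, map_one]
    rfl
  map_mul' a b := by
    apply BC.hom_ext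
    intro m
    rw [BC.map_mk, map_mul, End.mul_apply, End.mul_apply, BC.map_mk, BC.map_mk]
  map_zero' := by
    apply BC.hom_ext
    intro m
    rw [BC.map_mk, map_zero, LinearMap.zero_apply, LinearMap.zero_apply, map_zero]
  map_add' a b := by
    apply BC.hom_ext
    intro m
    rw [BC.map_mk, map_add, LinearMap.add_apply, LinearMap.add_apply, BC.map_mk, BC.map_mk, map_add]

variable {B : Type*} [CommRing B] (f : RX L →+* B)

theorem actBC_apply (a : 𝓞v[E]) : A.actBC f a = BC.map f (A.act a) := rfl

theorem actBC_mk (a : 𝓞v[E]) (m : M) : A.actBC f a (BC.mk f m) = BC.mk f (A.act a m) := BC.map_mk ..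

theorem actBC_algebraMap (r : Av F) : A.actBC f (algebraMap (Av F) _ r) =
    algebraMap B (End B (BC f M)) (f (coefR L r)) := by
  apply BC.hom_ext
  intro m
  rw [actBC_mk, A.act_algebraMap, map_smulₛₗ, algebraMap_end_apply]

theorem actBC_aeval (θ : 𝓞v[E]) (p : (Av F)[X]) : A.actBC f (aeval θ p) =
    aeval (A.actBC f θ) (p.map (f.comp (coefR L))) := by
  rw [aeval_def, hom_eval₂, aeval_def, eval₂_map]
  congr 1
  ext1 r
  exact A.actBC_algebraMap f r

theorem actBC_aeval_comm (a θ : 𝓞v[E]) (p : B[X]) (x : BC f M) :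
    A.actBC f a (aeval (A.actBC f θ) p x) = aeval (A.actBC f θ) p (A.actBC f a x) := by
  have h1 : Commute (A.actBC f a) (A.actBC f θ) := by
    change _ * _ = _ * _
    rw [← map_mul, mul_comm, map_mul]
  have h2 : Commute (A.actBC f a) (aeval (A.actBC f θ) p) :=
    Algebra.commute_of_mem_adjoin_singleton_of_commute
      (Polynomial.aeval_mem_adjoin_singleton B _) h1
  exact LinearMap.congr_fun h2 x

variable {C : Type*} [CommRing C] (g : B →+* C) (h : RX L →+* C) (hh : ∀ a, h a = g (f a))

theorem push_actBC (a : 𝓞v[E]) (x : BC f M) : BC.push f g h hh (A.actBC f a x) =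
    A.actBC h a (BC.push f g h hh x) :=
  BC.push_map f g h hh (A.act a) x

theorem push_aeval (θ : 𝓞v[E]) (p : B[X]) (x : BC f M) :
    BC.push f g h hh (aeval (A.actBC f θ) p x) =
    aeval (A.actBC h θ) (p.map g) (BC.push f g h hh x) := by
  induction p using induction_on' with
  | add p q hp hq =>
    rw [map_add, LinearMap.add_apply, map_add, hp, hq, Polynomial.map_add, map_add,
      LinearMap.add_apply]
  | monomial n a =>
    have h1 : BC.push f g h hh ((A.actBC f θ ^ n) x) = (A.actBC h θ ^ n) (BC.push f g h hh x) := by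
      rw [← map_pow, push_actBC, map_pow]
    rw [Polynomial.map_monomial, aeval_monomial, aeval_monomial, End.mul_apply, End.mul_apply,
      algebraMap_end_apply, algebraMap_end_apply, map_smulₛₗ, h1]

theorem tauB_actBC (hg : IsUnit (f (zmz L))) (a : 𝓞v[E])
    (x : BC (f.comp (sigma L)) M) :
    S.tauB f hg (A.actBC _ a x) = A.actBC f a (S.tauB f hg x) := A.tauB_comm f hg a x

theorem tauB_aeval (hg : IsUnit (f (zmz L))) (θ : 𝓞v[E]) (p : B[X]) (x : BC (f.comp (sigma L)) M) :
    S.tauB f hg (aeval (A.actBC _ θ) p x) = aeval (A.actBC f θ) p (S.tauB f hg x) := by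
  induction p using induction_on' with
  | add p q hp hq => rw [map_add, LinearMap.add_apply, map_add, hp, hq, map_add, LinearMap.add_apply]
  | monomial n a =>
    have h1 : S.tauB f hg ((A.actBC _ θ ^ n) x) = (A.actBC f θ ^ n) (S.tauB f hg x) := by
      rw [← map_pow, tauB_actBC, map_pow]
    rw [aeval_monomial, aeval_monomial, End.mul_apply, End.mul_apply, algebraMap_end_apply,
      algebraMap_end_apply, map_smul, h1]

end OEAction
end operators

/-! ### The eigenspaces of the de Rham realization -/

section eigenspaces
variable {L : ExtQ} [FD[L]] {M : Type w} [AddCommGroup M] [Module (RX L) M]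
  {S : LocalShtuka L M} {E : Type v} [CommRing E] [Algebra (Qv F) E] [Algebra (Av F) E]
  [IsScalarTower (Av F) (Qv F) E] (A : OEAction S E)

theorem expL_sigma_coefR : ((expL L).comp (sigma L)).comp (coefR L) = (expL L).comp (coefR L) := by
  ext1 f
  exact congrArg (expL L) (sigma_coefR L f)

/-- A component of `O_E` given by an idempotent `e` and an element `θ`, with a polynomial `g` of
which `θ` is a root in this component. -/
abbrev IsMonogenic (e θ : 𝓞v[E]) (g : (Av F)[X]) : Prop :=
  e * e = e ∧ e * aeval θ g = 0 ∧ ∀ a, ∃ p : (Av F)[X], e * a = e * aeval θ p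

theorem IsMonogenic.idem {e θ : 𝓞v[E]} {g : (Av F)[X]} (hm : IsMonogenic e θ g) : e * e = e := hm.1

theorem IsMonogenic.mul_aeval {e θ : 𝓞v[E]} {g : (Av F)[X]} (hm : IsMonogenic e θ g) :
    e * aeval θ g = 0 := hm.2.1

theorem IsMonogenic.exists_aeval {e θ : 𝓞v[E]} {g : (Av F)[X]} (hm : IsMonogenic e θ g) (a : 𝓞v[E]) :
    ∃ p : (Av F)[X], e * a = e * aeval θ p := hm.2.2 a

namespace OEAction
variable {e θ : 𝓞v[E]} {g : (Av F)[X]} (hm : IsMonogenic e θ g)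
include hm

theorem aeval_mul_map_eq_zero {B : Type*} [CommRing B] (f : RX L →+* B) (r : B[X]) {x : BC f M}
    (hx : A.actBC f e x = x) : aeval (A.actBC f θ) (g.map (f.comp (coefR L)) * r) x = 0 := by
  rw [map_mul, End.mul_apply, ← A.actBC_aeval, ← hx, ← A.actBC_aeval_comm, ← End.mul_apply,
    ← map_mul, mul_comm, hm.mul_aeval, map_zero, LinearMap.zero_apply]

theorem actBC_idem {B : Type*} [CommRing B] (f : RX L →+* B) (x : BC f M) :
    A.actBC f e (A.actBC f e x) = A.actBC f e x := by
  rw [← End.mul_apply, ← map_mul, hm.idem]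

theorem algHom_apply {φ : E →ₐ[Qv F] L} (hφ : φ e = 1) {a : 𝓞v[E]} {p : (Av F)[X]}
    (hp : e * a = e * aeval θ p) : φ a = p.eval₂ (algebraMap (Av F) L) (φ θ) := by
  have h1 := congrArg (fun x : 𝓞v[E] => φ x) hp
  have h2 : φ ((e * a : 𝓞v[E]) : E) = φ a := by
    have : φ ((e * a : 𝓞v[E]) : E) = φ e * φ a := map_mul φ _ _
    rw [this, hφ, one_mul]
  have h3 : φ ((e * aeval θ p : 𝓞v[E]) : E) = φ (aeval θ p : 𝓞v[E]) := by
    have : φ ((e * aeval θ p : 𝓞v[E]) : E) = φ e * φ (aeval θ p : 𝓞v[E]) := map_mul φ _ _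
    rw [this, hφ, one_mul]
  rw [← h2, h1, h3]
  have h4 := aeval_algHom_apply
    ((φ.restrictScalars (Av F)).comp 𝓞v[E].val) θ p
  exact h4.symm

variable {ι : Type*} [Fintype ι] {c : ι → RL L} {h : ι → L⟦X⟧} (H : IsSplitting g c h)
include H

/-- The `φ`-component of the de Rham realization is an eigenspace of `θ`. -/
theorem mem_Hpsi_iff {φ : E →ₐ[Qv F] L} (hφ : φ e = 1) {i : ι} (hφθ : φ θ = ι[L] (c i))
    (w : S.HdR) : w ∈ A.Hpsi φ ↔ A.actBC _ e w = w ∧ A.actBC _ θ w = h i • w := by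
  classical
  have := S.free
  have := S.finite
  set f := (expL L).comp (sigma L) with hf
  let b := BC.basis f (Free.chooseBasis (RX L) M)
  have : Nonempty ι := ⟨i⟩
  constructor
  · intro hw
    have he : A.actBC f e w = w := by
      have h1 : A.actBC f (1 - e) w = 0 := by
        apply eq_zero_of_forall_X_pow b
        intro n
        obtain ⟨k₀, hk⟩ := hw (1 - e) n
        obtain ⟨v, hv⟩ := hk (k₀ + 1) (Nat.le_succ _)
        refine ⟨v, ?_⟩
        have h2 : A.dev φ (1 - e) = A.actBC f (1 - e) := by
          have h3 : φ ((1 - e : 𝓞v[E]) : E) = 0 := by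
            have : φ ((1 - e : 𝓞v[E]) : E) = φ 1 - φ e := map_sub φ _ _
            rw [this, hφ, map_one, sub_self]
          rw [dev, h3, map_zero, zero_smul, sub_zero, actBC_apply]
        have h4 : (1 - e) ^ (k₀ + 1) = 1 - e := by
          have h5 : (1 - e) * (1 - e) = 1 - e := by
            rw [mul_sub, mul_one, sub_mul, one_mul, hm.idem, sub_self, sub_zero]
          exact IsIdempotentElem.pow_succ_eq k₀ h5
        rw [h2, ← map_pow, h4] at hv
        exact hv
      rw [map_sub, map_one, LinearMap.sub_apply, End.one_apply, sub_eq_zero] at h1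
      exact h1.symm
    refine ⟨he, ?_⟩
    obtain ⟨P, hP1, hPR, hPe⟩ := H.exists_projectors
    have heig : ∀ j, A.actBC f θ (aeval (A.actBC f θ) (P j) w) =
        h j • aeval (A.actBC f θ) (P j) w := by
      intro j
      obtain ⟨R, hR⟩ := hPR j
      rw [← expL_sigma_coefR] at hR
      have h1 := A.aeval_mul_map_eq_zero hm f R he
      rw [← hR, map_mul, End.mul_apply, map_sub, aeval_X, aeval_C, LinearMap.sub_apply,
        algebraMap_end_apply, sub_eq_zero] at h1
      exact h1
    have hz : ∀ j, j ≠ i → aeval (A.actBC f θ) (P j) w = 0 := by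
      intro j hj
      apply eq_zero_of_forall_X_pow b
      intro n
      obtain ⟨k, hk⟩ := hw θ n
      obtain ⟨v, hv⟩ := hk k le_rfl
      have h2 : A.dev φ θ ^ k = aeval (A.actBC f θ)
          ((X - C (PowerSeries.C (ι[L] (c i)))) ^ k) := by
        rw [map_pow, map_sub, aeval_X, aeval_C, dev, hφθ]
        rfl
      have h3 : aeval (A.actBC f θ) (P j) ((A.dev φ θ ^ k) w) =
          (h j - PowerSeries.C (ι[L] (c i))) ^ k •
            aeval (A.actBC f θ) (P j) w := by
        rw [h2, ← End.mul_apply, ← map_mul, mul_comm, map_mul, End.mul_apply,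
          aeval_apply_of_eigen (heig j), eval_pow, eval_sub, eval_X, eval_C]
      rw [hv, map_smul] at h3
      obtain ⟨u, hu⟩ := (H.isUnit_sub_C hj).pow k
      rw [← hu] at h3
      refine ⟨((u⁻¹ : (L⟦X⟧)ˣ) : L⟦X⟧) • aeval (A.actBC f θ) (P j) v, ?_⟩
      rw [smul_comm, h3, smul_smul, Units.inv_mul, one_smul]
    have hw' : w = aeval (A.actBC f θ) (P i) w := by
      have h1 : aeval (A.actBC f θ) (∑ j, P j) w = w := by
        rw [hP1, map_one, End.one_apply]
      rw [map_sum, LinearMap.sum_apply, sum_eq_single i] at h1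
      · exact h1.symm
      · exact fun j _ hj => hz j hj
      · exact fun h2 => absurd (mem_univ i) h2
    rw [hw']
    exact heig i
  · rintro ⟨he, hθ⟩ a n
    obtain ⟨p, hp⟩ := hm.exists_aeval a
    have h1 : A.actBC f a w = (p.map ((expL L).comp (coefR L))).eval (h i) • w := by
      rw [← aeval_apply_of_eigen hθ, ← expL_sigma_coefR, ← A.actBC_aeval]
      conv_lhs => rw [← he, ← End.mul_apply, ← map_mul, mul_comm, hp, mul_comm, map_mul,
        End.mul_apply, he]
    have h2 : PowerSeries.X ∣ (p.map ((expL L).comp (coefR L))).eval (h i) -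
        PowerSeries.C (φ a) := by
      rw [X_dvd_iff, map_sub, constantCoeff_C, algHom_apply hm hφ hp, ← eval₂_hom, eval₂_map,
        H.constantCoeff_eq, hφθ, sub_eq_zero]
      congr 1
      ext1 r
      exact evalL_coefR L r
    obtain ⟨r, hr⟩ := h2
    have h3 : ∀ k, (A.dev φ a ^ k) w = (PowerSeries.X * r) ^ k • w := by
      intro k
      induction k with
      | zero => rw [pow_zero, pow_zero, one_smul, End.one_apply]
      | succ k ih =>
        have h4 : A.dev φ a w = (PowerSeries.X * r) • w := by
          rw [← hr, sub_smul, ← h1]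
          rfl
        rw [pow_succ', End.mul_apply, ih, map_smul, h4, smul_smul, pow_succ]
    refine ⟨n, fun k hk => ⟨(PowerSeries.X ^ (k - n) * r ^ k) • w, ?_⟩⟩
    rw [h3, smul_smul, ← mul_assoc, ← pow_add, mul_pow, Nat.add_sub_cancel' hk]

omit H in
/-- The components of the de Rham realization that do not belong to `e` are annihilated by `e`. -/
theorem act_eq_zero_of_mem_Hpsi {φ : E →ₐ[Qv F] L} (hφ : φ e = 0) {w : S.HdR} (hw : w ∈ A.Hpsi φ) :
    A.actBC _ e w = 0 := by
  have := S.free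
  let b := BC.basis ((expL L).comp (sigma L)) (Free.chooseBasis (RX L) M)
  apply eq_zero_of_forall_X_pow b
  intro n
  obtain ⟨k₀, hk⟩ := hw e n
  obtain ⟨v, hv⟩ := hk (k₀ + 1) (Nat.le_succ _)
  refine ⟨v, ?_⟩
  have h2 : A.dev φ e = A.actBC _ e := by
    rw [dev, hφ, map_zero, zero_smul, sub_zero, actBC_apply]
  rw [h2, ← map_pow, IsIdempotentElem.pow_succ_eq k₀ hm.idem] at hv
  exact hv

end OEAction
end eigenspaces

/-! ### The relation between `M` and `σ̂^*M` given by the CM-type -/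

section relation
variable {L : ExtQ} {M : Type w} [AddCommGroup M] [Module (RX L) M] {S : LocalShtuka L M}
  {E : Type v} [CommRing E] [Algebra (Qv F) E] [Algebra (Av F) E] [IsScalarTower (Av F) (Qv F) E]
  (A : OEAction S E)

theorem zmz_ne_zero : zmz L ≠ 0 := by
  intro h
  have h1 := congrArg (coeff 1) h
  rw [zmz, map_sub, PowerSeries.coeff_one_X, PowerSeries.coeff_C, if_neg one_ne_zero, sub_zero,
    map_zero] at h1
  exact one_ne_zero h1

theorem LocalShtuka.TauRel.cancel {x : BC (sigma L) M} {y : M} {N : ℕ}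
    (h : S.TauRel (zmz L ^ N • x) (zmz L ^ N • y)) : S.TauRel x y := by
  unfold LocalShtuka.TauRel at *
  rw [map_smulₛₗ, map_smul, map_smulₛₗ (BC.mk (loc L)), map_pow] at h
  exact ((isUnit_loc L).pow N).smul_left_cancel.1 h

/-- The relation `τ(D(θ) e x) = (z - ζ)^N e m` is a correspondence between `σ̂^*M` and `M` that
is surjective on both sides. -/
structure TauCorr (e θ : 𝓞v[E]) (D : (RL L)[X]) (N : ℕ) : Prop where
  left : ∀ x : BC (sigma L) M, ∃ m : M, S.TauRel (aeval (A.actBC (sigma L) θ)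
    (D.map PowerSeries.C) (A.actBC (sigma L) e x)) (zmz L ^ N • A.act e m)
  right : ∀ m : M, ∃ x : BC (sigma L) M, S.TauRel (aeval (A.actBC (sigma L) θ)
    (D.map PowerSeries.C) (A.actBC (sigma L) e x)) (zmz L ^ N • A.act e m)

theorem push_smul_eq {A' B' C' : Type*} [CommRing A'] [CommRing B'] [CommRing C'] {P : Type*}
    [AddCommGroup P] [Module A' P] (f : A' →+* B') (g : B' →+* C') (h : A' →+* C')
    (hh : ∀ a, h a = g (f a)) (b : B') (x : BC f P) :
    BC.push f g h hh (b • x) = g b • BC.push f g h hh x := map_smulₛₗ _ _ _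

variable [FD[L]] {ι : Type*} [Fintype ι] {c : ι → RL L} {h : ι → L⟦X⟧}
  {g : (Av F)[X]}

/-- The polynomial `∏_i (Y - c_i)^{n_i}`. -/
def divisor (c : ι → RL L) (n : ι → ℕ) : (RL L)[X] := ∏ i, (X - C (c i)) ^ n i

/-- The polynomial `∏_i (Y - c_i)^{n_i}` is a divisor of a power of `z - ζ` modulo `g`. -/
theorem IsSplitting.exists_complement (H : IsSplitting g c h) (n : ι → ℕ) :
    ∃ (D' R : (RX L)[X]) (K : ℕ) (u : (RX L)ˣ), (divisor c n).map PowerSeries.C * D' =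
    C (zmz L ^ K * u) + g.map (coefR L) * R := by
  choose Q u hQ using H.exists_factor
  have h1 : ∀ s : Finset ι, ∃ (R : (RX L)[X]) (K : ℕ) (w : (RX L)ˣ),
      ∏ i ∈ s, ((X - C (PowerSeries.C (c i))) * Q i) ^ n i =
        C (zmz L ^ K * w) + g.map (coefR L) * R := by
    classical
    intro s
    induction s using Finset.induction_on with
    | empty => exact ⟨0, 0, 1, by simp⟩
    | insert i s hi ih =>
      obtain ⟨R, K, w, hR⟩ := ih
      have h2 : ∀ k : ℕ, ∃ R' : (RX L)[X], ((X - C (PowerSeries.C (c i))) * Q i) ^ k =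
          C ((zmz L * (-u i : (RX L)ˣ)) ^ k) + g.map (coefR L) * R' := by
        intro k
        obtain ⟨R', hR'⟩ := sub_dvd_pow_sub_pow
          ((X - C (PowerSeries.C (c i))) * Q i)
          (C (zmz L * (-u i : (RX L)ˣ))) k
        refine ⟨R', ?_⟩
        rw [map_pow, ← sub_eq_iff_eq_add', hR', hQ]
        congr 1
        rw [Units.val_neg, mul_neg, map_neg]
        ring
      obtain ⟨R', hR'⟩ := h2 (n i)
      refine ⟨C ((zmz L * (-u i : (RX L)ˣ)) ^ n i) * R + R' *
        (C (zmz L ^ K * w) + g.map (coefR L) * R), n i + K, (-u i) ^ n i * w, ?_⟩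
      rw [Finset.prod_insert hi, hR, hR', pow_add, Units.val_mul, Units.val_pow_eq_pow_val]
      simp only [map_mul, map_pow, mul_pow]
      ring
  obtain ⟨R, K, w, hR⟩ := h1 univ
  refine ⟨∏ i, Q i ^ n i, R, K, w, ?_⟩
  rw [← hR, divisor, Polynomial.map_prod, ← Finset.prod_mul_distrib]
  refine prod_congr rfl fun i _ => ?_
  rw [Polynomial.map_pow, Polynomial.map_sub, Polynomial.map_X, Polynomial.map_C, mul_pow]

theorem divisor_map_eval [DecidableEq ι] {k : Type*} [CommRing k] (f : RL L →+* k) (n : ι → ℕ)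
    (x : k) : ((divisor c n).map f).eval x = ∏ i, (x - f (c i)) ^ n i := by
  rw [divisor, Polynomial.map_prod, eval_prod]
  simp only [Polynomial.map_pow, Polynomial.map_sub, Polynomial.map_X, Polynomial.map_C, eval_pow,
    eval_sub, eval_X, eval_C]

theorem IsSplitting.exists_eval_divisor [DecidableEq ι] (H : IsSplitting g c h) (n : ι → ℕ) (i : ι) :
    ∃ u : (L⟦X⟧)ˣ, ((divisor c n).map ((PowerSeries.C (R := L)).comp ι[L])).eval
      (h i) = PowerSeries.X ^ n i * (u : L⟦X⟧) := by
  obtain ⟨w, hw, hwu, -⟩ := H.exists_sub_C i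
  have h1 : IsUnit (w ^ n i * ∏ j ∈ univ.erase i, (h i - PowerSeries.C (ι[L] (c j))) ^ n j) :=
    (hwu.pow (n i)).mul (IsUnit.prod_iff.2 fun j hj =>
      (H.isUnit_sub_C (ne_of_mem_erase hj).symm).pow (n j))
  refine ⟨h1.unit, ?_⟩
  rw [divisor_map_eval, ← Finset.mul_prod_erase _ _ (mem_univ i), IsUnit.unit_spec, ← mul_assoc,
    ← mul_pow, ← hw]
  rfl

end relation

section cmtype
variable {L : ExtQ} [FD[L]] {M : Type w} [AddCommGroup M] [Module (RX L) M]
  {S : LocalShtuka L M} {E : Type v} [CommRing E] [Algebra (Qv F) E] [Algebra (Av F) E]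
  [IsScalarTower (Av F) (Qv F) E] (A : OEAction S E) {e θ : 𝓞v[E]} {g : (Av F)[X]} {ι : Type*}
  [Fintype ι] {c : ι → RL L} {h : ι → L⟦X⟧}

namespace LocalShtuka

/-- The map `σ̂^*M → H^1_dR(M, L⟦z - ζ⟧)`. -/
def toHdR (_ : LocalShtuka L M) : BC (sigma L) M →ₛₗ[expL L] BC ((expL L).comp (sigma L)) M :=
  BC.push (sigma L) (expL L) ((expL L).comp (sigma L)) (fun _ => rfl)

theorem HdRtoLL_toHdR (x : BC (sigma L) M) : S.HdRtoLL (S.toHdR x) =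
    BC.push (sigma L) (expLL L) ((expLL L).comp (sigma L)) (fun _ => rfl) x :=
  BC.push_push _ _ _ _ _ _ _ (expLL L) (fun _ => rfl) x

theorem MtoLL_mk (m : M) : S.MtoLL (BC.mk (expL L) m) = BC.mk (expLL L) m := BC.push_mk ..

theorem MtoLL_smul (a : L⟦X⟧) (x : BC (expL L) M) :
    S.MtoLL (a • x) = ofPowerSeries ℤ L a • S.MtoLL x := map_smulₛₗ _ _ _

theorem HdRtoLL_smul (a : L⟦X⟧) (x : S.HdR) :
    S.HdRtoLL (a • x) = ofPowerSeries ℤ L a • S.HdRtoLL x := map_smulₛₗ _ _ _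

theorem HdRtoLL_actBC (A : OEAction S E) (a : 𝓞v[E]) (x : S.HdR) :
    S.HdRtoLL (A.actBC _ a x) = A.actBC _ a (S.HdRtoLL x) := A.push_actBC _ _ _ _ a x

theorem expLL_zmz_pow (K : ℕ) : expLL L (zmz L ^ K) = ofPowerSeries ℤ L (PowerSeries.X ^ K) := by
  rw [expLL, RingHom.comp_apply, map_pow, expL_zmz]

theorem ofPowerSeries_injective' : Injective (ofPowerSeries ℤ L) :=
  HahnSeries.ofPowerSeries_injective

theorem HdRtoLL_injective : Injective S.HdRtoLL := by
  have := S.free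
  exact BC.push_injective _ _ ofPowerSeries_injective' _ _
    (BC.basis _ (Free.chooseBasis (RX L) M))

theorem MtoLL_injective : Injective S.MtoLL := by
  have := S.free
  exact BC.push_injective _ _ ofPowerSeries_injective' _ _
    (BC.basis _ (Free.chooseBasis (RX L) M))

theorem exists_eq_of_toHdR {x : BC (sigma L) M} {N : ℕ} {y : S.HdR}
    (hx : S.toHdR x = (PowerSeries.X : L⟦X⟧) ^ N • y) : ∃ x', x = zmz L ^ N • x' ∧ S.toHdR x' =
    y := by
  have := S.free
  have := S.finite
  let b := BC.basis (sigma L) (Free.chooseBasis (RX L) M)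
  exact exists_eq_zmz_pow_smul b (BC.pushBasis _ _ _ (fun _ => rfl) b) S.toHdR
    (fun p i => BC.pushBasis_repr _ _ _ _ b p i) hx

theorem exists_eq_of_mk {x : M} {N : ℕ} {y : BC (expL L) M} (S : LocalShtuka L M)
    (hx : BC.mk (expL L) x = (PowerSeries.X : L⟦X⟧) ^ N • y) : ∃ x', x = zmz L ^ N • x' ∧
    BC.mk (expL L) x' = y := by
  have := S.free
  have := S.finite
  let b := Free.chooseBasis (RX L) M
  exact exists_eq_zmz_pow_smul b (BC.basis _ b) (BC.mk (expL L))
    (fun p i => BC.basis_repr_mk _ b p i) hx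

theorem zmz_pow_smul_cancel {x y : BC (sigma L) M} {N : ℕ} (S : LocalShtuka L M)
    (hxy : zmz L ^ N • x = zmz L ^ N • y) : x = y := by
  have := S.free
  let b := BC.basis (sigma L) (Free.chooseBasis (RX L) M)
  refine b.ext_elem fun i => ?_
  have h1 := congrArg (fun z => b.repr z i) hxy
  simp only [map_smul, Finsupp.smul_apply, smul_eq_mul] at h1
  exact mul_left_cancel₀ (pow_ne_zero _ zmz_ne_zero) h1

end LocalShtuka

namespace OEAction

theorem toHdR_actBC (a : 𝓞v[E]) (x : BC (sigma L) M) :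
    S.toHdR (A.actBC _ a x) = A.actBC _ a (S.toHdR x) := A.push_actBC _ _ _ _ a x

theorem toHdR_aeval (θ : 𝓞v[E]) (p : (RX L)[X]) (x : BC (sigma L) M) :
    S.toHdR (aeval (A.actBC _ θ) p x) =
      aeval (A.actBC _ θ) (p.map (expL L)) (S.toHdR x) := A.push_aeval _ _ _ _ θ p x

theorem expL_comp_C : (expL L).comp PowerSeries.C = PowerSeries.C.comp ι[L] :=
  RingHom.ext fun r => expL_C L r

variable (hm : IsMonogenic e θ g) (H : IsSplitting g c h)
include hm H

/-- `D(θ) e x` is a sum of eigenvectors, each divisible by the expected power of `z - ζ`. -/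
theorem exists_eigen_decomp [DecidableEq ι] [Nonempty ι] (n : ι → ℕ) (x : BC (sigma L) M) :
    ∃ v : ι → S.HdR, (∀ i, A.actBC ((expL L).comp (sigma L)) e (v i) = v i ∧
        A.actBC ((expL L).comp (sigma L)) θ (v i) = h i • v i) ∧
      S.toHdR (aeval (A.actBC (sigma L) θ)
        ((divisor c n).map PowerSeries.C) (A.actBC (sigma L) e x)) =
        ∑ i, (PowerSeries.X ^ n i : L⟦X⟧) • v i := by
  set Θ := A.actBC ((expL L).comp (sigma L)) θ
  obtain ⟨P, hP1, hPR, -⟩ := H.exists_projectors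
  choose u hu using H.exists_eval_divisor n
  set X := A.actBC _ e (S.toHdR x) with hX
  have hXe : A.actBC _ e X = X := A.actBC_idem hm _ _
  have heig : ∀ i, Θ (aeval Θ (P i) X) = h i • aeval Θ (P i) X := by
    intro j
    obtain ⟨R, hR⟩ := hPR j
    rw [← expL_sigma_coefR] at hR
    have h1 := A.aeval_mul_map_eq_zero hm _ R hXe
    rw [← hR, map_mul, End.mul_apply, map_sub, aeval_X, aeval_C, LinearMap.sub_apply,
      algebraMap_end_apply, sub_eq_zero] at h1
    exact h1
  refine ⟨fun i => (u i : L⟦X⟧) • aeval Θ (P i) X, fun i => ⟨?_, ?_⟩, ?_⟩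
  · rw [map_smul, A.actBC_aeval_comm, hXe]
  · rw [map_smul, heig, smul_comm]
  · rw [A.toHdR_aeval, A.toHdR_actBC, Polynomial.map_map, expL_comp_C]
    have h1 : X = ∑ i, aeval Θ (P i) X := by
      rw [← LinearMap.sum_apply, ← map_sum, hP1, map_one, End.one_apply]
    rw [← hX]
    conv_lhs => rw [h1, map_sum]
    refine sum_congr rfl fun i _ => ?_
    rw [aeval_apply_of_eigen (heig i), hu, mul_smul]

omit hm H in
theorem finsum_smul_extend [DecidableEq ι] (φ : ι → E →ₐ[Qv F] L) [Finite (E →ₐ[Qv F] L)]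
    [DecidableEq (E →ₐ[Qv F] L)] (d : (E →ₐ[Qv F] L) → ℤ) (v : ι → S.HdR) :
    (∑ᶠ χ, (single (-d χ) (1 : L) : L⸨X⸩) • S.HdRtoLL (∑ i, if φ i = χ then v i else 0)) = ∑ i,
    (single (-d (φ i)) (1 : L) : L⸨X⸩) • S.HdRtoLL (v i) := by
  have := Fintype.ofFinite (E →ₐ[Qv F] L)
  rw [finsum_eq_sum_of_fintype]
  simp only [map_sum, smul_sum]
  rw [sum_comm]
  refine sum_congr rfl fun i _ => ?_
  rw [sum_eq_single (φ i)]
  · rw [if_pos rfl]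
  · intro χ _ hχ
    rw [if_neg hχ.symm, map_zero, smul_zero]
  · exact fun h1 => absurd (mem_univ _) h1

omit hm H in
theorem ofPowerSeries_X_pow_mul_single {n N : ℕ} {d : ℤ} (hn : (n : ℤ) = N - d) :
    (ofPowerSeries ℤ L (PowerSeries.X ^ n)) = ofPowerSeries ℤ L (PowerSeries.X ^ N) *
    single (-d) (1 : L) := by
  rw [ofPowerSeries_X_pow, ofPowerSeries_X_pow, single_mul_single, mul_one, hn, sub_eq_add_neg]

theorem exists_tauB_sum_eq [DecidableEq ι] (φ : ι → E →ₐ[Qv F] L) (hφe : ∀ i, φ i e = 1)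
    (hφθ : ∀ i, φ i θ = ι[L] (c i)) [Finite (E →ₐ[Qv F] L)] {d : (E →ₐ[Qv F] L) → ℤ}
    (hd : A.HasCMType d) {n : ι → ℕ} {N : ℕ} (hn : ∀ i, (n i : ℤ) = N - d (φ i)) {v : ι → S.HdR}
    (hv : ∀ i, A.actBC ((expL L).comp (sigma L)) e (v i) = v i ∧
    A.actBC ((expL L).comp (sigma L)) θ (v i) = h i • v i) : ∃ y : BC (expL L) M,
    S.tauB (expLL L) (isUnit_expLL L) (S.HdRtoLL (∑ i, (PowerSeries.X ^ n i : L⟦X⟧) • v i)) =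
    S.MtoLL ((PowerSeries.X : L⟦X⟧) ^ N • y) := by
  classical
  have hw : ∀ χ, (∑ i, if φ i = χ then v i else 0) ∈ A.Hpsi χ := by
    intro χ
    refine Submodule.sum_mem _ fun i _ => ?_
    split_ifs with hi
    · rw [← hi, A.mem_Hpsi_iff hm H (hφe i) (hφθ i)]
      exact hv i
    · exact Submodule.zero_mem _
  obtain ⟨y, hy⟩ := (hd _).2 ⟨_, hw, rfl⟩
  have h3 : S.HdRtoLL (∑ i, (PowerSeries.X ^ n i : L⟦X⟧) • v i) =
      (ofPowerSeries ℤ L (PowerSeries.X ^ N)) •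
        ∑ᶠ χ, (single (-d χ) (1 : L) : L⸨X⸩) •
          S.HdRtoLL (∑ i, if φ i = χ then v i else 0) := by
    rw [finsum_smul_extend, map_sum, smul_sum]
    refine sum_congr rfl fun i _ => ?_
    rw [LocalShtuka.HdRtoLL_smul, smul_smul, ← ofPowerSeries_X_pow_mul_single (hn i)]
  refine ⟨y, ?_⟩
  rw [h3, map_smul, hy, LocalShtuka.MtoLL_smul]

omit H in
theorem exists_tauRel_of_tauB_eq {De : BC (sigma L) M} (he : A.actBC _ e De = De) {N : ℕ}
    {y : BC (expL L) M} (hy : S.tauB (expLL L) (isUnit_expLL L) (S.HdRtoLL (S.toHdR De)) =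
    S.MtoLL ((PowerSeries.X : L⟦X⟧) ^ N • y)) : ∃ m : M, S.TauRel De (zmz L ^ N • A.act e m) := by
  obtain ⟨K, hK⟩ := S.exists_tauRel_left
  obtain ⟨p, hp⟩ := hK De
  have hpe : S.TauRel (zmz L ^ K • De) (A.act e p) := by
    have h1 := hp.map A e
    have h2 : BC.map (sigma L) (A.act e) (zmz L ^ K • De) = zmz L ^ K • De := by
      rw [map_smul, ← actBC_apply, he]
    rwa [h2] at h1
  -- comparison over `L⸨z - ζ⸩`
  have h1 := hp.tauB (expLL L) (isUnit_expLL L)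
  rw [push_smul_eq, ← LocalShtuka.HdRtoLL_toHdR, map_smul, hy] at h1
  have h4 : BC.mk (expL L) p = (PowerSeries.X : L⟦X⟧) ^ (K + N) • y := by
    apply S.MtoLL_injective
    rw [LocalShtuka.MtoLL_mk, ← h1, LocalShtuka.expLL_zmz_pow, ← LocalShtuka.MtoLL_smul, smul_smul,
      ← pow_add]
  obtain ⟨m, rfl, -⟩ := S.exists_eq_of_mk h4
  refine ⟨m, ?_⟩
  rw [map_smul, pow_add, mul_smul] at hpe
  exact hpe.cancel

theorem exists_toHdR_eq_of_cmType [DecidableEq ι] (φ : ι → E →ₐ[Qv F] L)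
    (hφinj : Injective φ) (hφe : ∀ i, φ i e = 1)
    (hφ0 : ∀ χ : E →ₐ[Qv F] L, χ ∉ Set.range φ → χ e = 0)
    (hφθ : ∀ i, φ i θ = ι[L] (c i)) [Finite (E →ₐ[Qv F] L)]
    {d : (E →ₐ[Qv F] L) → ℤ} (hd : A.HasCMType d) {n : ι → ℕ} {N : ℕ}
    (hn : ∀ i, (n i : ℤ) = N - d (φ i)) (m : M) :
    ∃ (x'' : S.HdR) (K : ℕ) (x₁ : BC (sigma L) M), A.actBC _ e x'' = x'' ∧
      S.TauRel x₁ (zmz L ^ K • zmz L ^ N • A.act e m) ∧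
      S.toHdR x₁ = (PowerSeries.X ^ K : L⟦X⟧) • aeval (A.actBC _ θ)
        ((divisor c n).map (PowerSeries.C.comp ι[L])) x'' := by
  classical
  have := Fintype.ofFinite (E →ₐ[Qv F] L)
  set f := (expL L).comp (sigma L)
  set Θ := A.actBC f θ
  choose u hu using H.exists_eval_divisor n
  set x' := (S.tauB (expLL L) (isUnit_expLL L)).symm (BC.mk _ (A.act e m)) with hx'
  obtain ⟨w, hw, hxw⟩ := (hd x').1 ⟨BC.mk _ (A.act e m), by
    rw [hx', LinearEquiv.apply_symm_apply, LocalShtuka.MtoLL_mk]⟩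
  have hwi : ∀ i, A.actBC f e (w (φ i)) = w (φ i) ∧ Θ (w (φ i)) = h i • w (φ i) :=
    fun i => (A.mem_Hpsi_iff hm H (hφe i) (hφθ i) _).1 (hw _)
  have hex : A.actBC _ e x' = x' := by
    apply (S.tauB (expLL L) (isUnit_expLL L)).injective
    rw [A.tauB_actBC, hx', LinearEquiv.apply_symm_apply, actBC_mk, ← End.mul_apply, ← map_mul,
      hm.idem]
  set x'' : S.HdR := ∑ i, ((u i)⁻¹ : (L⟦X⟧)ˣ).1 • w (φ i) with hx''
  have hex'' : A.actBC f e x'' = x'' := by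
    rw [hx'', map_sum]
    refine sum_congr rfl fun i _ => ?_
    rw [map_smul, (hwi i).1]
  set Dp : L⟦X⟧[X] := (divisor c n).map (PowerSeries.C.comp ι[L]) with hDp
  have hDx : aeval Θ Dp x'' = ∑ i, (PowerSeries.X ^ n i : L⟦X⟧) • w (φ i) := by
    rw [hx'', map_sum]
    refine sum_congr rfl fun i _ => ?_
    rw [map_smul, aeval_apply_of_eigen (hwi i).2, hu, smul_smul, mul_left_comm, Units.inv_mul,
      mul_one]
  have hXx : (ofPowerSeries ℤ L (PowerSeries.X ^ N)) • x' = S.HdRtoLL (aeval Θ Dp x'') := by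
    rw [hDx, map_sum, ← hex, hxw, finsum_eq_sum_of_fintype, map_sum, smul_sum]
    rw [← Finset.sum_subset (Finset.subset_univ (univ.image φ)),
      Finset.sum_image fun i _ j _ hij => hφinj hij]
    · refine sum_congr rfl fun i _ => ?_
      rw [map_smul, ← LocalShtuka.HdRtoLL_actBC, (hwi i).1, LocalShtuka.HdRtoLL_smul, smul_smul]
      congr 1
      rw [ofPowerSeries_X_pow, ofPowerSeries_X_pow, single_mul_single, mul_one, hn, sub_eq_add_neg]
    · intro χ _ hχ
      have h1 : χ ∉ Set.range φ := by
        rintro ⟨i, rfl⟩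
        exact hχ (Finset.mem_image_of_mem _ (mem_univ i))
      rw [map_smul, ← LocalShtuka.HdRtoLL_actBC, A.act_eq_zero_of_mem_Hpsi hm (hφ0 χ h1) (hw χ),
        map_zero, smul_zero, smul_zero]
  obtain ⟨K, hK⟩ := S.exists_tauRel_right
  obtain ⟨x₁, hx₁⟩ := hK (zmz L ^ N • A.act e m)
  -- `x₁` corresponds to `(z - ζ)^K D(θ) x''`
  have h1 : S.toHdR x₁ = (PowerSeries.X ^ K : L⟦X⟧) • aeval Θ Dp x'' := by
    apply S.HdRtoLL_injective
    rw [LocalShtuka.HdRtoLL_toHdR]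
    apply (S.tauB (expLL L) (isUnit_expLL L)).injective
    rw [hx₁.tauB, LocalShtuka.HdRtoLL_smul, ← hXx, map_smulₛₗ (BC.mk (expLL L)),
      map_smulₛₗ (BC.mk (expLL L)), LocalShtuka.expLL_zmz_pow, LocalShtuka.expLL_zmz_pow]
    refine ((LinearEquiv.map_smul _ _ _).trans (congrArg _ ((LinearEquiv.map_smul _ _ _).trans
      (congrArg _ ?_)))).symm
    rw [hx', LinearEquiv.apply_symm_apply]
  exact ⟨x'', K, x₁, hex'', hx₁, h1⟩

theorem exists_tauRel_of_toHdR_eq {n : ι → ℕ} {N K : ℕ} {m : M} {x'' : S.HdR}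
    {x₁ : BC (sigma L) M} (hex'' : A.actBC _ e x'' = x'')
    (hx₁ : S.TauRel x₁ (zmz L ^ K • zmz L ^ N • A.act e m))
    (h1 : S.toHdR x₁ = (PowerSeries.X ^ K : L⟦X⟧) • aeval (A.actBC _ θ)
      ((divisor c n).map (PowerSeries.C.comp ι[L])) x'') :
    ∃ x : BC (sigma L) M, S.TauRel (aeval (A.actBC (sigma L) θ)
      ((divisor c n).map PowerSeries.C) (A.actBC (sigma L) e x)) (zmz L ^ N • A.act e m) := by
  set f := (expL L).comp (sigma L)
  set Θ := A.actBC f θ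
  set Dp : L⟦X⟧[X] := (divisor c n).map (PowerSeries.C.comp ι[L]) with hDp
  obtain ⟨D', R, K', u', hD'⟩ := H.exists_complement n
  have hDD : Dp * D'.map (expL L) = C (PowerSeries.X ^ K' * expL L u') +
      g.map (f.comp (coefR L)) * R.map (expL L) := by
    have h2 := congrArg (Polynomial.map (expL L)) hD'
    rw [Polynomial.map_mul, Polynomial.map_map, expL_comp_C, Polynomial.map_add, Polynomial.map_C,
      map_mul, map_pow, expL_zmz, Polynomial.map_mul, Polynomial.map_map] at h2
    rw [expL_sigma_coefR]
    exact h2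
  have h2 : S.toHdR (aeval (A.actBC (sigma L) θ) D' x₁) =
      (PowerSeries.X ^ (K + K') : L⟦X⟧) • (expL L u' • x'') := by
    rw [A.toHdR_aeval, h1, map_smul, ← End.mul_apply, ← map_mul, mul_comm, hDD, map_add,
      LinearMap.add_apply, A.aeval_mul_map_eq_zero hm f _ hex'', add_zero, aeval_C,
      algebraMap_end_apply, smul_smul, smul_smul, pow_add, mul_assoc]
  obtain ⟨x₂, hx₂, -⟩ := S.exists_eq_of_toHdR h2
  refine ⟨((u'⁻¹ : (RX L)ˣ) : RX L) • x₂, ?_⟩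
  apply LocalShtuka.TauRel.cancel (N := K)
  have h3 : zmz L ^ K • aeval (A.actBC (sigma L) θ)
      ((divisor c n).map PowerSeries.C) (A.actBC (sigma L) e (((u'⁻¹ : (RX L)ˣ) : RX L) • x₂)) =
      A.actBC (sigma L) e x₁ := by
    apply S.zmz_pow_smul_cancel (N := K')
    have h4 : zmz L ^ (K + K') • (A.actBC (sigma L) e x₂) =
        aeval (A.actBC (sigma L) θ) D' (A.actBC (sigma L) e x₁) := by
      rw [← map_smul, ← hx₂, A.actBC_aeval_comm]
    have hsc : (sigma L).comp (coefR L) = coefR L := by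
      ext1 r
      exact sigma_coefR L r
    have h5 := A.aeval_mul_map_eq_zero hm (sigma L) R (A.actBC_idem hm (sigma L) x₁)
    rw [hsc] at h5
    rw [smul_smul, ← pow_add, add_comm K' K, map_smul, map_smul, smul_comm, ← map_smul, h4,
      ← End.mul_apply, ← map_mul, hD', map_add, LinearMap.add_apply, h5, add_zero, aeval_C,
      algebraMap_end_apply, smul_smul, mul_left_comm, Units.inv_mul, mul_one]
  rw [h3]
  have h4 := hx₁.map A e
  rw [map_smul, map_smul, ← End.mul_apply, ← map_mul, hm.idem] at h4
  exact h4

/-- The Hodge-Pink lattice of a local shtuka with given CM-type, as a correspondence. -/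
theorem tauCorr_of_cmType [DecidableEq ι] [Nonempty ι] (φ : ι → E →ₐ[Qv F] L) (hφinj : Injective φ)
    (hφe : ∀ i, φ i e = 1) (hφ0 : ∀ χ : E →ₐ[Qv F] L, χ ∉ Set.range φ → χ e = 0)
    (hφθ : ∀ i, φ i θ = ι[L] (c i)) [Finite (E →ₐ[Qv F] L)] {d : (E →ₐ[Qv F] L) → ℤ}
    (hd : A.HasCMType d) {n : ι → ℕ} {N : ℕ} (hn : ∀ i, (n i : ℤ) = N - d (φ i)) :
    TauCorr A e θ (divisor c n) N where
  left x := by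
    obtain ⟨v, hv, hx⟩ := A.exists_eigen_decomp hm H n x
    obtain ⟨y, hy⟩ := A.exists_tauB_sum_eq hm H φ hφe hφθ hd hn hv
    rw [← hx] at hy
    exact A.exists_tauRel_of_tauB_eq hm (by rw [A.actBC_aeval_comm, A.actBC_idem hm]) hy
  right m := by
    obtain ⟨x'', K, x₁, hex, hx₁, h1⟩ :=
      A.exists_toHdR_eq_of_cmType hm H φ hφinj hφe hφ0 hφθ hd hn m
    exact A.exists_tauRel_of_toHdR_eq hm H hex hx₁ h1

end OEAction
end cmtype

/-! ### Evaluation at the powers of `ζ` -/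

section evaluation
variable (F) in
/-- The `q^n`-Frobenius of `ℂ_v`. -/
def frobC (n : ℕ) : Cv F →+* Cv F :=
  letI : Algebra (Av F) (Cv F) := ((toCv F).comp (algebraMap (Av F) (Qalg F))).toAlgebra
  frob (F := F) (Cv F) ^ n

theorem frobC_apply (n : ℕ) (x : Cv F) : frobC F n x = x ^ qF ^ n := by
  rw [frobC, RingHom.coe_pow]
  induction n generalizing x with
  | zero => simp
  | succ n ih =>
    rw [Function.iterate_succ_apply, ih]
    change (x ^ qF) ^ _ = _
    rw [← pow_mul, ← pow_succ']

variable (L : ExtQ)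

/-- The series over `L^sep` that converge at `s`. -/
def SepRestrAt (s : Cv F) : Subring (Lsep L)⟦X⟧ :=
  (Restr (Cv F) s).comap (PowerSeries.map (sepToC L))

/-- Evaluation at `s`. -/
def evAt (s : Cv F) : SepRestrAt L s →+* Cv F :=
  constantCoeff.comp ((taylor s).comp
    (((PowerSeries.map (sepToC L)).comp (SepRestrAt L s).subtype).codRestrict _ (fun f => f.2)))

theorem evAt_apply (s : Cv F) (f : SepRestrAt L s) : evAt L s f = ∑' i, sepToC L (coeff i f.1) *
    s ^ i :=
  constantCoeff_taylor s _

theorem norm_evAt_le (s : Cv F) (f : SepRestrAt L s) {c : ℝ} (hc0 : 0 ≤ c)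
    (hc : ∀ i, ‖sepToC L (coeff i f.1)‖ * ‖s‖ ^ i ≤ c) : ‖evAt L s f‖ ≤ c :=
  norm_constantCoeff_taylor_le s _ hc0 hc

theorem mem_SepRestrAt {s : Cv F} {f : (Lsep L)⟦X⟧} : f ∈ SepRestrAt L s ↔
    Tendsto (fun i => ‖sepToC L (coeff i f)‖ * ‖s‖ ^ i) atTop (𝓝 0) := by
  change PowerSeries.map (sepToC L) f ∈ Restr (Cv F) s ↔ _
  rw [mem_Restr]
  simp only [PowerSeries.coeff_map]

theorem SepRestr_le {s : Cv F} (hs : ‖s‖ ≤ ‖zetaC L‖) : SepRestr L ≤ SepRestrAt L s := by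
  intro f hf
  change f ∈ SepRestrAt L (zetaC L) at hf
  rw [mem_SepRestrAt] at hf ⊢
  refine squeeze_zero (fun _ => by positivity) (fun n => ?_) hf
  gcongr

/-- The map `∑ b_i z^i ↦ ∑ b_i^q z^i`, from the series that converge at `s` to those that converge
at `s^q`. -/
def frobAt (s : Cv F) : SepRestrAt L s →+* SepRestrAt L (s ^ qF) :=
  ((sigmaSep L).comp (SepRestrAt L s).subtype).codRestrict _ (fun f => by
    have hf := (mem_SepRestrAt L).1 f.2
    rw [mem_SepRestrAt]
    have h1 := hf.pow (qF)
    rw [zero_pow Fintype.card_ne_zero] at h1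
    refine h1.congr fun i => ?_
    rw [mul_pow, norm_pow, ← pow_mul, ← pow_mul, mul_comm i]
    congr 1
    rw [← norm_pow, ← map_pow]
    rfl)

theorem evAt_frobAt (s : Cv F) (f : SepRestrAt L s) : evAt L (s ^ qF) (frobAt L s f) =
    evAt L s f ^ qF := by
  have hsum : Summable fun i => sepToC L (coeff i f.1) * s ^ i := by
    have h1 := (mem_SepRestrAt L).1 f.2
    refine NonarchimedeanAddGroup.summable_of_tendsto_cofinite_zero ?_
    rw [Nat.cofinite_eq_atTop, tendsto_zero_iff_norm_tendsto_zero]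
    refine h1.congr fun i => ?_
    rw [norm_mul, norm_pow]
  have h2 : ∀ x : Cv F, frobC F 1 x = x ^ qF := fun x => by
    rw [frobC_apply, pow_one]
  have hc : Continuous (frobC F 1) := by
    have h3 : ⇑(frobC F 1) = fun x => x ^ qF := funext h2
    rw [h3]
    fun_prop
  rw [evAt_apply, evAt_apply]
  refine Eq.trans (tsum_congr fun i => ?_) ((hsum.map_tsum _ hc).symm.trans (h2 _))
  rw [map_mul, h2, h2, ← map_pow, ← pow_mul, ← pow_mul, mul_comm i]
  rfl

/-- The point `ζ^{q^n}`. -/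
def zetaPow (n : ℕ) : Cv F := zetaC L ^ qF ^ n

theorem norm_zetaPow_le (n : ℕ) : ‖zetaPow L n‖ ≤ ‖zetaC L‖ := by
  rw [zetaPow, norm_pow]
  exact pow_le_of_le_one (norm_nonneg _) (norm_zetaC_lt_one L).le
    (pow_ne_zero _ Fintype.card_ne_zero)

theorem zetaPow_succ (n : ℕ) : zetaPow L (n + 1) = zetaPow L n ^ qF := by
  rw [zetaPow, zetaPow, ← pow_mul, ← pow_succ]

/-- Evaluation of a series over `L^sep` at `ζ^{q^n}`. -/
def evSep (n : ℕ) : SepRestr L →+* Cv F :=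
  (evAt L (zetaPow L n)).comp (Subring.inclusion (SepRestr_le L (norm_zetaPow_le L n)))

theorem evSep_apply (n : ℕ) (f : SepRestr L) : evSep L n f =
    evAt L (zetaPow L n) ⟨f.1, SepRestr_le L (norm_zetaPow_le L n) f.2⟩ := rfl

theorem exists_norm_evSep_le (f : SepRestr L) : ∃ c : ℝ, 0 < c ∧ ∀ n, ‖evSep L n f‖ ≤ c := by
  have hf : f.1 ∈ SepRestrAt L (zetaC L) := f.2
  obtain ⟨c, hc⟩ := ((mem_SepRestrAt L).1 hf).bddAbove_range
  have hc' : ∀ i, ‖sepToC L (coeff i f.1)‖ * ‖zetaC L‖ ^ i ≤ c := fun i => hc ⟨i, rfl⟩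
  refine ⟨max c 1, lt_of_lt_of_le one_pos (le_max_right _ _), fun n => ?_⟩
  rw [evSep_apply]
  refine norm_evAt_le L _ _ (le_trans zero_le_one (le_max_right _ _)) fun i => ?_
  refine le_trans (mul_le_mul_of_nonneg_left ?_ (norm_nonneg _)) (le_max_of_le_left (hc' i))
  exact pow_le_pow_left₀ (norm_nonneg _) (norm_zetaPow_le L n) i

/-- Evaluation of a series over `R` at `ζ^{q^n}`. -/
def evR (n : ℕ) : RX L →+* Cv F := (evSep L n).comp (toSepRestr L)

theorem evR_apply (n : ℕ) (f : RX L) : evR L n f = ∑' i, toCv F (ι[L] (coeff i f) : L) *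
    zetaPow L n ^ i :=
  evAt_apply L _ _

theorem norm_evR_le (n : ℕ) (f : RX L) : ‖evR L n f‖ ≤ 1 := by
  refine norm_evAt_le L _ _ zero_le_one fun i => ?_
  have h1 : ‖sepToC L (coeff i ((toSepRestr L f).1))‖ ≤ 1 := by
    change ‖toCv F ((ι[L] (coeff i f) : L) : Qalg F)‖ ≤ 1
    rw [norm_toCv]
    exact norm_RL_le L _
  have h2 : ‖zetaPow L n‖ ^ i ≤ 1 := pow_le_one₀ (norm_nonneg _)
    ((norm_zetaPow_le L n).trans (norm_zetaC_lt_one L).le)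
  exact mul_le_one₀ h1 (by positivity) h2

theorem evR_C (n : ℕ) (r : RL L) : evR L n (PowerSeries.C r) = toCv F (ι[L] r : L) := by
  rw [evR_apply, tsum_eq_single 0]
  · simp
  · intro i hi
    rw [PowerSeries.coeff_C, if_neg hi]
    simp

theorem evR_X (n : ℕ) : evR L n PowerSeries.X = zetaPow L n := by
  rw [evR_apply, tsum_eq_single 1]
  · simp
  · intro i hi
    rw [PowerSeries.coeff_X, if_neg hi]
    simp

theorem evR_zmz (n : ℕ) : evR L n (zmz L) = zetaPow L n - zetaC L := by
  rw [zmz, map_sub, evR_X, evR_C]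
  rfl

theorem evR_coefR (n : ℕ) (f : Av F) : evR L n (coefR L f) =
    frobC F n (toCv F (algebraMap (Av F) (Qalg F) f)) := by
  have h : (evR L n).comp (coefR L) =
      (frobC F n).comp ((toCv F).comp (algebraMap (Av F) (Qalg F))) := by
    refine Av_hom_ext (fun f => norm_evR_le L n _) (fun f => ?_) ?_ ?_ fun a => ?_
    · rw [RingHom.comp_apply, frobC_apply, norm_pow, RingHom.comp_apply, norm_toCv]
      exact pow_le_one₀ (norm_nonneg _) (norm_of_isIntegral F isIntegral_algebraMap)
    · rw [RingHom.comp_apply, coefR, coef, PowerSeries.map_X, evR_X]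
      exact (norm_zetaPow_le L n).trans_lt (norm_zetaC_lt_one L)
    · rw [RingHom.comp_apply, coefR, coef, PowerSeries.map_X, evR_X, RingHom.comp_apply,
      frobC_apply, zetaPow, zetaC, zetaL, zeta]
      rfl
    · have h1 : ∀ m : ℕ, a ^ qF ^ m = a := fun m => FiniteField.pow_card_pow m a
      rw [RingHom.comp_apply, coefR, coef, PowerSeries.map_C, evR_C]
      change _ = frobC F n (toCv F (algebraMap (Av F) (Qalg F) (PowerSeries.C a)))
      rw [frobC_apply, ← map_pow, ← map_pow, ← map_pow, h1]
      rfl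
  exact RingHom.congr_fun h f

end evaluation

/-! ### The functionals on `M` attached to an eigenvector of the Tate module -/

theorem apply_eq_mul_of_basis {R V R' ι : Type*} [CommRing R] [CommRing R'] [AddCommGroup V]
    [Module R V] (b : Basis ι R V) (T : End R V) {χ : R →+* R'} (f : V →ₛₗ[χ] R') (t : R')
    (h : ∀ l, f (T (b l)) = t * f (b l)) (x : V) : f (T x) = t * f x := by
  have h1 : f.comp T = t • f := b.ext h
  exact LinearMap.congr_fun h1 x

section functional
variable {L K : ExtQ} {M : Type w} [AddCommGroup M] [Module (RX L) M] {S : LocalShtuka L M}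
  {E : Type v} [CommRing E] [Algebra (Qv F) E] [Algebra (Av F) E] [IsScalarTower (Av F) (Qv F) E]
  (A : OEAction S E) {ι : Type*} [Fintype ι] [DecidableEq ι]
  (tc : Basis ι (SepRestr L) (BC (toSepRestr L) M))

/-- The semilinear functional with given values on a basis. -/
def functional {R' : Type*} [CommRing R'] (χ : SepRestr L →+* R') (k : ι → R') :
    BC (toSepRestr L) M →ₛₗ[χ] R' where
  toFun x := ∑ l, χ (tc.repr x l) * k l
  map_add' x y := by
    simp only [map_add, Finsupp.add_apply, add_mul, sum_add_distrib]
  map_smul' a x := by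
    simp only [map_smul, Finsupp.smul_apply, smul_eq_mul, map_mul, mul_assoc, mul_sum]

theorem functional_apply {R' : Type*} [CommRing R'] (χ : SepRestr L →+* R') (k : ι → R')
    (x : BC (toSepRestr L) M) : functional tc χ k x = ∑ l, χ (tc.repr x l) * k l := rfl

theorem functional_basis {R' : Type*} [CommRing R'] (χ : SepRestr L →+* R') (k : ι → R') (l : ι) :
    functional tc χ k (tc l) = k l := by
  rw [functional_apply, sum_eq_single l]
  · rw [tc.repr_self, Finsupp.single_eq_same, map_one, one_mul]
  · intro j _ hj
    rw [tc.repr_self, Finsupp.single_eq_of_ne hj, map_zero, zero_mul]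
  · exact fun h => absurd (mem_univ _) h

variable (htc : ∀ l, S.convToSep (tc l) ∈ S.H1v)

theorem act_frame (a : 𝓞v[E]) (l : ι) : A.actBC (toSepRestr L) a (tc l) = ∑ j, toSepRestr L (coefR L
      ((LocalShtuka.h1vBasis tc htc).repr (A.actH1v a (LocalShtuka.h1vBasis tc htc l)) j)) •
        tc j := by
  apply LocalShtuka.convToSep_injective (S := S) tc
  have h1 : A.actH1v a (LocalShtuka.h1vBasis tc htc l) = ∑ j,
      ((LocalShtuka.h1vBasis tc htc).repr (A.actH1v a (LocalShtuka.h1vBasis tc htc l)) j) •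
        LocalShtuka.h1vBasis tc htc j := ((LocalShtuka.h1vBasis tc htc).sum_repr _).symm
  have h2 := congrArg (Submodule.subtype S.H1v) h1
  rw [map_sum] at h2
  rw [map_sum]
  have h3 : (A.actH1v a (LocalShtuka.h1vBasis tc htc l)).1 =
      BC.map _ (A.act a) (S.convToSep (tc l)) := by
    rw [LocalShtuka.h1vBasis_apply]
    rfl
  refine (A.push_actBC _ _ _ _ a (tc l)).trans ?_
  rw [OEAction.actBC_apply]
  refine h3.symm.trans (h2.trans (sum_congr rfl fun j _ => ?_))
  rw [map_smul]
  refine Eq.trans ?_ (push_smul_eq _ _ _ _ _ _).symm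
  have h4 : S.H1v.subtype (LocalShtuka.h1vBasis tc htc j) = S.convToSep (tc j) := by
    rw [LocalShtuka.h1vBasis_apply]
    rfl
  rw [h4]
  rfl

variable {ρ : E →ₐ[Qv F] K} {κ : S.H1v →ₗ[Av F] K} (hκa : ∀ a t, κ (A.actHom a t) = ρ a * κ t)
include hκa

theorem functional_act {R' : Type*} [CommRing R'] {χ : SepRestr L →+* R'} {j : K →+* R'}
    (hj : ∀ f : Av F, j (algebraMap (Av F) K f) = χ (toSepRestr L (coefR L f))) (a : 𝓞v[E])
    (x : BC (toSepRestr L) M) :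
    functional tc χ (fun l => j (κ (LocalShtuka.h1vBasis tc htc l))) (A.actBC (toSepRestr L) a x) =
    j (ρ a) * functional tc χ (fun l => j (κ (LocalShtuka.h1vBasis tc htc l))) x := by
  have h1 : ∀ l, functional tc χ (fun l => j (κ (LocalShtuka.h1vBasis tc htc l)))
      (A.actBC (toSepRestr L) a (tc l)) = j (ρ a) * j (κ (LocalShtuka.h1vBasis tc htc l)) := by
    intro l
    rw [act_frame A tc htc, map_sum, ← map_mul, ← hκa, OEAction.actHom_apply]
    conv_rhs => rw [← (LocalShtuka.h1vBasis tc htc).sum_repr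
      (A.actH1v a (LocalShtuka.h1vBasis tc htc l)), map_sum, map_sum]
    refine sum_congr rfl fun i _ => ?_
    rw [map_smulₛₗ, functional_basis, smul_eq_mul, map_smul, smul_def, map_mul, hj]
  exact apply_eq_mul_of_basis tc _ _ _ (fun l => (h1 l).trans (by rw [functional_basis])) x

end functional

theorem apply_aeval_of_eigen {R V R' : Type*} [CommRing R] [CommRing R'] [AddCommGroup V]
    [Module R V] {T : End R V} {χ : R →+* R'} {f : V →ₛₗ[χ] R'} {t : R'}
    (h : ∀ x, f (T x) = t * f x) (p : R[X]) (x : V) : f (aeval T p x) = p.eval₂ χ t * f x := by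
  induction p using induction_on' with
  | add p r hp hr => rw [map_add, LinearMap.add_apply, map_add, hp, hr, Polynomial.eval₂_add, add_mul]
  | monomial k a =>
    have h1 : ∀ k : ℕ, f ((T ^ k) x) = t ^ k * f x := by
      intro k
      induction k with
      | zero => simp
      | succ k ih => rw [pow_succ', End.mul_apply, h, ih, pow_succ', mul_assoc]
    rw [aeval_monomial, End.mul_apply, algebraMap_end_apply, map_smulₛₗ, h1,
      Polynomial.eval₂_monomial, smul_eq_mul, mul_assoc]

section frobenius
variable (L : ExtQ)

theorem evAt_of_eq_sigmaSep {n : ℕ} (f : SepRestr L) (w : SepRestrAt L (zetaPow L (n + 1)))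
    (hw : w.1 = sigmaSep L f.1) : evAt L (zetaPow L (n + 1)) w = evSep L n f ^ qF := by
  rw [evSep_apply, ← evAt_frobAt, evAt_apply, evAt_apply, hw, zetaPow_succ]
  rfl

theorem evR_sigma (n : ℕ) (a : RX L) : evR L (n + 1) (sigma L a) = evR L n a ^ qF :=
  evAt_of_eq_sigmaSep L (toSepRestr L a) _ (toSep_sigma L a)

theorem sigmaSep_mem {n : ℕ} (f : SepRestr L) : sigmaSep L f.1 ∈
    SepRestrAt L (zetaPow L (n + 1)) := by
  rw [zetaPow_succ]
  exact (frobAt L (zetaPow L n) ⟨f.1, SepRestr_le L (norm_zetaPow_le L n) f.2⟩).2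

theorem evR_comp_C (n : ℕ) : (evR L n).comp PowerSeries.C =
    (toCv F).comp ((algebraMap L (Qalg F)).comp ι[L]) :=
  RingHom.ext fun r => (evR_C L n r).trans rfl

end frobenius

section functional
variable {L : ExtQ} {M : Type w} [AddCommGroup M] [Module (RX L) M] {S : LocalShtuka L M}
  {ι : Type*} [Fintype ι] [DecidableEq ι] (tc : Basis ι (SepRestr L) (BC (toSepRestr L) M))
  (k : ι → Cv F)

/-- The functional `m ↦ ∑_l w_l(ζ^{q^n}) k_l^{q^n}` on `M`, where the `w_l` are the coordinates
of `m` with respect to a basis of `τ`-invariants. -/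
def lam (n : ℕ) : M →ₛₗ[evR L n] Cv F where
  toFun m := functional tc (evSep L n) (fun l => frobC F n (k l)) (BC.mk (toSepRestr L) m)
  map_add' x y := by rw [map_add, map_add]
  map_smul' a x := by
    rw [map_smulₛₗ (BC.mk (toSepRestr L)), map_smulₛₗ]
    rfl

theorem lam_apply (n : ℕ) (m : M) : lam tc k n m =
    functional tc (evSep L n) (fun l => frobC F n (k l)) (BC.mk (toSepRestr L) m) := rfl

/-- The functional on `σ̂^*M` that is induced by the `q`-th power of `lam`. -/
def mu' (n : ℕ) : BC (sigma L) M →ₛₗ[evR L (n + 1)] Cv F :=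
  BC.lift (sigma L) (evR L (n + 1))
    ((frobC F 1).toAddMonoidHom.comp (lam tc k n).toAddMonoidHom) (fun a m => by
      change frobC F 1 (lam tc k n (a • m)) = evR L (n + 1) (sigma L a) • frobC F 1 (lam tc k n m)
      rw [map_smulₛₗ, smul_eq_mul, map_mul, evR_sigma, smul_eq_mul]
      rw [frobC_apply, pow_one])

theorem mu'_mk (n : ℕ) (m : M) : mu' tc k n (BC.mk (sigma L) m) = lam tc k n m ^ qF := by
  refine (BC.lift_mk _ _ _ _ m).trans ?_
  change frobC F 1 (lam tc k n m) = _
  rw [frobC_apply, pow_one]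

variable {tc} (htc : ∀ l, S.convToSep (tc l) ∈ S.H1v)
include htc

theorem repr_tauB_mk (m : M) (l : ι) :
    (LocalShtuka.sepBasis tc).repr (S.tauB (toSep L) (isUnit_toSep L)
      (BC.mk ((toSep L).comp (sigma L)) m)) l =
      sigmaSep L (tc.repr (BC.mk (toSepRestr L) m) l).1 := by
  have h1 : S.tauB (toSep L) (isUnit_toSep L) (BC.mk ((toSep L).comp (sigma L)) m) =
      S.phiSep (BC.mk (toSep L) m) := by
    change _ = S.tauB (toSep L) (isUnit_toSep L) (S.sigmaStar (BC.mk (toSep L) m))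
    congr 1
    exact (BC.push_mk ..).symm
  have h2 : BC.mk (toSep L) m = S.convToSep (BC.mk (toSepRestr L) m) := (BC.push_mk ..).symm
  have h3 : S.phiSep (BC.mk (toSep L) m) = ∑ l, sigmaSep L (tc.repr (BC.mk (toSepRestr L) m) l).1 •
      LocalShtuka.sepBasis tc l := by
    conv_lhs => rw [← (LocalShtuka.sepBasis tc).sum_repr (BC.mk (toSep L) m), map_sum]
    refine sum_congr rfl fun l _ => ?_
    rw [map_smulₛₗ, h2, LocalShtuka.sepBasis_repr]
    congr 1
    rw [LocalShtuka.sepBasis_apply S]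
    exact (S.mem_H1v_iff_phiSep _).1 (htc l)
  exact (congrArg (fun z => (LocalShtuka.sepBasis tc).repr z l) (h1.trans h3)).trans
    (congrFun ((LocalShtuka.sepBasis tc).repr_sum_self _) l)

omit htc in
theorem repr_tauB_smul (r : (Lsep L)⟦X⟧) (z : BC ((toSep L).comp (sigma L)) M) (l : ι) :
    (LocalShtuka.sepBasis tc).repr (S.tauB (toSep L) (isUnit_toSep L) (r • z)) l = r *
    (LocalShtuka.sepBasis tc).repr (S.tauB (toSep L) (isUnit_toSep L) z) l :=
  (congrArg (fun z => (LocalShtuka.sepBasis tc).repr z l) (LinearEquiv.map_smul _ r z)).trans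
    (congrArg (fun f : ι →₀ (Lsep L)⟦X⟧ => f l) (LinearEquiv.map_smul _ r _))

theorem repr_tauB_push_smul_mk (r : RX L) (m : M) (l : ι) :
    (LocalShtuka.sepBasis tc).repr (S.tauB (toSep L) (isUnit_toSep L)
      (BC.push (sigma L) (toSep L) ((toSep L).comp (sigma L)) (fun _ => rfl)
        (r • BC.mk (sigma L) m))) l =
      toSep L r * sigmaSep L (tc.repr (BC.mk (toSepRestr L) m) l).1 := by
  have h5 : BC.push (sigma L) (toSep L) ((toSep L).comp (sigma L)) (fun _ => rfl)
      (r • BC.mk (sigma L) m) = toSep L r • BC.mk ((toSep L).comp (sigma L)) m :=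
    (push_smul_eq ..).trans (congrArg _ (BC.push_mk ..))
  exact (congrArg (fun z => (LocalShtuka.sepBasis tc).repr (S.tauB (toSep L) (isUnit_toSep L) z) l)
    h5).trans ((repr_tauB_smul (S := S) _ _ l).trans (congrArg _ (repr_tauB_mk htc m l)))

omit htc in
theorem sum_evAt_smul_mk (n : ℕ) (r : RX L) (m : M) :
    ∑ l, evAt L (zetaPow L (n + 1)) (Subring.inclusion (SepRestr_le L (norm_zetaPow_le L (n + 1)))
      (toSepRestr L r) * ⟨_, sigmaSep_mem L (tc.repr (BC.mk (toSepRestr L) m) l)⟩) *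
        frobC F (n + 1) (k l) = mu' tc k n (r • BC.mk (sigma L) m) := by
  have h1 : ∀ l, evAt L (zetaPow L (n + 1))
      ⟨_, sigmaSep_mem L (tc.repr (BC.mk (toSepRestr L) m) l)⟩ * frobC F (n + 1) (k l) =
      frobC F 1 (evSep L n (tc.repr (BC.mk (toSepRestr L) m) l) * frobC F n (k l)) := by
    have h0 : ∀ x y : Cv F, x ^ qF * frobC F (n + 1) y = frobC F 1 (x * frobC F n y) := by
      intro x y
      rw [map_mul, frobC_apply, frobC_apply, frobC_apply, frobC_apply, pow_one, ← pow_mul, pow_succ]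
    exact fun l => (congrArg (· * frobC F (n + 1) (k l)) (evAt_of_eq_sigmaSep L
      (tc.repr (BC.mk (toSepRestr L) m) l) _ rfl)).trans (h0 _ _)
  have h2 : mu' tc k n (r • BC.mk (sigma L) m) = evR L (n + 1) r * frobC F 1 (lam tc k n m) := by
    refine (map_smulₛₗ (mu' tc k n) r _).trans (congrArg _ ((mu'_mk tc k n m).trans ?_))
    rw [frobC_apply, pow_one]
  have h3 : frobC F 1 (lam tc k n m) = ∑ l, frobC F 1
      (evSep L n (tc.repr (BC.mk (toSepRestr L) m) l) * frobC F n (k l)) := map_sum (frobC F 1) _ _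
  refine Eq.trans ?_ ((h2.trans (congrArg _ h3)).trans (mul_sum _ _ _)).symm
  exact sum_congr rfl fun l _ =>
    (congrArg (· * frobC F (n + 1) (k l)) (map_mul _ _ _)).trans
      ((mul_assoc _ _ _).trans (congrArg _ (h1 l)))

theorem exists_repr_tauB (n : ℕ) (x : BC (sigma L) M) : ∃ w : ι → SepRestrAt L (zetaPow L (n + 1)),
      (∀ l, (LocalShtuka.sepBasis tc).repr (S.tauB (toSep L) (isUnit_toSep L)
        (BC.push (sigma L) (toSep L) ((toSep L).comp (sigma L)) (fun _ => rfl) x)) l = (w l).1) ∧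
      ∑ l, evAt L (zetaPow L (n + 1)) (w l) * frobC F (n + 1) (k l) = mu' tc k n x := by
  induction x using BC.induction with
  | h0 =>
    refine ⟨0, fun l => ?_, ?_⟩
    · rw [map_zero, map_zero, map_zero]
      rfl
    · rw [map_zero]
      exact Finset.sum_eq_zero fun l _ => by rw [Pi.zero_apply, map_zero, zero_mul]
  | hadd x y hx hy =>
    obtain ⟨w, hw, hwx⟩ := hx
    obtain ⟨w', hw', hwy⟩ := hy
    refine ⟨w + w', fun l => ?_, ?_⟩
    · rw [map_add, map_add, map_add, Finsupp.add_apply, hw, hw']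
      rfl
    · rw [map_add, ← hwx, ← hwy, ← sum_add_distrib]
      exact sum_congr rfl fun l _ => by rw [Pi.add_apply, map_add, add_mul]
  | hmk r m =>
    refine ⟨fun l => Subring.inclusion (SepRestr_le L (norm_zetaPow_le L (n + 1)))
      (toSepRestr L r) * ⟨_, sigmaSep_mem L (tc.repr (BC.mk (toSepRestr L) m) l)⟩,
      fun l => ?_, ?_⟩
    · exact repr_tauB_push_smul_mk htc r m l
    · exact sum_evAt_smul_mk k n r m

/-- The coordinates of `τ(x)` with respect to a `τ`-invariant basis are the Frobenius twists of those
of `x`. -/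
theorem lam_eq_mu' (n : ℕ) {x : BC (sigma L) M} {y : M} (hxy : S.TauRel x y) : lam tc k (n + 1) y =
    mu' tc k n x := by
  obtain ⟨w, hw, hwx⟩ := exists_repr_tauB (S := S) k htc n x
  rw [← hwx, lam_apply, functional_apply]
  refine sum_congr rfl fun l _ => ?_
  congr 1
  have h1 := hw l
  rw [hxy.tauB (toSep L) (isUnit_toSep L)] at h1
  have h2 : BC.mk (toSep L) y = S.convToSep (BC.mk (toSepRestr L) y) := (BC.push_mk ..).symm
  rw [h2, LocalShtuka.sepBasis_repr] at h1
  rw [evSep_apply]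
  congr 1
  exact Subtype.ext h1

end functional

section eigen
variable {L K : ExtQ} [FD[K]] {M : Type w} [AddCommGroup M] [Module (RX L) M]
  {S : LocalShtuka L M} {E : Type v} [CommRing E] [Algebra (Qv F) E] [Algebra (Av F) E]
  [IsScalarTower (Av F) (Qv F) E] (A : OEAction S E) {ι : Type*} [Fintype ι] [DecidableEq ι]
  {tc : Basis ι (SepRestr L) (BC (toSepRestr L) M)} (htc : ∀ l, S.convToSep (tc l) ∈ S.H1v)
  {ρ : E →ₐ[Qv F] K} {κ : S.H1v →ₗ[Av F] K} (hκa : ∀ a t, κ (A.actHom a t) = ρ a * κ t)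

/-- The values of an eigenvector on a basis, in `ℂ_v`. -/
def eigenVal (κ : S.H1v →ₗ[Av F] K) (l : ι) : Cv F := LtoC K (κ (LocalShtuka.h1vBasis tc htc l))

include hκa

theorem lam_act (n : ℕ) (a : 𝓞v[E]) (m : M) : lam tc (eigenVal htc κ) n (A.act a m) =
    frobC F n (LtoC K (ρ a)) * lam tc (eigenVal htc κ) n m := by
  have h1 := functional_act A tc htc hκa (χ := evSep L n) (j := (frobC F n).comp (LtoC K))
    (fun f => (evR_coefR L n f).symm) a (BC.mk (toSepRestr L) m)
  rw [OEAction.actBC_mk] at h1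
  exact h1

theorem mu'_act (n : ℕ) (a : 𝓞v[E]) (x : BC (sigma L) M) :
    mu' tc (eigenVal htc κ) n (A.actBC (sigma L) a x) = frobC F (n + 1) (LtoC K (ρ a)) *
    mu' tc (eigenVal htc κ) n x := by
  induction x using BC.induction with
  | h0 => rw [map_zero, map_zero, mul_zero]
  | hadd x y hx hy => rw [map_add, map_add, map_add, hx, hy, mul_add]
  | hmk r m =>
    rw [map_smul, map_smulₛₗ, map_smulₛₗ, OEAction.actBC_mk, mu'_mk, mu'_mk, lam_act A htc hκa,
      mul_pow, frobC_apply, frobC_apply, ← pow_mul, ← pow_succ, smul_eq_mul, smul_eq_mul,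
      mul_left_comm]

/-- The relation between the functionals given by a correspondence. -/
theorem mu'_eq_of_tauRel (n : ℕ) {e θ : 𝓞v[E]} (he : ρ e = 1)
    {D : (RL L)[X]} {N : ℕ} {x : BC (sigma L) M} {m : M}
    (h : S.TauRel (aeval (A.actBC (sigma L) θ)
      (D.map PowerSeries.C) (A.actBC (sigma L) e x)) (zmz L ^ N • A.act e m)) :
    D.eval₂ ((toCv F).comp ((algebraMap L (Qalg F)).comp ι[L]))
      (frobC F (n + 1) (LtoC K (ρ θ))) * mu' tc (eigenVal htc κ) n x =
      (zetaPow L (n + 1) - zetaC L) ^ N * lam tc (eigenVal htc κ) (n + 1) m := by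
  have h1 := lam_eq_mu' (eigenVal htc κ) htc n h
  rw [apply_aeval_of_eigen (fun x => mu'_act A htc hκa n θ x), mu'_act A htc hκa, he, map_one,
    map_one, one_mul, map_smulₛₗ, lam_act A htc hκa, he, map_one, map_one, one_mul, map_pow,
    evR_zmz, eval₂_map, evR_comp_C, smul_eq_mul] at h1
  exact h1.symm

end eigen

/-! ### Norms of the functionals -/

theorem norm_apply_le_of_basis {F : Type u} [Field F] [Fintype F] {R V ι : Type*} [CommRing R]
    [AddCommGroup V] [Module R V] [Fintype ι] (b : Basis ι R V) {χ : R →+* Cv F}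
    (hχ : ∀ r, ‖χ r‖ ≤ 1) (f : V →ₛₗ[χ] Cv F) {c : ℝ} (hc : ∀ i, ‖f (b i)‖ ≤ c) (hc0 : 0 ≤ c)
    (x : V) : ‖f x‖ ≤ c := by
  rw [← b.sum_repr x, map_sum]
  refine norm_sum_le_of_forall_le_of_nonneg hc0 fun i _ => ?_
  rw [map_smulₛₗ, norm_smul]
  exact (mul_le_of_le_one_left (norm_nonneg _) (hχ _)).trans (hc i)

/-- A bounded solution of `w_{n+1} = q w_n + b_n` is determined by the `b_n`. -/
theorem tendsto_sum_div_of_bounded {q B : ℝ} (hq : 1 < q) {w b : ℕ → ℝ} (hw : ∀ n, |w n| ≤ B)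
    (h : ∀ n, w (n + 1) = q * w n + b n) :
    Tendsto (fun n => ∑ k ∈ range n, b k / q ^ (k + 1)) atTop (𝓝 (-w 0)) := by
  have hq0 : q ≠ 0 := by positivity
  have h1 : ∀ n, ∑ k ∈ range n, b k / q ^ (k + 1) = w n / q ^ n - w 0 := by
    intro n
    induction n with
    | zero => simp
    | succ n ih =>
      rw [Finset.sum_range_succ, ih, h, pow_succ]
      field_simp
      ring
  have h2 : Tendsto (fun n => w n / q ^ n) atTop (𝓝 0) := by
    have h3 : Tendsto (fun n : ℕ => B * (q⁻¹) ^ n) atTop (𝓝 0) := by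
      have := (tendsto_pow_atTop_nhds_zero_of_lt_one (inv_nonneg.2 (zero_le_one.trans hq.le))
        (inv_lt_one_of_one_lt₀ hq)).const_mul B
      rwa [mul_zero] at this
    refine squeeze_zero_norm (fun n => ?_) h3
    rw [Real.norm_eq_abs, abs_div, inv_pow, abs_of_pos (show 0 < q ^ n by positivity),
      div_eq_mul_inv]
    exact mul_le_mul_of_nonneg_right (hw n) (by positivity)
  have h3 := h2.sub_const (w 0)
  rw [zero_sub] at h3
  exact h3.congr fun n => (h1 n).symm

section splitting
variable {L : ExtQ} [FD[L]] {ι : Type*} [Fintype ι] {g : (Av F)[X]}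
  {c : ι → RL L} {h : ι → L⟦X⟧}

theorem norm_evalL_unit (u : (RX L)ˣ) : ‖evalL L u‖ = 1 := by
  refine le_antisymm (norm_evalL_le L _) ?_
  have h1 : ‖evalL L u‖ * ‖evalL L ((u⁻¹ : (RX L)ˣ) : RX L)‖ = 1 := by
    rw [← norm_mul, ← map_mul, Units.mul_inv, map_one, norm_one]
  rw [← h1]
  exact mul_le_of_le_one_right (norm_nonneg _) (norm_evalL_le L _)

theorem sigma_pow_C (m : ℕ) (r : RL L) : (sigma L ^ m) (PowerSeries.C r) =
    PowerSeries.C (r ^ qF ^ m) := by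
  rw [RingHom.coe_pow]
  induction m generalizing r with
  | zero => simp
  | succ m ih =>
    rw [Function.iterate_succ_apply, sigma, PowerSeries.map_C, frob_apply, ← sigma, ih, ← pow_mul,
      ← pow_succ']

theorem sigma_pow_X (m : ℕ) : (sigma L ^ m) PowerSeries.X = PowerSeries.X := by
  rw [RingHom.coe_pow]
  exact Function.iterate_fixed (PowerSeries.map_X _) m

theorem sigma_pow_coefR (m : ℕ) (f : Av F) : (sigma L ^ m) (coefR L f) = coefR L f := by
  rw [RingHom.coe_pow]
  exact Function.iterate_fixed (sigma_coefR L f) m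

/-- The value of `g` at a proper power `c_i^{q^m}` of one of its roots has the norm of `ζ`. -/
theorem IsSplitting.prod_norm_pow_sub (H : IsSplitting g c h) (i : ι) (m : ℕ) : ∏ j,
    ‖ι[L] (c i) ^ qF ^ (m + 1) - ι[L] (c j)‖ = (qF : ℝ)⁻¹ := by
  obtain ⟨u, hu⟩ := H.exists_unit i
  have h1 := congrArg (fun f => evalL L ((sigma L ^ (m + 1)) f)) hu
  simp only [map_mul] at h1
  have h2 : (evalL L) ((sigma L ^ (m + 1)) ((g.map (coefR L)).eval (PowerSeries.C (c i)))) =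
      ∏ j, (ι[L] (c i) ^ qF ^ (m + 1) - ι[L] (c j)) := by
    have h3 : ((sigma L ^ (m + 1)).comp (coefR L)) = coefR L :=
      RingHom.ext fun f => sigma_pow_coefR (m + 1) f
    have h4 := H.map_constantCoeff
    rw [Polynomial.map_map] at h4
    rw [← Polynomial.eval₂_at_apply, ← eval_map, Polynomial.map_map, h3, sigma_pow_C,
      ← Polynomial.eval₂_at_apply, ← eval_map, Polynomial.map_map, evalL_C]
    change Polynomial.eval _ (g.map (constantCoeff.comp ((expL L).comp (coefR L)))) = _
    rw [h4, eval_prod]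
    simp only [eval_sub, eval_X, eval_C, map_pow]
  have hz : evalL L ((sigma L ^ (m + 1)) (zmz L)) = zetaL L - zetaL L ^ qF ^ (m + 1) := by
    have h5 : evalL L PowerSeries.X = zetaL L := by
      have h6 := evalL_zmz L
      rw [zmz, map_sub, evalL_C, sub_eq_zero] at h6
      exact h6
    rw [zmz, map_sub, map_sub, sigma_pow_X, sigma_pow_C, h5, evalL_C, map_pow]
    rfl
  have hz' : ‖zetaL L - zetaL L ^ qF ^ (m + 1)‖ = (qF : ℝ)⁻¹ := by
    have h7 : ‖zetaL L ^ qF ^ (m + 1)‖ < ‖zetaL L‖ := by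
      rw [norm_pow]
      exact pow_lt_self_of_lt_one₀ (norm_pos_iff.2 (zetaL_ne_zero L)) (norm_zetaL_lt_one L)
        (Nat.one_lt_pow (by omega) Fintype.one_lt_card)
    rw [sub_eq_add_neg, norm_add_eq_max_of_norm_ne_norm
      (by rw [norm_neg]; exact h7.ne'), norm_neg, max_eq_left h7.le, norm_zetaL]
  have h8 : ‖evalL L ((sigma L ^ (m + 1)) (u : RX L))‖ = 1 :=
    norm_evalL_unit (Units.map (sigma L ^ (m + 1) : RX L →+* RX L).toMonoidHom u)
  rw [h2, hz] at h1
  rw [← norm_prod, h1, norm_mul, hz', h8, mul_one]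

end splitting

section estimates
variable {L : ExtQ} {M : Type w} [AddCommGroup M] [Module (RX L) M] {S : LocalShtuka L M}
  {ι : Type*} [Fintype ι] [DecidableEq ι] [Nonempty ι]
  (tc : Basis ι (SepRestr L) (BC (toSepRestr L) M)) (k : ι → Cv F) (b : Basis ι (RX L) M)

/-- The norm of the functional `lam` on `M`. -/
def supLam (n : ℕ) : ℝ := ⨆ i, ‖lam tc k n (b i)‖

theorem norm_lam_basis_le (n : ℕ) (i : ι) : ‖lam tc k n (b i)‖ ≤ supLam tc k b n :=
  le_ciSup (f := fun i => ‖lam tc k n (b i)‖) (Set.finite_range _).bddAbove i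

theorem supLam_nonneg (n : ℕ) : 0 ≤ supLam tc k b n :=
  (norm_nonneg _).trans (norm_lam_basis_le tc k b n (Classical.arbitrary ι))

theorem norm_lam_le (n : ℕ) (m : M) : ‖lam tc k n m‖ ≤ supLam tc k b n :=
  norm_apply_le_of_basis b (norm_evR_le L n) _ (norm_lam_basis_le tc k b n)
    (supLam_nonneg tc k b n) m

theorem exists_norm_lam_eq (n : ℕ) : ∃ i, ‖lam tc k n (b i)‖ = supLam tc k b n :=
  exists_eq_ciSup_of_finite

theorem norm_mu'_le (n : ℕ) (x : BC (sigma L) M) : ‖mu' tc k n x‖ ≤ supLam tc k b n ^ qF := by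
  refine norm_apply_le_of_basis (BC.basis (sigma L) b) (norm_evR_le L (n + 1)) _ (fun i => ?_)
    (pow_nonneg (supLam_nonneg tc k b n) _) x
  rw [BC.basis_apply, mu'_mk, norm_pow]
  exact pow_le_pow_left₀ (norm_nonneg _) (norm_lam_basis_le tc k b n i) _

theorem exists_supLam_le (hk : ∀ l, ‖k l‖ ≤ 1) : ∃ C : ℝ, 0 < C ∧ ∀ n, supLam tc k b n ≤ C := by
  choose c hc0 hc using fun i l =>
    exists_norm_evSep_le L (tc.repr (BC.mk (toSepRestr L) (b i)) l)
  refine ⟨∑ i, ∑ l, c i l, Finset.sum_pos (fun i _ => Finset.sum_pos (fun l _ => hc0 i l)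
    Finset.univ_nonempty) Finset.univ_nonempty, fun n => ciSup_le fun i => ?_⟩
  refine le_trans ?_ (Finset.single_le_sum (f := fun i => ∑ l, c i l)
    (fun i _ => Finset.sum_nonneg fun l _ => (hc0 i l).le) (mem_univ i))
  rw [lam_apply, functional_apply]
  refine (norm_sum_le _ _).trans (Finset.sum_le_sum fun l _ => ?_)
  rw [norm_mul, frobC_apply, norm_pow]
  exact (mul_le_of_le_one_right (norm_nonneg _) (pow_le_one₀ (norm_nonneg _) (hk l))).trans
    (hc i l n)

theorem exists_le_supLam {l : ι} (hl : ‖k l‖ = 1) : ∃ C : ℝ, 0 < C ∧ ∀ n, C ≤ supLam tc k b n := by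
  let b' := BC.basis (toSepRestr L) b
  choose c hc0 hc using fun i => exists_norm_evSep_le L (b'.repr (tc l) i)
  have hC : 0 < ∑ i, c i := Finset.sum_pos (fun i _ => hc0 i) Finset.univ_nonempty
  refine ⟨(∑ i, c i)⁻¹, inv_pos.2 hC, fun n => ?_⟩
  rw [inv_le_iff_one_le_mul₀ hC]
  have h1 := functional_basis tc (evSep L n) (fun l => frobC F n (k l)) l
  rw [← b'.sum_repr (tc l), map_sum] at h1
  have h2 : ‖frobC F n (k l)‖ = 1 := by rw [frobC_apply, norm_pow, hl, one_pow]
  rw [← h2, ← h1, mul_comm, sum_mul]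
  refine (norm_sum_le _ _).trans (Finset.sum_le_sum fun i _ => ?_)
  rw [map_smulₛₗ, norm_smul, BC.basis_apply, ← lam_apply]
  exact mul_le_mul (hc i n) (norm_lam_basis_le tc k b n i) (norm_nonneg _) (hc0 i).le

end estimates

section recursion
variable {L K : ExtQ} [FD[L]] [FD[K]] {M : Type w}
  [AddCommGroup M] [Module (RX L) M] {S : LocalShtuka L M} {E : Type v} [CommRing E]
  [Algebra (Qv F) E] [Algebra (Av F) E] [IsScalarTower (Av F) (Qv F) E] {A : OEAction S E}
  {ι : Type*} [Fintype ι] [DecidableEq ι] [Nonempty ι]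
  {tc : Basis ι (SepRestr L) (BC (toSepRestr L) M)} (htc : ∀ l, S.convToSep (tc l) ∈ S.H1v)
  {ρ : E →ₐ[Qv F] K} {κ : S.H1v →ₗ[Av F] K} (hκa : ∀ a t, κ (A.actHom a t) = ρ a * κ t)
  (b : Basis ι (RX L) M) {e θ : 𝓞v[E]} (he : ρ e = 1) {I : Type*} [Fintype I] [DecidableEq I]
  {g : (Av F)[X]} {c : I → RL L} {h : I → L⟦X⟧} {i₀ : I}
  (hθ : ((ρ θ : K) : Qalg F) = (ι[L] (c i₀) : L))

theorem norm_zetaPow_succ_sub (m : ℕ) : ‖zetaPow L (m + 1) - zetaC L‖ = (qF : ℝ)⁻¹ := by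
  have h1 : ‖zetaC L‖ = (qF : ℝ)⁻¹ := by
    rw [zetaC, norm_toCv]
    exact norm_zetaL L
  have h2 : 0 < ‖zetaC L‖ := by
    rw [h1]
    exact inv_pos.2 (by exact_mod_cast Fintype.card_pos)
  have h7 : ‖zetaPow L (m + 1)‖ < ‖zetaC L‖ := by
    rw [zetaPow, norm_pow]
    exact pow_lt_self_of_lt_one₀ h2 (norm_zetaC_lt_one L)
      (Nat.one_lt_pow (by omega) Fintype.one_lt_card)
  rw [sub_eq_add_neg, norm_add_eq_max_of_norm_ne_norm
    (by rw [norm_neg]; exact h7.ne), norm_neg, max_eq_right h7.le, h1]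

include hθ in
theorem norm_divisor_eval (n : I → ℕ) (m : ℕ) :
    ‖(divisor c n).eval₂ ((toCv F).comp ((algebraMap L (Qalg F)).comp ι[L]))
      (frobC F m (LtoC K (ρ θ)))‖ =
      ∏ i, ‖ι[L] (c i₀) ^ qF ^ m - ι[L] (c i)‖ ^ n i := by
  rw [← eval_map, divisor_map_eval, norm_prod]
  refine prod_congr rfl fun i _ => ?_
  have h1 : LtoC K (ρ θ) = toCv F (ι[L] (c i₀) : L) := congrArg (toCv F) hθ
  rw [norm_pow, h1, frobC_apply, RingHom.comp_apply, ← map_pow, ← map_sub, norm_toCv]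
  rfl

include hκa he hθ in
/-- The recursion for the norms of the functionals given by the CM-type. -/
theorem supLam_succ {n : I → ℕ} {N : ℕ} (T : TauCorr A e θ (divisor c n) N) (m : ℕ) :
    (∏ i, ‖ι[L] (c i₀) ^ qF ^ (m + 1) - ι[L] (c i)‖ ^ n i) * supLam tc (eigenVal htc κ) b m ^ qF =
    ((qF : ℝ)⁻¹) ^ N * supLam tc (eigenVal htc κ) b (m + 1) := by
  have key : ∀ {x : BC (sigma L) M} {y : M}, S.TauRel (aeval (A.actBC (sigma L) θ)
      ((divisor c n).map PowerSeries.C) (A.actBC (sigma L) e x)) (zmz L ^ N • A.act e y) →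
      (∏ i, ‖ι[L] (c i₀) ^ qF ^ (m + 1) - ι[L] (c i)‖ ^ n i)
        * ‖mu' tc (eigenVal htc κ) m x‖ =
      ((qF : ℝ)⁻¹) ^ N * ‖lam tc (eigenVal htc κ) (m + 1) y‖ := by
    intro x y hxy
    have h1 := congrArg norm (mu'_eq_of_tauRel A htc hκa m he hxy)
    rwa [norm_mul, norm_mul, norm_pow, norm_divisor_eval hθ, norm_zetaPow_succ_sub] at h1
  apply le_antisymm
  · obtain ⟨i, hi⟩ := exists_norm_lam_eq tc (eigenVal htc κ) b m
    obtain ⟨y, hy⟩ := T.left (BC.mk (sigma L) (b i))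
    have h1 := key hy
    rw [mu'_mk, norm_pow, hi] at h1
    rw [h1]
    exact mul_le_mul_of_nonneg_left (norm_lam_le _ _ b _ _) (by positivity)
  · obtain ⟨i, hi⟩ := exists_norm_lam_eq tc (eigenVal htc κ) b (m + 1)
    obtain ⟨x, hx⟩ := T.right (b i)
    have h1 := key hx
    rw [hi] at h1
    rw [← h1]
    exact mul_le_mul_of_nonneg_left (norm_mu'_le _ _ b _ _)
      (Finset.prod_nonneg fun i _ => by positivity)

variable (F) in
theorem val_pow {k : Type*} [NormedField k] (x : k) (n : ℕ) : val F (x ^ n) = n * val F x := by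
  rw [val, val, norm_pow, Real.log_pow]
  ring

include hκa he hθ in
/-- The norm of the functional `lam` for `n = 0` is given by a convergent series. -/
theorem tendsto_val_supLam (H : IsSplitting g c h) {n : I → ℕ} {N : ℕ} {d : I → ℤ}
    (hn : ∀ i, (n i : ℤ) = N - d i) (T : TauCorr A e θ (divisor c n) N)
    (hκ : ∀ t, ‖κ t‖ ≤ 1) {l : ι} (hl : ‖eigenVal htc κ l‖ = 1) :
    Tendsto (fun m => ∑ j ∈ range m, (∑ i, (d i : ℝ) *
      val F (ι[L] (c i) - ι[L] (c i₀) ^ qF ^ (j + 1))) /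
        (qF : ℝ) ^ (j + 1)) atTop (𝓝 (val F (supLam tc (eigenVal htc κ) b 0))) := by
  set ν := supLam tc (eigenVal htc κ) b
  have hq : (1 : ℝ) < qF := by exact_mod_cast Fintype.one_lt_card
  have hlog : 0 < Real.log (qF) := Real.log_pos hq
  obtain ⟨C, hC0, hC⟩ := exists_supLam_le tc (eigenVal htc κ) b (fun l => by
    rw [eigenVal, LtoC, RingHom.comp_apply, norm_toCv]
    exact hκ _)
  obtain ⟨C', hC'0, hC'⟩ := exists_le_supLam tc (eigenVal htc κ) b hl
  have hν : ∀ m, 0 < ν m := fun m => hC'0.trans_le (hC' m)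
  have hprod := H.prod_norm_pow_sub i₀
  have hne : ∀ m i, ι[L] (c i₀) ^ qF ^ (m + 1) -
      ι[L] (c i) ≠ 0 := by
    intro m i h0
    have h1 := hprod m
    rw [prod_eq_zero (mem_univ i) (by rw [h0, norm_zero])] at h1
    exact (inv_pos.2 (zero_lt_one.trans hq)).ne h1
  set a : ℕ → I → ℝ := fun m i => val F (ι[L] (c i₀) ^ qF ^ (m + 1) -
      ι[L] (c i)) with ha
  have hinv : val F ((qF : ℝ)⁻¹) = 1 := by
    rw [val, norm_inv, Real.log_inv, neg_neg, Real.norm_of_nonneg (by positivity),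
      div_self hlog.ne']
  have hinv0 : ((qF : ℝ)⁻¹) ≠ 0 := inv_ne_zero (by positivity)
  have hsum : ∀ m, ∑ i, a m i = 1 := by
    intro m
    rw [ha, ← val_prod _ _ fun i _ => hne m i, ← hinv]
    apply val_eq_of_norm_eq
    rw [norm_prod, hprod, Real.norm_of_nonneg (by positivity)]
  have hrec : ∀ m, val F (ν (m + 1)) = qF * val F (ν m) - ∑ i, (d i : ℝ) * a m i := by
    intro m
    have h1 := congrArg (val F) (supLam_succ htc hκa b he hθ T m)
    have hne' : ∀ i ∈ univ, ‖ι[L] (c i₀) ^ qF ^ (m + 1) -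
      ι[L] (c i)‖ ^ n i ≠ 0 := fun i _ => pow_ne_zero _ (norm_ne_zero_iff.2 (hne m i))
    rw [val_mul (prod_ne_zero_iff.2 hne') (pow_ne_zero _ (hν m).ne'),
      val_mul (pow_ne_zero _ hinv0) (hν (m + 1)).ne', val_prod _ _ hne', val_pow, val_pow, hinv] at h1
    have h2 : ∑ i, val F (‖ι[L] (c i₀) ^ qF ^ (m + 1) -
        ι[L] (c i)‖ ^ n i) = N - ∑ i, (d i : ℝ) * a m i := by
      rw [← mul_one (N : ℝ), ← hsum m, mul_sum, ← Finset.sum_sub_distrib]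
      refine sum_congr rfl fun i _ => ?_
      have h3 : (n i : ℝ) = N - d i := by exact_mod_cast hn i
      rw [val_pow, ← sub_mul, h3]
      congr 1
      exact val_eq_of_norm_eq (norm_norm _)
    rw [h2] at h1
    linarith
  have hbd : ∀ m, |val F (ν m)| ≤ (|Real.log C| + |Real.log C'|) / Real.log (qF) := by
    intro m
    rw [val, Real.norm_of_nonneg (hν m).le, abs_div, abs_neg, abs_of_pos hlog]
    refine div_le_div_of_nonneg_right ?_ hlog.le
    have h1 := Real.log_le_log (hν m) (hC m)
    have h2 := Real.log_le_log hC'0 (hC' m)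
    rw [abs_le]
    constructor <;> linarith [le_abs_self (Real.log C), abs_nonneg (Real.log C),
      neg_abs_le (Real.log C'), abs_nonneg (Real.log C')]
  have h1 := (tendsto_sum_div_of_bounded hq hbd (b := fun m => - ∑ i, (d i : ℝ) * a m i)
    fun m => by rw [hrec, sub_eq_add_neg]).neg
  rw [neg_neg] at h1
  refine h1.congr fun m => ?_
  rw [← Finset.sum_neg_distrib]
  refine sum_congr rfl fun j _ => ?_
  rw [neg_div, neg_neg]
  congr 1
  refine sum_congr rfl fun i _ => ?_
  congr 1
  exact val_eq_of_norm_eq (norm_sub_rev _ _)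

end recursion

/-! ### Periods as values of a functional -/

section constants
/-- `x` is a power series in `z - ζ` with constant coefficient `c`. -/
def HasConst (x : (Cv F)⸨X⸩) (c : Cv F) : Prop :=
  ∃ p : (Cv F)⟦X⟧, ofPowerSeries ℤ (Cv F) p = x ∧ constantCoeff p = c

namespace HasConst
variable {x y : (Cv F)⸨X⸩} {c c' : Cv F}

theorem add (hx : HasConst x c) (hy : HasConst y c') : HasConst (x + y) (c + c') := by
  obtain ⟨p, rfl, rfl⟩ := hx
  obtain ⟨r, rfl, rfl⟩ := hy
  exact ⟨p + r, map_add _ _ _, map_add _ _ _⟩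

theorem mul (hx : HasConst x c) (hy : HasConst y c') : HasConst (x * y) (c * c') := by
  obtain ⟨p, rfl, rfl⟩ := hx
  obtain ⟨r, rfl, rfl⟩ := hy
  exact ⟨p * r, map_mul _ _ _, map_mul _ _ _⟩

theorem zero : HasConst (0 : (Cv F)⸨X⸩) 0 := ⟨0, map_zero _, map_zero _⟩

theorem one : HasConst (1 : (Cv F)⸨X⸩) 1 := ⟨1, map_one _, map_one _⟩

theorem sum {ι : Type*} (s : Finset ι) {x : ι → (Cv F)⸨X⸩} {c : ι → Cv F}
    (h : ∀ i ∈ s, HasConst (x i) (c i)) : HasConst (∑ i ∈ s, x i) (∑ i ∈ s, c i) := by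
  classical
  induction s using Finset.induction_on with
  | empty => exact zero
  | insert i s hi ih =>
    rw [Finset.sum_insert hi, Finset.sum_insert hi]
    exact (h i (Finset.mem_insert_self i s)).add
      (ih fun j hj => h j (Finset.mem_insert_of_mem hj))

theorem unique (hx : HasConst x c) (hx' : HasConst x c') : c = c' := by
  obtain ⟨p, rfl, rfl⟩ := hx
  obtain ⟨r, hr, rfl⟩ := hx'
  rw [HahnSeries.ofPowerSeries_injective hr]

theorem ne_zero (hx : HasConst x c) (hc : c ≠ 0) : x ≠ 0 := by
  rintro rfl
  exact hc (hx.unique zero)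

theorem leadingCoeff (hx : HasConst x c) (hc : c ≠ 0) : x.leadingCoeff = c := by
  have h0 := hx.ne_zero hc
  obtain ⟨p, rfl, rfl⟩ := hx
  have h1 : ∀ i : ℤ, (ofPowerSeries ℤ (Cv F) p).coeff i =
      if i < 0 then 0 else coeff i.natAbs p := PowerSeries.coeff_coe p
  have h2 : (ofPowerSeries ℤ (Cv F) p).order = 0 := by
    refine le_antisymm (HahnSeries.order_le_of_coeff_ne_zero ?_) ?_
    · rw [h1]
      simpa using hc
    · by_contra hlt
      apply (HahnSeries.coeff_order_eq_zero.not.2 h0)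
      rw [h1, if_pos (not_le.1 hlt)]
  rw [HahnSeries.leadingCoeff_eq, h2, h1]
  simp

theorem valT (hx : HasConst x c) (hc : c ≠ 0) : valT x = val F c := by
  rw [LocSht.valT, hx.leadingCoeff hc]

end HasConst

theorem valT_mul {x y : (Cv F)⸨X⸩} (hx : x ≠ 0) (hy : y ≠ 0) : valT (x * y) = valT x + valT y := by
  rw [valT, HahnSeries.leadingCoeff_mul,
    val_mul (HahnSeries.leadingCoeff_ne_zero.2 hx) (HahnSeries.leadingCoeff_ne_zero.2 hy)]
  rfl

theorem hasConst_expSep (L : ExtQ) (f : SepRestr L) : HasConst (expSep L f) (evSep L 0 f) := by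
  have h0 : zetaPow L 0 = zetaC L := by rw [zetaPow, pow_zero, pow_one]
  refine ⟨_, rfl, ?_⟩
  rw [evSep_apply, evAt_apply]
  exact (constantCoeff_taylor _ _).trans (tsum_congr fun i =>
    congrArg (fun s => sepToC L (coeff i f.1) * s ^ i) h0.symm)

variable {L : ExtQ} [FD[L]]

theorem hasConst_TtoC (y : L⟦X⟧) : HasConst (TtoC L y) (LtoC L (constantCoeff y)) :=
  ⟨_, rfl, by rw [← coeff_zero_eq_constantCoeff_apply, PowerSeries.coeff_map,
    coeff_zero_eq_constantCoeff_apply]⟩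

end constants

section lift
variable {L K : ExtQ} [FD[L]] [FD[K]]
  [Sep[K]] {α π ϑ : Qalg F} (hϑ : IsGood K α π ϑ) {I : Type*} [Fintype I]
  {c : I → RL L} {h : I → L⟦X⟧} (H : IsSplitting (minpoly (Av F) ϑ) c h) (i₀ : I)
include H

theorem QvToC_algebraMap (f : Av F) : LocalShtuka.QvToC L (algebraMap (Av F) (Qv F) f) =
    TtoC L (expL L (coefR L f)) := by
  rw [← expC_eq]
  exact IsLocalization.lift_eq _ f

/-- The embedding `K → ℂ_v⸨z - ζ⸩` with `z ↦ ζ + (z - ζ)` and a given image of the generator. -/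
theorem exists_lift_QvToC : ∃ j : K →+* (Cv F)⸨X⸩,
    (∀ x, j (algebraMap (Qv F) K x) = LocalShtuka.QvToC L x) ∧ j ⟨ϑ, hϑ.mem⟩ = TtoC L (h i₀) := by
  let y : Via (LocalShtuka.QvToC L) := TtoC L (h i₀)
  have hy : aeval y (minpoly (Qv F) hϑ.powerBasis.gen) = 0 := by
    rw [hϑ.powerBasis_gen, hϑ.coe_minpoly, aeval_def, eval₂_map]
    have h1 : (LocalShtuka.QvToC L).comp (algebraMap (Av F) (Qv F)) =
        (TtoC L).comp ((expL L).comp (coefR L)) := RingHom.ext fun f => QvToC_algebraMap H f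
    change eval₂ ((LocalShtuka.QvToC L).comp (algebraMap (Av F) (Qv F))) (TtoC L (h i₀)) _ = 0
    rw [h1, ← hom_eval₂, ← eval_map, H.eval_eq_zero, map_zero]
  refine ⟨(hϑ.powerBasis.lift y hy : K →ₐ[Qv F] Via (LocalShtuka.QvToC L)).toRingHom, fun x => ?_, ?_⟩
  · exact AlgHom.commutes (hϑ.powerBasis.lift y hy) x
  · have h2 := hϑ.powerBasis.lift_gen y hy
    rw [hϑ.powerBasis_gen] at h2
    exact h2

variable {i₀} {j : K →+* (Cv F)⸨X⸩} (hj : ∀ x, j (algebraMap (Qv F) K x) = LocalShtuka.QvToC L x)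
  (hjϑ : j ⟨ϑ, hϑ.mem⟩ = TtoC L (h i₀)) (hc : ϑ = (ι[L] (c i₀) : L))
include hj hjϑ hc

theorem hasConst_lift {x : K} (hx : ‖x‖ ≤ 1) : HasConst (j x) (LtoC K x) := by
  obtain ⟨p, rfl⟩ := hϑ.exists_aeval_eq hx
  have h1 : j (aeval (⟨ϑ, hϑ.mem⟩ : K) p) = TtoC L (p.eval₂ ((expL L).comp (coefR L)) (h i₀)) := by
    rw [aeval_def, hom_eval₂, hom_eval₂, hjϑ]
    congr 1
    ext1 f
    exact (hj (algebraMap (Av F) (Qv F) f)).trans (QvToC_algebraMap H f)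
  rw [h1]
  have h2 := hasConst_TtoC (p.eval₂ ((expL L).comp (coefR L)) (h i₀))
  convert h2 using 1
  rw [hom_eval₂, H.constantCoeff_eq, aeval_def, hom_eval₂, hom_eval₂]
  have h3 : LtoC K ⟨ϑ, hϑ.mem⟩ = LtoC L (ι[L] (c i₀)) := congrArg (toCv F) hc
  rw [h3]
  congr 1
  ext1 f
  change _ = LtoC L (evalL L (coefR L f))
  rw [evalL_coefR]
  rfl

theorem valT_lift {x : K} (hx : x ≠ 0) : j x ≠ 0 ∧ valT (j x) = val F x := by
  have key : ∀ {y : K}, y ≠ 0 → ‖y‖ ≤ 1 → valT (j y) = val F y := by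
    intro y hy0 hy
    have h1 := hasConst_lift hϑ H hj hjϑ hc hy
    rw [h1.valT ((map_ne_zero _).2 hy0)]
    exact val_eq_of_norm_eq (norm_toCv _)
  refine ⟨(map_ne_zero _).2 hx, ?_⟩
  rcases le_total ‖x‖ 1 with h1 | h1
  · exact key hx h1
  · have h2 := key (inv_ne_zero hx) (by rw [norm_inv]; exact inv_le_one_of_one_le₀ h1)
    have h3 : valT (j x) + valT (j x⁻¹) = val F x + val F x⁻¹ := by
      rw [← valT_mul ((map_ne_zero _).2 hx) ((map_ne_zero _).2 (inv_ne_zero hx)), ← map_mul,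
        mul_inv_cancel₀ hx, map_one, HasConst.one.valT (one_ne_zero : (1 : Cv F) ≠ 0),
        ← val_mul hx (inv_ne_zero hx), mul_inv_cancel₀ hx]
      exact val_eq_of_norm_eq (by rw [norm_one, norm_one])
    linarith

end lift

section period
variable {L K : ExtQ} {M : Type w} [AddCommGroup M] [Module (RX L) M] {S : LocalShtuka L M}
  {E : Type v} [CommRing E] [Algebra (Qv F) E] [Algebra (Av F) E] [IsScalarTower (Av F) (Qv F) E]
  (A : OEAction S E) {ι : Type*} [Fintype ι] [DecidableEq ι]
  {tc : Basis ι (SepRestr L) (BC (toSepRestr L) M)} (htc : ∀ l, S.convToSep (tc l) ∈ S.H1v)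

/-- The extension of a functional on the Tate module to `M ⊗ ℂ_v⸨z - ζ⸩`. -/
def extend (v : S.H1v →ₛₗ[LocalShtuka.AvToC L] (Cv F)⸨X⸩) : BC (expC L) M →ₗ[(Cv F)⸨X⸩] (Cv F)⸨X⸩ :=
  (LocalShtuka.expBasis tc).constr (Cv F)⸨X⸩ fun l => v (LocalShtuka.h1vBasis tc htc l)

theorem extend_basis (v : S.H1v →ₛₗ[LocalShtuka.AvToC L] (Cv F)⸨X⸩) (l : ι) :
    extend htc v (LocalShtuka.expBasis tc l) = v (LocalShtuka.h1vBasis tc htc l) :=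
  Basis.constr_basis _ _ _ _

theorem extend_apply (v : S.H1v →ₛₗ[LocalShtuka.AvToC L] (Cv F)⸨X⸩) (y : BC (expC L) M) :
    extend htc v y = ∑ l, (LocalShtuka.expBasis tc).repr y l * v (LocalShtuka.h1vBasis tc htc l) :=
  Basis.constr_apply_fintype _ _ _ _

theorem act_expBasis (a : 𝓞v[E]) (l : ι) :
    A.actBC (expC L) a (LocalShtuka.expBasis tc l) = ∑ j, LocalShtuka.AvToC L
      ((LocalShtuka.h1vBasis tc htc).repr (A.actH1v a (LocalShtuka.h1vBasis tc htc l)) j) •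
        LocalShtuka.expBasis tc j := by
  have h0 : ∀ j, LocalShtuka.expBasis tc j =
      BC.push (toSepRestr L) (expSep L) (expC L) (fun _ => rfl) (tc j) := fun j =>
    BC.pushBasis_apply ..
  refine (congrArg _ (h0 l)).trans ((A.push_actBC _ _ _ _ a (tc l)).symm.trans ?_)
  rw [act_frame A tc htc, map_sum]
  exact sum_congr rfl fun j _ => (push_smul_eq _ _ _ _ _ _).trans (congrArg _ (h0 j).symm)

theorem extend_act (v : S.H1v →ₛₗ[LocalShtuka.AvToC L] (Cv F)⸨X⸩) (a : 𝓞v[E]) (y : BC (expC L) M) :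
    extend htc v (A.actBC (expC L) a y) = extend htc (v.comp (A.actH1v a)) y := by
  have h1 : (extend htc v).comp (A.actBC (expC L) a) = extend htc (v.comp (A.actH1v a)) := by
    refine (LocalShtuka.expBasis tc).ext fun l => ?_
    rw [LinearMap.comp_apply, act_expBasis A htc, map_sum, extend_basis, LinearMap.comp_apply]
    conv_rhs => rw [← (LocalShtuka.h1vBasis tc htc).sum_repr
      (A.actH1v a (LocalShtuka.h1vBasis tc htc l)), map_sum]
    refine sum_congr rfl fun j _ => ?_
    rw [map_smul, extend_basis, map_smulₛₗ]
  exact LinearMap.congr_fun h1 y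

theorem extend_mk [FD[K]] {v : S.H1v →ₛₗ[LocalShtuka.AvToC L] (Cv F)⸨X⸩}
    {κ : S.H1v →ₗ[Av F] K} (hv : ∀ t, HasConst (v t) (LtoC K (κ t))) (m : M) :
    HasConst (extend htc v (BC.mk (expC L) m)) (lam tc (eigenVal htc κ) 0 m) := by
  rw [extend_apply, lam_apply, functional_apply]
  refine HasConst.sum _ fun l _ => ?_
  have h1 : (LocalShtuka.expBasis tc).repr (BC.mk (expC L) m) l =
      expSep L (tc.repr (BC.mk (toSepRestr L) m) l) := by
    have h2 : BC.mk (expC L) m = BC.push (toSepRestr L) (expSep L) (expC L) (fun _ => rfl)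
      (BC.mk (toSepRestr L) m) := (BC.push_mk ..).symm
    rw [h2]
    exact BC.pushBasis_repr ..
  rw [h1]
  refine (hasConst_expSep L _).mul ?_
  rw [frobC_apply, pow_zero, pow_one]
  exact hv _

/-- The functional on the Tate module given by an element of `H_{1,v}(M, Q_v)`. -/
def homFun (u : S.HomQv) : S.H1v →ₛₗ[LocalShtuka.AvToC L] (Cv F)⸨X⸩ where
  toFun t := LocalShtuka.QvToC L (u t)
  map_add' s t := by rw [map_add, map_add]
  map_smul' f t := by
    rw [map_smul, smul_def, map_mul, smul_eq_mul]
    congr 1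
    exact IsLocalization.lift_eq _ f

theorem evalC_eq_extend (u : S.HomQv) (y : BC (expC L) M) : S.evalC u (invFun S.compare y) =
    extend htc (homFun u) y := by
  rw [LocalShtuka.evalC_invFun_compare tc htc, extend_apply]
  rfl

variable {j : K →+* (Cv F)⸨X⸩} (hj : ∀ x, j (algebraMap (Qv F) K x) = LocalShtuka.QvToC L x)

/-- The functional on the Tate module given by a functional with values in `K`. -/
def liftFun (κ : S.H1v →ₗ[Av F] K) : S.H1v →ₛₗ[LocalShtuka.AvToC L] (Cv F)⸨X⸩ where
  toFun t := j (κ t)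
  map_add' s t := by rw [map_add, map_add]
  map_smul' f t := by
    rw [map_smul, smul_def, map_mul, smul_eq_mul]
    congr 1
    exact (hj (algebraMap (Av F) (Qv F) f)).trans (IsLocalization.lift_eq _ f)

theorem extend_liftFun_act {ρ : E →ₐ[Qv F] K} {κ : S.H1v →ₗ[Av F] K}
    (hκa : ∀ a t, κ (A.actHom a t) = ρ a * κ t) (a : 𝓞v[E]) (y : BC (expC L) M) :
    extend htc (liftFun hj κ) (A.actBC (expC L) a y) = j (ρ a) * extend htc (liftFun hj κ) y := by
  rw [extend_act, extend_apply, extend_apply, mul_sum]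
  refine sum_congr rfl fun l _ => ?_
  rw [mul_left_comm]
  congr 1
  exact (congrArg j (hκa a _)).trans (map_mul _ _ _)

variable [FD[K]] [Sep[K]] {α π ϑ : Qalg F}
  {ρ : E →ₐ[Qv F] K} {e θ : 𝓞v[E]} (C : IsComponent ρ α π ϑ e θ)

/-- On eigenvectors, the pairing with `u` is given by the `K`-valued functional whose trace
is `u`. -/
theorem evalC_eq_of_eigen {u : S.HomQv} {a₀ : K} {κ : S.H1v →ₗ[Av F] K}
    (hrep : ∀ t, traceRep A.actHom C.good e θ u t = a₀ * κ t) {y : BC (expC L) M}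
    (hye : A.actBC (expC L) e y = y) (hyθ : A.actBC (expC L) θ y = j ⟨ϑ, C.good.mem⟩ • y) :
    S.evalC u (invFun S.compare y) = j a₀ * extend htc (liftFun hj κ) y := by
  rw [evalC_eq_extend htc]
  set b := C.good.powerBasis.basis
  have hpow : ∀ k : ℕ, A.actBC (expC L) (e * θ ^ k) y = j ⟨ϑ, C.good.mem⟩ ^ k • y := by
    intro k
    induction k with
    | zero => rw [pow_zero, mul_one, pow_zero, one_smul, hye]
    | succ k ih =>
      rw [pow_succ', mul_left_comm, map_mul, End.mul_apply, ih, map_smul, hyθ, smul_smul,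
        ← pow_succ]
  have h1 : ∀ t, j (a₀ * κ t) =
      ∑ i : Fin C.good.powerBasis.dim, homFun u (A.actH1v (e * θ ^ (i : ℕ)) t) * j (b.traceDual i) := by
    intro t
    have h0 : traceRep A.actHom C.good e θ u t = ∑ i : Fin C.good.powerBasis.dim,
      u (A.actH1v (e * θ ^ (i : ℕ)) t) • b.traceDual i := rfl
    rw [← hrep, h0, map_sum]
    refine sum_congr rfl fun i _ => ?_
    rw [smul_def, map_mul, hj]
    rfl
  have h2 : j a₀ * extend htc (liftFun hj κ) y = ∑ i, j (b.traceDual i) *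
      extend htc ((homFun u).comp (A.actH1v (e * θ ^ (i : ℕ)))) y := by
    simp only [extend_apply, mul_sum]
    rw [sum_comm]
    refine sum_congr rfl fun l _ => ?_
    rw [mul_left_comm]
    have h3 : j a₀ * liftFun hj κ (LocalShtuka.h1vBasis tc htc l) = _ :=
      (map_mul j _ _).symm.trans (h1 (LocalShtuka.h1vBasis tc htc l))
    rw [h3, mul_sum]
    refine sum_congr rfl fun i _ => ?_
    rw [mul_comm (homFun u _), mul_left_comm]
    rfl
  have h4 : ∀ i, j (b.traceDual i) * extend htc ((homFun u).comp (A.actH1v (e * θ ^ (i : ℕ)))) y =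
      j (b.traceDual i * b i) * extend htc (homFun u) y := by
    intro i
    have h5 : b i = (⟨ϑ, C.good.mem⟩ : K) ^ (i : ℕ) := by
      rw [← C.good.powerBasis_gen]
      exact C.good.powerBasis.basis_eq_pow i
    rw [← extend_act, hpow, map_smul, smul_eq_mul, map_mul, h5, map_pow, mul_assoc]
  rw [h2, sum_congr rfl fun i _ => h4 i, ← sum_mul, ← map_sum, sum_traceDual_mul, map_one, one_mul]

end period

/-! ### Eigenfunctionals on the de Rham realization -/

theorem exists_eq_smul_add_of_isCoprime_pow {k V : Type*} [Field k] [AddCommGroup V] [Module k V]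
    {T : End k V} {c : k} {R : k[X]} (hR : R.eval c ≠ 0) {n : ℕ} {z : V}
    (h1 : ((T - algebraMap k (End k V) c) ^ n) z = 0) (h2 : aeval T ((X - C c) * R) z = 0) : T z =
    c • z := by
  have hco : IsCoprime ((X - C c) ^ n) R := by
    refine IsCoprime.pow_left (((Polynomial.irreducible_X_sub_C c).coprime_iff_not_dvd).2 ?_)
    rwa [Polynomial.dvd_iff_isRoot]
  obtain ⟨p, r, hpr⟩ := hco
  have h3 : (X - C c) = (X - C c) * p * (X - C c) ^ n + r * ((X - C c) * R) := by
    linear_combination (-(X - C c)) * hpr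
  have h4 : aeval T ((X - C c) ^ n) z = 0 := by
    rw [map_pow, map_sub, aeval_X, aeval_C, h1]
  have h5 : aeval T (X - C c) z = 0 := by
    rw [h3, map_add, LinearMap.add_apply, map_mul, End.mul_apply, h4, map_zero, map_mul,
      End.mul_apply, h2, map_zero, add_zero]
  rw [map_sub, aeval_X, aeval_C, LinearMap.sub_apply, algebraMap_end_apply, sub_eq_zero] at h5
  exact h5

section reduction
variable {L : ExtQ} [FD[L]] {M : Type w} [AddCommGroup M] [Module (RX L) M]
  {S : LocalShtuka L M} {E : Type v} [CommRing E] [Algebra (Qv F) E] [Algebra (Av F) E]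
  [IsScalarTower (Av F) (Qv F) E] (A : OEAction S E)

namespace LocalShtuka

/-- The map `σ̂^*M → H^1_dR(M, L)`. -/
def red (_ : LocalShtuka L M) : BC (sigma L) M →ₛₗ[evalL L] BC ((evalL L).comp (sigma L)) M :=
  BC.push (sigma L) (evalL L) ((evalL L).comp (sigma L)) (fun _ => rfl)

theorem red_smul (a : RX L) (x : BC (sigma L) M) : S.red (a • x) = evalL L a • S.red x :=
  push_smul_eq _ _ _ _ _ _

theorem redT_smul (a : L⟦X⟧) (w : S.HdR) :
    S.redT (a • w) = constantCoeff a • S.redT w := push_smul_eq _ _ _ _ _ _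

theorem redT_toHdR (x : BC (sigma L) M) : S.redT (S.toHdR x) = S.red x :=
  BC.push_push (sigma L) (expL L) _ _ _ _ _ _ (fun _ => rfl) x

theorem red_eq_zero {x : BC (sigma L) M} (hx : S.red x = 0) : ∃ y, x = zmz L • y := by
  have := S.free
  have := S.finite
  let b := BC.basis (sigma L) (Free.chooseBasis (RX L) M)
  have h1 : ∀ i, evalL L (b.repr x i) = 0 := by
    intro i
    rw [← BC.pushBasis_repr (sigma L) (evalL L) ((evalL L).comp (sigma L)) (fun _ => rfl) b x i]
    have h2 : BC.push (sigma L) (evalL L) ((evalL L).comp (sigma L)) (fun _ => rfl) x = 0 := hx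
    rw [h2, map_zero, Finsupp.zero_apply]
  choose y hy using fun i => exists_eq_zmz_mul L (h1 i)
  refine ⟨∑ i, y i • b i, b.ext_elem fun i => ?_⟩
  rw [map_smul, Finsupp.smul_apply, b.repr_sum_self, hy, smul_eq_mul]

theorem redT_surjective (z : S.HdRL) : ∃ w, S.redT w = z := by
  induction z using BC.induction with
  | h0 => exact ⟨0, map_zero _⟩
  | hmk a m =>
    refine ⟨PowerSeries.C a • BC.mk _ m, ?_⟩
    rw [redT_smul, constantCoeff_C]
    exact congrArg _ (BC.push_mk ..)
  | hadd x y hx hy =>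
    obtain ⟨v, rfl⟩ := hx
    obtain ⟨w, rfl⟩ := hy
    exact ⟨v + w, map_add _ _ _⟩

/-- The projection `σ̂^*M → H^1_dR(M, R)`. -/
def toHdRR (S : LocalShtuka L M) : BC (sigma L) M →ₗ[RX L] S.HdRR := Submodule.mkQ _

theorem toHdRR_surjective : Surjective S.toHdRR := Submodule.mkQ_surjective _

theorem redR_toHdRR (x : BC (sigma L) M) : S.redR (S.toHdRR x) = S.red x :=
  Submodule.liftQ_apply _ _ _

open scoped Pointwise in
theorem redR_injective {x y : S.HdRR} (h : S.redR x = S.redR y) : x = y := by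
  obtain ⟨x, rfl⟩ := S.toHdRR_surjective x
  obtain ⟨y, rfl⟩ := S.toHdRR_surjective y
  rw [redR_toHdRR, redR_toHdRR, ← sub_eq_zero, ← map_sub] at h
  obtain ⟨z, hz⟩ := S.red_eq_zero h
  rw [← sub_eq_zero, ← map_sub, hz]
  exact (Submodule.Quotient.mk_eq_zero _).2 (Submodule.smul_mem_pointwise_smul _ _ _ trivial)

end LocalShtuka

namespace OEAction

theorem redT_aeval (θ : 𝓞v[E]) (p : L⟦X⟧[X]) (w : S.HdR) : S.redT (aeval (A.actBC _ θ) p w) =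
    aeval (A.actBC _ θ) (p.map constantCoeff) (S.redT w) :=
  A.push_aeval _ _ _ _ θ p w

theorem redT_actBC (a : 𝓞v[E]) (w : S.HdR) :
    S.redT (A.actBC _ a w) = A.actBC _ a (S.redT w) := A.push_actBC _ _ _ _ a w

theorem red_aeval (θ : 𝓞v[E]) (p : (RX L)[X]) (x : BC (sigma L) M) :
    S.red (aeval (A.actBC _ θ) p x) =
      aeval (A.actBC _ θ) (p.map (evalL L)) (S.red x) := A.push_aeval _ _ _ _ θ p x

theorem red_actBC (a : 𝓞v[E]) (x : BC (sigma L) M) :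
    S.red (A.actBC _ a x) = A.actBC _ a (S.red x) := A.push_actBC _ _ _ _ a x

theorem redR_devR (φ : E →ₐ[Qv F] L) (a : 𝓞v[E]) (x : S.HdRR) : S.redR (A.devR φ a x) =
    A.actBC _ a (S.redR x) - φ a • S.redR x := by
  obtain ⟨x, rfl⟩ := S.toHdRR_surjective x
  have h1 : A.devR φ a (S.toHdRR x) =
      S.toHdRR (A.actBC (sigma L) a x - PowerSeries.C (psiR φ a) • x) := rfl
  rw [h1, LocalShtuka.redR_toHdRR, map_sub, red_actBC, LocalShtuka.red_smul, evalL_C,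
    LocalShtuka.redR_toHdRR]
  rfl

theorem redR_devR_pow (φ : E →ₐ[Qv F] L) (a : 𝓞v[E]) (k : ℕ) (x : S.HdRR) :
    S.redR ((A.devR φ a ^ k) x) = ((A.actBC ((evalL L).comp (sigma L)) a -
        algebraMap L (End L S.HdRL) (φ a)) ^ k) (S.redR x) := by
  induction k with
  | zero => rfl
  | succ k ih =>
    rw [pow_succ', End.mul_apply, redR_devR, ih, pow_succ', End.mul_apply, LinearMap.sub_apply,
      algebraMap_end_apply]

variable {e θ : 𝓞v[E]} {g : (Av F)[X]} (hm : IsMonogenic e θ g) {ι : Type*} [Fintype ι]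
  {c : ι → RL L} {h : ι → L⟦X⟧} (H : IsSplitting g c h)
include hm H

theorem comp_evalL_coefR : ((evalL L).comp (sigma L)).comp (coefR L) = (evalL L).comp (coefR L) :=
  RingHom.ext fun f => congrArg (evalL L) (sigma_coefR L f)

theorem map_evalL : g.map ((evalL L).comp (coefR L)) = ∏ i, (X - C (ι[L] (c i))) := by
  rw [← H.map_constantCoeff, Polynomial.map_map]
  rfl

/-- An element of the de Rham realization over `R` lies in the `φ`-component if and only if its
image over `L` is an eigenvector. -/
theorem mem_HpsiR_iff {φ : E →ₐ[Qv F] L} (hφ : φ e = 1) {i : ι} (hφθ : φ θ = ι[L] (c i))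
    (x : S.HdRR) : x ∈ A.HpsiR φ ↔ A.actBC _ e (S.redR x) = S.redR x ∧ A.actBC _ θ (S.redR x) =
    ι[L] (c i) • S.redR x := by
  classical
  constructor
  · intro hx
    have he : A.actBC _ e (S.redR x) = S.redR x := by
      obtain ⟨k₀, hk⟩ := hx (1 - e)
      have h1 := A.redR_devR_pow φ (1 - e) (k₀ + 1) x
      have h3 : φ ((1 - e : 𝓞v[E]) : E) = 0 := by
        have : φ ((1 - e : 𝓞v[E]) : E) = φ 1 - φ e := map_sub φ _ _
        rw [this, hφ, map_one, sub_self]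
      have h5 : (1 - e) * (1 - e) = 1 - e := by
        rw [mul_sub, mul_one, sub_mul, one_mul, hm.idem, sub_self, sub_zero]
      rw [hk _ (Nat.le_succ _), map_zero, h3, map_zero, sub_zero, ← map_pow,
        IsIdempotentElem.pow_succ_eq k₀ h5, map_sub, map_one, LinearMap.sub_apply,
        End.one_apply] at h1
      exact (sub_eq_zero.1 h1.symm).symm
    refine ⟨he, ?_⟩
    obtain ⟨k₀, hk⟩ := hx θ
    have h1 := A.redR_devR_pow φ θ k₀ x
    rw [hk _ le_rfl, map_zero, hφθ] at h1
    have h2 := A.aeval_mul_map_eq_zero hm ((evalL L).comp (sigma L)) 1 he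
    rw [mul_one, comp_evalL_coefR hm H, map_evalL hm H,
      ← Finset.mul_prod_erase _ _ (mem_univ i)] at h2
    refine exists_eq_smul_add_of_isCoprime_pow ?_ h1.symm h2
    rw [eval_prod, prod_ne_zero_iff]
    intro j hj
    rw [eval_sub, eval_X, eval_C, sub_ne_zero]
    exact fun e => ne_of_mem_erase hj (H.injective (algebraMap_RL_injective L e)).symm
  · rintro ⟨he, hθ⟩ a
    refine ⟨1, fun k hk => ?_⟩
    obtain ⟨k, rfl⟩ := Nat.exists_eq_add_of_le' hk
    obtain ⟨p, hp⟩ := hm.exists_aeval a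
    have h1 : A.actBC _ a (S.redR x) = φ a • S.redR x := by
      have h2 := aeval_apply_of_eigen hθ (p.map ((evalL L).comp (coefR L)))
      rw [← comp_evalL_coefR hm H, ← A.actBC_aeval] at h2
      have h3 : A.actBC _ a (S.redR x) = A.actBC _ (aeval θ p) (S.redR x) := by
        conv_lhs => rw [← he, ← End.mul_apply, ← map_mul, mul_comm, hp, mul_comm, map_mul,
          End.mul_apply, he]
      rw [h3, h2, comp_evalL_coefR hm H, algHom_apply hm hφ hp, hφθ, eval_map]
      congr 2
      exact RingHom.ext fun f => evalL_coefR L f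
    have h4 : A.devR φ a x = 0 := by
      apply S.redR_injective
      rw [redR_devR, h1, sub_self, map_zero]
    rw [pow_succ, End.mul_apply, h4, map_zero]

/-- The eigenvectors over `L` are the multiples of the reduction of a generator. -/
theorem exists_eq_smul_redT {φ : E →ₐ[Qv F] L} (hφ : φ e = 1) {i : ι} (hφθ : φ θ = ι[L] (c i))
    {ω : S.HdR} (hω : A.IsGenerator φ ω) {z : S.HdRL} (he : A.actBC _ e z = z)
    (hθ : A.actBC _ θ z = ι[L] (c i) • z) : ∃ a : L, z = a • S.redT ω := by
  classical
  have : Nonempty ι := ⟨i⟩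
  obtain ⟨P, -, hPR, hPe⟩ := H.exists_projectors
  obtain ⟨R, hR⟩ := hPR i
  obtain ⟨w, rfl⟩ := S.redT_surjective z
  set v := A.actBC _ e w with hv
  have hev : A.actBC _ e v = v := A.actBC_idem hm _ _
  have hmem : aeval (A.actBC _ θ) (P i) v ∈ A.Hpsi φ := by
    rw [A.mem_Hpsi_iff hm H hφ hφθ]
    refine ⟨by rw [A.actBC_aeval_comm, hev], ?_⟩
    rw [← expL_sigma_coefR] at hR
    have h1 := A.aeval_mul_map_eq_zero hm ((expL L).comp (sigma L)) R hev
    rw [← hR, map_mul, End.mul_apply, map_sub, aeval_X, aeval_C, LinearMap.sub_apply,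
      algebraMap_end_apply, sub_eq_zero] at h1
    exact h1
  rw [← hω, mem_span_singleton] at hmem
  obtain ⟨a, ha⟩ := hmem
  refine ⟨constantCoeff a, ?_⟩
  have h2 : ((P i).map constantCoeff).eval (ι[L] (c i)) = 1 := by
    rw [← H.constantCoeff_eq, eval_map, eval₂_hom, hPe, if_pos rfl, map_one]
  rw [← LocalShtuka.redT_smul, ha, redT_aeval, hv, redT_actBC, he, aeval_apply_of_eigen hθ, h2,
    one_smul]

omit hm H in
/-- A functional on `H^1_dR(M, L)` for which `e` and `θ` have the eigenvalues `1` and `t`, and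
whose norm is `ν` with respect to the lattice `H^1_dR(M, R)`. -/
abbrev IsEigenfunctional (e θ : 𝓞v[E]) (t : L) (ν : ℝ) (f : S.HdRL →ₛₗ[LtoC L] Cv F) : Prop :=
  0 < ν ∧ (∀ z, f (A.actBC _ e z) = f z) ∧ (∀ z, f (A.actBC _ θ z) = LtoC L t * f z) ∧
  (∀ x, ‖f (S.red x)‖ ≤ ν) ∧ ∃ x, ‖f (S.red x)‖ = ν

variable {A} {i : ι} {ν : ℝ} {f : S.HdRL →ₛₗ[LtoC L] Cv F}
  (hf : A.IsEigenfunctional e θ (ι[L] (c i)) ν f) [DecidableEq ι]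
include hf

/-- On eigenvectors in the lattice, the norm of an eigenfunctional is multiplied by
`∏_{j ≠ i} (c_i - c_j)`. -/
theorem IsEigenfunctional.norm_le_of_eigen {x : BC (sigma L) M}
    (he : A.actBC _ e (S.red x) = S.red x) (hθ : A.actBC _ θ (S.red x) = ι[L] (c i) • S.red x) :
    ‖f (S.red x)‖ ≤ ‖∏ j ∈ univ.erase i, (ι[L] (c i) - ι[L] (c j))‖ * ν := by
  obtain ⟨Q, u, hQ⟩ := H.exists_factor i
  set y := A.actBC (sigma L) e x with hy
  have hyx : S.red y = S.red x := by rw [hy, red_actBC, he]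
  obtain ⟨v, hv⟩ : ∃ v, aeval (A.actBC (sigma L) θ)
      (X - C (PowerSeries.C (c i))) y = zmz L • v := by
    apply S.red_eq_zero
    rw [red_aeval, hyx, Polynomial.map_sub, Polynomial.map_X, Polynomial.map_C, evalL_C, map_sub,
      aeval_X, aeval_C, LinearMap.sub_apply, algebraMap_end_apply, hθ, sub_self]
  have h1 : (u : RX L) • y = -aeval (A.actBC (sigma L) θ) Q v := by
    apply S.zmz_pow_smul_cancel (N := 1)
    have h2 : zmz L • aeval (A.actBC (sigma L) θ) Q v = -((zmz L * u) • y) := by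
      have hsc : (sigma L).comp (coefR L) = coefR L := RingHom.ext fun r => sigma_coefR L r
      have h3 := A.aeval_mul_map_eq_zero hm (sigma L) 1 (A.actBC_idem hm (sigma L) x)
      rw [hsc, mul_one] at h3
      rw [← map_smul, ← hv, ← End.mul_apply, ← map_mul, mul_comm Q, hQ, map_sub,
        LinearMap.sub_apply, h3, zero_sub, aeval_C, algebraMap_end_apply]
    rw [pow_one, smul_neg, h2, neg_neg, mul_smul]
  have h4 := congrArg (fun x => ‖f (S.red x)‖) h1
  rw [LocalShtuka.red_smul, map_smulₛₗ, map_neg, map_neg, norm_neg, norm_smul, red_aeval,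
    apply_aeval_of_eigen hf.2.2.1, norm_mul, hyx] at h4
  have h5 : ‖LtoC L (evalL L u)‖ = 1 := (norm_toCv _).trans (norm_evalL_unit u)
  rw [h5, one_mul, eval₂_hom, H.eval_factor hQ] at h4
  rw [h4]
  exact mul_le_mul (norm_toCv _).le (hf.2.2.2.1 v) (norm_nonneg _) (norm_nonneg _)

theorem IsEigenfunctional.exists_eigen : ∃ x : BC (sigma L) M, A.actBC _ e (S.red x) = S.red x ∧
    A.actBC _ θ (S.red x) = ι[L] (c i) • S.red x ∧ ‖f (S.red x)‖ = ‖∏ j ∈ univ.erase i,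
    (ι[L] (c i) - ι[L] (c j))‖ * ν := by
  obtain ⟨Q, u, hQ⟩ := H.exists_factor i
  obtain ⟨x, hx⟩ := hf.2.2.2.2
  have hz : A.actBC _ e (A.actBC _ e (S.red x)) = A.actBC _ e (S.red x) := A.actBC_idem hm _ _
  refine ⟨aeval (A.actBC (sigma L) θ) Q (A.actBC (sigma L) e x), ?_, ?_, ?_⟩
  · rw [red_aeval, red_actBC, A.actBC_aeval_comm, hz]
  · rw [red_aeval, red_actBC]
    have h1 := A.aeval_mul_map_eq_zero hm ((evalL L).comp (sigma L)) 1 hz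
    have h2 := congrArg (Polynomial.map (evalL L)) hQ
    rw [Polynomial.map_mul, Polynomial.map_sub, Polynomial.map_X, Polynomial.map_C, evalL_C,
      Polynomial.map_sub, Polynomial.map_C, map_mul, evalL_zmz, zero_mul, map_zero, sub_zero,
      Polynomial.map_map] at h2
    rw [mul_one, comp_evalL_coefR hm H, ← h2, map_mul, End.mul_apply, map_sub, aeval_X, aeval_C,
      LinearMap.sub_apply, algebraMap_end_apply, sub_eq_zero] at h1
    exact h1
  · rw [red_aeval, red_actBC, apply_aeval_of_eigen hf.2.2.1, hf.2.1, norm_mul, hx, eval₂_hom,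
    H.eval_factor hQ]
    exact congrArg (· * ν) (norm_toCv _)

theorem IsSplitting.prod_sub_ne_zero : ∏ j ∈ univ.erase i, (ι[L] (c i) - ι[L] (c j)) ≠ 0 := by
  rw [prod_ne_zero_iff]
  intro j hj
  rw [sub_ne_zero]
  exact fun e => ne_of_mem_erase hj (H.injective (algebraMap_RL_injective L e)).symm

variable {φ : E →ₐ[Qv F] L} (hφ : φ e = 1) (hφθ : φ θ = ι[L] (c i)) {ω : S.HdR}
  (hω : A.IsGenerator φ ω)
include hφ hφθ hω

theorem IsEigenfunctional.norm_of_isIntegralGenerator (hω' : A.IsIntegralGenerator φ ω) :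
    ‖f (S.redT ω)‖ = ‖∏ j ∈ univ.erase i, (ι[L] (c i) - ι[L] (c j))‖ * ν := by
  obtain ⟨W, hW, hWω⟩ := hω'.2
  obtain ⟨x, rfl⟩ := S.toHdRR_surjective W
  have hxω : S.red x = S.redT ω := (S.redR_toHdRR x).symm.trans hWω
  have hmem := (A.mem_HpsiR_iff hm H hφ hφθ _).1 (hW ▸ mem_span_singleton_self _)
  rw [hWω] at hmem
  refine le_antisymm ?_ ?_
  · rw [← hxω] at hmem ⊢
    exact hf.norm_le_of_eigen hm H hmem.1 hmem.2
  · obtain ⟨y, hye, hyθ, hy⟩ := hf.exists_eigen hm H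
    have h1 : S.toHdRR y ∈ A.HpsiR φ := by
      rw [A.mem_HpsiR_iff hm H hφ hφθ]
      have : S.redR (S.toHdRR y) = S.red y := S.redR_toHdRR y
      rw [this]
      exact ⟨hye, hyθ⟩
    rw [← hW, mem_span_singleton] at h1
    obtain ⟨r, hr⟩ := h1
    have h2 : evalL L r • S.redT ω = S.red y := by
      rw [← hWω, ← map_smulₛₗ, hr]
      exact S.redR_toHdRR y
    rw [← hy, ← h2, map_smulₛₗ, norm_smul]
    refine mul_le_of_le_one_left (norm_nonneg _) ?_
    exact (norm_toCv _).trans_le (norm_evalL_le L r)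

theorem IsEigenfunctional.apply_redT_ne_zero : f (S.redT ω) ≠ 0 := by
  obtain ⟨x, hxe, hxθ, hx⟩ := hf.exists_eigen hm H
  obtain ⟨a, ha⟩ := A.exists_eq_smul_redT hm H hφ hφθ hω hxe hxθ
  intro h0
  rw [ha, map_smulₛₗ, h0, smul_zero, norm_zero] at hx
  exact mul_ne_zero (norm_ne_zero_iff.2 (IsSplitting.prod_sub_ne_zero hm H hf)) hf.1.ne' hx.symm

theorem IsEigenfunctional.exists_isIntegralGenerator [Sep[L]] : ∃ p :
    L⟦X⟧ × S.HdR, A.IsIntegralGenerator φ p.2 ∧ ω = p.1 • p.2 := by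
  obtain ⟨x, hxe, hxθ, hx⟩ := hf.exists_eigen hm H
  obtain ⟨a, ha⟩ := A.exists_eq_smul_redT hm H hφ hφθ hω hxe hxθ
  have h0 := hf.apply_redT_ne_zero hm H hφ hφθ hω
  have ha0 : a ≠ 0 := by
    rintro rfl
    rw [ha, zero_smul, map_zero, norm_zero] at hx
    exact mul_ne_zero (norm_ne_zero_iff.2 (IsSplitting.prod_sub_ne_zero hm H hf)) hf.1.ne' hx.symm
  have hu : IsUnit (PowerSeries.C a : L⟦X⟧) := (isUnit_iff_ne_zero.2 ha0).map PowerSeries.C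
  have hxR : S.redR (S.toHdRR x) = S.red x := S.redR_toHdRR x
  refine ⟨(PowerSeries.C a⁻¹, PowerSeries.C a • ω), ⟨?_, S.toHdRR x, ?_, ?_⟩, ?_⟩
  · exact (Submodule.span_singleton_smul_eq hu ω).trans hω
  · refine le_antisymm ?_ fun y hy => ?_
    · rw [Submodule.span_singleton_le_iff_mem, A.mem_HpsiR_iff hm H hφ hφθ, hxR]
      exact ⟨hxe, hxθ⟩
    · obtain ⟨y, rfl⟩ := S.toHdRR_surjective y
      have hyR : S.redR (S.toHdRR y) = S.red y := S.redR_toHdRR y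
      have hy' := (A.mem_HpsiR_iff hm H hφ hφθ _).1 hy
      rw [hyR] at hy'
      obtain ⟨b, hb⟩ := A.exists_eq_smul_redT hm H hφ hφθ hω hy'.1 hy'.2
      have h1 := hf.norm_le_of_eigen hm H hy'.1 hy'.2
      rw [← hx, hb, ha, map_smulₛₗ, map_smulₛₗ, norm_smul, norm_smul] at h1
      have h2 : ‖b‖ ≤ ‖a‖ := by
        have h3 := le_of_mul_le_mul_right h1 (norm_pos_iff.2 h0)
        exact ((norm_toCv _).symm.trans_le h3).trans (norm_toCv _).le
      have h3 : ‖b / a‖ ≤ 1 := by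
        rw [norm_div]
        exact div_le_one_of_le₀ h2 (norm_nonneg _)
      rw [mem_span_singleton]
      refine ⟨PowerSeries.C (mkRL L (b / a) h3), S.redR_injective ?_⟩
      rw [map_smulₛₗ, hxR, hyR, evalL_C, ha, hb, smul_smul]
      congr 1
      exact div_mul_cancel₀ b ha0
  · rw [hxR, ha, LocalShtuka.redT_smul, constantCoeff_C]
  · change ω = PowerSeries.C a⁻¹ • PowerSeries.C a • ω
    rw [smul_smul, ← map_mul, inv_mul_cancel₀ ha0, map_one, one_smul]

/-- The valuation of a generator is the valuation of the value of an eigenfunctional, up to a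
normalization. -/
theorem IsEigenfunctional.valOmega_eq [Sep[L]] : A.valOmega φ ω =
    val F (f (S.redT ω)) - val F ν - ∑ j ∈ univ.erase i, val F (ι[L] (c i) - ι[L] (c j)) := by
  have hex := hf.exists_isIntegralGenerator hm H hφ hφθ hω
  have h0 := hf.apply_redT_ne_zero hm H hφ hφθ hω
  have hG := IsSplitting.prod_sub_ne_zero hm H hf
  rw [valOmega, dif_pos hex]
  set p := hex.choose
  obtain ⟨h1, h2⟩ := hex.choose_spec
  have h3 := hf.norm_of_isIntegralGenerator hm H hφ hφθ h1.1 h1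
  have h4 : f (S.redT ω) = LtoC L (constantCoeff p.1) * f (S.redT p.2) := by
    conv_lhs => rw [h2]
    rw [LocalShtuka.redT_smul, map_smulₛₗ, smul_eq_mul]
  have h5 : constantCoeff p.1 ≠ 0 := by
    intro h6
    rw [h6, map_zero, zero_mul] at h4
    exact h0 h4
  have h6 : ‖f (S.redT ω)‖ = ‖constantCoeff p.1‖ * (‖∏ j ∈ univ.erase i,
      (ι[L] (c i) - ι[L] (c j))‖ * ν) := by
    rw [h4, norm_mul, h3]
    exact congrArg (· * _) (norm_toCv _)
  rw [← val_prod _ _ (prod_ne_zero_iff.1 hG), val, val, val, val, h6,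
    Real.log_mul (norm_ne_zero_iff.2 h5) (mul_ne_zero (norm_ne_zero_iff.2 hG) hf.1.ne'),
    Real.log_mul (norm_ne_zero_iff.2 hG) hf.1.ne', Real.norm_of_nonneg hf.1.le]
  ring

end OEAction
end reduction

/-! ### The valuations of the periods -/

section functional
variable {L : ExtQ} [FD[L]] {M : Type w} [AddCommGroup M] [Module (RX L) M]
  {S : LocalShtuka L M}

/-- A functional on `H^1_dR(M, L⟦z - ζ⟧)` without poles on `σ̂^*M` has a reduction modulo
`z - ζ`. -/
theorem LocalShtuka.exists_reduction {Q : S.HdR →ₛₗ[TtoC L] (Cv F)⸨X⸩}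
    (hQ : ∀ x, ∃ c, HasConst (Q (S.toHdR x)) c) : ∃ f : S.HdRL →ₛₗ[LtoC L] Cv F, ∀ w,
    HasConst (Q w) (f (S.redT w)) := by
  have hmk : ∀ m, S.toHdR (BC.mk (sigma L) m) = BC.mk ((expL L).comp (sigma L)) m := fun m =>
    BC.push_mk ..
  have hsmul : ∀ (a : L⟦X⟧) (w : S.HdR) {x}, HasConst (Q w) x →
      HasConst (Q (a • w)) (LtoC L (constantCoeff a) * x) := by
    intro a w x hx
    rw [map_smulₛₗ]
    exact (hasConst_TtoC a).mul hx
  have hadd : ∀ (v w : S.HdR) {x y}, HasConst (Q v) x → HasConst (Q w) y →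
      HasConst (Q (v + w)) (x + y) := by
    intro v w x y hx hy
    rw [map_add]
    exact hx.add hy
  have hall : ∀ w : S.HdR, ∃ c, HasConst (Q w) c := by
    intro w
    induction w using BC.induction with
    | h0 => exact ⟨0, by rw [map_zero]; exact HasConst.zero⟩
    | hmk a m =>
      obtain ⟨c, hc⟩ := hQ (BC.mk (sigma L) m)
      rw [hmk] at hc
      exact ⟨_, hsmul a _ hc⟩
    | hadd v w hv hw =>
      obtain ⟨x, hx⟩ := hv
      obtain ⟨y, hy⟩ := hw
      exact ⟨_, hadd v w hx hy⟩
  choose c hc using hall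
  have hc0 : c 0 = 0 := (hc 0).unique (by rw [map_zero]; exact HasConst.zero)
  let φ : M →+ Cv F :=
    { toFun := fun m => c (BC.mk _ m)
      map_zero' := by rw [map_zero, hc0]
      map_add' := fun m m' => by
        rw [map_add]
        exact (hc _).unique (hadd _ _ (hc _) (hc _)) }
  have hφ : ∀ a m, φ (a • m) = LtoC L (((evalL L).comp (sigma L)) a) • φ m := by
    intro a m
    refine (hc _).unique ?_
    rw [map_smulₛₗ (BC.mk ((expL L).comp (sigma L)))]
    exact hsmul _ _ (hc _)
  refine ⟨BC.lift ((evalL L).comp (sigma L)) (LtoC L) φ hφ, fun w => ?_⟩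
  induction w using BC.induction with
  | h0 =>
    rw [map_zero, map_zero, map_zero]
    exact HasConst.zero
  | hmk a m =>
    have h1 : BC.lift ((evalL L).comp (sigma L)) (LtoC L) φ hφ
        (S.redT (a • BC.mk ((expL L).comp (sigma L)) m)) =
        LtoC L (constantCoeff a) * c (BC.mk _ m) := by
      rw [redT_smul, map_smulₛₗ]
      refine congrArg _ ((congrArg _ ?_).trans (BC.lift_mk ((evalL L).comp (sigma L)) (LtoC L) φ hφ m))
      exact BC.push_mk ..
    rw [h1]
    exact hsmul a _ (hc _)
  | hadd v w hv hw =>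
    have h1 : BC.lift ((evalL L).comp (sigma L)) (LtoC L) φ hφ (S.redT (v + w)) = _ :=
      (congrArg _ (map_add S.redT v w)).trans (map_add _ _ _)
    rw [h1]
    exact hadd v w hv hw

end functional

section valT
theorem valT_single (k : ℤ) : valT (single k (1 : Cv F)) = 0 := by
  rw [valT, HahnSeries.leadingCoeff_of_single, val, norm_one, Real.log_one, neg_zero, zero_div]

variable {L : ExtQ} [FD[L]] {I : Type*} [Fintype I] [DecidableEq I]
  {c : I → RL L} {h : I → L⟦X⟧} {g : (Av F)[X]}

/-- The factor `(z - ζ)^{-N} ∏_i (h_{i₀} - c_i)^{n_i}`. -/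
def divisorVal (c : I → RL L) (t : L⟦X⟧) (n : I → ℕ) (N : ℕ) : (Cv F)⸨X⸩ :=
  single (-(N : ℤ)) 1 * TtoC L (((divisor c n).map ((PowerSeries.C (R := L)).comp ι[L])).eval t)

/-- The leading coefficient is a product of powers of differences of the `c_i`: the factor
`h_{i₀} - c_{i₀}` contributes `z - ζ` and the inverse of the derivative of `g`. -/
theorem valT_divisorVal (H : IsSplitting g c h) (i₀ : I) {n : I → ℕ} {N : ℕ} {d : I → ℤ}
    (hn : ∀ i, (n i : ℤ) = N - d i) : divisorVal c (h i₀) n N ≠ 0 ∧ valT (divisorVal c (h i₀) n N) =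
    -∑ i ∈ univ.erase i₀, (d i - d i₀ : ℝ) * val F (ι[L] (c i₀) - ι[L] (c i)) := by
  obtain ⟨w, hw, hwu, hw1⟩ := H.exists_sub_C i₀
  have hne : ∀ i ∈ univ.erase i₀, ι[L] (c i₀) - ι[L] (c i) ≠ 0 := fun i hi => by
    rw [sub_ne_zero]
    exact fun e => ne_of_mem_erase hi (H.injective (algebraMap_RL_injective L e)).symm
  have hw0 : constantCoeff w ≠ 0 := (isUnit_iff_constantCoeff.1 hwu).ne_zero
  set U : L⟦X⟧ := w ^ n i₀ * ∏ i ∈ univ.erase i₀, (h i₀ - PowerSeries.C (ι[L] (c i))) ^ n i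
  have hU : constantCoeff U = constantCoeff w ^ n i₀ * ∏ i ∈ univ.erase i₀,
        (ι[L] (c i₀) - ι[L] (c i)) ^ n i := by
    rw [map_mul, map_pow, map_prod]
    simp only [map_pow, map_sub, H.constantCoeff_eq, constantCoeff_C]
  have hU0 : constantCoeff U ≠ 0 := by
    rw [hU]
    exact mul_ne_zero (pow_ne_zero _ hw0) (prod_ne_zero_iff.2 fun i hi =>
      pow_ne_zero _ (hne i hi))
  have hUC := hasConst_TtoC (L := L) U
  have hLU0 : LtoC L (constantCoeff U) ≠ 0 := (map_ne_zero _).2 hU0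
  have h1 : divisorVal c (h i₀) n N = single ((n i₀ : ℤ) - N) 1 * TtoC L U := by
    have h2 : ((divisor c n).map ((PowerSeries.C (R := L)).comp ι[L])).eval (h i₀) =
        PowerSeries.X ^ n i₀ * U := by
      rw [divisor_map_eval, ← Finset.mul_prod_erase _ _ (mem_univ i₀), ← mul_assoc, ← mul_pow, ← hw]
      rfl
    have h3 : TtoC L (PowerSeries.X ^ n i₀) = single (n i₀ : ℤ) 1 := by
      rw [TtoC, RingHom.comp_apply, map_pow, PowerSeries.map_X, ofPowerSeries_X_pow]
    rw [divisorVal, h2, map_mul, h3, ← mul_assoc, single_mul_single, mul_one, neg_add_eq_sub]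
  have h4 : (single ((n i₀ : ℤ) - N) (1 : Cv F)) ≠ 0 := HahnSeries.single_ne_zero one_ne_zero
  refine ⟨h1 ▸ mul_ne_zero h4 (hUC.ne_zero hLU0), ?_⟩
  have h5 : val F (constantCoeff w) = -∑ i ∈ univ.erase i₀, val F (ι[L] (c i₀) - ι[L] (c i)) := by
    rw [← val_prod _ _ hne, eq_neg_iff_add_eq_zero, ← val_mul hw0 (prod_ne_zero_iff.2 hne), val,
      hw1, Real.log_one, neg_zero, zero_div]
  have h6 : val F (LtoC L (constantCoeff U)) = val F (constantCoeff U) :=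
    val_eq_of_norm_eq (norm_toCv _)
  rw [h1, valT_mul h4 (hUC.ne_zero hLU0), valT_single, zero_add, hUC.valT hLU0, h6, hU,
    val_mul (pow_ne_zero _ hw0) (prod_ne_zero_iff.2 fun i hi => pow_ne_zero _ (hne i hi)),
    val_pow, val_prod _ _ fun i hi => pow_ne_zero _ (hne i hi), h5, mul_neg, mul_sum,
    ← Finset.sum_neg_distrib, ← Finset.sum_neg_distrib, ← sum_add_distrib]
  refine sum_congr rfl fun i _ => ?_
  have h7 : ∀ i, (n i : ℝ) = N - d i := fun i => by exact_mod_cast hn i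
  rw [val_pow, h7, h7]
  ring

end valT

section period
variable {L K : ExtQ} [FD[L]] {M : Type w} [AddCommGroup M] [Module (RX L) M]
  {S : LocalShtuka L M} {E : Type v} [CommRing E] [Algebra (Qv F) E] [Algebra (Av F) E]
  [IsScalarTower (Av F) (Qv F) E] {A : OEAction S E} {ι : Type*} [Fintype ι] [DecidableEq ι]
  {tc : Basis ι (SepRestr L) (BC (toSepRestr L) M)} (htc : ∀ l, S.convToSep (tc l) ∈ S.H1v)
  {j : K →+* (Cv F)⸨X⸩} (hj : ∀ x, j (algebraMap (Qv F) K x) = LocalShtuka.QvToC L x)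
  (κ : S.H1v →ₗ[Av F] K)

/-- The functional on the de Rham realization given by a functional on the Tate module and the
comparison isomorphism, multiplied by `a`. -/
def deRhamFun (a : (Cv F)⸨X⸩) : S.HdR →ₛₗ[TtoC L] (Cv F)⸨X⸩ where
  toFun w := a * extend htc (liftFun hj κ) (S.tauB (expC L) (isUnit_expC L) (S.HdRtoC w))
  map_add' v w := by rw [map_add, map_add, map_add, mul_add]
  map_smul' r w := by
    have h1 : S.HdRtoC (r • w) = TtoC L r • S.HdRtoC w := push_smul_eq _ _ _ _ _ _
    rw [h1, LinearEquiv.map_smul, LinearMap.map_smul, smul_eq_mul, smul_eq_mul, mul_left_comm]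

theorem deRhamFun_apply (a : (Cv F)⸨X⸩) (w : S.HdR) : deRhamFun htc hj κ a w =
    a * extend htc (liftFun hj κ) (S.tauB (expC L) (isUnit_expC L) (S.HdRtoC w)) := rfl

theorem HdRtoC_toHdR (x : BC (sigma L) M) : S.HdRtoC (S.toHdR x) =
    BC.push (sigma L) (expC L) ((expC L).comp (sigma L)) (fun _ => rfl) x :=
  BC.push_push (sigma L) (expL L) _ _ (TtoC L) _ _ _ (expC_eq L) x

theorem HdRtoC_actBC (a : 𝓞v[E]) (w : S.HdR) :
    S.HdRtoC (A.actBC _ a w) = A.actBC _ a (S.HdRtoC w) := A.push_actBC _ _ _ _ a w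

variable {κ} {ρ : E →ₐ[Qv F] K} (hκa : ∀ a t, κ (A.actHom a t) = ρ a * κ t)
include hκa

theorem deRhamFun_act (a : (Cv F)⸨X⸩) (x : 𝓞v[E]) (w : S.HdR) :
    deRhamFun htc hj κ a (A.actBC _ x w) = j (ρ x) * deRhamFun htc hj κ a w := by
  rw [deRhamFun_apply, deRhamFun_apply, HdRtoC_actBC, A.tauB_actBC, extend_liftFun_act A htc hj hκa,
    mul_left_comm]

variable {e θ : 𝓞v[E]} (he : ρ e = 1) {I : Type*} [Fintype I] [DecidableEq I] {c : I → RL L}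
  {t : L⟦X⟧} (hθ : j (ρ θ) = TtoC L t)
include he hθ

/-- On a pair in the correspondence given by the CM-type, the functional on the de Rham
realization is the functional on `M`. -/
theorem deRhamFun_toHdR {n : I → ℕ} {N : ℕ} {x : BC (sigma L) M} {m : M}
    (hx : S.TauRel (aeval (A.actBC (sigma L) θ)
      ((divisor c n).map PowerSeries.C) (A.actBC (sigma L) e x)) (zmz L ^ N • A.act e m)) :
    deRhamFun htc hj κ (divisorVal c t n N) (S.toHdR x) =
      extend htc (liftFun hj κ) (BC.mk (expC L) m) := by
  set f := extend htc (liftFun hj κ)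
  have hact : ∀ (a : 𝓞v[E]) y, f (A.actBC (expC L) a y) = j (ρ a) * f y :=
    extend_liftFun_act A htc hj hκa
  have h1 := congrArg f (hx.tauB (expC L) (isUnit_expC L))
  rw [A.push_aeval, A.push_actBC, A.tauB_aeval, A.tauB_actBC, apply_aeval_of_eigen (hact θ), hact,
    he, map_one, one_mul, map_smulₛₗ (BC.mk (expC L)), LinearMap.map_smul, ← A.actBC_mk, hact, he,
    map_one, one_mul, hθ, smul_eq_mul] at h1
  have h2 : eval₂ (RingHom.id _) (TtoC L t)
      (((divisor c n).map PowerSeries.C).map (expC L)) =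
      TtoC L (((divisor c n).map ((PowerSeries.C (R := L)).comp ι[L])).eval t) := by
    rw [← eval₂_hom, eval₂_map, eval₂_map, eval₂_map, RingHom.id_comp]
    congr 1
    exact RingHom.ext fun r => (expC_eq L _).trans (congrArg (TtoC L) (expL_C L r))
  have h3 : single (-(N : ℤ)) (1 : Cv F) * expC L (zmz L ^ N) = 1 := by
    rw [map_pow, expC_zmz, HahnSeries.single_pow, single_mul_single, one_pow, mul_one, nsmul_one,
      neg_add_cancel]
    rfl
  rw [h2] at h1
  rw [deRhamFun_apply, HdRtoC_toHdR, divisorVal, mul_assoc, h1, ← mul_assoc, h3, one_mul]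

omit hκa he hθ in
theorem exists_norm_eigenVal_eq_one [FD[K]] (hκ : ∀ t, ‖κ t‖ ≤ 1)
    (hκ1 : ∃ t, κ t = 1) : ∃ l, ‖eigenVal htc κ l‖ = 1 := by
  obtain ⟨t₀, ht₀⟩ := hκ1
  by_contra! hne
  have hn : ∀ l, ‖eigenVal htc κ l‖ = ‖κ (LocalShtuka.h1vBasis tc htc l)‖ := fun l => norm_toCv _
  have hlt : ∀ l, ‖κ (LocalShtuka.h1vBasis tc htc l)‖ < 1 := fun l =>
    lt_of_le_of_ne (hκ _) ((hn l).symm.trans_ne (hne l))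
  have h1 : ‖κ t₀‖ < 1 := by
    rw [← (LocalShtuka.h1vBasis tc htc).sum_repr t₀, map_sum]
    refine lt_of_not_ge fun hge => ?_
    rcases isEmpty_or_nonempty ι with hι | hι
    · rw [Finset.univ_eq_empty, Finset.sum_empty, norm_zero] at hge
      exact zero_lt_one.not_ge hge
    · obtain ⟨l, -, hl⟩ := IsUltrametricDist.exists_norm_finsetSum_le_of_nonempty
        Finset.univ_nonempty fun l => κ ((LocalShtuka.h1vBasis tc htc).repr t₀ l •
          LocalShtuka.h1vBasis tc htc l)
      refine ((hge.trans hl).trans ?_).not_gt (hlt l)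
      rw [map_smul, ← algebraMap_smul (Qv F), norm_smul]
      exact mul_le_of_le_one_left (norm_nonneg _) (norm_Av_le F _)
  rw [ht₀, norm_one] at h1
  exact lt_irrefl _ h1

variable [Nonempty ι] (b : Basis ι (RX L) M) [FD[K]]

/-- The functional on the de Rham realization reduces to an eigenfunctional. -/
theorem exists_isEigenfunctional {n : I → ℕ} {N : ℕ} (T : TauCorr A e θ (divisor c n) N)
    (hv : ∀ t, HasConst (liftFun hj κ t) (LtoC K (κ t))) {l : ι} (hl : ‖eigenVal htc κ l‖ = 1) :
    ∃ f : S.HdRL →ₛₗ[LtoC L] Cv F,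
    A.IsEigenfunctional e θ (constantCoeff t) (supLam tc (eigenVal htc κ) b 0) f ∧ ∀ w,
    HasConst (deRhamFun htc hj κ (divisorVal c t n N) w) (f (S.redT w)) := by
  set Q := deRhamFun htc hj κ (divisorVal c t n N) with hQ
  have hQm : ∀ {x m}, S.TauRel (aeval (A.actBC (sigma L) θ)
      ((divisor c n).map PowerSeries.C) (A.actBC (sigma L) e x)) (zmz L ^ N • A.act e m) →
      HasConst (Q (S.toHdR x)) (lam tc (eigenVal htc κ) 0 m) := by
    intro x m hx
    rw [hQ, deRhamFun_toHdR htc hj hκa he hθ hx]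
    exact extend_mk htc hv m
  obtain ⟨f, hf⟩ := S.exists_reduction (Q := Q) fun x => by
    obtain ⟨m, hm⟩ := T.left x
    exact ⟨_, hQm hm⟩
  have hfx : ∀ {x m}, S.TauRel (aeval (A.actBC (sigma L) θ)
      ((divisor c n).map PowerSeries.C) (A.actBC (sigma L) e x)) (zmz L ^ N • A.act e m) →
      f (S.red x) = lam tc (eigenVal htc κ) 0 m := by
    intro x m hx
    rw [← S.redT_toHdR]
    exact (hf _).unique (hQm hx)
  refine ⟨f, ⟨?_, fun z => ?_, fun z => ?_, fun x => ?_, ?_⟩, hf⟩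
  · obtain ⟨C, hC, hC'⟩ := exists_le_supLam tc (eigenVal htc κ) b hl
    exact hC.trans_le (hC' 0)
  · obtain ⟨w, rfl⟩ := S.redT_surjective z
    rw [← A.redT_actBC]
    refine (hf _).unique ?_
    rw [hQ, deRhamFun_act htc hj hκa, he, map_one, one_mul]
    exact hf w
  · obtain ⟨w, rfl⟩ := S.redT_surjective z
    rw [← A.redT_actBC]
    refine (hf _).unique ?_
    rw [hQ, deRhamFun_act htc hj hκa, hθ]
    exact (hasConst_TtoC t).mul (hf w)
  · obtain ⟨m, hm⟩ := T.left x
    rw [hfx hm]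
    exact norm_lam_le tc _ b 0 m
  · obtain ⟨i, hi⟩ := exists_norm_lam_eq tc (eigenVal htc κ) b 0
    obtain ⟨x, hx⟩ := T.right (b i)
    exact ⟨x, by rw [hfx hx, hi]⟩

end period

section valuation
variable {L K : ExtQ} [FD[L]] [Sep[L]]
  [FD[K]] [Sep[K]] {M : Type w} [AddCommGroup M]
  [Module (RX L) M] {S : LocalShtuka L M} {E : Type v} [CommRing E] [Algebra (Qv F) E]
  [Algebra (Av F) E] [IsScalarTower (Av F) (Qv F) E] [Module.Finite (Qv F) E] [IsSemisimpleRing E]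
  (hEL : ∀ (χ : E →ₐ[Qv F] Qalg F) (e : E), χ e ∈ L) {A : OEAction S E} {ρ : E →ₐ[Qv F] K}
  {α π ϑ : Qalg F} {e θ : 𝓞v[E]} (C : IsComponent ρ α π ϑ e θ) {I : Type*} [Fintype I]
  [DecidableEq I] {c : I → RL L} {h : I → L⟦X⟧} (H : IsSplitting (minpoly (Av F) ϑ) c h) {i₀ : I}
  (hA : Injective A.act) {φ : E →ₐ[Qv F] L} (hφρ : ∀ x, (φ x : Qalg F) = ρ x)
  (hc : φ θ = ι[L] (c i₀))

include C in
theorem IsComponent.isMonogenic : IsMonogenic e θ (minpoly (Av F) ϑ) :=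
  ⟨C.idem, C.mul_aeval_minpoly, fun a => by
    obtain ⟨p, -, hp⟩ := C.exists_aeval_eq a
    exact ⟨p, hp⟩⟩

include H hφρ hc in
theorem val_derivGen : val F C.good.derivGen = ∑ i ∈ univ.erase i₀,
    val F (ι[L] (c i₀) - ι[L] (c i)) := by
  have hne : ∀ i ∈ univ.erase i₀, ι[L] (c i₀) - ι[L] (c i) ≠ 0 := fun i hi => by
    rw [sub_ne_zero]
    exact fun e => ne_of_mem_erase hi (H.injective (algebraMap_RL_injective L e)).symm
  have hϑ : ϑ = algebraMap L (Qalg F) (ι[L] (c i₀)) := by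
    rw [← hc]
    refine Eq.trans ?_ (hφρ θ).symm
    rw [C.map_theta]
  rw [← val_prod _ _ hne]
  refine val_eq_of_norm_eq ?_
  change ‖(C.good.derivGen : Qalg F)‖ = ‖((∏ i ∈ univ.erase i₀,
    (ι[L] (c i₀) - ι[L] (c i)) : L) : Qalg F)‖
  congr 1
  have h1 := congrArg derivative (OEAction.map_evalL C.isMonogenic H)
  rw [derivative_map] at h1
  have h2 := congrArg (fun p => algebraMap L (Qalg F) (p.eval (ι[L] (c i₀)))) h1
  have h3 : (algebraMap L (Qalg F)).comp ((evalL L).comp (coefR L)) = algebraMap (Av F) (Qalg F) :=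
    RingHom.ext fun f => congrArg (algebraMap L (Qalg F)) (evalL_coefR L f)
  rw [eval_map, hom_eval₂, h3, ← hϑ] at h2
  refine (C.good.coe_derivGen.trans h2).trans (congrArg (algebraMap L (Qalg F)) ?_)
  rw [Polynomial.derivative_prod_finset, Polynomial.eval_finsetSum, sum_eq_single i₀]
  · rw [eval_mul, Polynomial.derivative_X_sub_C, Polynomial.eval_one, mul_one, eval_prod]
    simp only [eval_sub, eval_X, eval_C]
  · intro i _ hi
    rw [eval_mul, eval_prod, prod_eq_zero (mem_erase.2 ⟨hi.symm, mem_univ i₀⟩), zero_mul]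
    rw [eval_sub, eval_X, eval_C, sub_self]
  · exact fun h0 => absurd (mem_univ i₀) h0

include hEL hφρ hA in
/-- An `O_E`-generator corresponds to a generator of the codifferent, which is `g'(ϑ)⁻¹ O_K`. -/
theorem valU_eq {ι : Type*} [Fintype ι] [DecidableEq ι]
    {tc : Basis ι (SepRestr L) (BC (toSepRestr L) M)} (htc : ∀ l, S.convToSep (tc l) ∈ S.H1v)
    {u : S.HomQv} (hu : A.IsEGenerator u) {a₀ : K} (ha₀ : a₀ ≠ 0) {κ : S.H1v →ₗ[Av F] K}
    (hκ : ∀ t, ‖κ t‖ ≤ 1) (hκ1 : ∃ t, κ t = 1) (hκa : ∀ a t, κ (A.actHom a t) = ρ a * κ t)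
    (hrep : ∀ t, traceRep A.actHom C.good e θ u t = a₀ * κ t) : A.valU φ u = val F a₀ +
    val F C.good.derivGen := by
  have hex := A.exists_isOEGenerator hEL tc htc hA hu
  have h0 : A.valU φ u = val F (φ hex.choose.1) := dif_pos hex
  rw [h0, ← val_mul ha₀ C.good.derivGen_ne_zero]
  obtain ⟨h1, h2, h3⟩ := hex.choose_spec
  have hn : ∀ x, ‖φ x‖ = ‖ρ x‖ := fun x => congrArg (fun y : Qalg F => ‖y‖) (hφρ x)
  exact val_eq_of_norm_eq ((hn _).trans (A.norm_rho_eq C hκ hκ1 hκa hrep h1 h2 h3))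

include hEL C H hA hφρ hc in
/-- The valuation of a period. -/
theorem valT_period {N : ℕ} {n : I → ℕ} {d : I → ℤ} (hn : ∀ i, (n i : ℤ) = N - d i)
    (T : TauCorr A e θ (divisor c n) N) {ω : S.HdR} (hω : A.IsGenerator φ ω) {u : S.HomQv}
    (hu : A.IsEGenerator u) : S.period u ω ≠ 0 ∧
    Tendsto (fun m => ∑ k ∈ range m, (∑ i, (d i : ℝ) *
      val F (ι[L] (c i) - ι[L] (c i₀) ^ qF ^ (k + 1))) /
        (qF : ℝ) ^ (k + 1)) atTop (𝓝 (valT (S.period u ω) -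
      A.valOmega φ ω - A.valU φ u - ∑ i ∈ univ.erase i₀, (d i - d i₀ : ℝ) *
        val F (ι[L] (c i₀) - ι[L] (c i)))) := by
  have := S.free
  have := S.finite
  have hφe : φ e = 1 := Subtype.ext ((hφρ e).trans (congrArg Subtype.val C.map_e))
  have hϑ : ϑ = (ι[L] (c i₀) : L) := by
    rw [← hc, hφρ, C.map_theta]
  have hm := C.isMonogenic
  classical
  let b := Free.chooseBasis (RX L) M
  obtain ⟨tc, htc⟩ := S.exists_frame b
  obtain ⟨a₀, κ, ha₀, hκ, hκ1, hκa, hrep⟩ := A.exists_kappa C tc htc hA hu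
  obtain ⟨l, hl⟩ := exists_norm_eigenVal_eq_one htc hκ hκ1
  have : Nonempty (Free.ChooseBasisIndex (RX L) M) := ⟨l⟩
  obtain ⟨j, hj, hjϑ⟩ := exists_lift_QvToC C.good H i₀
  have hθ : j (ρ θ) = TtoC L (h i₀) := by rw [C.map_theta, hjϑ]
  have hρθ : ((ρ θ : K) : Qalg F) = (ι[L] (c i₀) : L) := by rw [← hφρ, hc]
  -- the reduction modulo `z - ζ` of the functional, normalized so that it has no poles
  obtain ⟨f, hf, hfQ⟩ := exists_isEigenfunctional htc hj hκa C.map_e hθ b T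
    (fun t => hasConst_lift C.good H hj hjϑ hϑ (hκ t)) hl
  rw [H.constantCoeff_eq] at hf
  have hlim := tendsto_val_supLam htc hκa b C.map_e hρθ H hn T hκ hl
  obtain ⟨hD0, hD⟩ := valT_divisorVal H i₀ hn
  obtain ⟨hj0, hjv⟩ := valT_lift C.good H hj hjϑ hϑ ha₀
  have hf0 := hf.apply_redT_ne_zero hm H hφe hc hω
  have hω' := (A.mem_Hpsi_iff hm H hφe hc ω).1 (hω ▸ mem_span_singleton_self ω)
  -- the value of the functional on `ω`; its multiple by `a₀` is the period
  set P := extend htc (liftFun hj κ) (S.tauB (expC L) (isUnit_expC L) (S.HdRtoC ω)) with hP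
  have hQ : HasConst (divisorVal c (h i₀) n N * P) (f (S.redT ω)) := hfQ ω
  have hP0 : P ≠ 0 := right_ne_zero_of_mul (hQ.ne_zero hf0)
  have hper : S.period u ω = j a₀ * P := by
    refine evalC_eq_of_eigen A htc hj C hrep ?_ ?_
    · rw [← A.tauB_actBC, ← HdRtoC_actBC, hω'.1]
    · have h1 : S.HdRtoC (h i₀ • ω) = TtoC L (h i₀) • S.HdRtoC ω := push_smul_eq _ _ _ _ _ _
      rw [← A.tauB_actBC, ← HdRtoC_actBC, hω'.2, h1, hjϑ]
      exact LinearEquiv.map_smul _ _ _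
  refine ⟨hper ▸ mul_ne_zero hj0 hP0, ?_⟩
  convert hlim using 2
  have h2 := hQ.valT hf0
  rw [valT_mul hD0 hP0, hD] at h2
  rw [hper, valT_mul hj0 hP0, hjv, valU_eq hEL C hA hφρ htc hu ha₀ hκ hκ1 hκa hrep,
    hf.valOmega_eq hm H hφe hc hω, val_derivGen C H hφρ hc]
  linarith

end valuation

/-! ### Extension of scalars to a conjugate field -/

/-- A semilinear map that intertwines two endomorphisms intertwines their polynomials. -/
theorem map_aeval_of_intertwine {R R' V V' : Type*} [CommRing R] [CommRing R'] [AddCommGroup V]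
    [Module R V] [AddCommGroup V'] [Module R' V'] {χ : R →+* R'} (p : V →ₛₗ[χ] V') {T : End R V}
    {T' : End R' V'} (h : ∀ x, p (T x) = T' (p x)) (P : R[X]) (x : V) : p (aeval T P x) =
    aeval T' (P.map χ) (p x) := by
  induction P using induction_on' with
  | add P Q hP hQ =>
    rw [map_add, LinearMap.add_apply, map_add, hP, hQ, Polynomial.map_add, map_add,
      LinearMap.add_apply]
  | monomial n a =>
    have h1 : p ((T ^ n) x) = (T' ^ n) (p x) := by
      induction n with
      | zero => rfl
      | succ n ih => rw [pow_succ', End.mul_apply, h, ih, pow_succ', End.mul_apply]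
    rw [Polynomial.map_monomial, aeval_monomial, aeval_monomial, End.mul_apply, End.mul_apply,
      algebraMap_end_apply, algebraMap_end_apply, map_smulₛₗ, h1]

section conjugates
variable {L L' : ExtQ} (η : L →ₐ[Qv F] L') {M : Type w} [AddCommGroup M] [Module (RX L) M]
  {S : LocalShtuka L M} {E : Type v} [CommRing E] [Algebra (Av F) E] (A : OEAction S E)

theorem etaR_injective : Injective (etaR η) := fun a b h => by
  apply algebraMap_RL_injective L
  apply η.injective
  exact congrArg ι[L'] h

theorem OEAction.conj_act_injective (hA : Injective A.act) : Injective (A.conj η).act := by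
  have := S.free
  let b := Free.chooseBasis (RX L) M
  have hmk : Injective (BC.mk (etaX η) : M → BC (etaX η) M) := by
    intro m m' h
    refine b.ext_elem fun i => PowerSeries.map_injective _ (etaR_injective η) ?_
    rw [← etaX, ← BC.basis_repr_mk (etaX η), h, BC.basis_repr_mk]
  intro a a' h
  refine hA (LinearMap.ext fun m => hmk ?_)
  rw [← BC.map_mk, ← BC.map_mk]
  exact LinearMap.congr_fun h (BC.mk (etaX η) m)

/-- The map `σ̂^*M → σ̂^*(M^η)`. -/
def conjSigma (η : L →ₐ[Qv F] L') (M : Type w) [AddCommGroup M] [Module (RX L) M] :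
    BC (sigma L) M →ₛₗ[etaX η] BC (sigma L') (BC (etaX η) M) :=
  BC.lift (sigma L) (etaX η)
    ((BC.mk (sigma L') : BC (etaX η) M →ₛₗ[_] _).toAddMonoidHom.comp
      (BC.mk (etaX η) : M →ₛₗ[_] _).toAddMonoidHom)
    (fun a m => by
      change BC.mk (sigma L') (BC.mk (etaX η) (a • m)) =
        etaX η (sigma L a) • BC.mk (sigma L') (BC.mk (etaX η) m)
      rw [map_smulₛₗ, map_smulₛₗ, etaX_sigma])

theorem conjSigma_mk (m : M) :
    conjSigma η M (BC.mk (sigma L) m) = BC.mk (sigma L') (BC.mk (etaX η) m) := BC.lift_mk ..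

/-- A property of the elements of `σ̂^*(M^η)` that is stable under linear combinations holds if it
holds on the image of `σ̂^*M`. -/
theorem conjSigma_induction {p : BC (sigma L') (BC (etaX η) M) → Prop}
    (h : ∀ x, p (conjSigma η M x)) (hadd : ∀ x y, p x → p y → p (x + y))
    (hsmul : ∀ (r : RX L') x, p x → p (r • x)) (x) : p x := by
  have h0 : p 0 := by
    have := h 0
    rwa [map_zero] at this
  induction x using BC.induction with
  | h0 => exact h0
  | hadd x y hx hy => exact hadd x y hx hy
  | hmk r y =>
    refine hsmul r _ ?_
    induction y using BC.induction with
    | h0 => rwa [map_zero]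
    | hadd x y hx hy => rw [map_add]; exact hadd _ _ hx hy
    | hmk s m =>
      rw [map_smulₛₗ, ← conjSigma_mk]
      exact hsmul _ _ (h _)

theorem LocalShtuka.TauRel.conj {x : BC (sigma L) M} {y : M} (h : S.TauRel x y) :
    (S.conj η).TauRel (conjSigma η M x) (BC.mk (etaX η) y) := by
  have h1 : BC.push (sigma L') (loc L') ((loc L').comp (sigma L')) (fun _ => rfl)
      (conjSigma η M x) = BC.assoc (etaX η) ((loc L').comp (sigma L'))
        (((loc L').comp (etaX η)).comp (sigma L)) (fun a => congrArg (loc L') (etaX_sigma η a))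
        (BC.push (sigma L) ((loc L').comp (etaX η)) (((loc L').comp (etaX η)).comp (sigma L))
          (fun _ => rfl) x) := by
    clear h
    induction x using BC.induction with
    | h0 => simp only [map_zero]
    | hadd x y hx hy => rw [map_add, map_add, hx, hy, map_add, map_add]
    | hmk r m =>
      rw [push_smul_eq, BC.push_mk, map_smulₛₗ, conjSigma_mk, push_smul_eq, BC.push_mk, map_smul,
        BC.assoc_mk]
      rfl
  have h2 := h.tauB _ (isUnit_etaX η _ (isUnit_loc L'))
  unfold LocalShtuka.TauRel
  rw [h1]
  simp only [LocalShtuka.conj, LinearEquiv.trans_apply, LinearEquiv.symm_apply_apply]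
  refine (congrArg _ h2).trans ?_
  exact BC.assoc_mk ..

theorem conjSigma_actBC (a : 𝓞v[E]) (x : BC (sigma L) M) : conjSigma η M (A.actBC (sigma L) a x) =
    (A.conj η).actBC (sigma L') a (conjSigma η M x) := by
  induction x using BC.induction with
  | h0 => simp only [map_zero]
  | hadd x y hx hy => rw [map_add, map_add, hx, hy, map_add, map_add]
  | hmk r m =>
    rw [map_smul, OEAction.actBC_mk, map_smulₛₗ, map_smulₛₗ, conjSigma_mk, conjSigma_mk, map_smul,
      OEAction.actBC_mk]
    exact congrArg (fun y => etaX η r • BC.mk (sigma L') y) (BC.map_mk ..).symm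

theorem divisor_map_etaR {ι : Type*} [Fintype ι] (c : ι → RL L) (n : ι → ℕ) :
    (divisor c n).map (etaR η) = divisor (fun i => etaR η (c i)) n := by
  rw [divisor, divisor, Polynomial.map_prod]
  simp only [Polynomial.map_pow, Polynomial.map_sub, Polynomial.map_X, Polynomial.map_C]

theorem TauCorr.conj {A : OEAction S E} {e θ : 𝓞v[E]} {D : (RL L)[X]} {N : ℕ}
    (T : TauCorr A e θ D N) : TauCorr (A.conj η) e θ (D.map (etaR η)) N := by
  have key : ∀ {x m}, S.TauRel (aeval (A.actBC (sigma L) θ)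
      (D.map PowerSeries.C) (A.actBC (sigma L) e x)) (zmz L ^ N • A.act e m) →
      (S.conj η).TauRel (aeval ((A.conj η).actBC (sigma L') θ)
        ((D.map (etaR η)).map PowerSeries.C) ((A.conj η).actBC (sigma L') e (conjSigma η M x)))
        (zmz L' ^ N • (A.conj η).act e (BC.mk (etaX η) m)) := by
    intro x m h
    have h1 := h.conj η
    rw [map_aeval_of_intertwine (conjSigma η M) (conjSigma_actBC η A θ), conjSigma_actBC,
      map_smulₛₗ (BC.mk (etaX η)), map_pow, etaX_zmz, Polynomial.map_map] at h1
    have h2 : (etaX η).comp PowerSeries.C = (PowerSeries.C (R := RL L')).comp (etaR η) :=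
      RingHom.ext fun r => PowerSeries.map_C (etaR η) r
    have h3 : (A.conj η).act e (BC.mk (etaX η) m) = BC.mk (etaX η) (A.act e m) := BC.map_mk ..
    rw [Polynomial.map_map, ← h2, h3]
    exact h1
  have hadd : ∀ {x y m m'}, (S.conj η).TauRel (aeval ((A.conj η).actBC (sigma L') θ)
        ((D.map (etaR η)).map PowerSeries.C) ((A.conj η).actBC (sigma L') e x))
        (zmz L' ^ N • (A.conj η).act e m) →
      (S.conj η).TauRel (aeval ((A.conj η).actBC (sigma L') θ)
        ((D.map (etaR η)).map PowerSeries.C) ((A.conj η).actBC (sigma L') e y))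
        (zmz L' ^ N • (A.conj η).act e m') →
      (S.conj η).TauRel (aeval ((A.conj η).actBC (sigma L') θ)
        ((D.map (etaR η)).map PowerSeries.C) ((A.conj η).actBC (sigma L') e (x + y)))
        (zmz L' ^ N • (A.conj η).act e (m + m')) := by
    intro x y m m' h h'
    rw [map_add, map_add, map_add, smul_add]
    exact h.add h'
  have hsmul : ∀ (r : RX L') {x m}, (S.conj η).TauRel
      (aeval ((A.conj η).actBC (sigma L') θ)
        ((D.map (etaR η)).map PowerSeries.C) ((A.conj η).actBC (sigma L') e x))
        (zmz L' ^ N • (A.conj η).act e m) →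
      (S.conj η).TauRel (aeval ((A.conj η).actBC (sigma L') θ)
        ((D.map (etaR η)).map PowerSeries.C) ((A.conj η).actBC (sigma L') e (r • x)))
        (zmz L' ^ N • (A.conj η).act e (r • m)) := by
    intro r x m h
    rw [map_smul, map_smul, map_smul, smul_comm]
    exact h.smul r
  refine ⟨fun x => ?_, fun m => ?_⟩
  · induction x using conjSigma_induction η with
    | h x =>
      obtain ⟨m, hm⟩ := T.left x
      exact ⟨_, key hm⟩
    | hadd x y hx hy =>
      obtain ⟨m, hm⟩ := hx
      obtain ⟨m', hm'⟩ := hy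
      exact ⟨_, hadd hm hm'⟩
    | hsmul r x hx =>
      obtain ⟨m, hm⟩ := hx
      exact ⟨_, hsmul r hm⟩
  · induction m using BC.induction with
    | h0 =>
      obtain ⟨x, hx⟩ := T.right 0
      have h1 := key hx
      rw [map_zero (BC.mk (etaX η))] at h1
      exact ⟨_, h1⟩
    | hmk r m =>
      obtain ⟨x, hx⟩ := T.right m
      exact ⟨_, hsmul r (key hx)⟩
    | hadd x y hx hy =>
      obtain ⟨m, hm⟩ := hx
      obtain ⟨m', hm'⟩ := hy
      exact ⟨_, hadd hm hm'⟩

variable [FD[L]] [FD[L']]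

theorem IsSplitting.conj {ι : Type*} [Fintype ι] {g : (Av F)[X]} {c : ι → RL L} {h : ι → L⟦X⟧}
    (H : IsSplitting g c h) :
    IsSplitting g (fun i => etaR η (c i)) (fun i => PowerSeries.map η.toRingHom (h i)) := by
  refine ⟨fun i => ?_, (etaR_injective η).comp H.injective, fun i => ?_, ?_⟩
  · rw [← coeff_zero_eq_constantCoeff_apply, PowerSeries.coeff_map,
      coeff_zero_eq_constantCoeff_apply, H.constantCoeff_eq]
    rfl
  · obtain ⟨u, hu⟩ := H.exists_unit i
    refine ⟨Units.map (etaX η).toMonoidHom u, ?_⟩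
    have h1 := congrArg (etaX η) hu
    have h2 : (etaX η).comp (coefR L) = coefR L' := RingHom.ext (etaX_coefR η)
    rw [eval_map, hom_eval₂, h2, map_mul, etaX_zmz] at h1
    rw [eval_map]
    have h3 : etaX η (PowerSeries.C (c i)) = PowerSeries.C (etaR η (c i)) := PowerSeries.map_C _ _
    rw [← h3, h1]
    rfl
  · have h1 := congrArg (Polynomial.map (PowerSeries.map η.toRingHom)) H.map_eq
    have h2 : (PowerSeries.map η.toRingHom).comp ((expL L).comp (coefR L)) =
        (expL L').comp (coefR L') := RingHom.ext fun f => by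
      rw [RingHom.comp_apply, RingHom.comp_apply, ← expL_etaX, etaX_coefR]
      rfl
    rw [Polynomial.map_map, h2, Polynomial.map_prod] at h1
    rw [h1]
    simp only [Polynomial.map_sub, Polynomial.map_X, Polynomial.map_C]

theorem conjHdR_mk (m : M) : S.conjHdR η (BC.mk ((expL L).comp (sigma L)) m) =
    BC.mk ((expL L').comp (sigma L')) (BC.mk (etaX η) m) := BC.lift_mk ..

theorem conjHdR_smul (a : L⟦X⟧) (w : S.HdR) :
    S.conjHdR η (a • w) = PowerSeries.map η.toRingHom a • S.conjHdR η w := map_smulₛₗ _ _ _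

theorem conjHdR_actBC (a : 𝓞v[E]) (x : S.HdR) : S.conjHdR η (A.actBC _ a x) =
    (A.conj η).actBC _ a (S.conjHdR η x) := by
  induction x using BC.induction with
  | h0 => simp only [map_zero]
  | hadd x y hx hy => rw [map_add, map_add, hx, hy, map_add, map_add]
  | hmk r m =>
    rw [map_smul, OEAction.actBC_mk, conjHdR_smul, conjHdR_smul, conjHdR_mk, conjHdR_mk, map_smul,
      OEAction.actBC_mk]
    exact congrArg (fun y => PowerSeries.map η.toRingHom r • BC.mk ((expL L').comp (sigma L')) y)
      (BC.map_mk ..).symm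

variable [Algebra (Qv F) E] [IsScalarTower (Av F) (Qv F) E] {A}

/-- The extension of scalars of a generator of the `φ`-component. -/
theorem OEAction.IsGenerator.conj {e θ : 𝓞v[E]} {g : (Av F)[X]} (hm : IsMonogenic e θ g) {ι : Type*}
    [Fintype ι] [DecidableEq ι] {c : ι → RL L} {h : ι → L⟦X⟧} (H : IsSplitting g c h)
    {φ : E →ₐ[Qv F] L} (hφ : φ e = 1) {i : ι} (hφθ : φ θ = ι[L] (c i)) {ω : S.HdR}
    (hω : A.IsGenerator φ ω) : (A.conj η).IsGenerator (η.comp φ) (S.conjHdR η ω) := by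
  have : Nonempty ι := ⟨i⟩
  have H' := H.conj η
  have hφ' : (η.comp φ) e = 1 := (congrArg η hφ).trans (map_one η)
  have hφθ' : (η.comp φ) θ = ι[L'] (etaR η (c i)) := congrArg η hφθ
  obtain ⟨P, -, hPR, hPe⟩ := H.exists_projectors
  obtain ⟨R, hR⟩ := hPR i
  rw [← expL_sigma_coefR] at hR
  have hproj : ∀ w : S.HdR, ∃ a : L⟦X⟧, a • ω = aeval (A.actBC _ θ) (P i) (A.actBC _ e w) := by
    intro w
    have hev := A.actBC_idem hm ((expL L).comp (sigma L)) w
    rw [← mem_span_singleton, hω, A.mem_Hpsi_iff hm H hφ hφθ]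
    refine ⟨by rw [A.actBC_aeval_comm, hev], ?_⟩
    have h1 := A.aeval_mul_map_eq_zero hm ((expL L).comp (sigma L)) R hev
    rw [← hR, map_mul, End.mul_apply, map_sub, aeval_X, aeval_C, LinearMap.sub_apply,
      algebraMap_end_apply, sub_eq_zero] at h1
    exact h1
  have hmem := (A.mem_Hpsi_iff hm H hφ hφθ ω).1 (hω ▸ mem_span_singleton_self ω)
  refine le_antisymm ?_ fun w hw => ?_
  · rw [Submodule.span_singleton_le_iff_mem, (A.conj η).mem_Hpsi_iff hm H' hφ' hφθ',
    ← conjHdR_actBC, ← conjHdR_actBC, hmem.1, hmem.2, conjHdR_smul]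
    exact ⟨rfl, rfl⟩
  · obtain ⟨he, hθ⟩ := ((A.conj η).mem_Hpsi_iff hm H' hφ' hφθ' w).1 hw
    have h1 : ∀ w : (S.conj η).HdR, aeval ((A.conj η).actBC _ θ)
        ((P i).map (PowerSeries.map η.toRingHom)) ((A.conj η).actBC _ e w) ∈
        span L'⟦X⟧ {S.conjHdR η ω} := by
      intro w
      have h2 : ∀ m, aeval ((A.conj η).actBC _ θ)
          ((P i).map (PowerSeries.map η.toRingHom)) ((A.conj η).actBC _ e
            (BC.mk ((expL L').comp (sigma L')) (BC.mk (etaX η) m))) ∈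
          span L'⟦X⟧ {S.conjHdR η ω} := by
        intro m
        obtain ⟨a, ha⟩ := hproj (BC.mk ((expL L).comp (sigma L)) m)
        rw [← conjHdR_mk, ← conjHdR_actBC,
          ← map_aeval_of_intertwine (S.conjHdR η) (conjHdR_actBC η A θ), ← ha, conjHdR_smul]
        exact Submodule.smul_mem _ _ (mem_span_singleton_self _)
      induction w using BC.induction with
      | h0 => rw [map_zero, map_zero]; exact Submodule.zero_mem _
      | hadd x y hx hy => rw [map_add, map_add]; exact Submodule.add_mem _ hx hy
      | hmk r y =>
        rw [map_smul, map_smul]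
        refine Submodule.smul_mem _ _ ?_
        induction y using BC.induction with
        | h0 => rw [map_zero, map_zero, map_zero]; exact Submodule.zero_mem _
        | hadd x y hx hy => rw [map_add, map_add, map_add]; exact Submodule.add_mem _ hx hy
        | hmk s m =>
          rw [map_smulₛₗ, map_smul, map_smul]
          exact Submodule.smul_mem _ _ (h2 m)
    have h3 := h1 w
    rwa [he, aeval_apply_of_eigen hθ, eval_map, eval₂_hom, hPe, if_pos rfl, map_one, one_smul] at h3

end conjugates

/-! ### The period formula for a conjugate -/

section conjugatePeriod
variable {L : ExtQ} [FD[L]] {E : Type v} [CommRing E] [Algebra (Qv F) E]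
  [Module.Finite (Qv F) E]

theorem isSeparable_fieldRange [Sep[L]] (η : L →ₐ[Qv F] Qalg F) :
    Sep[η.fieldRange] :=
  Algebra.IsSeparable.of_equiv_equiv (RingEquiv.refl _)
    (AlgEquiv.ofInjectiveField η : L ≃ₐ[Qv F] η.fieldRange).toRingEquiv (by
      ext x
      exact congrArg Subtype.val ((AlgEquiv.ofInjectiveField η).commutes x).symm)

/-- If `L` contains the images of all homomorphisms `E → Q_v^alg`, then each of them factors
through each embedding of `L`. -/
theorem exists_comp_eq (hEL : ∀ (χ : E →ₐ[Qv F] Qalg F) (e : E), χ e ∈ L) (η : L →ₐ[Qv F] Qalg F)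
    (χ : E →ₐ[Qv F] Qalg F) : ∃ φ : E →ₐ[Qv F] L, η.comp φ = χ := by
  let r : (E →ₐ[Qv F] Qalg F) → (E →ₐ[Qv F] L) := fun χ => χ.codRestrict L.toSubalgebra (hEL χ)
  have hinj : Injective fun χ => η.comp (r χ) := fun χ χ' h => by
    ext x
    exact congrArg Subtype.val (η.injective (DFunLike.congr_fun h x))
  obtain ⟨χ', h⟩ := Finite.surjective_of_injective hinj χ
  exact ⟨r χ', h⟩

/-- The splitting over `L` of the minimal polynomial of a monogenic generator, from its
splitting by the embeddings. -/
theorem IsGood.exists_isSplitting [Sep[L]] {K : ExtQ}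
    [FD[K]] [Sep[K]] {α π ϑ : Qalg F}
    (hg : IsGood K α π ϑ) (η : L →ₐ[Qv F] Qalg F) {c : (K →ₐ[Qv F] Qalg F) → RL L}
    (hc : ∀ f, η (ι[L] (c f)) = f ⟨ϑ, hg.mem⟩) : ∃ h, IsSplitting (minpoly (Av F) ϑ) c h := by
  have hηA : ((η : L →+* Qalg F).comp ι[L]).comp (algebraMap (Av F) (RL L)) =
      algebraMap (Av F) (Qalg F) := RingHom.ext fun a => by
    change η (algebraMap (Av F) L a) = _
    exact (η.restrictScalars (Av F)).commutes a
  have hinj : Injective ((η : L →+* Qalg F).comp ι[L]) :=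
    η.injective.comp (algebraMap_RL_injective L)
  refine LocSht.exists_isSplitting (minpoly.monic hg.isIntegral) (fun f f' hff => ?_) ?_
    fun f => ?_
  · apply hg.algHom_ext
    rw [← hc, ← hc, hff]
  · apply Polynomial.map_injective _ hinj
    rw [Polynomial.map_map, hηA, minpoly_Av_map_eq_prod hg, Polynomial.map_prod]
    refine prod_congr rfl fun f _ => ?_
    rw [Polynomial.map_sub, Polynomial.map_X, Polynomial.map_C]
    exact congrArg (fun y => X - Polynomial.C y) (hc f).symm
  · set G := minpoly (Av F) ϑ
    have hev : ‖ι[L] ((G.map ((algebraMap (Av F) (RL L)).comp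
        (PowerSeries.C.comp constantCoeff))).eval (c f))‖ =
        ‖aeval (f ⟨ϑ, hg.mem⟩)
          (G.map (PowerSeries.C.comp constantCoeff))‖ := by
      rw [← norm_algHom η]
      congr 1
      rw [eval_map, aeval_def, eval₂_map, ← hηA, ← hc, RingHom.comp_assoc]
      exact hom_eval₂ G _ ((η : L →+* Qalg F).comp ι[L]) (c f)
    rw [hev, ← algHom_aeval_Av f ⟨ϑ, hg.mem⟩, norm_algHom, ← norm_zetaQ, ← hg.norm_aeval_reduction]
    change ‖aeval ϑ _‖ = _
    rw [aeval_def, aeval_def, eval₂_map, eval₂_map, ← RingHom.comp_assoc]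
    congr 3

theorem isSeparable_rangeField [Sep[L]] (η : L →ₐ[Qv F] Qalg F)
    (ψ : E →ₐ[Qv F] L) : Sep[rangeField (η.comp ψ)] := by
  have := isSeparable_fieldRange η
  refine isSeparable_of_le (L := η.fieldRange) ?_
  rintro - ⟨x, rfl⟩
  exact ⟨ψ x, rfl⟩

open Classical in
/-- The elements `x f` of `k` stand for the conjugates of `ϑ`; only the norms of their differences
matter. -/
theorem IsGood.eq_periodSum_of_tendsto {K : ExtQ}
    [FD[K]] [Sep[K]] {α π ϑ : Qalg F}
    (hg : IsGood K α π ϑ) (c : (K →ₐ[Qv F] Qalg F) → ℝ) {k : Type*} [NormedField k]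
    (x : (K →ₐ[Qv F] Qalg F) → k)
    (hx : ∀ f n, ‖x f - x K.val ^ n‖ = ‖f ⟨ϑ, hg.mem⟩ - ϑ ^ n‖) {X : ℝ}
    (h : Tendsto (fun m => ∑ k ∈ range m, (∑ f, c f *
      val F (x f - x K.val ^ qF ^ (k + 1))) / (qF : ℝ) ^ (k + 1)) atTop
      (𝓝 (X - ∑ f ∈ univ.erase K.val, (c f - c K.val) * val F (x K.val - x f)))) :
    X = periodSum K ⟨ϑ, hg.mem⟩ c := by
  have hv : ∀ f n, val F (x f - x K.val ^ n) = val F (f ⟨ϑ, hg.mem⟩ - ϑ ^ n) := fun f n =>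
    val_eq_of_norm_eq (hx f n)
  simp only [hv] at h
  have h1 := tendsto_nhds_unique h (hg.summable_periodSum c).hasSum.tendsto_sum_nat
  have h2 : ∑ f ∈ univ.erase K.val, (c f - c K.val) * val F (x K.val - x f) =
      ∑ f, (c f - c K.val) * val F (f ⟨ϑ, hg.mem⟩ - ϑ) := by
    rw [← add_sum_erase _ _ (mem_univ K.val), sub_self, zero_mul, zero_add]
    refine sum_congr rfl fun f _ => ?_
    have h3 := hv f 1
    rw [pow_one, pow_one] at h3
    rw [← h3]
    exact congrArg _ (val_eq_of_norm_eq (norm_sub_rev _ _))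
  rw [h2] at h1
  unfold periodSum
  linarith

variable [Sep[L]] [IsSemisimpleRing E] [Algebra (Av F) E]
  [IsScalarTower (Av F) (Qv F) E] {M : Type w} [AddCommGroup M] [Module (RX L) M]
  {S : LocalShtuka L M} {A : OEAction S E}

/-- The idempotent of a simple factor of `E` is annihilated by the homomorphisms that do not factor
through the simple factor. -/
theorem IsComponent.apply_eq_zero {K : ExtQ} [FD[K]]
    [Sep[K]] {α π ϑ : Qalg F} {ρ : E →ₐ[Qv F] K} (hρ : Surjective ρ)
    {e θ : 𝓞v[E]} (C : IsComponent ρ α π ϑ e θ) {χ : E →ₐ[Qv F] Qalg F}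
    (h : ∀ f : K →ₐ[Qv F] Qalg F, f.comp ρ ≠ χ) : χ e = 0 := by
  by_contra h0
  have h1 : χ e * χ e = χ e := by
    rw [← map_mul]
    exact congrArg (fun x : 𝓞v[E] => χ x) C.idem
  have hker : RingHom.ker ρ.toRingHom ≤ RingHom.ker χ.toRingHom := fun x hx => by
    have h2 := congrArg χ (C.eq_zero x hx)
    rw [map_mul, map_zero] at h2
    exact (mul_eq_zero.1 h2).resolve_left h0
  refine h (AlgHom.liftOfSurjective ρ hρ χ hker) (AlgHom.ext fun x => ?_)
  exact AlgHom.liftOfSurjective_apply ρ hρ χ hker x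

variable (hEL : ∀ (χ : E →ₐ[Qv F] Qalg F) (e : E), χ e ∈ L) (hA : Injective A.act)
  {d : (E →ₐ[Qv F] L) → ℤ} (hd : A.HasCMType d) {ψ : E →ₐ[Qv F] L} {ω : S.HdR}
  (hω : A.IsGenerator ψ ω) (η : L →ₐ[Qv F] Qalg F) {u : (S.conj (etaL η)).HomQv}
  (hu : (A.conj (etaL η)).IsEGenerator u)

include hEL hA hd hω hu in
/-- The valuation of the period of a conjugate is the sum of the valuations of the differential
form and of the cycle and of a sum over the embeddings of the field `η(ψ(E))`. -/
theorem valT_period_conj [Nonempty (E →ₐ[Qv F] L)]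
    [Sep[rangeField (η.comp ψ)]] {α π ϑ : Qalg F}
    (hg : IsGood (rangeField (η.comp ψ)) α π ϑ) :
    (S.conj (etaL η)).period u (S.conjHdR (etaL η) ω) ≠ 0 ∧
    valT ((S.conj (etaL η)).period u (S.conjHdR (etaL η) ω)) =
      periodSum (rangeField (η.comp ψ)) ⟨ϑ, hg.mem⟩
        (fun f => (d (pullBack η (f.comp (rangeHom (η.comp ψ)))) : ℝ)) +
      ((A.conj (etaL η)).valOmega ((etaL η).comp ψ) (S.conjHdR (etaL η) ω) +
        (A.conj (etaL η)).valU ((etaL η).comp ψ) u) := by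
  classical
  have := isSeparable_fieldRange η
  set K := rangeField (η.comp ψ)
  set ρ := rangeHom (η.comp ψ) with hρ
  have hρs : Surjective ρ := rangeHom_surjective _
  obtain ⟨e, θ, C⟩ := exists_isComponent hρs hg
  let φ : (K →ₐ[Qv F] Qalg F) → (E →ₐ[Qv F] L) := fun f => pullBack η (f.comp ρ)
  have hφ : ∀ f, η.comp (φ f) = f.comp ρ := fun f => pullBack_apply (exists_comp_eq hEL η _)
  have hφ' : ∀ f x, η (φ f x) = f (ρ x) := fun f x => DFunLike.congr_fun (hφ f) x
  have hφψ : φ K.val = ψ := by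
    have h1 : K.val.comp ρ = η.comp ψ := AlgHom.ext fun x => rfl
    change pullBack η (K.val.comp ρ) = ψ
    rw [h1, pullBack_comp]
  have hφe : ∀ f, φ f e = 1 := fun f => η.injective ((hφ' f e).trans (by
    rw [C.map_e, map_one]
    exact (map_one η).symm))
  have hφinj : Injective φ := fun f f' h => AlgHom.ext fun y => by
    obtain ⟨x, rfl⟩ := hρs y
    rw [← hφ', ← hφ', h]
  have hφ0 : ∀ χ : E →ₐ[Qv F] L, χ ∉ Set.range φ → χ e = 0 := fun χ hχ => by
    have h1 : (η.comp χ) e = 0 := C.apply_eq_zero hρs fun f hf => hχ ⟨f, by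
      change pullBack η (f.comp ρ) = χ
      rw [hf, pullBack_comp]⟩
    exact η.injective (h1.trans (map_zero η).symm)
  have hφϑ : ∀ f, η (φ f θ) = f ⟨ϑ, hg.mem⟩ := fun f => by rw [hφ', C.map_theta]
  let c : (K →ₐ[Qv F] Qalg F) → RL L := fun f => mkRL L (φ f θ) (by
    rw [← norm_algHom η, hφϑ, norm_algHom]
    exact hg.norm_le)
  obtain ⟨h, H⟩ := hg.exists_isSplitting η (c := c) hφϑ
  have hm := C.isMonogenic
  have : Nonempty (K →ₐ[Qv F] Qalg F) := ⟨K.val⟩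
  -- any `N` that is at least all the `d_i` would do
  let N : ℕ := ∑ f, (d (φ f)).natAbs
  have hN : ∀ f, (((N - d (φ f)).toNat : ℕ) : ℤ) = N - d (φ f) := fun f => by
    have h1 : (d (φ f)).natAbs ≤ N :=
      Finset.single_le_sum (f := fun f => (d (φ f)).natAbs) (fun _ _ => Nat.zero_le _)
        (mem_univ f)
    omega
  have T := (A.tauCorr_of_cmType hm H φ hφinj hφe hφ0 (fun _ => rfl) hd hN).conj (etaL η)
  rw [divisor_map_etaR] at T
  have hω' := hω.conj (etaL η) hm H (i := K.val) (by rw [← hφψ]; exact hφe _)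
    (by rw [← hφψ]; rfl)
  have hEL' : ∀ (χ : E →ₐ[Qv F] Qalg F) (x : E), χ x ∈ η.fieldRange := fun χ x => by
    obtain ⟨χ', rfl⟩ := exists_comp_eq hEL η χ
    exact ⟨χ' x, rfl⟩
  obtain ⟨hne, hlim⟩ := valT_period hEL' C (H.conj (etaL η))
    (A.conj_act_injective (etaL η) hA) (φ := (etaL η).comp ψ) (fun x => rfl) (i₀ := K.val)
    (congrArg (etaL η) (by rw [← hφψ]; rfl)) hN T hω' hu
  refine ⟨hne, ?_⟩
  have hc' : ∀ f, ((algebraMap (RL η.fieldRange) η.fieldRange (etaR (etaL η) (c f)) :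
      η.fieldRange) : Qalg F) = f ⟨ϑ, hg.mem⟩ := hφϑ
  have h1 := hg.eq_periodSum_of_tendsto (fun f => (d (φ f) : ℝ)) _ (fun f k => ?_) hlim
  · linarith
  · change ‖((algebraMap (RL η.fieldRange) η.fieldRange (etaR (etaL η) (c f)) : η.fieldRange) :
      Qalg F) - ((algebraMap (RL η.fieldRange) η.fieldRange (etaR (etaL η) (c K.val)) :
      η.fieldRange) : Qalg F) ^ k‖ = _
    rw [hc', hc']
    rfl

end conjugatePeriod

end LocSht
end

theorem corollary4p17 {F : Type u} [Field F] [Fintype F]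
    (L : IntermediateField (Qv F) (Qalg F)) [FiniteDimensional (Qv F) L]
    [Algebra.IsSeparable (Qv F) L]
    (E : Type v) [CommRing E] [Algebra (Qv F) E] [Module.Finite (Qv F) E] [IsSemisimpleRing E]
    [Algebra.IsSeparable (Qv F) E] [Algebra (Av F) E] [IsScalarTower (Av F) (Qv F) E]
    (hEL : ∀ (χ : E →ₐ[Qv F] Qalg F) (e : E), χ e ∈ L)
    {M : Type w} [AddCommGroup M] [Module (RX L) M] (S : LocalShtuka L M) (A : OEAction S E)
    (hCM : A.HasCM) (d : (E →ₐ[Qv F] L) → ℤ) (hd : A.HasCMType d)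
    (ψ : E →ₐ[Qv F] L) (ω : S.HdR) (hω : A.IsGenerator ψ ω)
    (u : ∀ η : L →ₐ[Qv F] Qalg F, (S.conj (etaL η)).HomQv)
    (hu : ∀ η, (A.conj (etaL η)).IsEGenerator (u η)) :
    (∀ η, (S.conj (etaL η)).period (u η) (S.conjHdR (etaL η) ω) ≠ 0) ∧
    1 / (Nat.card (L →ₐ[Qv F] Qalg F) : ℝ) *
        ∑ᶠ η, valT ((S.conj (etaL η)).period (u η) (S.conjHdR (etaL η) ω)) =
      Zv (aZero d ψ) 1 - muArt (aZero d ψ) +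
        1 / (Nat.card (L →ₐ[Qv F] Qalg F) : ℝ) *
          ∑ᶠ η, ((A.conj (etaL η)).valOmega ((etaL η).comp ψ) (S.conjHdR (etaL η) ω) +
            (A.conj (etaL η)).valU ((etaL η).comp ψ) (u η)) := by
  have : Nonempty (E →ₐ[Qv F] L) := ⟨ψ⟩
  have hsep : ∀ η : L →ₐ[Qv F] Qalg F, Algebra.IsSeparable (Qv F) (rangeField (η.comp ψ)) :=
    fun η => isSeparable_rangeField η ψ
  choose α π ϑ hϑ using fun η : L →ₐ[Qv F] Qalg F => exists_isGood (rangeField (η.comp ψ))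
  have key := fun η => valT_period_conj hEL hCM.1 hd hω η (hu η) (hϑ η)
  refine ⟨fun η => (key η).1, ?_⟩
  rw [Zv_sub_muArt_aZero d ψ (fun η => rangeField (η.comp ψ)) (fun η => rangeHom (η.comp ψ))
    (fun _ _ => rfl) ϑ α π hϑ, ← mul_add, finsum_eq_sum_of_fintype, finsum_eq_sum_of_fintype,
    ← Finset.sum_add_distrib]
  exact congrArg _ (Finset.sum_congr rfl fun η _ => (key η).2)
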